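/- Let $\mathbb F_4=\{0,1,\omega,\omega^2\}$. For a linear code $C\subseteq\mathbb F_4^n$, a repair set of the $i$-th symbol is a set $R\subseteq\{1,\dots,n\}\setminus\{i\}$ for which there are nonzero $\lambda_j\in\mathbb F_4$ ($j\in R$) with $c_i=\sum_{j\in R}\lambda_jc_j$ for all $c\in C$. An $(n,k,r)$ locally repairable code (LRC) is a linear code of length $n$ and dimension $k$ for which one can choose a repair set $R_i$ for every symbol $i$ such that $\max_i|R_i|=r$. It is optimal if its minimum distance $d$ meets the Singleton-like bound, $d=n-k-\lceil k/r\rceil+2$. **Theorem.** Let $r\ge1$, $k>r$ and $d\ge2$. An optimal quaternary $(n,k,r)$ LRC with minimum distance $d$ exists if and only if $(n,k,r)$ and $d$ belong to one of the 27 classes listed below ($s$ denotes an integer). Moreover, each matrix listed for a class has linearly independent rows and is a parity-check matrix of an optimal quaternary LRC with the stated parameters. Notation: in the matrices, 2 stands for $\omega$ and 3 for $\omega^2$, and entries are written without separators; $a$ and $b$ are parameters. $U_l B$ is the matrix with $I_l\otimes(1\cdots1)$ on top of $(1\cdots1)\otimes B$, where the first all-one row is as long as the rows of $B$ and the second has length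 $l$. $X_l(T,L,B)$ is the block matrix $\left(\begin{smallmatrix}T&0\\0&I_l\otimes(1\cdots1)\\L&(1\cdots1)\otimes B\end{smallmatrix}\right)$ with the same conventions. 1. $(n,k,r)=(k+\lceil k/r\rceil,k,r)$, $k>r\ge1$, $d=2$: if $r\mid k$, $H=I_{k/r}\otimes(1\cdots1)$ with $r+1$ ones; if $r\nmid k$, any matrix $H$ obtained from $I_{\lceil k/r\rceil}\otimes(1\cdots1)$ (with $r+1$ ones) by deleting $r-(k\bmod r)$ columns such that some row of $H$ still has weight $r+1$, and also any matrix obtained from such an $H$ by replacing at most $r-(k\bmod r)$ zeros by nonzero elements in such a way that every row has weight at most $r+1$. 2. $(n,k,r)=(3s+3,2s+1,2)$, $s\ge2$, $d=3$: $U_{s+1}\left(\begin{smallmatrix}012\end{smallmatrix}\right)$. 3. $(n,k,r)=(4s+3,3s+1,3)$, $s\ge2$, $d=3$: $X_{s-1}\left(\left(\begin{smallmatrix}111a000\\0001111\end{smallmatrix}\right),\left(\begin{smallmatrix}0231023\end{smallmatrix}\right),\left(\begin{smallmatrix}1023\end{smallmatrix}\right)\right)$ with $a\in\{0,1\}$.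 4. $(n,k,r)=(5s+3,4s+1,4)$, $s=2,3$, $d=3$: $\left(\begin{smallmatrix}1111100000000\\0000111110000\\0000000011111\\0123012300123\end{smallmatrix}\right)$ and $\left(\begin{smallmatrix}111110000000000000\\000011111000000000\\000000000111110000\\000000000000011111\\012300123012300123\end{smallmatrix}\right)$ respectively. 5. $(n,k,r)=(6s+3,5s+1,5)$, $s=2$, $d=3$: $\left(\begin{smallmatrix}111111000000000\\000001111110000\\000010000011111\\012301012310123\end{smallmatrix}\right)$. 6. $(n,k,r)=(4s+4,3s+2,3)$, $s\ge2$, $d=3$: $U_{s+1}\left(\begin{smallmatrix}0123\end{smallmatrix}\right)$. 7. $(n,k,r)=(r+4,r+1,r)$, $2\le r\le15$, $d=3$: the last $r+4$ columns of $\left(\begin{smallmatrix}1111111111111111000\\1112223333210000111\\1231231230003021210\end{smallmatrix}\right)$. 8. $(n,k,r)=(r+5,r+2,r)$, $3\le r\le15$, $d=3$: the last $r+5$ columns of $\left(\begin{smallmatrix}11111111111111110000\\11122233332100001111\\12312312300030213210\end{smallmatrix}\right)$. 9. $(n,k,r)=(r+6,r+3,r)$, $6\le r\le15$, $d=3$: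 the last $r+6$ columns of $\left(\begin{smallmatrix}111111111111111100000\\111222333320000101111\\123123123003021013210\end{smallmatrix}\right)$. 10. $(n,k,r)=(4s+4,3s+1,3)$, $s\ge2$, $d=4$: $U_{s+1}\left(\begin{smallmatrix}0101\\0011\end{smallmatrix}\right)$. 11. $(n,k,r)=(5s+4,4s+1,4)$, $s\ge2$, $d=4$: $X_{s-1}\left(\left(\begin{smallmatrix}1111a0000\\000011111\end{smallmatrix}\right),\left(\begin{smallmatrix}010333010\\001313100\end{smallmatrix}\right),\left(\begin{smallmatrix}01033\\00131\end{smallmatrix}\right)\right)$ with $a\in\{0,1\}$. 12. $(n,k,r)=(6s+4,5s+1,5)$, $s\ge2$, $d=4$: $X_{s-1}\left(\left(\begin{smallmatrix}1111ab0000\\0000111111\end{smallmatrix}\right),\left(\begin{smallmatrix}0103313010\\0013133100\end{smallmatrix}\right),\left(\begin{smallmatrix}010313\\001331\end{smallmatrix}\right)\right)$ with $a,b\in\{0,1\}$; also $X_{s-2}\left(\left(\begin{smallmatrix}11111a0000000000\\0000011111b00000\\0000000000111111\end{smallmatrix}\right),\left(\begin{smallmatrix}0103313301112233\\0013131310030232\end{smallmatrix}\right),\left(\begin{smallmatrix}010313\\001331\end{smallmatrix}\right)\right)$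 with $a,b\in\{0,1\}$ (for $s=2$ the second block column and the second block row are absent). 13. $(n,k,r)=(7s+4,6s+1,6)$, $s=2,3$, $d=4$: $\left(\begin{smallmatrix}111111100000000000\\000000111111100000\\000000000001111111\\010331111230301033\\001313032000300131\end{smallmatrix}\right)$ and $\left(\begin{smallmatrix}1111111000000000000000000\\0000001111111000000000000\\0000010000000111111000000\\0000000000000000001111111\\1122000010331112200010331\\0301321001313030131001313\end{smallmatrix}\right)$ respectively. 14. $(n,k,r)=(8s+4,7s+1,7)$, $s=2$, $d=4$: $\left(\begin{smallmatrix}11111111000000000000\\00000011111111000000\\00000000000011111111\\01033111113313010331\\00131301320103001313\end{smallmatrix}\right)$. 15. $(n,k,r)=(5s+5,4s+2,4)$, $s\ge2$, $d=4$: $U_{s+1}\left(\begin{smallmatrix}01033\\00131\end{smallmatrix}\right)$. 16. $(n,k,r)=(6s+5,5s+2,5)$, $s\ge2$, $d=4$: $X_{s-1}\left(\left(\begin{smallmatrix}11111a00000\\00000111111\end{smallmatrix}\right),\left(\begin{smallmatrix}01033133010\\00131313100\end{smallmatrix}\right),\left(\begin{smallmatrix}010133\\001331\end{smallmatrix}\right)\right)$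 with $a\in\{0,1\}$. 17. $(n,k,r)=(7s+5,6s+2,6)$, $s=2$, $d=4$: $\left(\begin{smallmatrix}1111111000000000000\\0000001111111000000\\0000000000001111111\\0103313133213010331\\0013131232311001313\end{smallmatrix}\right)$. 18. $(n,k,r)=(6s+6,5s+3,5)$, $s\ge2$, $d=4$: $U_{s+1}\left(\begin{smallmatrix}010331\\001313\end{smallmatrix}\right)$. 19. $(n,k,r)=(2s+2,s,1)$, $s\ge2$, $d=4$: $U_{s+1}\left(\begin{smallmatrix}01\end{smallmatrix}\right)$. 20. $(n,k,r)=(r+5,r+1,r)$, $2\le r\le11$, $d=4$: the first $r+5$ columns of $\left(\begin{smallmatrix}1110000321233131\\0011100232202233\\0000111223332112\\3210123111112132\end{smallmatrix}\right)$. 21. $(n,k,r)=(r+6,r+2,r)$, $3\le r\le11$, $d=4$: the first $r+6$ columns of $\left(\begin{smallmatrix}11110000021333223\\00011110021121312\\00100011132223211\\12011200312223001\end{smallmatrix}\right)$. 22. $(n,k,r)=(r+7,r+3,r)$, $5\le r\le7$, $d=4$: the first $r+7$ columns of $\left(\begin{smallmatrix}11111100000012\\00001111110012\\11000011001112\\12121212121222\end{smallmatrix}\right)$.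 23. $(n,k,r)=(2r+6,2r+1,r)$, $2\le r\le7$, $d=4$: for $r=2,\dots,7$ in this order: $\left(\begin{smallmatrix}1110000000\\0011100000\\0000011100\\0000000111\\1211212112\end{smallmatrix}\right)$, $\left(\begin{smallmatrix}111100000000\\001111000000\\000000111100\\000000001111\\121212121212\end{smallmatrix}\right)$, $\left(\begin{smallmatrix}11111000000000\\00011111000000\\10000000111100\\00000100001111\\11212121121212\end{smallmatrix}\right)$, $\left(\begin{smallmatrix}1111110000000000\\0000111111000000\\1000000010111100\\0100000001001111\\1112121211121212\end{smallmatrix}\right)$, $\left(\begin{smallmatrix}111111100000000000\\000001111111000000\\101000000010111100\\010000000101001111\\112121212112121212\end{smallmatrix}\right)$, $\left(\begin{smallmatrix}11111111000000000000\\00000011111111000000\\10100000001010111100\\01010000000101001111\\11221212121122121212\end{smallmatrix}\right)$. 24. $(n,k,r)=(2k+4,k,1)$, $k=2,3$, $d=6$: $\left(\begin{smallmatrix}11000000\\00110000\\00001100\\00000011\\01010100\\02010001\end{smallmatrix}\right)$ and $\left(\begin{smallmatrix}1100000000\\0011000000\\0000110000\\0000001100\\0000000011\\0101020200\\0201010001\end{smallmatrix}\right)$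 respectively. 25. $(n,k,r)=(2k+6,k,1)$, $k=2,3$, $d=8$: $\left(\begin{smallmatrix}1100000000\\0011000000\\0000110000\\0000001100\\0000000011\\0101020200\\0201010001\\0001000201\end{smallmatrix}\right)$ and $\left(\begin{smallmatrix}110000000000\\001100000000\\000011000000\\000000110000\\000000001100\\000000000011\\010102020000\\020101000100\\000100020101\end{smallmatrix}\right)$ respectively. 26. $(n,k,r)=(n,k,k-1)$, $3\le k\le6$, $5\le n-k\le6$, $d=n-k$: for $(12,6,5)$: $H=\left(\begin{smallmatrix}111111000000\\000000111111\\010021001013\\003010001212\\000323003301\\000022033122\end{smallmatrix}\right)$; for the other parameters an optimal code is obtained from the code with parity-check matrix $H$ by shortening at some $6-k$ coordinates and puncturing at some $6-(n-k)$ further coordinates. 27. $(n,k,r)=(3s+6,2s+1,2)$, $s=2,3$, $d=6$: $\left(\begin{smallmatrix}111000000000\\000111000000\\000000111000\\000000000111\\031031031000\\002022020010\\011010030001\end{smallmatrix}\right)$ and $\left(\begin{smallmatrix}111000000000000\\000111000000000\\000000111000000\\000000000111000\\000000000000111\\031031031000012\\002022020010003\\011010030001013\end{smallmatrix}\right)$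 respectively. -/

import Mathlib

/-- `R` is a repair set for the `i`-th symbol of the linear code `C`: `i ∉ R` and
`c i = ∑ j ∈ R, μ j * c j` for all codewords `c`, with nonzero coefficients `μ j`. -/
def IsRepairSet {F ι : Type*} [Field F] (C : Submodule F (ι → F)) (i : ι) (R : Finset ι) : Prop :=
  i ∉ R ∧ ∃ μ : ι → F, (∀ j ∈ R, μ j ≠ 0) ∧ ∀ c ∈ C, c i = ∑ j ∈ R, μ j * c j

/-- `C` has (all-symbol) locality `r`: one can choose a repair set for every symbol so that the
largest chosen repair set has size exactly `r`. -/
def HasLocality {F ι : Type*} [Field F] (C : Submodule F (ι → F)) (r : ℕ) : Prop :=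
  ∃ R : ι → Finset ι, (∀ i, IsRepairSet C i (R i)) ∧ (∀ i, (R i).card ≤ r) ∧ ∃ i, (R i).card = r

/-- `C` has minimum (Hamming) distance `d`. -/
def HasMinDist {F ι : Type*} [Field F] [DecidableEq F] [Fintype ι]
    (C : Submodule F (ι → F)) (d : ℕ) : Prop :=
  IsLeast {m : ℕ | ∃ x ∈ C, ∃ y ∈ C, x ≠ y ∧ hammingDist x y = m} d

/-- `C` is an `(n, k, r)` locally repairable code: length `n`, dimension `k`, locality `r`. -/
def IsLRC {F ι : Type*} [Field F] [Fintype ι]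
    (C : Submodule F (ι → F)) (n k r : ℕ) : Prop :=
  Fintype.card ι = n ∧ Module.finrank F C = k ∧ HasLocality C r

/-- `C` is an optimal `(n, k, r)` locally repairable code with minimum distance `d`:
the Singleton-like bound holds with equality, `d = n - k - ⌈k / r⌉ + 2`. -/
def IsOptimalLRC {F ι : Type*} [Field F] [DecidableEq F] [Fintype ι]
    (C : Submodule F (ι → F)) (n k r d : ℕ) : Prop :=
  IsLRC C n k r ∧ HasMinDist C d ∧ d + k + k ⌈/⌉ r = n + 2

/-- `H` is a parity-check matrix (rows linearly independent) of an optimal `(n, k, r)` LRC with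
minimum distance `d`. -/
def IsPCMOfOptimalLRC {F ρ ι : Type*} [Field F] [DecidableEq F] [Fintype ι]
    (H : Matrix ρ ι F) (n k r d : ℕ) : Prop :=
  LinearIndependent F H.row ∧ IsOptimalLRC (LinearMap.ker H.mulVecLin) n k r d

/-- The code obtained from `C` by shortening at the coordinates in `S` (keep the codewords that
vanish on `S`, delete these coordinates) and puncturing (deleting) the coordinates in `P`. -/
def shortenPuncture {F ι : Type*} [Field F] (C : Submodule F (ι → F)) (S P : Finset ι) :
    Submodule F ({j : ι // j ∉ S ∧ j ∉ P} → F) :=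
  (C ⊓ ⨅ j ∈ S, LinearMap.ker (LinearMap.proj (R := F) (φ := fun _ : ι => F) j)).map
    (LinearMap.funLeft F F Subtype.val)

/-- The matrix `I_l ⊗ (1 1 … 1)` with all-one rows of length `w`. -/
def localityRows (F : Type*) [Field F] (l w : ℕ) : Matrix (Fin l) (Fin l × Fin w) F :=
  Matrix.of fun i j => if j.1 = i then 1 else 0

/-- The matrix `(1 1 … 1) ⊗ B`: `l` copies of `B` side by side. -/
def copies {F ρ : Type*} [Field F] {w : ℕ} (l : ℕ) (B : Matrix ρ (Fin w) F) :
    Matrix ρ (Fin l × Fin w) F :=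
  Matrix.of fun i j => B i j.2

/-- The matrix with `I_l ⊗ (1 … 1)` on top of `(1 … 1) ⊗ B`. -/
def uniformPCM {F ρ : Type*} [Field F] {w : ℕ} (l : ℕ) (B : Matrix ρ (Fin w) F) :
    Matrix (Fin l ⊕ ρ) (Fin l × Fin w) F :=
  Matrix.fromRows (localityRows F l w) (copies l B)

/-- The block matrix with block rows `(T, 0)`, `(0, I_l ⊗ (1 … 1))` and `(L, (1 … 1) ⊗ B)`. -/
def mixedPCM {F τ ρ κ : Type*} [Field F] {w : ℕ} (T : Matrix τ κ F) (L : Matrix ρ κ F)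
    (l : ℕ) (B : Matrix ρ (Fin w) F) :
    Matrix ((τ ⊕ Fin l) ⊕ ρ) (κ ⊕ Fin l × Fin w) F :=
  Matrix.fromRows (Matrix.fromBlocks T 0 0 (localityRows F l w)) (Matrix.fromCols L (copies l B))

/-- The matrix obtained from `I_l ⊗ (1 … 1)` (blocks of width `w`) by deleting the columns
in `D`. -/
def truncatedRows (F : Type*) [Field F] (l w : ℕ) (D : Finset (Fin l × Fin w)) :
    Matrix (Fin l) {j : Fin l × Fin w // j ∉ D} F :=
  (localityRows F l w).submatrix id Subtype.val

/-- `H'` is obtained from `H` by substituting nonzero elements for at most `m` zero entries. -/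
def IsZeroSubstitution {F ρ ι : Type*} [Field F] [DecidableEq F] [Fintype ρ] [Fintype ι]
    (H H' : Matrix ρ ι F) (m : ℕ) : Prop :=
  (∀ i j, H i j ≠ 0 → H' i j = H i j) ∧
    (Finset.univ.filter fun p : ρ × ι => H' p.1 p.2 ≠ H p.1 p.2).card ≤ m

/-- Keep the columns of `H` with index at least `m`, i.e. delete the first `m` columns. -/
def dropCols {F ρ : Type*} {N : ℕ} (m : ℕ) (H : Matrix ρ (Fin N) F) :
    Matrix ρ {j : Fin N // m ≤ j.val} F :=
  H.submatrix id Subtype.val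

/-- Keep the first `m` columns of `H`. -/
def takeCols {F ρ : Type*} {N : ℕ} (m : ℕ) (H : Matrix ρ (Fin N) F) :
    Matrix ρ {j : Fin N // j.val < m} F :=
  H.submatrix id Subtype.val

/-- Auxiliary rows repeated in every block for the lengths `3s+3`, distance 3. -/
def aux3s3 {F : Type*} [Field F] (ω : F) : Matrix (Fin 1) (Fin 3) F :=
  !![0, 1, ω]

/-- First two locality rows on the first 7 columns, length `4s+3`. -/
def top4s3 {F : Type*} [Field F] (α : F) : Matrix (Fin 2) (Fin 7) F :=
  !![1, 1, 1, α, 0, 0, 0;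
     0, 0, 0, 1, 1, 1, 1]

/-- Auxiliary row on the first 7 columns, length `4s+3`. -/
def left4s3 {F : Type*} [Field F] (ω : F) : Matrix (Fin 1) (Fin 7) F :=
  !![0, ω, ω^2, 1, 0, ω, ω^2]

/-- Auxiliary rows repeated in every block for the lengths `4s+3`. -/
def aux4s3 {F : Type*} [Field F] (ω : F) : Matrix (Fin 1) (Fin 4) F :=
  !![1, 0, ω, ω^2]

/-- A `[13, 9, 3]` code with locality 4. -/
def mat13_9 {F : Type*} [Field F] (ω : F) : Matrix (Fin 4) (Fin 13) F :=
  !![1, 1, 1, 1, 1, 0, 0, 0, 0, 0, 0, 0, 0;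
     0, 0, 0, 0, 1, 1, 1, 1, 1, 0, 0, 0, 0;
     0, 0, 0, 0, 0, 0, 0, 0, 1, 1, 1, 1, 1;
     0, 1, ω, ω^2, 0, 1, ω, ω^2, 0, 0, 1, ω, ω^2]

/-- An `[18, 13, 3]` code with locality 4. -/
def mat18_13_d3 {F : Type*} [Field F] (ω : F) : Matrix (Fin 5) (Fin 18) F :=
  !![1, 1, 1, 1, 1, 0, 0, 0, 0, 0, 0, 0, 0, 0, 0, 0, 0, 0;
     0, 0, 0, 0, 1, 1, 1, 1, 1, 0, 0, 0, 0, 0, 0, 0, 0, 0;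
     0, 0, 0, 0, 0, 0, 0, 0, 0, 1, 1, 1, 1, 1, 0, 0, 0, 0;
     0, 0, 0, 0, 0, 0, 0, 0, 0, 0, 0, 0, 0, 1, 1, 1, 1, 1;
     0, 1, ω, ω^2, 0, 0, 1, ω, ω^2, 0, 1, ω, ω^2, 0, 0, 1, ω, ω^2]

/-- A `[15, 11, 3]` code with locality 5. -/
def mat15_11 {F : Type*} [Field F] (ω : F) : Matrix (Fin 4) (Fin 15) F :=
  !![1, 1, 1, 1, 1, 1, 0, 0, 0, 0, 0, 0, 0, 0, 0;
     0, 0, 0, 0, 0, 1, 1, 1, 1, 1, 1, 0, 0, 0, 0;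
     0, 0, 0, 0, 1, 0, 0, 0, 0, 0, 1, 1, 1, 1, 1;
     0, 1, ω, ω^2, 0, 1, 0, 1, ω, ω^2, 1, 0, 1, ω, ω^2]

/-- Auxiliary rows repeated in every block for the lengths `4s+4`, distance 3. -/
def aux4s4 {F : Type*} [Field F] (ω : F) : Matrix (Fin 1) (Fin 4) F :=
  !![0, 1, ω, ω^2]

/-- A `[19, 16, 3]` shortened Hamming code. -/
def ham19 {F : Type*} [Field F] (ω : F) : Matrix (Fin 3) (Fin 19) F :=
  !![1, 1, 1, 1, 1, 1, 1, 1, 1, 1, 1, 1, 1, 1, 1, 1, 0, 0, 0;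
     1, 1, 1, ω, ω, ω, ω^2, ω^2, ω^2, ω^2, ω, 1, 0, 0, 0, 0, 1, 1, 1;
     1, ω, ω^2, 1, ω, ω^2, 1, ω, ω^2, 0, 0, 0, ω^2, 0, ω, 1, ω, 1, 0]

/-- A `[20, 17, 3]` shortened Hamming code. -/
def ham20 {F : Type*} [Field F] (ω : F) : Matrix (Fin 3) (Fin 20) F :=
  !![1, 1, 1, 1, 1, 1, 1, 1, 1, 1, 1, 1, 1, 1, 1, 1, 0, 0, 0, 0;
     1, 1, 1, ω, ω, ω, ω^2, ω^2, ω^2, ω^2, ω, 1, 0, 0, 0, 0, 1, 1, 1, 1;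
     1, ω, ω^2, 1, ω, ω^2, 1, ω, ω^2, 0, 0, 0, ω^2, 0, ω, 1, ω^2, ω, 1, 0]

/-- The `[21, 18, 3]` Hamming code. -/
def ham21 {F : Type*} [Field F] (ω : F) : Matrix (Fin 3) (Fin 21) F :=
  !![1, 1, 1, 1, 1, 1, 1, 1, 1, 1, 1, 1, 1, 1, 1, 1, 0, 0, 0, 0, 0;
     1, 1, 1, ω, ω, ω, ω^2, ω^2, ω^2, ω^2, ω, 0, 0, 0, 0, 1, 0, 1, 1, 1, 1;
     1, ω, ω^2, 1, ω, ω^2, 1, ω, ω^2, 0, 0, ω^2, 0, ω, 1, 0, 1, ω^2, ω, 1, 0]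

/-- Auxiliary rows repeated in every block for the lengths `4s+4`, distance 4. -/
def aux4s4d4 (F : Type*) [Field F] : Matrix (Fin 2) (Fin 4) F :=
  !![0, 1, 0, 1;
     0, 0, 1, 1]

/-- First two locality rows on the first 9 columns, length `5s+4`. -/
def top5s4 {F : Type*} [Field F] (α : F) : Matrix (Fin 2) (Fin 9) F :=
  !![1, 1, 1, 1, α, 0, 0, 0, 0;
     0, 0, 0, 0, 1, 1, 1, 1, 1]

/-- Auxiliary rows on the first 9 columns, length `5s+4`. -/
def left5s4 {F : Type*} [Field F] (ω : F) : Matrix (Fin 2) (Fin 9) F :=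
  !![0, 1, 0, ω^2, ω^2, ω^2, 0, 1, 0;
     0, 0, 1, ω^2, 1, ω^2, 1, 0, 0]

/-- Auxiliary rows repeated in every block for the lengths `5s+4`. -/
def aux5s4 {F : Type*} [Field F] (ω : F) : Matrix (Fin 2) (Fin 5) F :=
  !![0, 1, 0, ω^2, ω^2;
     0, 0, 1, ω^2, 1]

/-- First two locality rows on the first 10 columns, length `6s+4`. -/
def top6s4 {F : Type*} [Field F] (α β : F) : Matrix (Fin 2) (Fin 10) F :=
  !![1, 1, 1, 1, α, β, 0, 0, 0, 0;
     0, 0, 0, 0, 1, 1, 1, 1, 1, 1]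

/-- Auxiliary rows on the first 10 columns, length `6s+4`. -/
def left6s4 {F : Type*} [Field F] (ω : F) : Matrix (Fin 2) (Fin 10) F :=
  !![0, 1, 0, ω^2, ω^2, 1, ω^2, 0, 1, 0;
     0, 0, 1, ω^2, 1, ω^2, ω^2, 1, 0, 0]

/-- Auxiliary rows repeated in every block for the lengths `6s+4` (both constructions). -/
def aux6s4 {F : Type*} [Field F] (ω : F) : Matrix (Fin 2) (Fin 6) F :=
  !![0, 1, 0, ω^2, 1, ω^2;
     0, 0, 1, ω^2, ω^2, 1]

/-- First three locality rows on the first 16 columns, length `6s+4`, second construction. -/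
def topB6s4 {F : Type*} [Field F] (α β : F) : Matrix (Fin 3) (Fin 16) F :=
  !![1, 1, 1, 1, 1, α, 0, 0, 0, 0, 0, 0, 0, 0, 0, 0;
     0, 0, 0, 0, 0, 1, 1, 1, 1, 1, β, 0, 0, 0, 0, 0;
     0, 0, 0, 0, 0, 0, 0, 0, 0, 0, 1, 1, 1, 1, 1, 1]

/-- Auxiliary rows on the first 16 columns, length `6s+4`, second construction. -/
def leftB6s4 {F : Type*} [Field F] (ω : F) : Matrix (Fin 2) (Fin 16) F :=
  !![0, 1, 0, ω^2, ω^2, 1, ω^2, ω^2, 0, 1, 1, 1, ω, ω, ω^2, ω^2;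
     0, 0, 1, ω^2, 1, ω^2, 1, ω^2, 1, 0, 0, ω^2, 0, ω, ω^2, ω]

/-- An `[18, 13, 4]` code with locality 6. -/
def mat18_13 {F : Type*} [Field F] (ω : F) : Matrix (Fin 5) (Fin 18) F :=
  !![1, 1, 1, 1, 1, 1, 1, 0, 0, 0, 0, 0, 0, 0, 0, 0, 0, 0;
     0, 0, 0, 0, 0, 0, 1, 1, 1, 1, 1, 1, 1, 0, 0, 0, 0, 0;
     0, 0, 0, 0, 0, 0, 0, 0, 0, 0, 0, 1, 1, 1, 1, 1, 1, 1;
     0, 1, 0, ω^2, ω^2, 1, 1, 1, 1, ω, ω^2, 0, ω^2, 0, 1, 0, ω^2, ω^2;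
     0, 0, 1, ω^2, 1, ω^2, 0, ω^2, ω, 0, 0, 0, ω^2, 0, 0, 1, ω^2, 1]

/-- A `[25, 19, 4]` code with locality 6. -/
def mat25_19 {F : Type*} [Field F] (ω : F) : Matrix (Fin 6) (Fin 25) F :=
  !![1, 1, 1, 1, 1, 1, 1, 0, 0, 0, 0, 0, 0, 0, 0, 0, 0, 0, 0, 0, 0, 0, 0, 0, 0;
     0, 0, 0, 0, 0, 0, 1, 1, 1, 1, 1, 1, 1, 0, 0, 0, 0, 0, 0, 0, 0, 0, 0, 0, 0;
     0, 0, 0, 0, 0, 1, 0, 0, 0, 0, 0, 0, 0, 1, 1, 1, 1, 1, 1, 0, 0, 0, 0, 0, 0;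
     0, 0, 0, 0, 0, 0, 0, 0, 0, 0, 0, 0, 0, 0, 0, 0, 0, 0, 1, 1, 1, 1, 1, 1, 1;
     1, 1, ω, ω, 0, 0, 0, 0, 1, 0, ω^2, ω^2, 1, 1, 1, ω, ω, 0, 0, 0, 1, 0, ω^2, ω^2, 1;
     0, ω^2, 0, 1, ω^2, ω, 1, 0, 0, 1, ω^2, 1, ω^2, 0, ω^2, 0, 1, ω^2, 1, 0, 0, 1, ω^2, 1, ω^2]

/-- A `[20, 15, 4]` code with locality 7. -/
def mat20_15 {F : Type*} [Field F] (ω : F) : Matrix (Fin 5) (Fin 20) F :=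
  !![1, 1, 1, 1, 1, 1, 1, 1, 0, 0, 0, 0, 0, 0, 0, 0, 0, 0, 0, 0;
     0, 0, 0, 0, 0, 0, 1, 1, 1, 1, 1, 1, 1, 1, 0, 0, 0, 0, 0, 0;
     0, 0, 0, 0, 0, 0, 0, 0, 0, 0, 0, 0, 1, 1, 1, 1, 1, 1, 1, 1;
     0, 1, 0, ω^2, ω^2, 1, 1, 1, 1, 1, ω^2, ω^2, 1, ω^2, 0, 1, 0, ω^2, ω^2, 1;
     0, 0, 1, ω^2, 1, ω^2, 0, 1, ω^2, ω, 0, 1, 0, ω^2, 0, 0, 1, ω^2, 1, ω^2]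

/-- Auxiliary rows repeated in every block for the lengths `5s+5`. -/
def aux5s5 {F : Type*} [Field F] (ω : F) : Matrix (Fin 2) (Fin 5) F :=
  !![0, 1, 0, ω^2, ω^2;
     0, 0, 1, ω^2, 1]

/-- First two locality rows on the first 11 columns, length `6s+5`. -/
def top6s5 {F : Type*} [Field F] (α : F) : Matrix (Fin 2) (Fin 11) F :=
  !![1, 1, 1, 1, 1, α, 0, 0, 0, 0, 0;
     0, 0, 0, 0, 0, 1, 1, 1, 1, 1, 1]

/-- Auxiliary rows on the first 11 columns, length `6s+5`. -/
def left6s5 {F : Type*} [Field F] (ω : F) : Matrix (Fin 2) (Fin 11) F :=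
  !![0, 1, 0, ω^2, ω^2, 1, ω^2, ω^2, 0, 1, 0;
     0, 0, 1, ω^2, 1, ω^2, 1, ω^2, 1, 0, 0]

/-- Auxiliary rows repeated in every block for the lengths `6s+5`. -/
def aux6s5 {F : Type*} [Field F] (ω : F) : Matrix (Fin 2) (Fin 6) F :=
  !![0, 1, 0, 1, ω^2, ω^2;
     0, 0, 1, ω^2, ω^2, 1]

/-- A `[19, 14, 4]` code with locality 6. -/
def mat19_14 {F : Type*} [Field F] (ω : F) : Matrix (Fin 5) (Fin 19) F :=
  !![1, 1, 1, 1, 1, 1, 1, 0, 0, 0, 0, 0, 0, 0, 0, 0, 0, 0, 0;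
     0, 0, 0, 0, 0, 0, 1, 1, 1, 1, 1, 1, 1, 0, 0, 0, 0, 0, 0;
     0, 0, 0, 0, 0, 0, 0, 0, 0, 0, 0, 0, 1, 1, 1, 1, 1, 1, 1;
     0, 1, 0, ω^2, ω^2, 1, ω^2, 1, ω^2, ω^2, ω, 1, ω^2, 0, 1, 0, ω^2, ω^2, 1;
     0, 0, 1, ω^2, 1, ω^2, 1, ω, ω^2, ω, ω^2, 1, 1, 0, 0, 1, ω^2, 1, ω^2]

/-- Auxiliary rows repeated in every block for the lengths `6s+6`. -/
def aux6s6 {F : Type*} [Field F] (ω : F) : Matrix (Fin 2) (Fin 6) F :=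
  !![0, 1, 0, ω^2, ω^2, 1;
     0, 0, 1, ω^2, 1, ω^2]

/-- Auxiliary rows repeated in every block for the lengths `2s+2`. -/
def aux2s2 (F : Type*) [Field F] : Matrix (Fin 1) (Fin 2) F :=
  !![0, 1]

/-- A `[16, 12, 4]` code. -/
def cap16 {F : Type*} [Field F] (ω : F) : Matrix (Fin 4) (Fin 16) F :=
  !![1, 1, 1, 0, 0, 0, 0, ω^2, ω, 1, ω, ω^2, ω^2, 1, ω^2, 1;
     0, 0, 1, 1, 1, 0, 0, ω, ω^2, ω, ω, 0, ω, ω, ω^2, ω^2;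
     0, 0, 0, 0, 1, 1, 1, ω, ω, ω^2, ω^2, ω^2, ω, 1, 1, ω;
     ω^2, ω, 1, 0, 1, ω, ω^2, 1, 1, 1, 1, 1, ω, 1, ω^2, ω]

/-- A `[17, 13, 4]` code. -/
def cap17 {F : Type*} [Field F] (ω : F) : Matrix (Fin 4) (Fin 17) F :=
  !![1, 1, 1, 1, 0, 0, 0, 0, 0, ω, 1, ω^2, ω^2, ω^2, ω, ω, ω^2;
     0, 0, 0, 1, 1, 1, 1, 0, 0, ω, 1, 1, ω, 1, ω^2, 1, ω;
     0, 0, 1, 0, 0, 0, 1, 1, 1, ω^2, ω, ω, ω, ω^2, ω, 1, 1;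
     1, ω, 0, 1, 1, ω, 0, 0, ω^2, 1, ω, ω, ω, ω^2, 0, 0, 1]

/-- A `[14, 10, 4]` code. -/
def cap14 {F : Type*} [Field F] (ω : F) : Matrix (Fin 4) (Fin 14) F :=
  !![1, 1, 1, 1, 1, 1, 0, 0, 0, 0, 0, 0, 1, ω;
     0, 0, 0, 0, 1, 1, 1, 1, 1, 1, 0, 0, 1, ω;
     1, 1, 0, 0, 0, 0, 1, 1, 0, 0, 1, 1, 1, ω;
     1, ω, 1, ω, 1, ω, 1, ω, 1, ω, 1, ω, ω, ω]

/-- A `[10, 5, 4]` code with locality 2. -/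
def matTwo2 {F : Type*} [Field F] (ω : F) : Matrix (Fin 5) (Fin 10) F :=
  !![1, 1, 1, 0, 0, 0, 0, 0, 0, 0;
     0, 0, 1, 1, 1, 0, 0, 0, 0, 0;
     0, 0, 0, 0, 0, 1, 1, 1, 0, 0;
     0, 0, 0, 0, 0, 0, 0, 1, 1, 1;
     1, ω, 1, 1, ω, 1, ω, 1, 1, ω]

/-- A `[12, 7, 4]` code with locality 3. -/
def matTwo3 {F : Type*} [Field F] (ω : F) : Matrix (Fin 5) (Fin 12) F :=
  !![1, 1, 1, 1, 0, 0, 0, 0, 0, 0, 0, 0;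
     0, 0, 1, 1, 1, 1, 0, 0, 0, 0, 0, 0;
     0, 0, 0, 0, 0, 0, 1, 1, 1, 1, 0, 0;
     0, 0, 0, 0, 0, 0, 0, 0, 1, 1, 1, 1;
     1, ω, 1, ω, 1, ω, 1, ω, 1, ω, 1, ω]

/-- A `[14, 9, 4]` code with locality 4. -/
def matTwo4 {F : Type*} [Field F] (ω : F) : Matrix (Fin 5) (Fin 14) F :=
  !![1, 1, 1, 1, 1, 0, 0, 0, 0, 0, 0, 0, 0, 0;
     0, 0, 0, 1, 1, 1, 1, 1, 0, 0, 0, 0, 0, 0;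
     1, 0, 0, 0, 0, 0, 0, 0, 1, 1, 1, 1, 0, 0;
     0, 0, 0, 0, 0, 1, 0, 0, 0, 0, 1, 1, 1, 1;
     1, 1, ω, 1, ω, 1, ω, 1, 1, ω, 1, ω, 1, ω]

/-- A `[16, 11, 4]` code with locality 5. -/
def matTwo5 {F : Type*} [Field F] (ω : F) : Matrix (Fin 5) (Fin 16) F :=
  !![1, 1, 1, 1, 1, 1, 0, 0, 0, 0, 0, 0, 0, 0, 0, 0;
     0, 0, 0, 0, 1, 1, 1, 1, 1, 1, 0, 0, 0, 0, 0, 0;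
     1, 0, 0, 0, 0, 0, 0, 0, 1, 0, 1, 1, 1, 1, 0, 0;
     0, 1, 0, 0, 0, 0, 0, 0, 0, 1, 0, 0, 1, 1, 1, 1;
     1, 1, 1, ω, 1, ω, 1, ω, 1, 1, 1, ω, 1, ω, 1, ω]

/-- A `[18, 13, 4]` code with locality 6. -/
def matTwo6 {F : Type*} [Field F] (ω : F) : Matrix (Fin 5) (Fin 18) F :=
  !![1, 1, 1, 1, 1, 1, 1, 0, 0, 0, 0, 0, 0, 0, 0, 0, 0, 0;
     0, 0, 0, 0, 0, 1, 1, 1, 1, 1, 1, 1, 0, 0, 0, 0, 0, 0;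
     1, 0, 1, 0, 0, 0, 0, 0, 0, 0, 1, 0, 1, 1, 1, 1, 0, 0;
     0, 1, 0, 0, 0, 0, 0, 0, 0, 1, 0, 1, 0, 0, 1, 1, 1, 1;
     1, 1, ω, 1, ω, 1, ω, 1, ω, 1, 1, ω, 1, ω, 1, ω, 1, ω]

/-- A `[20, 15, 4]` code with locality 7. -/
def matTwo7 {F : Type*} [Field F] (ω : F) : Matrix (Fin 5) (Fin 20) F :=
  !![1, 1, 1, 1, 1, 1, 1, 1, 0, 0, 0, 0, 0, 0, 0, 0, 0, 0, 0, 0;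
     0, 0, 0, 0, 0, 0, 1, 1, 1, 1, 1, 1, 1, 1, 0, 0, 0, 0, 0, 0;
     1, 0, 1, 0, 0, 0, 0, 0, 0, 0, 1, 0, 1, 0, 1, 1, 1, 1, 0, 0;
     0, 1, 0, 1, 0, 0, 0, 0, 0, 0, 0, 1, 0, 1, 0, 0, 1, 1, 1, 1;
     1, 1, ω, ω, 1, ω, 1, ω, 1, ω, 1, 1, ω, ω, 1, ω, 1, ω, 1, ω]

/-- An `[8, 2, 6]` code with locality 1. -/
def mat8_2 {F : Type*} [Field F] (ω : F) : Matrix (Fin 6) (Fin 8) F :=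
  !![1, 1, 0, 0, 0, 0, 0, 0;
     0, 0, 1, 1, 0, 0, 0, 0;
     0, 0, 0, 0, 1, 1, 0, 0;
     0, 0, 0, 0, 0, 0, 1, 1;
     0, 1, 0, 1, 0, 1, 0, 0;
     0, ω, 0, 1, 0, 0, 0, 1]

/-- A `[10, 3, 6]` code with locality 1. -/
def mat10_3 {F : Type*} [Field F] (ω : F) : Matrix (Fin 7) (Fin 10) F :=
  !![1, 1, 0, 0, 0, 0, 0, 0, 0, 0;
     0, 0, 1, 1, 0, 0, 0, 0, 0, 0;
     0, 0, 0, 0, 1, 1, 0, 0, 0, 0;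
     0, 0, 0, 0, 0, 0, 1, 1, 0, 0;
     0, 0, 0, 0, 0, 0, 0, 0, 1, 1;
     0, 1, 0, 1, 0, ω, 0, ω, 0, 0;
     0, ω, 0, 1, 0, 1, 0, 0, 0, 1]

/-- A `[10, 2, 8]` code with locality 1. -/
def mat10_2 {F : Type*} [Field F] (ω : F) : Matrix (Fin 8) (Fin 10) F :=
  !![1, 1, 0, 0, 0, 0, 0, 0, 0, 0;
     0, 0, 1, 1, 0, 0, 0, 0, 0, 0;
     0, 0, 0, 0, 1, 1, 0, 0, 0, 0;
     0, 0, 0, 0, 0, 0, 1, 1, 0, 0;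
     0, 0, 0, 0, 0, 0, 0, 0, 1, 1;
     0, 1, 0, 1, 0, ω, 0, ω, 0, 0;
     0, ω, 0, 1, 0, 1, 0, 0, 0, 1;
     0, 0, 0, 1, 0, 0, 0, ω, 0, 1]

/-- A `[12, 3, 8]` code with locality 1. -/
def mat12_3 {F : Type*} [Field F] (ω : F) : Matrix (Fin 9) (Fin 12) F :=
  !![1, 1, 0, 0, 0, 0, 0, 0, 0, 0, 0, 0;
     0, 0, 1, 1, 0, 0, 0, 0, 0, 0, 0, 0;
     0, 0, 0, 0, 1, 1, 0, 0, 0, 0, 0, 0;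
     0, 0, 0, 0, 0, 0, 1, 1, 0, 0, 0, 0;
     0, 0, 0, 0, 0, 0, 0, 0, 1, 1, 0, 0;
     0, 0, 0, 0, 0, 0, 0, 0, 0, 0, 1, 1;
     0, 1, 0, 1, 0, ω, 0, ω, 0, 0, 0, 0;
     0, ω, 0, 1, 0, 1, 0, 0, 0, 1, 0, 0;
     0, 0, 0, 1, 0, 0, 0, ω, 0, 1, 0, 1]

/-- A `[12, 6, 6]` near-MDS code with locality 5. -/
def nearMDS12 {F : Type*} [Field F] (ω : F) : Matrix (Fin 6) (Fin 12) F :=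
  !![1, 1, 1, 1, 1, 1, 0, 0, 0, 0, 0, 0;
     0, 0, 0, 0, 0, 0, 1, 1, 1, 1, 1, 1;
     0, 1, 0, 0, ω, 1, 0, 0, 1, 0, 1, ω^2;
     0, 0, ω^2, 0, 1, 0, 0, 0, 1, ω, 1, ω;
     0, 0, 0, ω^2, ω, ω^2, 0, 0, ω^2, ω^2, 0, 1;
     0, 0, 0, 0, ω, ω, 0, ω^2, ω^2, 1, ω, ω]

/-- A `[12, 5, 6]` code with locality 2. -/
def mat12_5 {F : Type*} [Field F] (ω : F) : Matrix (Fin 7) (Fin 12) F :=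
  !![1, 1, 1, 0, 0, 0, 0, 0, 0, 0, 0, 0;
     0, 0, 0, 1, 1, 1, 0, 0, 0, 0, 0, 0;
     0, 0, 0, 0, 0, 0, 1, 1, 1, 0, 0, 0;
     0, 0, 0, 0, 0, 0, 0, 0, 0, 1, 1, 1;
     0, ω^2, 1, 0, ω^2, 1, 0, ω^2, 1, 0, 0, 0;
     0, 0, ω, 0, ω, ω, 0, ω, 0, 0, 1, 0;
     0, 1, 1, 0, 1, 0, 0, ω^2, 0, 0, 0, 1]

/-- A `[15, 7, 6]` code with locality 2. -/
def mat15_7 {F : Type*} [Field F] (ω : F) : Matrix (Fin 8) (Fin 15) F :=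
  !![1, 1, 1, 0, 0, 0, 0, 0, 0, 0, 0, 0, 0, 0, 0;
     0, 0, 0, 1, 1, 1, 0, 0, 0, 0, 0, 0, 0, 0, 0;
     0, 0, 0, 0, 0, 0, 1, 1, 1, 0, 0, 0, 0, 0, 0;
     0, 0, 0, 0, 0, 0, 0, 0, 0, 1, 1, 1, 0, 0, 0;
     0, 0, 0, 0, 0, 0, 0, 0, 0, 0, 0, 0, 1, 1, 1;
     0, ω^2, 1, 0, ω^2, 1, 0, ω^2, 1, 0, 0, 0, 0, 1, ω;
     0, 0, ω, 0, ω, ω, 0, ω, 0, 0, 1, 0, 0, 0, ω^2;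
     0, 1, 1, 0, 1, 0, 0, ω^2, 0, 0, 0, 1, 0, 1, ω^2]

/-! A code `C` is studied through the columns of a parity-check matrix, that is, through vectors `h
i` in `V = (ι → F) ⧸ C`, a space of dimension `n - k`. Distance at least `d` means that any `d - 1`
of these vectors are independent. A dual word is a functional on `V`, supported on the points where
it does not vanish, and locality says that every point lies in a support of size at most `r + 1`.

Choosing local functionals one after another, each nonzero at a common zero of the earlier ones,
yields an independent family. Each step lowers the dimension of the common kernel by one and uses up
at most `r + 1` points. This proves the Singleton-like bound (`IsLocal.singleton_bound`). Write `k =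
m * r + t` with `1 ≤ t ≤ r`; then optimality says `dim V = m + d - 1` and `n = m * (r + 1) + t + d -
1` (`IsOptConfig`). So `m` independent local functionals leave at least `t + d - 1` points in a
space of dimension `d - 1`, and `m + 1` of them leave at most `d - 2` points. Over four elements
there is little room for this: pairwise independent vectors in dimension two number at most five,
arcs in dimension three at most six, and arcs in dimension `m ≥ 4` at most `m + 1`
(`RelDist.card_le_five`, `RelDist.card_le_six`, `RelDist.card_le_add_one`).

For `d = 3, 4` and `m ≥ 2` there are two cases. If some `m + 1` local functionals cover all points,
incidences are counted twice: the points covered by one functional only are at most four (`d = 3`)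
or six (`d = 4`) for each functional, and for `d = 4` the count is sharpened by
`RelDist.hyperoval_pair`. If no such family covers, a family of size `m` with the most common zeros
forces large unions of supports; this is contradictory for `d = 3` and leaves few parameters for `d
= 4`. For `m = 1` the question is about point sets in the projective plane and about caps in
projective three-space of order four; the case of a cap with a hyperoval section is settled by a
search (`RelDist.card_nonzeros_le_eight`).

For `d ≥ 5` the arc bound forces `t = 1`. The impossibility of ten lines of the projective plane of
order four with at most three through each point gives `r ≤ 5` and `d ≤ 6` when `r ≥ 2`. If `m ≥ 2`
or `r = 1`, all estimates are tight and the supports partition the points into blocks of size `r +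
1`. For `m, r ≥ 2` this gives `r + 1 ∣ d`, and only blocks of three, five or six points remain; they
are handled by counting and by a second search (`BlockRel.not_six_six`).

Conversely, a code with the required locality and with dimension and distance at least as claimed is
optimal, because the bound excludes larger values (`isOptimalLRC_of_le`). The distances of the
matrices are verified by computation. The infinite families need only finite checks, since words
that are nonzero in two blocks already have weight four. -/

section Config

/-! ### Local functionals and the Singleton-like bound -/

variable {F V ι : Type*} [Field F] [DecidableEq F] [AddCommGroup V] [Module F V] [Fintype ι]

/-- Every nontrivial linear relation between the vectors `h i` involves at least `d` of them. -/
def RelDist (F : Type*) {V ι : Type*} [Field F] [DecidableEq F] [AddCommGroup V] [Module F V]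
    [Fintype ι] (h : ι → V) (d : ℕ) : Prop :=
  ∀ x : ι → F, ∑ i, x i • h i = 0 → x ≠ 0 → d ≤ hammingNorm x

/-- The indices of the vectors on which the functional `u` does not vanish. -/
def nonzeros (h : ι → V) (u : Module.Dual F V) : Finset ι :=
  Finset.univ.filter fun i => u (h i) ≠ 0

/-- The indices of the vectors on which all functionals in `L` vanish. -/
def zeros (h : ι → V) (L : Finset (Module.Dual F V)) : Finset ι :=
  Finset.univ.filter fun i => ∀ u ∈ L, u (h i) = 0

@[simp] theorem mem_nonzeros {h : ι → V} {u : Module.Dual F V} {i : ι} :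
    i ∈ nonzeros h u ↔ u (h i) ≠ 0 := by simp [nonzeros]

@[simp] theorem mem_zeros {h : ι → V} {L : Finset (Module.Dual F V)} {i : ι} :
    i ∈ zeros h L ↔ ∀ u ∈ L, u (h i) = 0 := by simp [zeros]

theorem RelDist.mono {h : ι → V} {d e : ℕ} (H : RelDist F h d) (hed : e ≤ d) : RelDist F h e :=
  fun x hx hx0 => hed.trans (H x hx hx0)

theorem RelDist.linearIndepOn {h : ι → V} {d : ℕ} (H : RelDist F h d) {s : Finset ι}
    (hs : s.card < d) : LinearIndepOn F h (s : Set ι) := by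
  classical
  rw [linearIndepOn_finset_iff]
  intro g hg i hi
  by_contra hne
  have := H (fun i => if i ∈ s then g i else 0) (by simpa [ite_smul, Finset.sum_ite_mem] using hg)
    (fun h0 => hne (by simpa [hi] using congrFun h0 i))
  have h2 : hammingNorm (fun i => if i ∈ s then g i else 0) ≤ s.card := by
    unfold hammingNorm
    apply Finset.card_le_card
    intro j hj
    simp at hj
    exact hj.1
  omega

omit [DecidableEq F] [Fintype ι] in
theorem LinearIndepOn.card_le_finrank_of_mem [FiniteDimensional F V] {h : ι → V} {s : Finset ι}
    (hs : LinearIndepOn F h (s : Set ι)) (W : Submodule F V) (hW : ∀ i ∈ s, h i ∈ W) :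
    s.card ≤ Module.finrank F W := by
  have h1 : LinearIndependent F (fun i : s => (⟨h i, hW i i.2⟩ : W)) :=
    LinearIndependent.of_comp W.subtype hs
  simpa using h1.fintype_card_le_finrank

/-- Otherwise `finrank W + 1` of the vectors would still be fewer than `d`, hence independent, in a
space too small for them. -/
theorem RelDist.card_le_finrank [FiniteDimensional F V] {h : ι → V} {d : ℕ} (H : RelDist F h d)
    {s : Finset ι} (W : Submodule F V) (hW : ∀ i ∈ s, h i ∈ W) (hd : Module.finrank F W + 1 < d) :
    s.card ≤ Module.finrank F W := by
  by_contra! hlt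
  obtain ⟨t, hts, ht⟩ := Finset.exists_subset_card_eq (Nat.succ_le_of_lt hlt)
  have := (H.linearIndepOn (s := t) (by omega)).card_le_finrank_of_mem W fun i hi => hW i (hts hi)
  omega

/-- The common kernel of the functionals in `L`. -/
def commonKer (L : Finset (Module.Dual F V)) : Submodule F V :=
  (Submodule.span F (L : Set (Module.Dual F V))).dualCoannihilator

omit [DecidableEq F] in
theorem mem_commonKer {L : Finset (Module.Dual F V)} {v : V} :
    v ∈ commonKer L ↔ ∀ u ∈ L, u v = 0 := by
  rw [commonKer, Submodule.mem_dualCoannihilator]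
  constructor
  · exact fun H u hu => H u (Submodule.subset_span hu)
  · intro H u hu
    induction hu using Submodule.span_induction with
    | mem x hx => exact H x hx
    | zero => rfl
    | add x y _ _ hx hy => simp [hx, hy]
    | smul c x _ hx => simp [hx]

omit [DecidableEq F] in
theorem finrank_commonKer [FiniteDimensional F V] {L : Finset (Module.Dual F V)}
    (hL : LinearIndepOn F id (L : Set (Module.Dual F V))) :
    Module.finrank F (commonKer L) + L.card = Module.finrank F V := by
  have := Subspace.finrank_add_finrank_dualCoannihilator_eq
    (Submodule.span F (L : Set (Module.Dual F V)))
  rw [finrank_span_finset_eq_card hL] at this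
  rw [commonKer]; omega

theorem mem_commonKer_of_mem_zeros {h : ι → V} {L : Finset (Module.Dual F V)} {i : ι}
    (hi : i ∈ zeros h L) : h i ∈ commonKer L :=
  mem_commonKer.2 (mem_zeros.1 hi)

/-- A linearly independent family of functionals, each nonzero on at most `r + 1` points. -/
def IsLocalFamily (h : ι → V) (r : ℕ) (L : Finset (Module.Dual F V)) : Prop :=
  LinearIndepOn F id (L : Set (Module.Dual F V)) ∧ ∀ u ∈ L, (nonzeros h u).card ≤ r + 1

/-- Every point has a local functional. -/
def IsLocal (F : Type*) {V ι : Type*} [Field F] [DecidableEq F] [AddCommGroup V] [Module F V]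
    [Fintype ι] (h : ι → V) (r : ℕ) : Prop :=
  ∀ i, ∃ u : Module.Dual F V, u (h i) ≠ 0 ∧ (nonzeros h u).card ≤ r + 1

theorem isLocalFamily_empty (h : ι → V) (r : ℕ) : IsLocalFamily (F := F) h r ∅ := by
  simp [IsLocalFamily]

theorem notMem_span_of_mem_zeros {h : ι → V} {L : Finset (Module.Dual F V)} {i : ι}
    {u : Module.Dual F V} (hi : i ∈ zeros h L) (hu : u (h i) ≠ 0) :
    u ∉ Submodule.span F (L : Set (Module.Dual F V)) := by
  intro hmem
  have := mem_commonKer_of_mem_zeros hi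
  rw [commonKer, Submodule.mem_dualCoannihilator] at this
  exact hu (this u hmem)

variable [DecidableEq (Module.Dual F V)]

/-- A functional in the span of `L` vanishes at the common zeros of `L`; one that does not vanish at
such a zero is therefore independent of `L`. This is what makes greedy choices independent. -/
theorem IsLocalFamily.insert {h : ι → V} {r : ℕ} {L : Finset (Module.Dual F V)}
    (hL : IsLocalFamily h r L) {i : ι} {u : Module.Dual F V} (hi : i ∈ zeros h L)
    (hu : u (h i) ≠ 0) (hr : (nonzeros h u).card ≤ r + 1) :
    IsLocalFamily h r (insert u L) ∧ (insert u L).card = L.card + 1 := by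
  have hspan := notMem_span_of_mem_zeros hi hu
  have hnot : u ∉ L := fun hmem => hspan (Submodule.subset_span hmem)
  refine ⟨⟨?_, ?_⟩, Finset.card_insert_of_notMem hnot⟩
  · rw [Finset.coe_insert]
    exact LinearIndepOn.id_insert hL.1 hspan
  · intro v hv
    rcases Finset.mem_insert.1 hv with rfl | hv
    · exact hr
    · exact hL.2 v hv

omit [DecidableEq (Module.Dual F V)] in
theorem IsLocalFamily.subset {h : ι → V} {r : ℕ} {L M : Finset (Module.Dual F V)}
    (hL : IsLocalFamily h r L) (hM : M ⊆ L) : IsLocalFamily h r M :=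
  ⟨hL.1.mono (by exact_mod_cast hM), fun u hu => hL.2 u (hM hu)⟩

theorem zeros_insert [DecidableEq ι] (h : ι → V) (u : Module.Dual F V)
    (L : Finset (Module.Dual F V)) : zeros h (insert u L) = zeros h L \ nonzeros h u := by
  ext i
  simp [and_comm]

theorem card_zeros_le_insert (h : ι → V) (u : Module.Dual F V)
    (L : Finset (Module.Dual F V)) :
    (zeros h L).card ≤ (zeros h (insert u L)).card + (nonzeros h u).card := by
  classical
  rw [zeros_insert]
  have := Finset.le_card_sdiff (nonzeros h u) (zeros h L)
  omega

/-- Greedy extension of local families. -/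
theorem IsLocal.extend {h : ι → V} {r : ℕ} (hloc : IsLocal F h r) (j : ℕ) :
    ∀ L : Finset (Module.Dual F V), IsLocalFamily h r L → j * (r + 1) < (zeros h L).card + (r + 1) →
      ∃ M, L ⊆ M ∧ IsLocalFamily h r M ∧ M.card = L.card + j ∧
        (zeros h L).card ≤ (zeros h M).card + j * (r + 1) := by
  induction j with
  | zero => exact fun L hL _ => ⟨L, subset_rfl, hL, by simp, by simp⟩
  | succ j ih =>
    intro L hL hlt
    -- Without subtraction, the hypothesis says that `j - 1` steps, each costing at most `r + 1`
    -- zeros, cannot exhaust the common zeros. So one is left before every step, including the last.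
    obtain ⟨i, hi⟩ : (zeros h L).Nonempty := by
      rw [← Finset.card_pos]
      have : r + 1 ≤ (j + 1) * (r + 1) := Nat.le_mul_of_pos_left _ (by omega)
      omega
    obtain ⟨u, hu, hr⟩ := hloc i
    obtain ⟨hL', hc⟩ := hL.insert hi hu hr
    have h1 := card_zeros_le_insert h u L
    obtain ⟨M, hLM, hM, hMc, hMz⟩ := ih (insert u L) hL' (by rw [add_mul] at hlt; omega)
    refine ⟨M, (Finset.subset_insert u L).trans hLM, hM, by omega, ?_⟩
    rw [add_mul]; omega

omit [DecidableEq (Module.Dual F V)] in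
theorem zeros_empty (h : ι → V) : zeros (F := F) h ∅ = Finset.univ := by
  ext; simp

omit [DecidableEq (Module.Dual F V)] in
theorem zeros_anti (h : ι → V) {L M : Finset (Module.Dual F V)} (hLM : L ⊆ M) :
    zeros h M ⊆ zeros h L := by
  intro i hi
  rw [mem_zeros] at hi ⊢
  exact fun u hu => hi u (hLM hu)

omit [DecidableEq (Module.Dual F V)] in
/-- A local family of size `finrank V - e` exists and has many common zeros. -/
theorem IsLocal.exists_family {h : ι → V} {r : ℕ} (hloc : IsLocal F h r) (j : ℕ)
    (hj : j * (r + 1) < Fintype.card ι + (r + 1)) :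
    ∃ M : Finset (Module.Dual F V), IsLocalFamily h r M ∧ M.card = j ∧
      Fintype.card ι ≤ (zeros h M).card + j * (r + 1) := by
  classical
  obtain ⟨M, -, hM, hc, hz⟩ := hloc.extend j ∅ (isLocalFamily_empty h r)
    (by rw [zeros_empty]; simpa using hj)
  exact ⟨M, hM, by simpa using hc, by simpa [zeros_empty] using hz⟩

omit [DecidableEq (Module.Dual F V)] in
/-- The Singleton-like bound, for systems of vectors. -/
theorem IsLocal.singleton_bound [FiniteDimensional F V] {h : ι → V} {r : ℕ} (hloc : IsLocal F h r)
    {m e : ℕ} (hV : Module.finrank F V ≤ m + e)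
    (hcard : m * (r + 1) + e < Fintype.card ι) : ¬ RelDist F h (e + 2) := by
  intro H
  -- After `m` functionals more than `e` points are left in a common kernel of dimension at most
  -- `e`.
  obtain ⟨M, hM, hc, hz⟩ := hloc.exists_family m (by omega)
  have h1 := finrank_commonKer hM.1
  have h2 := H.card_le_finrank (s := zeros h M) (commonKer M)
    (fun i hi => mem_commonKer_of_mem_zeros hi)
  by_cases h3 : Module.finrank F (commonKer M) + 1 < e + 2
  · have := h2 h3
    omega
  · omega

end Config

/-! ### Codes as systems of vectors -/

section CodeConfig

variable {F ι : Type*} [Field F] [DecidableEq F] [Fintype ι] [DecidableEq ι]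

theorem ceilDiv_eq_of_bounds {k r l : ℕ} (hr : 0 < r) (h1 : (l - 1) * r < k) (h2 : k ≤ l * r) :
    k ⌈/⌉ r = l := by
  apply le_antisymm
  · rw [ceilDiv_le_iff_le_mul hr, mul_comm]; exact h2
  · by_contra! hlt
    have : k ⌈/⌉ r ≤ l - 1 := by omega
    rw [ceilDiv_le_iff_le_mul hr, mul_comm] at this
    omega

theorem le_ceilDiv_mul {k r : ℕ} (hr : 0 < r) : k ≤ (k ⌈/⌉ r) * r := by
  rw [mul_comm, ← ceilDiv_le_iff_le_mul hr]

theorem ceilDiv_pos_of_pos {k r : ℕ} (hr : 0 < r) (hk : 0 < k) : 0 < k ⌈/⌉ r := by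
  have := le_ceilDiv_mul (k := k) hr
  rcases Nat.eq_zero_or_pos (k ⌈/⌉ r) with h | h
  · simp [h] at this; omega
  · exact h

theorem ceilDiv_sub_one_mul_lt {k r : ℕ} (hr : 0 < r) (hk : 0 < k) : (k ⌈/⌉ r - 1) * r < k := by
  by_contra! hle
  rw [mul_comm, ← ceilDiv_le_iff_le_mul hr] at hle
  have : 0 < k ⌈/⌉ r := ceilDiv_pos_of_pos hr hk
  omega

/-- The images of the standard basis vectors modulo a code: the columns of a parity-check matrix. -/
def quotCol (C : Submodule F (ι → F)) (i : ι) : (ι → F) ⧸ C :=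
  C.mkQ (Pi.single i 1)

omit [DecidableEq F] in
theorem sum_smul_quotCol (C : Submodule F (ι → F)) (x : ι → F) :
    ∑ i, x i • quotCol C i = C.mkQ x := by
  conv_rhs => rw [pi_eq_sum_univ' x]
  simp [quotCol, map_sum]

theorem relDist_quotCol_iff (C : Submodule F (ι → F)) (d : ℕ) :
    RelDist F (quotCol C) d ↔ ∀ c ∈ C, c ≠ 0 → d ≤ hammingNorm c := by
  simp [RelDist, sum_smul_quotCol]

/-- The functional on the quotient by `C` given by a word orthogonal to `C`. -/
def quotFunctional (C : Submodule F (ι → F)) (w : ι → F) (hw : ∀ c ∈ C, ∑ i, w i * c i = 0) :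
    Module.Dual F ((ι → F) ⧸ C) :=
  C.liftQ (∑ i, w i • LinearMap.proj i) (by
    intro c hc
    simpa [LinearMap.mem_ker] using hw c hc)

omit [DecidableEq F] in
theorem quotFunctional_quotCol (C : Submodule F (ι → F)) (w : ι → F)
    (hw : ∀ c ∈ C, ∑ i, w i * c i = 0) (i : ι) :
    quotFunctional C w hw (quotCol C i) = w i := by
  simp [quotFunctional, quotCol, Pi.single_apply]

theorem nonzeros_quotFunctional (C : Submodule F (ι → F)) (w : ι → F)
    (hw : ∀ c ∈ C, ∑ i, w i * c i = 0) :
    nonzeros (quotCol C) (quotFunctional C w hw) = Finset.univ.filter fun i => w i ≠ 0 := by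
  ext i; simp [quotFunctional_quotCol]

/-- With everything on one side, a repair rule is a dual word with entry `1` at `i` and `-μ j` on
`R`; the coefficients being nonzero, its support is all of `insert i R`. -/
theorem IsRepairSet.exists_functional {C : Submodule F (ι → F)} {i : ι} {R : Finset ι}
    (h : IsRepairSet C i R) : ∃ u : Module.Dual F ((ι → F) ⧸ C),
      nonzeros (quotCol C) u = insert i R := by
  obtain ⟨hi, μ, hμ, hC⟩ := h
  let w : ι → F := fun j => if j = i then 1 else if j ∈ R then - μ j else 0
  have hw : ∀ c ∈ C, ∑ j, w j * c j = 0 := by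
    intro c hc
    have h1 : ∀ j, w j * c j = (if j = i then c j else 0) - if j ∈ R then μ j * c j else 0 := by
      intro j
      by_cases hj : j = i
      · subst hj; simp [w, hi]
      · by_cases hR : j ∈ R <;> simp [w, hj, hR]
    simp only [h1, Finset.sum_sub_distrib, Finset.sum_ite_eq', Finset.mem_univ, if_true]
    rw [hC c hc]
    simp
  refine ⟨quotFunctional C w hw, ?_⟩
  rw [nonzeros_quotFunctional]
  ext j
  by_cases hj : j = i
  · simp [w, hj]
  · by_cases hR : j ∈ R
    · simp [w, hj, hR, hμ j hR]
    · simp [w, hj, hR]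

theorem HasLocality.isLocal {C : Submodule F (ι → F)} {r : ℕ} (h : HasLocality C r) :
    IsLocal F (quotCol C) r ∧
      ∃ u : Module.Dual F ((ι → F) ⧸ C), (nonzeros (quotCol C) u).card = r + 1 := by
  obtain ⟨R, hR, hcard, i₀, hi₀⟩ := h
  constructor
  · intro i
    obtain ⟨u, hu⟩ := (hR i).exists_functional
    refine ⟨u, ?_, ?_⟩
    · rw [← mem_nonzeros, hu]; exact Finset.mem_insert_self _ _
    · rw [hu, Finset.card_insert_of_notMem (hR i).1]
      have := hcard i; omega
  · obtain ⟨u, hu⟩ := (hR i₀).exists_functional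
    exact ⟨u, by rw [hu, Finset.card_insert_of_notMem (hR i₀).1, hi₀]⟩

omit [DecidableEq ι] in
theorem HasMinDist.le_hammingNorm {C : Submodule F (ι → F)} {d : ℕ} (h : HasMinDist C d) :
    ∀ c ∈ C, c ≠ 0 → d ≤ hammingNorm c := by
  intro c hc h0
  refine h.2 ⟨c, hc, 0, C.zero_mem, h0, ?_⟩
  simp

/-- A code with locality and large enough dimension and distance is optimal. -/
theorem isOptimalLRC_of_le {C : Submodule F (ι → F)} {n k r d : ℕ} (hn : Fintype.card ι = n)
    (hr : 1 ≤ r) (hk : 1 ≤ k) (hd : 2 ≤ d) (hdim : k ≤ Module.finrank F C)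
    (hloc : HasLocality C r) (hdist : ∀ c ∈ C, c ≠ 0 → d ≤ hammingNorm c)
    (hE : d + k + k ⌈/⌉ r = n + 2) : IsOptimalLRC C n k r d := by
  have hquot := Submodule.finrank_quotient_add_finrank C
  rw [Module.finrank_pi, hn] at hquot
  have hl := ceilDiv_sub_one_mul_lt (k := k) (r := r) hr hk
  have hl0 : 0 < k ⌈/⌉ r := ceilDiv_pos_of_pos hr hk
  obtain ⟨l, hlk⟩ : ∃ l, k ⌈/⌉ r = l + 1 := ⟨k ⌈/⌉ r - 1, by omega⟩
  rw [hlk] at hl hE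
  have hl' : l * (r + 1) = l * r + l := by ring
  simp only [Nat.add_sub_cancel] at hl
  have hD := (relDist_quotCol_iff C d).2 hdist
  refine ⟨⟨hn, ?_, hloc⟩, ?_, by rw [hlk]; exact hE⟩
  -- A larger dimension would make the quotient too small for distance `d = e + 2`. The bound is
  -- applied with `l = ⌈k / r⌉ - 1` functionals.
  · by_contra hne
    obtain ⟨e, rfl⟩ : ∃ e, d = e + 2 := ⟨d - 2, by omega⟩
    refine hloc.isLocal.1.singleton_bound (m := l) (e := e) ?_ ?_ hD
    · omega
    · omega
  -- If no word had weight `d`, the distance would be at least `d + 1`, again against the bound.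
  · have hex : ∃ c ∈ C, c ≠ 0 ∧ hammingNorm c = d := by
      by_contra! hno
      obtain ⟨e, rfl⟩ : ∃ e, d = e + 1 := ⟨d - 1, by omega⟩
      refine hloc.isLocal.1.singleton_bound (m := l) (e := e) ?_ ?_
        ((relDist_quotCol_iff C (e + 2)).2 fun c hc h0 => ?_)
      · omega
      · omega
      · have h1 := hdist c hc h0
        have h2 := hno c hc h0
        omega
    constructor
    · obtain ⟨c, hc, h0, hcd⟩ := hex
      exact ⟨c, hc, 0, C.zero_mem, h0, by simpa using hcd⟩
    · rintro m ⟨x, hx, y, hy, hxy, rfl⟩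
      rw [hammingDist_eq_hammingNorm]
      exact hdist _ (by simpa [neg_add_eq_sub] using C.sub_mem hy hx)
        (by rw [neg_add_eq_sub]; exact sub_ne_zero.2 hxy.symm)

/-- Local repair from dual words covering all coordinates. -/
theorem hasLocality_of_words {C : Submodule F (ι → F)} {r : ℕ}
    (hcov : ∀ j, ∃ w : ι → F, (∀ c ∈ C, ∑ i, w i * c i = 0) ∧ w j ≠ 0 ∧ hammingNorm w ≤ r + 1)
    (hex : ∃ w : ι → F, (∀ c ∈ C, ∑ i, w i * c i = 0) ∧ hammingNorm w = r + 1) :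
    HasLocality C r := by
  have key : ∀ (w : ι → F) (j : ι), (∀ c ∈ C, ∑ i, w i * c i = 0) → w j ≠ 0 →
      IsRepairSet C j ((Finset.univ.filter fun i => w i ≠ 0).erase j) ∧
        ((Finset.univ.filter fun i => w i ≠ 0).erase j).card + 1 = hammingNorm w := by
    intro w j hw hj
    have hmem : j ∈ Finset.univ.filter fun i => w i ≠ 0 := by simp [hj]
    refine ⟨⟨by simp, fun i => - (w j)⁻¹ * w i, ?_, ?_⟩, Finset.card_erase_add_one hmem⟩
    · intro i hi
      simp at hi
      simp [hj, hi.2]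
    · intro c hc
      have h1 := hw c hc
      rw [← Finset.sum_filter_add_sum_filter_not Finset.univ (fun i => w i ≠ 0),
        Finset.sum_eq_zero (s := Finset.univ.filter fun i => ¬ w i ≠ 0) (by
          intro i hi; simp at hi; simp [hi]), add_zero, ← Finset.add_sum_erase _ _ hmem] at h1
      simp only [mul_assoc]
      rw [← Finset.mul_sum]
      rw [← eq_neg_iff_add_eq_zero] at h1
      have h2 : ∑ x ∈ (Finset.univ.filter fun i => w i ≠ 0).erase j, w x * c x = - (w j * c j) := by
        rw [h1, neg_neg]
      rw [h2]
      field_simp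
  choose w hw hwj hwr using hcov
  obtain ⟨w₀, hw₀, hc₀⟩ := hex
  obtain ⟨j₀, hj₀⟩ : ∃ j, w₀ j ≠ 0 := by
    by_contra! h
    have : w₀ = 0 := funext h
    simp [this] at hc₀
  -- The maximum `r` has to be attained by the chosen sets, so the word of weight `r + 1` is used at
  -- one position `j₀` of its support.
  refine ⟨fun j => if j = j₀ then (Finset.univ.filter fun i => w₀ i ≠ 0).erase j₀ else
    (Finset.univ.filter fun i => w j i ≠ 0).erase j, ?_, ?_, j₀, ?_⟩
  · intro j
    by_cases h : j = j₀
    · subst h; simpa using (key w₀ j hw₀ hj₀).1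
    · simpa [h] using (key (w j) j (hw j) (hwj j)).1
  · intro j
    by_cases h : j = j₀
    · subst h; have := (key w₀ j hw₀ hj₀).2; simp only [if_true]; omega
    · have := (key (w j) j (hw j) (hwj j)).2
      have := hwr j
      simp only [h, if_false]; omega
  · have := (key w₀ j₀ hw₀ hj₀).2
    simp only [if_true]; omega

/-- Criterion for parity-check matrices of optimal codes whose rows provide the locality. -/
theorem isPCMOfOptimalLRC_of_rows {ρ : Type*} [Fintype ρ] {H : Matrix ρ ι F} {n k r d : ℕ}
    (hn : Fintype.card ι = n) (hk : Fintype.card ρ + k = n) (hr : 1 ≤ r) (hk1 : 1 ≤ k)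
    (hd : 2 ≤ d) (hE : d + k + k ⌈/⌉ r = n + 2)
    (hcov : ∀ j, ∃ i, H i j ≠ 0 ∧ hammingNorm (H i) ≤ r + 1)
    (hex : ∃ i, hammingNorm (H i) = r + 1)
    (hdist : ∀ x, H.mulVec x = 0 → x ≠ 0 → d ≤ hammingNorm x) :
    IsPCMOfOptimalLRC H n k r d := by
  have hrn := LinearMap.finrank_range_add_finrank_ker H.mulVecLin
  rw [Module.finrank_pi, hn] at hrn
  have hrank : Module.finrank F (LinearMap.range H.mulVecLin) ≤ Fintype.card ρ := by
    have := Submodule.finrank_le (LinearMap.range H.mulVecLin)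
    rwa [Module.finrank_pi] at this
  have hortho : ∀ i, ∀ c ∈ LinearMap.ker H.mulVecLin, ∑ j, H i j * c j = 0 := by
    intro i c hc
    exact congrFun (LinearMap.mem_ker.1 hc) i
  have hopt : IsOptimalLRC (LinearMap.ker H.mulVecLin) n k r d := by
    refine isOptimalLRC_of_le hn hr hk1 hd (by omega) (hasLocality_of_words ?_ ?_) ?_ hE
    · intro j
      obtain ⟨i, hi, hw⟩ := hcov j
      exact ⟨H i, hortho i, hi, hw⟩
    · obtain ⟨i, hi⟩ := hex
      exact ⟨H i, hortho i, hi⟩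
    · exact fun c hc => hdist c (LinearMap.mem_ker.1 hc)
  refine ⟨?_, hopt⟩
  -- Optimality has fixed the dimension of the kernel, so the rank is `n - k`, the number of rows.
  rw [linearIndependent_iff_card_eq_finrank_span]
  have h1 : H.rank = Module.finrank F (Submodule.span F (Set.range H.row)) :=
    H.rank_eq_finrank_span_row
  have h2 : H.rank = Module.finrank F (LinearMap.range H.mulVecLin) := rfl
  have h3 := hopt.1.2.1
  rw [Set.finrank]
  omega

end CodeConfig

/-! ### The field with four elements -/

/-- `ω` generates the field with four elements. -/
structure IsQuatGen {F : Type*} [Field F] (ω : F) : Prop where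
  ne_zero : ω ≠ 0
  add_self : ∀ x : F, x + x = 0
  sq : ω ^ 2 = ω + 1
  cases : ∀ x : F, x = 0 ∨ x = 1 ∨ x = ω ∨ x = ω ^ 2

theorem isQuatGen {F : Type*} [Field F] (hF : Nat.card F = 4) {ω : F} (h0 : ω ≠ 0) (h1 : ω ≠ 1) :
    IsQuatGen ω := by
  have hfin : Finite F := Nat.finite_of_card_ne_zero (by omega)
  have := Fintype.ofFinite F
  have hc : Fintype.card F = 4 := by rwa [← Nat.card_eq_fintype_card]
  have h2 : (2 : F) = 0 := by
    have := Nat.cast_card_eq_zero F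
    rw [hc] at this
    have h4 : (2 : F) * 2 = 0 := by norm_num at this ⊢; exact this
    simpa using h4
  have hadd : ∀ x : F, x + x = 0 := fun x => by rw [← two_mul, h2, zero_mul]
  have hw3 : ω ^ 3 = 1 := by
    have := FiniteField.pow_card_sub_one_eq_one ω h0
    rwa [hc] at this
  have hsq : ω ^ 2 = ω + 1 := by
    have : (ω - 1) * (ω ^ 2 + ω + 1) = 0 := by linear_combination hw3
    rcases mul_eq_zero.1 this with h | h
    · exact absurd (sub_eq_zero.1 h) h1
    · linear_combination h - (ω + 1) * h2
  refine ⟨h0, hadd, hsq, fun x => ?_⟩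
  by_cases hx : x = 0
  · exact Or.inl hx
  right
  have h3 : x ^ 3 = 1 := by
    have := FiniteField.pow_card_sub_one_eq_one x hx
    rwa [hc] at this
  have : (x - 1) * ((x - ω) * (x - ω ^ 2)) = 0 := by
    have hs : 1 + ω + ω ^ 2 = 0 := by linear_combination hsq + (ω + 1) * h2
    linear_combination h3 - (x ^ 2 - ω * x) * hs - hw3
  rcases mul_eq_zero.1 this with h | h
  · exact Or.inl (sub_eq_zero.1 h)
  · rcases mul_eq_zero.1 h with h | h
    · exact Or.inr (Or.inl (sub_eq_zero.1 h))
    · exact Or.inr (Or.inr (sub_eq_zero.1 h))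

/-! ### Packing vectors over the field into natural numbers -/

section Digits

variable {F : Type*} [Field F]

/-- The element of the field of order four with a given code. -/
def quat (ω : F) : ℕ → F
  | 0 => 0
  | 1 => 1
  | 2 => ω
  | _ => ω ^ 2

/-- Multiplication of codes. -/
def mulCode (a b : ℕ) : ℕ := if a = 0 ∨ b = 0 then 0 else (a + b - 2) % 3 + 1

variable {ω : F}

/-- The two bits of a code are the coordinates in the basis `1, ω`, as `ω ^ 2 = ω + 1` has code `3`;
in characteristic two addition is then bitwise exclusive or. -/
theorem IsQuatGen.quat_xor (hω : IsQuatGen ω) {a b : ℕ} (ha : a < 4) (hb : b < 4) :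
    quat ω (a ^^^ b) = quat ω a + quat ω b := by
  have h2 : (2 : F) = 0 := by rw [← one_add_one_eq_two]; exact hω.add_self 1
  have := hω.sq
  interval_cases a <;> interval_cases b <;> simp [quat, hω.add_self] <;> grind

/-- A nonzero code `a` stands for `ω ^ (a - 1)`, so `mulCode` adds exponents modulo `3`. -/
theorem IsQuatGen.quat_mul (hω : IsQuatGen ω) {a b : ℕ} (ha : a < 4) (hb : b < 4) :
    quat ω (mulCode a b) = quat ω a * quat ω b := by
  have h2 : (2 : F) = 0 := by rw [← one_add_one_eq_two]; exact hω.add_self 1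
  have := hω.sq
  interval_cases a <;> interval_cases b <;> simp [quat, mulCode] <;> grind

theorem IsQuatGen.quat_eq_zero (hω : IsQuatGen ω) {a : ℕ} : quat ω a = 0 ↔ a = 0 := by
  rcases a with _ | _ | _ | a
  · simp [quat]
  · simp [quat]
  · simp [quat, hω.ne_zero]
  · simp [quat, hω.ne_zero]

theorem IsQuatGen.exists_code (hω : IsQuatGen ω) (x : F) : ∃ a < 4, quat ω a = x := by
  rcases hω.cases x with rfl | rfl | rfl | rfl
  · exact ⟨0, by omega, rfl⟩
  · exact ⟨1, by omega, rfl⟩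
  · exact ⟨2, by omega, rfl⟩
  · exact ⟨3, by omega, rfl⟩

/-- The vector with packed code `v` (two bits for each coordinate). -/
def unpack (ω : F) (v : ℕ) : ℕ → F := fun i => quat ω (v / 2 ^ (2 * i) % 4)

/-- The packed code with the given digits. -/
def pack : List ℕ → ℕ
  | [] => 0
  | d :: ds => d + 4 * pack ds

theorem IsQuatGen.unpack_xor (hω : IsQuatGen ω) (a b : ℕ) :
    unpack ω (a ^^^ b) = unpack ω a + unpack ω b := by
  funext i
  have h4 : (4 : ℕ) = 2 ^ 2 := rfl
  simp only [unpack, Pi.add_apply]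
  rw [Nat.xor_div_two_pow, h4, Nat.xor_mod_two_pow, ← h4]
  exact hω.quat_xor (Nat.mod_lt _ (by omega)) (Nat.mod_lt _ (by omega))

theorem IsQuatGen.unpack_eq_zero (hω : IsQuatGen ω) {v : ℕ} (h : unpack ω v = 0) : v = 0 := by
  induction v using Nat.strong_induction_on with
  | _ v ih =>
    have h0 := congrFun h 0
    simp only [unpack, Pi.zero_apply, hω.quat_eq_zero, Nat.mul_zero, pow_zero, Nat.div_one] at h0
    by_contra hv
    have hlt : v / 4 < v := by omega
    have := ih (v / 4) hlt (by
      funext i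
      have := congrFun h (i + 1)
      simp only [unpack, Pi.zero_apply] at this ⊢
      rwa [mul_add, pow_add, mul_comm, ← Nat.div_div_eq_div_mul] at this)
    omega

theorem unpack_pack {ds : List ℕ} (hds : ∀ d ∈ ds, d < 4) (i : ℕ) :
    unpack ω (pack ds) i = quat ω (ds.getD i 0) := by
  induction ds generalizing i with
  | nil => simp [unpack, pack]
  | cons d ds ih =>
    have hd : d < 4 := hds d (by simp)
    cases i with
    | zero => simp only [unpack, pack, List.getD_cons_zero]; congr 1; omega
    | succ i =>
      have := ih (fun d hd => hds d (by simp [hd])) i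
      simp only [unpack, pack, List.getD_cons_succ] at this ⊢
      rw [← this]
      congr 1
      rw [mul_add, pow_add, mul_comm (2 ^ (2 * i)), ← Nat.div_div_eq_div_mul]
      congr 2
      omega

end Digits

/-! ### A verified search for short linear relations -/

section Search

/-- Entry `(i, j)` of a table of codes. -/
def entry (L : List (List ℕ)) (i j : ℕ) : ℕ := (L.getD i []).getD j 0

/-- The codes of the multiples of column `j` of a table, and a mask marking the rows that vanish
in the columns `j, …, N - 1`. -/
structure ColData where
  one : ℕ
  two : ℕ
  three : ℕ
  mask : ℕ

def colDigits (L : List (List ℕ)) (s j : ℕ) : List ℕ :=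
  (List.range L.length).map fun i => mulCode s (entry L i j)

def maskDigits (L : List (List ℕ)) (N j : ℕ) : List ℕ :=
  (List.range L.length).map fun i =>
    if (List.range N).all fun j' => j' < j || entry L i j' == 0 then 3 else 0

def colData (L : List (List ℕ)) (N j : ℕ) : ColData :=
  ⟨pack (colDigits L 1 j), pack (colDigits L 2 j), pack (colDigits L 3 j), pack (maskDigits L N j)⟩

/-- Checks that no combination of at most `b` columns has value `acc`. -/
def noSol : List ColData → ℕ → ℕ → Bool
  | [], _, acc => !(Nat.beq acc 0)
  | c :: cs, b, acc =>
    match b with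
    | 0 => !(Nat.beq acc 0)
    | b + 1 => !(Nat.beq (Nat.land acc c.mask) 0) || (noSol cs (b + 1) acc &&
        (noSol cs b (Nat.xor acc c.one) && (noSol cs b (Nat.xor acc c.two) &&
          noSol cs b (Nat.xor acc c.three))))

/-- Checks that the masks are disjoint from all later columns. -/
def masksOK : List ColData → Bool
  | [] => true
  | c :: cs => ((c :: cs).all fun e => Nat.beq (Nat.land e.one c.mask) 0 &&
      (Nat.beq (Nat.land e.two c.mask) 0 && Nat.beq (Nat.land e.three c.mask) 0)) && masksOK cs

/-- Checks that any `b` columns are linearly independent. -/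
def noRel : List ColData → ℕ → Bool
  | [], _ => true
  | c :: cs, b =>
    match b with
    | 0 => true
    | b + 1 => noRel cs (b + 1) && noSol cs b c.one

/-- All the checks needed for minimum distance at least `b + 1`. -/
def distCheck (L : List (List ℕ)) (N b : ℕ) : Bool :=
  (L.all fun row => row.all fun a => Nat.blt a 4) &&
    (masksOK ((List.range N).map (colData L N)) && noRel ((List.range N).map (colData L N)) b)


def ColData.sel (c : ColData) : ℕ → ℕ
  | 0 => 0
  | 1 => c.one
  | 2 => c.two
  | _ => c.three

/-- The value of a combination of columns. -/
def comb (f : ℕ → ColData) (g : ℕ → ℕ) (js : List ℕ) : ℕ :=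
  js.foldr (fun j acc => (f j).sel (g j) ^^^ acc) 0

theorem comb_eq_zero_of_countP {f : ℕ → ColData} {g : ℕ → ℕ} {js : List ℕ}
    (h : js.countP (fun j => g j != 0) = 0) : comb f g js = 0 := by
  induction js with
  | nil => rfl
  | cons j js ih =>
    rw [List.countP_cons] at h
    have h1 : g j = 0 := by
      by_contra hne
      simp [hne] at h
    have h2 := ih (by omega)
    simp only [comb, List.foldr_cons] at h2 ⊢
    rw [h2, h1]; simp [ColData.sel]

/-- Justifies pruning: a nonzero digit in a row that vanishes in all columns still to come can no
longer be cancelled. -/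
theorem comb_land_mask {f : ℕ → ColData} {g : ℕ → ℕ} {js : List ℕ} {m : ℕ}
    (h : ∀ j ∈ js, (f j).one &&& m = 0 ∧ (f j).two &&& m = 0 ∧ (f j).three &&& m = 0) :
    comb f g js &&& m = 0 := by
  induction js with
  | nil => simp [comb]
  | cons j js ih =>
    have h2 := ih fun i hi => h i (by simp [hi])
    obtain ⟨h3, h4, h5⟩ := h j (by simp)
    simp only [comb, List.foldr_cons] at h2 ⊢
    rw [Nat.and_xor_distrib_right, h2]
    rcases g j with _ | _ | _ | n <;> simp [ColData.sel, h3, h4, h5]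

theorem nat_beq_false_iff {a b : ℕ} : (!(Nat.beq a b)) = true ↔ a ≠ b := by
  have : Nat.beq a b = true ↔ a = b := ⟨Nat.eq_of_beq_eq_true, fun h => by subst h; exact Nat.beq_refl a⟩
  rw [Bool.not_eq_true', ne_eq, ← this, Bool.not_eq_true]

theorem nat_beq_iff {a b : ℕ} : Nat.beq a b = true ↔ a = b :=
  ⟨Nat.eq_of_beq_eq_true, fun h => by subst h; exact Nat.beq_refl a⟩

/-- Induction along the columns, branching on the coefficient of the first one. A branch is cut off
when the accumulated vector has a nonzero digit in a row that vanishes from this column on. -/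
theorem noSol_sound {f : ℕ → ColData} {g : ℕ → ℕ} (js : List ℕ) :
    ∀ b acc, masksOK (js.map f) = true → noSol (js.map f) b acc = true →
      js.countP (fun j => g j != 0) ≤ b → acc ^^^ comb f g js ≠ 0 := by
  induction js with
  | nil =>
    intro b acc _ h _
    simpa only [List.map_nil, noSol, nat_beq_false_iff, comb, List.foldr_nil, Nat.xor_zero] using h
  | cons j js ih =>
    intro b acc hm h hc
    cases b with
    | zero =>
      rw [comb_eq_zero_of_countP (by omega), Nat.xor_zero]
      simpa only [List.map_cons, noSol, nat_beq_false_iff] using h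
    | succ b =>
      have hm' := hm
      simp only [List.map_cons, masksOK, Bool.and_eq_true, List.all_eq_true, nat_beq_iff] at hm
      simp only [List.map_cons, noSol, Bool.or_eq_true, nat_beq_false_iff, Bool.and_eq_true] at h
      rcases h with h | ⟨h0, h1, h2, h3⟩
      · intro h0
        apply h
        have : comb f g (j :: js) &&& (f j).mask = 0 := by
          apply comb_land_mask
          intro i hi
          exact hm.1 (f i) (by
            rw [← List.map_cons]; exact List.mem_map_of_mem hi)
        have h1 := congrArg (· &&& (f j).mask) h0
        simp only [Nat.and_xor_distrib_right, this] at h1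
        simpa using h1
      · rw [List.countP_cons] at hc
        have hcomb : comb f g (j :: js) = (f j).sel (g j) ^^^ comb f g js := rfl
        rw [hcomb, ← Nat.xor_assoc]
        rcases hg : g j with _ | _ | _ | n
        · simp only [ColData.sel, Nat.xor_zero]
          exact ih _ _ hm.2 h0 (by simp only [hg] at hc; simpa using hc)
        · exact ih _ _ hm.2 h1 (by simp only [hg] at hc; simpa using hc)
        · exact ih _ _ hm.2 h2 (by simp only [hg] at hc; simpa using hc)
        · exact ih _ _ hm.2 h3 (by simp only [hg] at hc; simpa using hc)

variable {F : Type*} [Field F] {ω : F}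

theorem mulCode_lt {a b : ℕ} : mulCode a b < 4 := by
  unfold mulCode
  split_ifs <;> omega

theorem entry_of_length_le {L : List (List ℕ)} {i : ℕ} (h : L.length ≤ i) (j : ℕ) :
    entry L i j = 0 := by
  unfold entry
  rw [List.getD_eq_default _ _ h]; simp

theorem entry_lt {L : List (List ℕ)} (h : (L.all fun row => row.all fun a => Nat.blt a 4) = true)
    (i j : ℕ) : entry L i j < 4 := by
  simp only [List.all_eq_true, Nat.blt_eq] at h
  by_cases hi : i < L.length
  · unfold entry
    rw [List.getD_eq_getElem _ _ hi]
    by_cases hj : j < (L[i]).length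
    · rw [List.getD_eq_getElem _ _ hj]
      exact h _ (List.getElem_mem hi) _ (List.getElem_mem hj)
    · rw [List.getD_eq_default _ _ (by omega)]; omega
  · rw [entry_of_length_le (by omega)]; omega

theorem IsQuatGen.unpack_colDigits (hω : IsQuatGen ω) {L : List (List ℕ)}
    (hL : ∀ i j, entry L i j < 4) {s : ℕ} (hs : s < 4) (j : ℕ) :
    unpack ω (pack (colDigits L s j)) = fun i => quat ω s * quat ω (entry L i j) := by
  funext i
  rw [unpack_pack (by
    intro d hd
    simp only [colDigits, List.mem_map] at hd
    obtain ⟨i, -, rfl⟩ := hd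
    exact mulCode_lt), ← hω.quat_mul hs (hL i j)]
  by_cases hi : i < L.length
  · rw [List.getD_eq_getElem _ _ (by simpa [colDigits] using hi)]
    simp [colDigits]
  · rw [List.getD_eq_default _ _ (by simp [colDigits]; omega), entry_of_length_le (by omega)]
    simp [mulCode]

theorem IsQuatGen.unpack_sel (hω : IsQuatGen ω) {L : List (List ℕ)}
    (hL : ∀ i j, entry L i j < 4) {N a : ℕ} (ha : a < 4) (j : ℕ) :
    unpack ω ((colData L N j).sel a) = fun i => quat ω a * quat ω (entry L i j) := by
  interval_cases a
  · funext i; simp [ColData.sel, unpack, quat]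
  · exact hω.unpack_colDigits hL (by omega) j
  · exact hω.unpack_colDigits hL (by omega) j
  · exact hω.unpack_colDigits hL (by omega) j

theorem IsQuatGen.unpack_comb (hω : IsQuatGen ω) {L : List (List ℕ)}
    (hL : ∀ i j, entry L i j < 4) {N : ℕ} {g : ℕ → ℕ} (hg : ∀ j, g j < 4) (js : List ℕ) :
    unpack ω (comb (colData L N) g js) =
      fun i => (js.map fun j => quat ω (g j) * quat ω (entry L i j)).sum := by
  induction js with
  | nil => funext i; simp [comb, unpack, quat]
  | cons j js ih =>
    have hcomb : comb (colData L N) g (j :: js) =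
      (colData L N j).sel (g j) ^^^ comb (colData L N) g js := rfl
    rw [hcomb, hω.unpack_xor, hω.unpack_sel hL (hg j), ih]
    funext i
    simp

/-- The first nonzero coefficient of a relation can be scaled to one. Hence it suffices to show, for
every column, that few later columns never cancel it. -/
theorem noRel_sound [DecidableEq F] (hω : IsQuatGen ω) {L : List (List ℕ)}
    (hL : ∀ i j, entry L i j < 4) {N : ℕ} (js : List ℕ) {b : ℕ}
    (hm : masksOK (js.map (colData L N)) = true) (h : noRel (js.map (colData L N)) b = true)
    (x : ℕ → F) (hx : ∀ i, (js.map fun j => x j * quat ω (entry L i j)).sum = 0)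
    (hc : js.countP (fun j => x j != 0) ≤ b) : ∀ j ∈ js, x j = 0 := by
  induction js with
  | nil => simp
  | cons j js ih =>
    rw [List.countP_cons] at hc
    simp only [List.map_cons, masksOK, Bool.and_eq_true] at hm
    by_cases hj : x j = 0
    · have : ∀ i ∈ js, x i = 0 := by
        cases b with
        | zero =>
          intro i hi
          have h0 : js.countP (fun j => x j != 0) = 0 := by omega
          rw [List.countP_eq_zero] at h0
          simpa using h0 i hi
        | succ b =>
          simp only [List.map_cons, noRel, Bool.and_eq_true] at h
          refine ih hm.2 h.1 (fun i => ?_) (by omega)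
          simpa [hj] using hx i
      simpa [hj] using this
    · exfalso
      cases b with
      | zero => simp [hj] at hc
      | succ b =>
        simp only [List.map_cons, noRel, Bool.and_eq_true] at h
        choose g hg4 hg using fun i => hω.exists_code ((x j)⁻¹ * x i)
        refine noSol_sound (g := g) js b _ hm.2 h.2 ?_ ?_
        · refine le_trans (le_of_eq ?_) (show js.countP (fun j => x j != 0) ≤ b by
            simp [hj] at hc; simpa using hc)
          apply List.countP_congr
          intro i _
          have : g i = 0 ↔ x i = 0 := by
            rw [← hω.quat_eq_zero, hg]; simp [hj]
          simp [this]
        · apply hω.unpack_eq_zero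
          have h1 := hω.unpack_sel hL (N := N) (a := 1) (by omega) j
          rw [hω.unpack_xor, hω.unpack_comb hL hg4]
          have h2 : unpack ω (colData L N j).one = fun i => quat ω 1 * quat ω (entry L i j) := h1
          rw [h2]
          funext i
          have h3 := hx i
          simp only [List.map_cons, List.sum_cons] at h3
          have h4 : (js.map fun j => quat ω (g j) * quat ω (entry L i j)).sum =
              (x j)⁻¹ * (js.map fun j => x j * quat ω (entry L i j)).sum := by
            rw [← List.sum_map_mul_left]
            congr 1
            apply List.map_congr_left
            intro k _
            rw [hg, mul_assoc]
          have h5 : quat ω 1 = 1 := rfl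
          simp only [Pi.add_apply, Pi.zero_apply, h4, h5, one_mul]
          rw [← mul_right_inj' hj, mul_add, ← mul_assoc, mul_inv_cancel₀ hj, one_mul, mul_zero, h3]

/-- Soundness of `distCheck`. -/
theorem distCheck_sound [DecidableEq F] (hω : IsQuatGen ω) {L : List (List ℕ)} {N b : ℕ}
    (h : distCheck L N b = true) {ι : Type*} [Fintype ι] {e : ι → ℕ} (he : Function.Injective e)
    (heN : ∀ i, e i < N) {x : ι → F} (hx : ∀ i < L.length, ∑ j, quat ω (entry L i (e j)) * x j = 0)
    (hx0 : x ≠ 0) : b + 1 ≤ hammingNorm x := by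
  classical
  simp only [distCheck, Bool.and_eq_true] at h
  have hL := entry_lt h.1
  by_contra! hlt
  -- The relation is extended by zero to all `N` columns of the table, so one check serves every
  -- submatrix consisting of some of the columns.
  let y : ℕ → F := fun n => if hn : ∃ j, e j = n then x hn.choose else 0
  have hy : ∀ j, y (e j) = x j := by
    intro j
    have hn : ∃ j', e j' = e j := ⟨j, rfl⟩
    simp only [y, dif_pos hn]
    rw [he hn.choose_spec]
  have hy0 : ∀ n, n ∉ Finset.univ.image e → y n = 0 := by
    intro n hn
    have : ¬ ∃ j, e j = n := by simpa using hn
    simp only [y, dif_neg this]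
  have hsub : Finset.univ.image e ⊆ Finset.range N := by
    intro n hn
    obtain ⟨j, -, rfl⟩ := Finset.mem_image.1 hn
    exact Finset.mem_range.2 (heN j)
  have key := noRel_sound hω hL (List.range N) h.2.1 h.2.2 y ?_ ?_
  · apply hx0
    funext j
    rw [← hy j]
    exact key (e j) (List.mem_range.2 (heN j))
  · intro i
    have hsum : ((List.range N).map fun j => y j * quat ω (entry L i j)).sum =
        ∑ j ∈ Finset.range N, y j * quat ω (entry L i j) := by
      simp [Finset.sum, Finset.range, Multiset.range]
    rw [hsum, ← Finset.sum_subset hsub, Finset.sum_image (by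
      intro a _ b _ hab; exact he hab)]
    · simp only [hy]
      by_cases hi : i < L.length
      · rw [← hx i hi]
        exact Finset.sum_congr rfl fun j _ => mul_comm _ _
      · apply Finset.sum_eq_zero
        intro j _
        rw [entry_of_length_le (by omega)]; simp [quat]
    · intro n _ hn
      rw [hy0 n hn, zero_mul]
  · have h1 : (List.range N).countP (fun j => y j != 0) = ((Finset.range N).filter fun j => y j ≠ 0).card := by
      rw [List.countP_eq_length_filter]
      simp only [Finset.card, Finset.filter, Finset.range, Multiset.range]
      simp
      congr 1
    rw [h1]
    have h2 : ((Finset.range N).filter fun j => y j ≠ 0) ⊆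
        (Finset.univ.filter fun j => x j ≠ 0).image e := by
      intro n hn
      simp only [Finset.mem_filter] at hn
      by_contra hni
      apply hn.2
      by_cases hn' : n ∈ Finset.univ.image e
      · obtain ⟨j, -, rfl⟩ := Finset.mem_image.1 hn'
        exact absurd (Finset.mem_image_of_mem e (by simpa [hy] using hn.2)) hni
      · exact hy0 n hn'
    have h3 := (Finset.card_le_card h2).trans Finset.card_image_le
    unfold hammingNorm at hlt
    omega

end Search

/-! ### Optimality of a matrix from computed checks -/

section Checks

variable {F : Type*} [Field F] {ω : F}

/-- For an explicit matrix and its table the hypothesis holds by `rfl`, so no case distinction over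
the entries is needed. -/
theorem entries_of_ofFn {m n : ℕ} {H : Matrix (Fin m) (Fin n) F} {L : List (List ℕ)}
    (h : (List.ofFn fun i => List.ofFn (H i)) = L.map (List.map (quat ω))) :
    L.length = m ∧ ∀ i j, H i j = quat ω (entry L i j) := by
  have hlen : L.length = m := by
    have := congrArg List.length h
    simpa using this.symm
  refine ⟨hlen, fun i j => ?_⟩
  have h1 : (List.ofFn fun i => List.ofFn (H i))[(i : ℕ)]? = (L.map (List.map (quat ω)))[(i : ℕ)]? := by
    rw [h]
  have hi : (i : ℕ) < L.length := by omega
  simp only [List.getElem?_ofFn, i.2, dif_pos, List.getElem?_map, List.getElem?_eq_getElem hi,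
    Option.map_some, Option.some.injEq] at h1
  have h2 : (List.ofFn (H i))[(j : ℕ)]? = (L[(i : ℕ)].map (quat ω))[(j : ℕ)]? := by
    rw [← h1]
  have hj : (j : ℕ) < (L[(i : ℕ)]).length := by
    have := congrArg List.length h1
    simp at this
    omega
  simp only [List.getElem?_ofFn, j.2, dif_pos, List.getElem?_map, List.getElem?_eq_getElem hj,
    Option.map_some, Option.some.injEq] at h2
  rw [entry, List.getD_eq_getElem _ _ hi, List.getD_eq_getElem _ _ hj]
  exact h2

/-- The weight of row `i` of a table in the columns `js`. -/
def rowWeight (L : List (List ℕ)) (js : List ℕ) (i : ℕ) : ℕ :=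
  (js.filter fun j => !(Nat.beq (entry L i j) 0)).length

/-- Checks that rows of weight at most `r + 1` cover the columns `js`, and that a row of weight
`r + 1` exists. -/
def locCheck (L : List (List ℕ)) (js : List ℕ) (r : ℕ) : Bool :=
  (js.all fun j => (List.range L.length).any fun i =>
    !(Nat.beq (entry L i j) 0) && Nat.ble (rowWeight L js i) (r + 1)) &&
  (List.range L.length).any fun i => Nat.beq (rowWeight L js i) (r + 1)

variable [DecidableEq F]

theorem IsQuatGen.hammingNorm_eq_rowWeight (hω : IsQuatGen ω) {L : List (List ℕ)} {ι : Type*}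
    [Fintype ι] {e : ι → ℕ} (he : Function.Injective e) {js : List ℕ} (hnd : js.Nodup)
    (hjs : ∀ n, n ∈ js ↔ ∃ j, e j = n) (i : ℕ) :
    hammingNorm (fun j => quat ω (entry L i (e j))) = rowWeight L js i := by
  classical
  unfold hammingNorm rowWeight
  rw [← List.toFinset_card_of_nodup (hnd.filter _), ← Finset.card_image_of_injective _ he]
  congr 1
  ext n
  simp only [Finset.mem_image, Finset.mem_filter, Finset.mem_univ, true_and, ne_eq,
    hω.quat_eq_zero, List.mem_toFinset, List.mem_filter, nat_beq_false_iff, hjs]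
  constructor
  · rintro ⟨j, hj, rfl⟩; exact ⟨⟨j, rfl⟩, hj⟩
  · rintro ⟨⟨j, rfl⟩, hj⟩; exact ⟨j, hj, rfl⟩

theorem IsQuatGen.locality_of_locCheck (hω : IsQuatGen ω) {L : List (List ℕ)} {ι : Type*}
    [Fintype ι] {e : ι → ℕ} (he : Function.Injective e) {js : List ℕ} (hnd : js.Nodup)
    (hjs : ∀ n, n ∈ js ↔ ∃ j, e j = n) {m r : ℕ} (hm : L.length = m) {H : Matrix (Fin m) ι F}
    (hH : ∀ i j, H i j = quat ω (entry L i (e j))) (h : locCheck L js r = true) :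
    (∀ j, ∃ i, H i j ≠ 0 ∧ hammingNorm (H i) ≤ r + 1) ∧ ∃ i, hammingNorm (H i) = r + 1 := by
  subst hm
  have hw : ∀ i : Fin L.length, hammingNorm (H i) = rowWeight L js i := by
    intro i
    rw [← hω.hammingNorm_eq_rowWeight he hnd hjs]
    congr 1
    funext j
    exact hH i j
  simp only [locCheck, Bool.and_eq_true, List.all_eq_true, List.any_eq_true, List.mem_range,
    nat_beq_false_iff, nat_beq_iff, Nat.ble_eq] at h
  constructor
  · intro j
    obtain ⟨i, hi, h1, h2⟩ := h.1 (e j) ((hjs _).2 ⟨j, rfl⟩)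
    refine ⟨⟨i, hi⟩, ?_, ?_⟩
    · rw [hH]; exact fun h0 => h1 (hω.quat_eq_zero.1 h0)
    · rw [hw]; exact h2
  · obtain ⟨i, hi, h1⟩ := h.2
    exact ⟨⟨i, hi⟩, by rw [hw]; exact h1⟩

/-- The map `e` places the columns of `H` in a table that may be wider. The distance is inherited
from the wider table; locality is not, and is checked on the columns `js` that are actually used. -/
theorem IsQuatGen.isPCM_of_checks (hω : IsQuatGen ω) {L : List (List ℕ)} {ι : Type*}
    [Fintype ι] [DecidableEq ι] {e : ι → ℕ} (he : Function.Injective e) {js : List ℕ}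
    (hnd : js.Nodup) (hjs : ∀ n, n ∈ js ↔ ∃ j, e j = n) {m n k r d N : ℕ} (hm : L.length = m)
    {H : Matrix (Fin m) ι F} (hH : ∀ i j, H i j = quat ω (entry L i (e j))) (heN : ∀ j, e j < N)
    (hloc : locCheck L js r = true) (hdist : distCheck L N (d - 1) = true)
    (hn : js.length = n) (hk : m + k = n) (hr : 1 ≤ r) (hk1 : 1 ≤ k) (hd : 2 ≤ d)
    (hE : d + k + k ⌈/⌉ r = n + 2) : IsPCMOfOptimalLRC H n k r d := by
  obtain ⟨h1, h2⟩ := hω.locality_of_locCheck he hnd hjs hm hH hloc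
  have hcard : Fintype.card ι = n := by
    rw [← hn, ← List.toFinset_card_of_nodup hnd, ← Finset.card_univ,
      ← Finset.card_image_of_injective _ he]
    congr 1
    ext n; simp [hjs]
  refine isPCMOfOptimalLRC_of_rows hcard (by simpa using hk) hr hk1 hd hE h1 h2 ?_
  intro x hx hx0
  have := distCheck_sound hω hdist he heN (x := x) (fun i hi => ?_) hx0
  · omega
  · have := congrFun hx ⟨i, hm ▸ hi⟩
    simp only [Matrix.mulVec, dotProduct, hH] at this
    exact this

/-- Optimality of an explicit matrix by computation. -/
theorem IsQuatGen.isPCM_full (hω : IsQuatGen ω) {L : List (List ℕ)} {m n k r d : ℕ}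
    {H : Matrix (Fin m) (Fin n) F}
    (hH : (List.ofFn fun i => List.ofFn (H i)) = L.map (List.map (quat ω)))
    (hloc : locCheck L (List.range n) r = true) (hdist : distCheck L n (d - 1) = true)
    (hk : m + k = n) (hr : 1 ≤ r) (hk1 : 1 ≤ k) (hd : 2 ≤ d) (hE : d + k + k ⌈/⌉ r = n + 2) :
    IsPCMOfOptimalLRC H n k r d := by
  obtain ⟨h1, h2⟩ := entries_of_ofFn hH
  exact hω.isPCM_of_checks (e := Fin.val) Fin.val_injective List.nodup_range
    (fun n => by
      rw [List.mem_range]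
      exact ⟨fun h => ⟨⟨n, h⟩, rfl⟩, fun ⟨j, hj⟩ => hj ▸ j.2⟩) h1 h2 (fun j => j.2) hloc hdist
    List.length_range hk hr hk1 hd hE

theorem IsQuatGen.isPCM_dropCols (hω : IsQuatGen ω) {L : List (List ℕ)} {m N n k r d t : ℕ}
    {H : Matrix (Fin m) (Fin N) F}
    (hH : (List.ofFn fun i => List.ofFn (H i)) = L.map (List.map (quat ω)))
    (hdist : distCheck L N (d - 1) = true) (ht : t ≤ N)
    (hloc : locCheck L (List.range' t (N - t)) r = true) (hn : N - t = n)
    (hk : m + k = n) (hr : 1 ≤ r) (hk1 : 1 ≤ k) (hd : 2 ≤ d) (hE : d + k + k ⌈/⌉ r = n + 2) :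
    IsPCMOfOptimalLRC (dropCols t H) n k r d := by
  obtain ⟨h1, h2⟩ := entries_of_ofFn hH
  exact hω.isPCM_of_checks (e := fun j : {j : Fin N // t ≤ j.val} => j.1.val)
    (fun a b hab => Subtype.ext (Fin.ext hab)) List.nodup_range'
    (fun n => by
      rw [List.mem_range'_1]
      constructor
      · rintro ⟨h3, h4⟩; exact ⟨⟨⟨n, by omega⟩, h3⟩, rfl⟩
      · rintro ⟨j, rfl⟩; have := j.2; have := j.1.2; omega) h1
    (fun i j => h2 i j.1) (fun j => j.1.2) hloc hdist (by simpa using hn) hk hr hk1 hd hE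

theorem IsQuatGen.isPCM_takeCols (hω : IsQuatGen ω) {L : List (List ℕ)} {m N n k r d : ℕ}
    {H : Matrix (Fin m) (Fin N) F}
    (hH : (List.ofFn fun i => List.ofFn (H i)) = L.map (List.map (quat ω)))
    (hdist : distCheck L N (d - 1) = true) (hn : n ≤ N)
    (hloc : locCheck L (List.range n) r = true)
    (hk : m + k = n) (hr : 1 ≤ r) (hk1 : 1 ≤ k) (hd : 2 ≤ d) (hE : d + k + k ⌈/⌉ r = n + 2) :
    IsPCMOfOptimalLRC (takeCols n H) n k r d := by
  obtain ⟨h1, h2⟩ := entries_of_ofFn hH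
  exact hω.isPCM_of_checks (e := fun j : {j : Fin N // j.val < n} => j.1.val)
    (fun a b hab => Subtype.ext (Fin.ext hab)) List.nodup_range
    (fun n' => by
      rw [List.mem_range]
      constructor
      · intro h3; exact ⟨⟨⟨n', by omega⟩, h3⟩, rfl⟩
      · rintro ⟨j, rfl⟩; exact j.2) h1
    (fun i j => h2 i j.1) (fun j => j.1.2) hloc hdist List.length_range hk hr hk1 hd hE

end Checks

/-! ### Block matrices for the infinite families -/

section Blocks

variable {F : Type*} [Field F] [DecidableEq F]

theorem hammingNorm_eq_sum {ι : Type*} [Fintype ι] (x : ι → F) :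
    hammingNorm x = ∑ i, if x i ≠ 0 then 1 else 0 := by
  rw [hammingNorm, Finset.card_filter]

theorem hammingNorm_sum_prod {κ : Type*} [Fintype κ] {l w : ℕ} (x : κ ⊕ Fin l × Fin w → F) :
    hammingNorm x = hammingNorm (fun j => x (Sum.inl j)) +
      ∑ b, hammingNorm fun c => x (Sum.inr (b, c)) := by
  simp only [hammingNorm_eq_sum, Fintype.sum_sum_type, Fintype.sum_prod_type]

/-- A check with nonzero entry at the only nonzero coordinate of `y` cannot evaluate to zero. -/
theorem hammingNorm_ne_one_of_sum {κ : Type*} [Fintype κ] {y : κ → F}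
    (h : ∀ j, ∃ a : κ → F, a j ≠ 0 ∧ ∑ i, a i * y i = 0) : hammingNorm y ≠ 1 := by
  classical
  intro h1
  rw [hammingNorm, Finset.card_eq_one] at h1
  obtain ⟨j, hj⟩ := h1
  have hj0 : y j ≠ 0 := by
    have : j ∈ Finset.univ.filter fun i => y i ≠ 0 := by rw [hj]; simp
    simpa using this
  obtain ⟨a, haj, ha⟩ := h j
  rw [Finset.sum_eq_single j] at ha
  · rcases mul_eq_zero.1 ha with h | h
    · exact haj h
    · exact hj0 h
  · intro i _ hij
    have : i ∉ Finset.univ.filter fun i => y i ≠ 0 := by rw [hj]; simpa using hij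
    have : y i = 0 := by simpa using this
    rw [this, mul_zero]
  · simp

/-- Distance of codes whose checks split into blocks. -/
theorem le_hammingNorm_of_blocks {τ ρ κ : Type*} [Fintype κ] {l w d : ℕ} (hd : d ≤ 4)
    {T : Matrix τ κ F} {L : Matrix ρ κ F} {B : Matrix ρ (Fin w) F}
    (hT : ∀ j, ∃ i, T i j ≠ 0)
    (hK : ∀ y : κ → F, (∀ i, ∑ j, T i j * y j = 0) → (∀ i, ∑ j, L i j * y j = 0) → y ≠ 0 →
      d ≤ hammingNorm y)
    (hB : ∀ z : Fin w → F, ∑ c, z c = 0 → (∀ i, ∑ c, B i c * z c = 0) → z ≠ 0 →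
      d ≤ hammingNorm z)
    {x : κ ⊕ Fin l × Fin w → F} (h1 : ∀ i, ∑ j, T i j * x (Sum.inl j) = 0)
    (h2 : ∀ b, ∑ c, x (Sum.inr (b, c)) = 0)
    (h3 : ∀ i, ∑ j, L i j * x (Sum.inl j) + ∑ b, ∑ c, B i c * x (Sum.inr (b, c)) = 0)
    (hx : x ≠ 0) : d ≤ hammingNorm x := by
  rw [hammingNorm_sum_prod]
  set y : κ → F := fun j => x (Sum.inl j) with hy
  set z : Fin l → Fin w → F := fun b c => x (Sum.inr (b, c)) with hz
  change d ≤ hammingNorm y + ∑ b', hammingNorm (z b')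
  -- The local checks exclude weight one on the special columns and on every block. So each nonzero
  -- part has weight at least two, and two nonzero parts already give `4 ≥ d`; there remain the
  -- words that live in a single part.
  have hy1 : hammingNorm y ≠ 1 := by
    apply hammingNorm_ne_one_of_sum
    intro j
    obtain ⟨i, hi⟩ := hT j
    exact ⟨T i, hi, h1 i⟩
  have hz1 : ∀ b, hammingNorm (z b) ≠ 1 := fun b =>
    hammingNorm_ne_one_of_sum fun j => ⟨fun _ => 1, one_ne_zero, by simpa using h2 b⟩
  have hy2 : y ≠ 0 → 2 ≤ hammingNorm y := by
    intro h
    have := hammingNorm_pos_iff.2 h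
    omega
  have hz2 : ∀ b, z b ≠ 0 → 2 ≤ hammingNorm (z b) := by
    intro b h
    have := hammingNorm_pos_iff.2 h
    have := hz1 b
    omega
  by_cases hz0 : ∀ b, z b = 0
  · have hy0 : y ≠ 0 := by
      intro h
      apply hx
      funext j
      rcases j with j | ⟨b, c⟩
      · exact congrFun h j
      · exact congrFun (hz0 b) c
    have := hK y h1 (fun i => by
      have h := h3 i
      have h4 : ∑ b, ∑ c, B i c * x (Sum.inr (b, c)) = 0 := by
        refine Finset.sum_eq_zero fun b _ => Finset.sum_eq_zero fun c _ => ?_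
        have : x (Sum.inr (b, c)) = 0 := congrFun (hz0 b) c
        rw [this, mul_zero]
      rwa [h4, add_zero] at h) hy0
    omega
  · push Not at hz0
    obtain ⟨b, hb⟩ := hz0
    have hsum : hammingNorm (z b) + ∑ b' ∈ Finset.univ.erase b, hammingNorm (z b') =
        ∑ b', hammingNorm (z b') := Finset.add_sum_erase _ (fun b' => hammingNorm (z b')) (Finset.mem_univ b)
    have h2b := hz2 b hb
    by_cases hy0 : y = 0
    · by_cases hb' : ∀ b', b' ≠ b → z b' = 0
      · have := hB (z b) (h2 b) (fun i => by
          have h := h3 i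
          rw [Finset.sum_eq_zero (fun j _ => by
            have : x (Sum.inl j) = 0 := congrFun hy0 j
            rw [this, mul_zero]), zero_add, Finset.sum_eq_single b] at h
          · exact h
          · intro b' _ hne
            refine Finset.sum_eq_zero fun c _ => ?_
            have : x (Sum.inr (b', c)) = 0 := congrFun (hb' b' hne) c
            rw [this, mul_zero]
          · simp) hb
        omega
      · push Not at hb'
        obtain ⟨b', hne, hb'⟩ := hb'
        have h4 : hammingNorm (z b') ≤ ∑ b' ∈ Finset.univ.erase b, hammingNorm (z b') :=
          Finset.single_le_sum (f := fun b' => hammingNorm (z b')) (fun _ _ => Nat.zero_le _)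
            (Finset.mem_erase.2 ⟨hne, Finset.mem_univ _⟩)
        have := hz2 b' hb'
        omega
    · have := hy2 hy0
      omega

theorem hammingNorm_localityRow (l w : ℕ) (b : Fin l) :
    hammingNorm (localityRows F l w b) = w := by
  rw [hammingNorm_eq_sum, Fintype.sum_prod_type, Finset.sum_eq_single b]
  · simp [localityRows]
  · intro b' _ hne
    simp [localityRows, hne]
  · simp

omit [DecidableEq F] in
theorem sum_localityRow {l w : ℕ} (b : Fin l) (z : Fin l × Fin w → F) :
    ∑ j, localityRows F l w b j * z j = ∑ c, z (b, c) := by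
  rw [Fintype.sum_prod_type, Finset.sum_eq_single b]
  · simp [localityRows]
  · intro b' _ hne
    simp [localityRows, hne]
  · simp

theorem isPCM_uniform {ρ : Type*} [Fintype ρ] {l w n k r d : ℕ} {B : Matrix ρ (Fin w) F}
    (hB : ∀ z : Fin w → F, ∑ c, z c = 0 → (∀ i, ∑ c, B i c * z c = 0) → z ≠ 0 →
      d ≤ hammingNorm z)
    (hw : w = r + 1) (hl : 1 ≤ l) (hn : l * w = n) (hk : l + Fintype.card ρ + k = n)
    (hr : 1 ≤ r) (hk1 : 1 ≤ k) (hd : 2 ≤ d) (hd4 : d ≤ 4) (hE : d + k + k ⌈/⌉ r = n + 2) :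
    IsPCMOfOptimalLRC (uniformPCM l B) n k r d := by
  have hrow : ∀ b, hammingNorm (uniformPCM l B (Sum.inl b)) = w := hammingNorm_localityRow l w
  refine isPCMOfOptimalLRC_of_rows (by simpa using hn) (by simpa using hk) hr hk1 hd hE ?_ ?_ ?_
  · intro j
    exact ⟨Sum.inl j.1, by simp [uniformPCM, localityRows], by rw [hrow]; omega⟩
  · exact ⟨Sum.inl ⟨0, hl⟩, by rw [hrow]; omega⟩
  · intro x hx hx0
    have h1 : ∀ i, ∑ j, uniformPCM l B i j * x j = 0 := fun i => congrFun hx i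
    -- The uniform matrix is the case without special columns.
    have := le_hammingNorm_of_blocks (κ := Empty) (τ := Empty) (l := l) hd4 (T := fun i => i.elim)
      (L := fun _ j => j.elim) (B := B) (by simp)
      (fun y _ _ hy => absurd (Subsingleton.elim y 0) hy) hB
      (x := fun j => Sum.elim (fun j : Empty => j.elim) x j) (by simp) (fun b => ?_) (fun i => ?_) ?_
    · rw [hammingNorm_sum_prod] at this
      rw [hammingNorm_eq_sum, Fintype.sum_prod_type]
      simp only [← hammingNorm_eq_sum]
      have h0 : hammingNorm (fun j : Empty => (j.elim : F)) = 0 := by simp [hammingNorm]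
      simpa [h0] using this
    · simpa using (sum_localityRow b x).symm.trans (h1 (Sum.inl b))
    · have := h1 (Sum.inr i)
      simp only [uniformPCM, copies, Matrix.fromRows_apply_inr, Matrix.of_apply,
        Fintype.sum_prod_type] at this
      simpa using this
    · intro h
      apply hx0
      funext j
      exact congrFun h (Sum.inr j)

theorem isPCM_mixed {τ ρ κ : Type*} [Fintype ρ] [Fintype τ] [Fintype κ] [DecidableEq κ]
    {l w n k r d : ℕ} {T : Matrix τ κ F} {L : Matrix ρ κ F} {B : Matrix ρ (Fin w) F}
    (hT : ∀ j, ∃ i, T i j ≠ 0 ∧ hammingNorm (T i) ≤ r + 1)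
    (hK : ∀ y : κ → F, (∀ i, ∑ j, T i j * y j = 0) → (∀ i, ∑ j, L i j * y j = 0) → y ≠ 0 →
      d ≤ hammingNorm y)
    (hB : ∀ z : Fin w → F, ∑ c, z c = 0 → (∀ i, ∑ c, B i c * z c = 0) → z ≠ 0 →
      d ≤ hammingNorm z)
    (hw : w = r + 1) (hl : 1 ≤ l) (hn : Fintype.card κ + l * w = n)
    (hk : Fintype.card τ + l + Fintype.card ρ + k = n)
    (hr : 1 ≤ r) (hk1 : 1 ≤ k) (hd : 2 ≤ d) (hd4 : d ≤ 4) (hE : d + k + k ⌈/⌉ r = n + 2) :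
    IsPCMOfOptimalLRC (mixedPCM T L l B) n k r d := by
  have hrow : ∀ b, hammingNorm (mixedPCM T L l B (Sum.inl (Sum.inr b))) = w := by
    intro b
    rw [hammingNorm_eq_sum, Fintype.sum_sum_type]
    have := hammingNorm_localityRow (F := F) l w b
    rw [hammingNorm_eq_sum] at this
    simp only [mixedPCM, Matrix.fromRows_apply_inl, Matrix.fromBlocks_apply₂₁,
      Matrix.fromBlocks_apply₂₂, Matrix.zero_apply, ne_eq, not_true_eq_false, if_false,
      Finset.sum_const_zero, zero_add]
    exact this
  have hrowT : ∀ i, hammingNorm (mixedPCM T L l B (Sum.inl (Sum.inl i))) = hammingNorm (T i) := by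
    intro i
    rw [hammingNorm_eq_sum, Fintype.sum_sum_type, hammingNorm_eq_sum]
    simp only [mixedPCM, Matrix.fromRows_apply_inl, Matrix.fromBlocks_apply₁₁,
      Matrix.fromBlocks_apply₁₂, Matrix.zero_apply, ne_eq, not_true_eq_false, if_false,
      Finset.sum_const_zero, add_zero]
    exact Finset.sum_congr rfl fun j _ => by congr
  refine isPCMOfOptimalLRC_of_rows (by simpa using hn) (by simpa [add_assoc] using hk) hr hk1 hd
    hE ?_ ?_ ?_
  · rintro (j | j)
    · obtain ⟨i, hi, hi2⟩ := hT j
      exact ⟨Sum.inl (Sum.inl i), by simpa [mixedPCM] using hi, by rw [hrowT]; exact hi2⟩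
    · exact ⟨Sum.inl (Sum.inr j.1), by simp [mixedPCM, localityRows], by rw [hrow]; omega⟩
  · exact ⟨Sum.inl (Sum.inr ⟨0, hl⟩), by rw [hrow]; omega⟩
  · intro x hx hx0
    have h1 : ∀ i, ∑ j, mixedPCM T L l B i j * x j = 0 := fun i => congrFun hx i
    refine le_hammingNorm_of_blocks hd4 (fun j => ?_) hK hB (fun i => ?_) (fun b => ?_)
      (fun i => ?_) hx0
    · obtain ⟨i, hi, -⟩ := hT j
      exact ⟨i, hi⟩
    · have := h1 (Sum.inl (Sum.inl i))
      rw [Fintype.sum_sum_type] at this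
      simpa [mixedPCM] using this
    · have := h1 (Sum.inl (Sum.inr b))
      rw [Fintype.sum_sum_type] at this
      simp only [mixedPCM, Matrix.fromRows_apply_inl, Matrix.fromBlocks_apply₂₁,
        Matrix.fromBlocks_apply₂₂, Matrix.zero_apply, zero_mul, Finset.sum_const_zero,
        zero_add] at this
      rwa [sum_localityRow b (fun j => x (Sum.inr j))] at this
    · have := h1 (Sum.inr i)
      rw [Fintype.sum_sum_type, Fintype.sum_prod_type] at this
      simpa [mixedPCM, copies] using this

end Blocks

/-! ### Block families checked on their finite pieces -/

section TableChecks

variable {F : Type*} [Field F] [DecidableEq F] {ω : F}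

theorem entry_append_left {L M : List (List ℕ)} {i : ℕ} (h : i < L.length) (j : ℕ) :
    entry (L ++ M) i j = entry L i j := by
  unfold entry
  rw [List.getD_append _ _ _ _ h]

theorem entry_append_right (L M : List (List ℕ)) (i j : ℕ) :
    entry (L ++ M) (L.length + i) j = entry M i j := by
  unfold entry
  rw [List.getD_append_right _ _ _ _ (by omega), Nat.add_sub_cancel_left]

theorem IsQuatGen.dist_of_check (hω : IsQuatGen ω) {p q w d : ℕ} {LT LB : List (List ℕ)}
    {T : Matrix (Fin p) (Fin w) F} {B : Matrix (Fin q) (Fin w) F}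
    (hT : (List.ofFn fun i => List.ofFn (T i)) = LT.map (List.map (quat ω)))
    (hB : (List.ofFn fun i => List.ofFn (B i)) = LB.map (List.map (quat ω)))
    (h : distCheck (LT ++ LB) w (d - 1) = true) (y : Fin w → F)
    (h1 : ∀ i, ∑ c, T i c * y c = 0) (h2 : ∀ i, ∑ c, B i c * y c = 0) (hy : y ≠ 0) :
    d ≤ hammingNorm y := by
  obtain ⟨hTl, hT⟩ := entries_of_ofFn hT
  obtain ⟨hBl, hB⟩ := entries_of_ofFn hB
  have := distCheck_sound hω h (e := Fin.val) Fin.val_injective (fun j => j.2) (x := y)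
    (fun i hi => ?_) hy
  · omega
  · rw [List.length_append] at hi
    by_cases hp : i < LT.length
    · have := h1 ⟨i, by omega⟩
      simp only [hT] at this
      simpa only [entry_append_left hp] using this
    · obtain ⟨i', rfl⟩ : ∃ i', i = LT.length + i' := ⟨i - LT.length, by omega⟩
      have := h2 ⟨i', by omega⟩
      simp only [hB] at this
      simpa only [entry_append_right] using this

/-- A block family of the shape `uniformPCM`, checked by computation. -/
theorem IsQuatGen.isPCM_uniform_of_check (hω : IsQuatGen ω) {q l w n k r d : ℕ}
    {LB : List (List ℕ)} {B : Matrix (Fin q) (Fin w) F}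
    (hB : (List.ofFn fun i => List.ofFn (B i)) = LB.map (List.map (quat ω)))
    (h : distCheck ([List.replicate w 1] ++ LB) w (d - 1) = true)
    (hw : w = r + 1) (hl : 1 ≤ l) (hn : l * w = n) (hk : l + q + k = n)
    (hr : 1 ≤ r) (hk1 : 1 ≤ k) (hd : 2 ≤ d) (hd4 : d ≤ 4) (hE : d + k + k ⌈/⌉ r = n + 2) :
    IsPCMOfOptimalLRC (uniformPCM l B) n k r d := by
  refine isPCM_uniform (fun z hz1 hz2 hz => ?_) hw hl hn (by simpa using hk) hr hk1 hd hd4 hE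
  refine hω.dist_of_check (T := fun (_ : Fin 1) (_ : Fin w) => (1 : F)) ?_ hB h z
    (fun _ => by simpa using hz1) hz2 hz
  simp [quat, List.ofFn_const]

/-- A block family of the shape `mixedPCM`, checked by computation. -/
theorem IsQuatGen.isPCM_mixed_of_check (hω : IsQuatGen ω) {p q v l w n k r d : ℕ}
    {LT LL LB : List (List ℕ)} {T : Matrix (Fin p) (Fin v) F} {L : Matrix (Fin q) (Fin v) F}
    {B : Matrix (Fin q) (Fin w) F}
    (hT : (List.ofFn fun i => List.ofFn (T i)) = LT.map (List.map (quat ω)))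
    (hL : (List.ofFn fun i => List.ofFn (L i)) = LL.map (List.map (quat ω)))
    (hB : (List.ofFn fun i => List.ofFn (B i)) = LB.map (List.map (quat ω)))
    (hloc : locCheck LT (List.range v) r = true)
    (h1 : distCheck (LT ++ LL) v (d - 1) = true)
    (h2 : distCheck ([List.replicate w 1] ++ LB) w (d - 1) = true)
    (hw : w = r + 1) (hl : 1 ≤ l) (hn : v + l * w = n) (hk : p + l + q + k = n)
    (hr : 1 ≤ r) (hk1 : 1 ≤ k) (hd : 2 ≤ d) (hd4 : d ≤ 4) (hE : d + k + k ⌈/⌉ r = n + 2) :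
    IsPCMOfOptimalLRC (mixedPCM T L l B) n k r d := by
  obtain ⟨hTl, hTe⟩ := entries_of_ofFn hT
  refine isPCM_mixed ?_ (fun y => hω.dist_of_check hT hL h1 y) (fun z hz1 hz2 hz => ?_) hw hl
    (by simpa using hn) (by simpa using hk) hr hk1 hd hd4 hE
  · exact (hω.locality_of_locCheck (e := Fin.val) Fin.val_injective List.nodup_range
      (fun n => by
        rw [List.mem_range]
        exact ⟨fun h => ⟨⟨n, h⟩, rfl⟩, fun ⟨j, hj⟩ => hj ▸ j.2⟩) hTl hTe hloc).1
  · refine hω.dist_of_check (T := fun (_ : Fin 1) (_ : Fin w) => (1 : F)) ?_ hB h2 z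
      (fun _ => by simpa using hz1) hz2 hz
    simp [quat, List.ofFn_const]

theorem IsQuatGen.isPCM_fromRows_of_check (hω : IsQuatGen ω) {p q n k r d : ℕ}
    {LT LL : List (List ℕ)} {T : Matrix (Fin p) (Fin n) F} {L : Matrix (Fin q) (Fin n) F}
    (hT : (List.ofFn fun i => List.ofFn (T i)) = LT.map (List.map (quat ω)))
    (hL : (List.ofFn fun i => List.ofFn (L i)) = LL.map (List.map (quat ω)))
    (hloc : locCheck LT (List.range n) r = true)
    (h1 : distCheck (LT ++ LL) n (d - 1) = true) (hk : p + q + k = n)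
    (hr : 1 ≤ r) (hk1 : 1 ≤ k) (hd : 2 ≤ d) (hE : d + k + k ⌈/⌉ r = n + 2) :
    IsPCMOfOptimalLRC (Matrix.fromRows T L) n k r d := by
  obtain ⟨hTl, hTe⟩ := entries_of_ofFn hT
  obtain ⟨h2, i, hi⟩ := hω.locality_of_locCheck (e := Fin.val) Fin.val_injective List.nodup_range
    (fun n => by
      rw [List.mem_range]
      exact ⟨fun h => ⟨⟨n, h⟩, rfl⟩, fun ⟨j, hj⟩ => hj ▸ j.2⟩) hTl hTe hloc
  refine isPCMOfOptimalLRC_of_rows (by simp) (by simpa using hk) hr hk1 hd hE (fun j => ?_)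
    ⟨Sum.inl i, hi⟩ (fun x hx hx0 => ?_)
  · obtain ⟨i, hi⟩ := h2 j
    exact ⟨Sum.inl i, hi⟩
  · exact hω.dist_of_check hT hL h1 x (fun i => congrFun hx (Sum.inl i))
      (fun i => congrFun hx (Sum.inr i)) hx0

end TableChecks

/-! ### Tables of codes for the listed matrices -/

section Tables

def tabMat13_9 : List (List ℕ) :=
  [[1, 1, 1, 1, 1, 0, 0, 0, 0, 0, 0, 0, 0],
   [0, 0, 0, 0, 1, 1, 1, 1, 1, 0, 0, 0, 0],
   [0, 0, 0, 0, 0, 0, 0, 0, 1, 1, 1, 1, 1],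
   [0, 1, 2, 3, 0, 1, 2, 3, 0, 0, 1, 2, 3]]

def tabMat18_13_d3 : List (List ℕ) :=
  [[1, 1, 1, 1, 1, 0, 0, 0, 0, 0, 0, 0, 0, 0, 0, 0, 0, 0],
   [0, 0, 0, 0, 1, 1, 1, 1, 1, 0, 0, 0, 0, 0, 0, 0, 0, 0],
   [0, 0, 0, 0, 0, 0, 0, 0, 0, 1, 1, 1, 1, 1, 0, 0, 0, 0],
   [0, 0, 0, 0, 0, 0, 0, 0, 0, 0, 0, 0, 0, 1, 1, 1, 1, 1],
   [0, 1, 2, 3, 0, 0, 1, 2, 3, 0, 1, 2, 3, 0, 0, 1, 2, 3]]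

def tabMat15_11 : List (List ℕ) :=
  [[1, 1, 1, 1, 1, 1, 0, 0, 0, 0, 0, 0, 0, 0, 0],
   [0, 0, 0, 0, 0, 1, 1, 1, 1, 1, 1, 0, 0, 0, 0],
   [0, 0, 0, 0, 1, 0, 0, 0, 0, 0, 1, 1, 1, 1, 1],
   [0, 1, 2, 3, 0, 1, 0, 1, 2, 3, 1, 0, 1, 2, 3]]

def tabHam19 : List (List ℕ) :=
  [[1, 1, 1, 1, 1, 1, 1, 1, 1, 1, 1, 1, 1, 1, 1, 1, 0, 0, 0],
   [1, 1, 1, 2, 2, 2, 3, 3, 3, 3, 2, 1, 0, 0, 0, 0, 1, 1, 1],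
   [1, 2, 3, 1, 2, 3, 1, 2, 3, 0, 0, 0, 3, 0, 2, 1, 2, 1, 0]]

def tabHam20 : List (List ℕ) :=
  [[1, 1, 1, 1, 1, 1, 1, 1, 1, 1, 1, 1, 1, 1, 1, 1, 0, 0, 0, 0],
   [1, 1, 1, 2, 2, 2, 3, 3, 3, 3, 2, 1, 0, 0, 0, 0, 1, 1, 1, 1],
   [1, 2, 3, 1, 2, 3, 1, 2, 3, 0, 0, 0, 3, 0, 2, 1, 3, 2, 1, 0]]

def tabHam21 : List (List ℕ) :=
  [[1, 1, 1, 1, 1, 1, 1, 1, 1, 1, 1, 1, 1, 1, 1, 1, 0, 0, 0, 0, 0],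
   [1, 1, 1, 2, 2, 2, 3, 3, 3, 3, 2, 0, 0, 0, 0, 1, 0, 1, 1, 1, 1],
   [1, 2, 3, 1, 2, 3, 1, 2, 3, 0, 0, 3, 0, 2, 1, 0, 1, 3, 2, 1, 0]]

def tabMat18_13 : List (List ℕ) :=
  [[1, 1, 1, 1, 1, 1, 1, 0, 0, 0, 0, 0, 0, 0, 0, 0, 0, 0],
   [0, 0, 0, 0, 0, 0, 1, 1, 1, 1, 1, 1, 1, 0, 0, 0, 0, 0],
   [0, 0, 0, 0, 0, 0, 0, 0, 0, 0, 0, 1, 1, 1, 1, 1, 1, 1],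
   [0, 1, 0, 3, 3, 1, 1, 1, 1, 2, 3, 0, 3, 0, 1, 0, 3, 3],
   [0, 0, 1, 3, 1, 3, 0, 3, 2, 0, 0, 0, 3, 0, 0, 1, 3, 1]]

def tabMat25_19 : List (List ℕ) :=
  [[1, 1, 1, 1, 1, 1, 1, 0, 0, 0, 0, 0, 0, 0, 0, 0, 0, 0, 0, 0, 0, 0, 0, 0, 0],
   [0, 0, 0, 0, 0, 0, 1, 1, 1, 1, 1, 1, 1, 0, 0, 0, 0, 0, 0, 0, 0, 0, 0, 0, 0],
   [0, 0, 0, 0, 0, 1, 0, 0, 0, 0, 0, 0, 0, 1, 1, 1, 1, 1, 1, 0, 0, 0, 0, 0, 0],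
   [0, 0, 0, 0, 0, 0, 0, 0, 0, 0, 0, 0, 0, 0, 0, 0, 0, 0, 1, 1, 1, 1, 1, 1, 1],
   [1, 1, 2, 2, 0, 0, 0, 0, 1, 0, 3, 3, 1, 1, 1, 2, 2, 0, 0, 0, 1, 0, 3, 3, 1],
   [0, 3, 0, 1, 3, 2, 1, 0, 0, 1, 3, 1, 3, 0, 3, 0, 1, 3, 1, 0, 0, 1, 3, 1, 3]]

def tabMat20_15 : List (List ℕ) :=
  [[1, 1, 1, 1, 1, 1, 1, 1, 0, 0, 0, 0, 0, 0, 0, 0, 0, 0, 0, 0],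
   [0, 0, 0, 0, 0, 0, 1, 1, 1, 1, 1, 1, 1, 1, 0, 0, 0, 0, 0, 0],
   [0, 0, 0, 0, 0, 0, 0, 0, 0, 0, 0, 0, 1, 1, 1, 1, 1, 1, 1, 1],
   [0, 1, 0, 3, 3, 1, 1, 1, 1, 1, 3, 3, 1, 3, 0, 1, 0, 3, 3, 1],
   [0, 0, 1, 3, 1, 3, 0, 1, 3, 2, 0, 1, 0, 3, 0, 0, 1, 3, 1, 3]]

def tabMat19_14 : List (List ℕ) :=
  [[1, 1, 1, 1, 1, 1, 1, 0, 0, 0, 0, 0, 0, 0, 0, 0, 0, 0, 0],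
   [0, 0, 0, 0, 0, 0, 1, 1, 1, 1, 1, 1, 1, 0, 0, 0, 0, 0, 0],
   [0, 0, 0, 0, 0, 0, 0, 0, 0, 0, 0, 0, 1, 1, 1, 1, 1, 1, 1],
   [0, 1, 0, 3, 3, 1, 3, 1, 3, 3, 2, 1, 3, 0, 1, 0, 3, 3, 1],
   [0, 0, 1, 3, 1, 3, 1, 2, 3, 2, 3, 1, 1, 0, 0, 1, 3, 1, 3]]

def tabCap16 : List (List ℕ) :=
  [[1, 1, 1, 0, 0, 0, 0, 3, 2, 1, 2, 3, 3, 1, 3, 1],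
   [0, 0, 1, 1, 1, 0, 0, 2, 3, 2, 2, 0, 2, 2, 3, 3],
   [0, 0, 0, 0, 1, 1, 1, 2, 2, 3, 3, 3, 2, 1, 1, 2],
   [3, 2, 1, 0, 1, 2, 3, 1, 1, 1, 1, 1, 2, 1, 3, 2]]

def tabCap17 : List (List ℕ) :=
  [[1, 1, 1, 1, 0, 0, 0, 0, 0, 2, 1, 3, 3, 3, 2, 2, 3],
   [0, 0, 0, 1, 1, 1, 1, 0, 0, 2, 1, 1, 2, 1, 3, 1, 2],
   [0, 0, 1, 0, 0, 0, 1, 1, 1, 3, 2, 2, 2, 3, 2, 1, 1],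
   [1, 2, 0, 1, 1, 2, 0, 0, 3, 1, 2, 2, 2, 3, 0, 0, 1]]

def tabCap14 : List (List ℕ) :=
  [[1, 1, 1, 1, 1, 1, 0, 0, 0, 0, 0, 0, 1, 2],
   [0, 0, 0, 0, 1, 1, 1, 1, 1, 1, 0, 0, 1, 2],
   [1, 1, 0, 0, 0, 0, 1, 1, 0, 0, 1, 1, 1, 2],
   [1, 2, 1, 2, 1, 2, 1, 2, 1, 2, 1, 2, 2, 2]]

def tabMatTwo2 : List (List ℕ) :=
  [[1, 1, 1, 0, 0, 0, 0, 0, 0, 0],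
   [0, 0, 1, 1, 1, 0, 0, 0, 0, 0],
   [0, 0, 0, 0, 0, 1, 1, 1, 0, 0],
   [0, 0, 0, 0, 0, 0, 0, 1, 1, 1],
   [1, 2, 1, 1, 2, 1, 2, 1, 1, 2]]

def tabMatTwo3 : List (List ℕ) :=
  [[1, 1, 1, 1, 0, 0, 0, 0, 0, 0, 0, 0],
   [0, 0, 1, 1, 1, 1, 0, 0, 0, 0, 0, 0],
   [0, 0, 0, 0, 0, 0, 1, 1, 1, 1, 0, 0],
   [0, 0, 0, 0, 0, 0, 0, 0, 1, 1, 1, 1],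
   [1, 2, 1, 2, 1, 2, 1, 2, 1, 2, 1, 2]]

def tabMatTwo4 : List (List ℕ) :=
  [[1, 1, 1, 1, 1, 0, 0, 0, 0, 0, 0, 0, 0, 0],
   [0, 0, 0, 1, 1, 1, 1, 1, 0, 0, 0, 0, 0, 0],
   [1, 0, 0, 0, 0, 0, 0, 0, 1, 1, 1, 1, 0, 0],
   [0, 0, 0, 0, 0, 1, 0, 0, 0, 0, 1, 1, 1, 1],
   [1, 1, 2, 1, 2, 1, 2, 1, 1, 2, 1, 2, 1, 2]]

def tabMatTwo5 : List (List ℕ) :=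
  [[1, 1, 1, 1, 1, 1, 0, 0, 0, 0, 0, 0, 0, 0, 0, 0],
   [0, 0, 0, 0, 1, 1, 1, 1, 1, 1, 0, 0, 0, 0, 0, 0],
   [1, 0, 0, 0, 0, 0, 0, 0, 1, 0, 1, 1, 1, 1, 0, 0],
   [0, 1, 0, 0, 0, 0, 0, 0, 0, 1, 0, 0, 1, 1, 1, 1],
   [1, 1, 1, 2, 1, 2, 1, 2, 1, 1, 1, 2, 1, 2, 1, 2]]

def tabMatTwo6 : List (List ℕ) :=
  [[1, 1, 1, 1, 1, 1, 1, 0, 0, 0, 0, 0, 0, 0, 0, 0, 0, 0],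
   [0, 0, 0, 0, 0, 1, 1, 1, 1, 1, 1, 1, 0, 0, 0, 0, 0, 0],
   [1, 0, 1, 0, 0, 0, 0, 0, 0, 0, 1, 0, 1, 1, 1, 1, 0, 0],
   [0, 1, 0, 0, 0, 0, 0, 0, 0, 1, 0, 1, 0, 0, 1, 1, 1, 1],
   [1, 1, 2, 1, 2, 1, 2, 1, 2, 1, 1, 2, 1, 2, 1, 2, 1, 2]]

def tabMatTwo7 : List (List ℕ) :=
  [[1, 1, 1, 1, 1, 1, 1, 1, 0, 0, 0, 0, 0, 0, 0, 0, 0, 0, 0, 0],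
   [0, 0, 0, 0, 0, 0, 1, 1, 1, 1, 1, 1, 1, 1, 0, 0, 0, 0, 0, 0],
   [1, 0, 1, 0, 0, 0, 0, 0, 0, 0, 1, 0, 1, 0, 1, 1, 1, 1, 0, 0],
   [0, 1, 0, 1, 0, 0, 0, 0, 0, 0, 0, 1, 0, 1, 0, 0, 1, 1, 1, 1],
   [1, 1, 2, 2, 1, 2, 1, 2, 1, 2, 1, 1, 2, 2, 1, 2, 1, 2, 1, 2]]

def tabMat8_2 : List (List ℕ) :=
  [[1, 1, 0, 0, 0, 0, 0, 0],
   [0, 0, 1, 1, 0, 0, 0, 0],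
   [0, 0, 0, 0, 1, 1, 0, 0],
   [0, 0, 0, 0, 0, 0, 1, 1],
   [0, 1, 0, 1, 0, 1, 0, 0],
   [0, 2, 0, 1, 0, 0, 0, 1]]

def tabMat10_3 : List (List ℕ) :=
  [[1, 1, 0, 0, 0, 0, 0, 0, 0, 0],
   [0, 0, 1, 1, 0, 0, 0, 0, 0, 0],
   [0, 0, 0, 0, 1, 1, 0, 0, 0, 0],
   [0, 0, 0, 0, 0, 0, 1, 1, 0, 0],
   [0, 0, 0, 0, 0, 0, 0, 0, 1, 1],
   [0, 1, 0, 1, 0, 2, 0, 2, 0, 0],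
   [0, 2, 0, 1, 0, 1, 0, 0, 0, 1]]

def tabMat10_2 : List (List ℕ) :=
  [[1, 1, 0, 0, 0, 0, 0, 0, 0, 0],
   [0, 0, 1, 1, 0, 0, 0, 0, 0, 0],
   [0, 0, 0, 0, 1, 1, 0, 0, 0, 0],
   [0, 0, 0, 0, 0, 0, 1, 1, 0, 0],
   [0, 0, 0, 0, 0, 0, 0, 0, 1, 1],
   [0, 1, 0, 1, 0, 2, 0, 2, 0, 0],
   [0, 2, 0, 1, 0, 1, 0, 0, 0, 1],
   [0, 0, 0, 1, 0, 0, 0, 2, 0, 1]]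

def tabMat12_3 : List (List ℕ) :=
  [[1, 1, 0, 0, 0, 0, 0, 0, 0, 0, 0, 0],
   [0, 0, 1, 1, 0, 0, 0, 0, 0, 0, 0, 0],
   [0, 0, 0, 0, 1, 1, 0, 0, 0, 0, 0, 0],
   [0, 0, 0, 0, 0, 0, 1, 1, 0, 0, 0, 0],
   [0, 0, 0, 0, 0, 0, 0, 0, 1, 1, 0, 0],
   [0, 0, 0, 0, 0, 0, 0, 0, 0, 0, 1, 1],
   [0, 1, 0, 1, 0, 2, 0, 2, 0, 0, 0, 0],
   [0, 2, 0, 1, 0, 1, 0, 0, 0, 1, 0, 0],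
   [0, 0, 0, 1, 0, 0, 0, 2, 0, 1, 0, 1]]

def tabNearMDS12 : List (List ℕ) :=
  [[1, 1, 1, 1, 1, 1, 0, 0, 0, 0, 0, 0],
   [0, 0, 0, 0, 0, 0, 1, 1, 1, 1, 1, 1],
   [0, 1, 0, 0, 2, 1, 0, 0, 1, 0, 1, 3],
   [0, 0, 3, 0, 1, 0, 0, 0, 1, 2, 1, 2],
   [0, 0, 0, 3, 2, 3, 0, 0, 3, 3, 0, 1],
   [0, 0, 0, 0, 2, 2, 0, 3, 3, 1, 2, 2]]

def tabMat12_5 : List (List ℕ) :=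
  [[1, 1, 1, 0, 0, 0, 0, 0, 0, 0, 0, 0],
   [0, 0, 0, 1, 1, 1, 0, 0, 0, 0, 0, 0],
   [0, 0, 0, 0, 0, 0, 1, 1, 1, 0, 0, 0],
   [0, 0, 0, 0, 0, 0, 0, 0, 0, 1, 1, 1],
   [0, 3, 1, 0, 3, 1, 0, 3, 1, 0, 0, 0],
   [0, 0, 2, 0, 2, 2, 0, 2, 0, 0, 1, 0],
   [0, 1, 1, 0, 1, 0, 0, 3, 0, 0, 0, 1]]

def tabMat15_7 : List (List ℕ) :=
  [[1, 1, 1, 0, 0, 0, 0, 0, 0, 0, 0, 0, 0, 0, 0],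
   [0, 0, 0, 1, 1, 1, 0, 0, 0, 0, 0, 0, 0, 0, 0],
   [0, 0, 0, 0, 0, 0, 1, 1, 1, 0, 0, 0, 0, 0, 0],
   [0, 0, 0, 0, 0, 0, 0, 0, 0, 1, 1, 1, 0, 0, 0],
   [0, 0, 0, 0, 0, 0, 0, 0, 0, 0, 0, 0, 1, 1, 1],
   [0, 3, 1, 0, 3, 1, 0, 3, 1, 0, 0, 0, 0, 1, 2],
   [0, 0, 2, 0, 2, 2, 0, 2, 0, 0, 1, 0, 0, 0, 3],
   [0, 1, 1, 0, 1, 0, 0, 3, 0, 0, 0, 1, 0, 1, 3]]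

def tabAux3s3 : List (List ℕ) :=
  [[0, 1, 2]]

def tabLeft4s3 : List (List ℕ) :=
  [[0, 2, 3, 1, 0, 2, 3]]

def tabAux4s3 : List (List ℕ) :=
  [[1, 0, 2, 3]]

def tabAux4s4 : List (List ℕ) :=
  [[0, 1, 2, 3]]

def tabAux4s4d4 : List (List ℕ) :=
  [[0, 1, 0, 1],
   [0, 0, 1, 1]]

def tabLeft5s4 : List (List ℕ) :=
  [[0, 1, 0, 3, 3, 3, 0, 1, 0],
   [0, 0, 1, 3, 1, 3, 1, 0, 0]]

def tabAux5s4 : List (List ℕ) :=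
  [[0, 1, 0, 3, 3],
   [0, 0, 1, 3, 1]]

def tabLeft6s4 : List (List ℕ) :=
  [[0, 1, 0, 3, 3, 1, 3, 0, 1, 0],
   [0, 0, 1, 3, 1, 3, 3, 1, 0, 0]]

def tabAux6s4 : List (List ℕ) :=
  [[0, 1, 0, 3, 1, 3],
   [0, 0, 1, 3, 3, 1]]

def tabLeftB6s4 : List (List ℕ) :=
  [[0, 1, 0, 3, 3, 1, 3, 3, 0, 1, 1, 1, 2, 2, 3, 3],
   [0, 0, 1, 3, 1, 3, 1, 3, 1, 0, 0, 3, 0, 2, 3, 2]]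

def tabAux5s5 : List (List ℕ) :=
  [[0, 1, 0, 3, 3],
   [0, 0, 1, 3, 1]]

def tabLeft6s5 : List (List ℕ) :=
  [[0, 1, 0, 3, 3, 1, 3, 3, 0, 1, 0],
   [0, 0, 1, 3, 1, 3, 1, 3, 1, 0, 0]]

def tabAux6s5 : List (List ℕ) :=
  [[0, 1, 0, 1, 3, 3],
   [0, 0, 1, 3, 3, 1]]

def tabAux6s6 : List (List ℕ) :=
  [[0, 1, 0, 3, 3, 1],
   [0, 0, 1, 3, 1, 3]]

def tabAux2s2 : List (List ℕ) :=
  [[0, 1]]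

def tabTop4s3 (a : ℕ) : List (List ℕ) :=
  [[1, 1, 1, a, 0, 0, 0],
   [0, 0, 0, 1, 1, 1, 1]]

def tabTop5s4 (a : ℕ) : List (List ℕ) :=
  [[1, 1, 1, 1, a, 0, 0, 0, 0],
   [0, 0, 0, 0, 1, 1, 1, 1, 1]]

def tabTop6s4 (a b : ℕ) : List (List ℕ) :=
  [[1, 1, 1, 1, a, b, 0, 0, 0, 0],
   [0, 0, 0, 0, 1, 1, 1, 1, 1, 1]]

def tabTopB6s4 (a b : ℕ) : List (List ℕ) :=
  [[1, 1, 1, 1, 1, a, 0, 0, 0, 0, 0, 0, 0, 0, 0, 0],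
   [0, 0, 0, 0, 0, 1, 1, 1, 1, 1, b, 0, 0, 0, 0, 0],
   [0, 0, 0, 0, 0, 0, 0, 0, 0, 0, 1, 1, 1, 1, 1, 1]]

def tabTop6s5 (a : ℕ) : List (List ℕ) :=
  [[1, 1, 1, 1, 1, a, 0, 0, 0, 0, 0],
   [0, 0, 0, 0, 0, 1, 1, 1, 1, 1, 1]]

end Tables

/-! ### Optimality of the listed matrices -/

section Instances

variable {F : Type*} [Field F] [DecidableEq F] {ω : F}

set_option maxRecDepth 10000 in
theorem IsQuatGen.isPCM_mat13_9 (hω : IsQuatGen ω) : IsPCMOfOptimalLRC (mat13_9 ω) 13 9 4 3 :=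
  hω.isPCM_full (L := tabMat13_9) rfl (by decide +kernel) (by decide +kernel) rfl (by omega) (by omega)
    (by omega) rfl

set_option maxRecDepth 10000 in
theorem IsQuatGen.isPCM_mat18_13_d3 (hω : IsQuatGen ω) : IsPCMOfOptimalLRC (mat18_13_d3 ω) 18 13 4 3 :=
  hω.isPCM_full (L := tabMat18_13_d3) rfl (by decide +kernel) (by decide +kernel) rfl (by omega) (by omega)
    (by omega) rfl

set_option maxRecDepth 10000 in
theorem IsQuatGen.isPCM_mat15_11 (hω : IsQuatGen ω) : IsPCMOfOptimalLRC (mat15_11 ω) 15 11 5 3 :=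
  hω.isPCM_full (L := tabMat15_11) rfl (by decide +kernel) (by decide +kernel) rfl (by omega) (by omega)
    (by omega) rfl

set_option maxRecDepth 10000 in
theorem IsQuatGen.isPCM_mat18_13 (hω : IsQuatGen ω) : IsPCMOfOptimalLRC (mat18_13 ω) 18 13 6 4 :=
  hω.isPCM_full (L := tabMat18_13) rfl (by decide +kernel) (by decide +kernel) rfl (by omega) (by omega)
    (by omega) rfl

set_option maxRecDepth 10000 in
theorem IsQuatGen.isPCM_mat25_19 (hω : IsQuatGen ω) : IsPCMOfOptimalLRC (mat25_19 ω) 25 19 6 4 :=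
  hω.isPCM_full (L := tabMat25_19) rfl (by decide +kernel) (by decide +kernel) rfl (by omega) (by omega)
    (by omega) rfl

set_option maxRecDepth 10000 in
theorem IsQuatGen.isPCM_mat20_15 (hω : IsQuatGen ω) : IsPCMOfOptimalLRC (mat20_15 ω) 20 15 7 4 :=
  hω.isPCM_full (L := tabMat20_15) rfl (by decide +kernel) (by decide +kernel) rfl (by omega) (by omega)
    (by omega) rfl

set_option maxRecDepth 10000 in
theorem IsQuatGen.isPCM_mat19_14 (hω : IsQuatGen ω) : IsPCMOfOptimalLRC (mat19_14 ω) 19 14 6 4 :=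
  hω.isPCM_full (L := tabMat19_14) rfl (by decide +kernel) (by decide +kernel) rfl (by omega) (by omega)
    (by omega) rfl

set_option maxRecDepth 10000 in
theorem IsQuatGen.isPCM_matTwo2 (hω : IsQuatGen ω) : IsPCMOfOptimalLRC (matTwo2 ω) 10 5 2 4 :=
  hω.isPCM_full (L := tabMatTwo2) rfl (by decide +kernel) (by decide +kernel) rfl (by omega) (by omega)
    (by omega) rfl

set_option maxRecDepth 10000 in
theorem IsQuatGen.isPCM_matTwo3 (hω : IsQuatGen ω) : IsPCMOfOptimalLRC (matTwo3 ω) 12 7 3 4 :=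
  hω.isPCM_full (L := tabMatTwo3) rfl (by decide +kernel) (by decide +kernel) rfl (by omega) (by omega)
    (by omega) rfl

set_option maxRecDepth 10000 in
theorem IsQuatGen.isPCM_matTwo4 (hω : IsQuatGen ω) : IsPCMOfOptimalLRC (matTwo4 ω) 14 9 4 4 :=
  hω.isPCM_full (L := tabMatTwo4) rfl (by decide +kernel) (by decide +kernel) rfl (by omega) (by omega)
    (by omega) rfl

set_option maxRecDepth 10000 in
theorem IsQuatGen.isPCM_matTwo5 (hω : IsQuatGen ω) : IsPCMOfOptimalLRC (matTwo5 ω) 16 11 5 4 :=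
  hω.isPCM_full (L := tabMatTwo5) rfl (by decide +kernel) (by decide +kernel) rfl (by omega) (by omega)
    (by omega) rfl

set_option maxRecDepth 10000 in
theorem IsQuatGen.isPCM_matTwo6 (hω : IsQuatGen ω) : IsPCMOfOptimalLRC (matTwo6 ω) 18 13 6 4 :=
  hω.isPCM_full (L := tabMatTwo6) rfl (by decide +kernel) (by decide +kernel) rfl (by omega) (by omega)
    (by omega) rfl

set_option maxRecDepth 10000 in
theorem IsQuatGen.isPCM_matTwo7 (hω : IsQuatGen ω) : IsPCMOfOptimalLRC (matTwo7 ω) 20 15 7 4 :=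
  hω.isPCM_full (L := tabMatTwo7) rfl (by decide +kernel) (by decide +kernel) rfl (by omega) (by omega)
    (by omega) rfl

set_option maxRecDepth 10000 in
theorem IsQuatGen.isPCM_mat8_2 (hω : IsQuatGen ω) : IsPCMOfOptimalLRC (mat8_2 ω) 8 2 1 6 :=
  hω.isPCM_full (L := tabMat8_2) rfl (by decide +kernel) (by decide +kernel) rfl (by omega) (by omega)
    (by omega) rfl

set_option maxRecDepth 10000 in
theorem IsQuatGen.isPCM_mat10_3 (hω : IsQuatGen ω) : IsPCMOfOptimalLRC (mat10_3 ω) 10 3 1 6 :=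
  hω.isPCM_full (L := tabMat10_3) rfl (by decide +kernel) (by decide +kernel) rfl (by omega) (by omega)
    (by omega) rfl

set_option maxRecDepth 10000 in
theorem IsQuatGen.isPCM_mat10_2 (hω : IsQuatGen ω) : IsPCMOfOptimalLRC (mat10_2 ω) 10 2 1 8 :=
  hω.isPCM_full (L := tabMat10_2) rfl (by decide +kernel) (by decide +kernel) rfl (by omega) (by omega)
    (by omega) rfl

set_option maxRecDepth 10000 in
theorem IsQuatGen.isPCM_mat12_3 (hω : IsQuatGen ω) : IsPCMOfOptimalLRC (mat12_3 ω) 12 3 1 8 :=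
  hω.isPCM_full (L := tabMat12_3) rfl (by decide +kernel) (by decide +kernel) rfl (by omega) (by omega)
    (by omega) rfl

set_option maxRecDepth 10000 in
theorem IsQuatGen.isPCM_nearMDS12 (hω : IsQuatGen ω) : IsPCMOfOptimalLRC (nearMDS12 ω) 12 6 5 6 :=
  hω.isPCM_full (L := tabNearMDS12) rfl (by decide +kernel) (by decide +kernel) rfl (by omega) (by omega)
    (by omega) rfl

set_option maxRecDepth 10000 in
theorem IsQuatGen.isPCM_mat12_5 (hω : IsQuatGen ω) : IsPCMOfOptimalLRC (mat12_5 ω) 12 5 2 6 :=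
  hω.isPCM_full (L := tabMat12_5) rfl (by decide +kernel) (by decide +kernel) rfl (by omega) (by omega)
    (by omega) rfl

set_option maxRecDepth 10000 in
theorem IsQuatGen.isPCM_mat15_7 (hω : IsQuatGen ω) : IsPCMOfOptimalLRC (mat15_7 ω) 15 7 2 6 :=
  hω.isPCM_full (L := tabMat15_7) rfl (by decide +kernel) (by decide +kernel) rfl (by omega) (by omega)
    (by omega) rfl

set_option maxRecDepth 10000 in
-- Distance three asks for pairwise non-proportional columns, which is checked once for the full
-- matrix. The covering by rows of weight at most `r + 1` depends on the number of dropped columns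
-- and is checked for each `r`.
theorem IsQuatGen.isPCM_ham19 (hω : IsQuatGen ω) {r : ℕ} (h1 : 2 ≤ r) (h2 : r ≤ 15) :
    IsPCMOfOptimalLRC (dropCols (15 - r) (ham19 ω)) (r + 4) (r + 1) r 3 := by
  refine hω.isPCM_dropCols (L := tabHam19) rfl (by decide +kernel) (by omega) ?_ (by omega) (by omega)
    (by omega) (by omega) (by omega) ?_
  · interval_cases r <;> decide +kernel
  · rw [ceilDiv_eq_of_bounds (l := 2) (by omega) (by omega) (by omega)]
    omega

set_option maxRecDepth 10000 in
theorem IsQuatGen.isPCM_ham20 (hω : IsQuatGen ω) {r : ℕ} (h1 : 3 ≤ r) (h2 : r ≤ 15) :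
    IsPCMOfOptimalLRC (dropCols (15 - r) (ham20 ω)) (r + 5) (r + 2) r 3 := by
  refine hω.isPCM_dropCols (L := tabHam20) rfl (by decide +kernel) (by omega) ?_ (by omega) (by omega)
    (by omega) (by omega) (by omega) ?_
  · interval_cases r <;> decide +kernel
  · rw [ceilDiv_eq_of_bounds (l := 2) (by omega) (by omega) (by omega)]
    omega

set_option maxRecDepth 10000 in
theorem IsQuatGen.isPCM_ham21 (hω : IsQuatGen ω) {r : ℕ} (h1 : 6 ≤ r) (h2 : r ≤ 15) :
    IsPCMOfOptimalLRC (dropCols (15 - r) (ham21 ω)) (r + 6) (r + 3) r 3 := by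
  refine hω.isPCM_dropCols (L := tabHam21) rfl (by decide +kernel) (by omega) ?_ (by omega) (by omega)
    (by omega) (by omega) (by omega) ?_
  · interval_cases r <;> decide +kernel
  · rw [ceilDiv_eq_of_bounds (l := 2) (by omega) (by omega) (by omega)]
    omega

set_option maxRecDepth 10000 in
theorem IsQuatGen.isPCM_cap16 (hω : IsQuatGen ω) {r : ℕ} (h1 : 2 ≤ r) (h2 : r ≤ 11) :
    IsPCMOfOptimalLRC (takeCols (r + 5) (cap16 ω)) (r + 5) (r + 1) r 4 := by
  refine hω.isPCM_takeCols (L := tabCap16) rfl (by decide +kernel) (by omega) ?_ (by omega)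
    (by omega) (by omega) (by omega) ?_
  · interval_cases r <;> decide +kernel
  · rw [ceilDiv_eq_of_bounds (l := 2) (by omega) (by omega) (by omega)]
    omega

set_option maxRecDepth 10000 in
theorem IsQuatGen.isPCM_cap17 (hω : IsQuatGen ω) {r : ℕ} (h1 : 3 ≤ r) (h2 : r ≤ 11) :
    IsPCMOfOptimalLRC (takeCols (r + 6) (cap17 ω)) (r + 6) (r + 2) r 4 := by
  refine hω.isPCM_takeCols (L := tabCap17) rfl (by decide +kernel) (by omega) ?_ (by omega)
    (by omega) (by omega) (by omega) ?_
  · interval_cases r <;> decide +kernel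
  · rw [ceilDiv_eq_of_bounds (l := 2) (by omega) (by omega) (by omega)]
    omega

set_option maxRecDepth 10000 in
theorem IsQuatGen.isPCM_cap14 (hω : IsQuatGen ω) {r : ℕ} (h1 : 5 ≤ r) (h2 : r ≤ 7) :
    IsPCMOfOptimalLRC (takeCols (r + 7) (cap14 ω)) (r + 7) (r + 3) r 4 := by
  refine hω.isPCM_takeCols (L := tabCap14) rfl (by decide +kernel) (by omega) ?_ (by omega)
    (by omega) (by omega) (by omega) ?_
  · interval_cases r <;> decide +kernel
  · rw [ceilDiv_eq_of_bounds (l := 2) (by omega) (by omega) (by omega)]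
    omega

theorem IsQuatGen.isPCM_aux3s3 (hω : IsQuatGen ω) {s : ℕ} (hs : 2 ≤ s) :
    IsPCMOfOptimalLRC (uniformPCM (s + 1) (aux3s3 ω)) (3 * s + 3) (2 * s + 1) 2 3 := by
  refine hω.isPCM_uniform_of_check (LB := tabAux3s3) rfl (by decide +kernel) rfl (by omega) (by omega)
    (by omega) (by omega) (by omega) (by omega) (by omega) ?_
  rw [ceilDiv_eq_of_bounds (l := s + 1) (by omega) (by omega) (by omega)]
  omega

theorem IsQuatGen.isPCM_aux4s4 (hω : IsQuatGen ω) {s : ℕ} (hs : 2 ≤ s) :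
    IsPCMOfOptimalLRC (uniformPCM (s + 1) (aux4s4 ω)) (4 * s + 4) (3 * s + 2) 3 3 := by
  refine hω.isPCM_uniform_of_check (LB := tabAux4s4) rfl (by decide +kernel) rfl (by omega) (by omega)
    (by omega) (by omega) (by omega) (by omega) (by omega) ?_
  rw [ceilDiv_eq_of_bounds (l := s + 1) (by omega) (by omega) (by omega)]
  omega

theorem IsQuatGen.isPCM_aux4s4d4 (hω : IsQuatGen ω) {s : ℕ} (hs : 2 ≤ s) :
    IsPCMOfOptimalLRC (uniformPCM (s + 1) (aux4s4d4 F)) (4 * s + 4) (3 * s + 1) 3 4 := by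
  refine hω.isPCM_uniform_of_check (LB := tabAux4s4d4) rfl (by decide +kernel) rfl (by omega) (by omega)
    (by omega) (by omega) (by omega) (by omega) (by omega) ?_
  rw [ceilDiv_eq_of_bounds (l := s + 1) (by omega) (by omega) (by omega)]
  omega

theorem IsQuatGen.isPCM_aux5s5 (hω : IsQuatGen ω) {s : ℕ} (hs : 2 ≤ s) :
    IsPCMOfOptimalLRC (uniformPCM (s + 1) (aux5s5 ω)) (5 * s + 5) (4 * s + 2) 4 4 := by
  refine hω.isPCM_uniform_of_check (LB := tabAux5s5) rfl (by decide +kernel) rfl (by omega) (by omega)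
    (by omega) (by omega) (by omega) (by omega) (by omega) ?_
  rw [ceilDiv_eq_of_bounds (l := s + 1) (by omega) (by omega) (by omega)]
  omega

theorem IsQuatGen.isPCM_aux6s6 (hω : IsQuatGen ω) {s : ℕ} (hs : 2 ≤ s) :
    IsPCMOfOptimalLRC (uniformPCM (s + 1) (aux6s6 ω)) (6 * s + 6) (5 * s + 3) 5 4 := by
  refine hω.isPCM_uniform_of_check (LB := tabAux6s6) rfl (by decide +kernel) rfl (by omega) (by omega)
    (by omega) (by omega) (by omega) (by omega) (by omega) ?_
  rw [ceilDiv_eq_of_bounds (l := s + 1) (by omega) (by omega) (by omega)]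
  omega

theorem IsQuatGen.isPCM_aux2s2 (hω : IsQuatGen ω) {s : ℕ} (hs : 2 ≤ s) :
    IsPCMOfOptimalLRC (uniformPCM (s + 1) (aux2s2 F)) (2 * s + 2) (s) 1 4 := by
  refine hω.isPCM_uniform_of_check (LB := tabAux2s2) rfl (by decide +kernel) rfl (by omega) (by omega)
    (by omega) (by omega) (by omega) (by omega) (by omega) ?_
  rw [ceilDiv_eq_of_bounds (l := s) (by omega) (by omega) (by omega)]
  omega

theorem IsQuatGen.isPCM_top4s3 (hω : IsQuatGen ω) {s : ℕ} (hs : 2 ≤ s) {α : F}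
    (hα : α = 0 ∨ α = 1) :
    IsPCMOfOptimalLRC (mixedPCM (top4s3 α) (left4s3 ω) (s - 1) (aux4s3 ω)) (4 * s + 3) (3 * s + 1) 3 3 := by
  -- The parameter is replaced by its code, so that in both cases the table is closed and can be
  -- evaluated.
  obtain ⟨a, hha, rfl⟩ : ∃ a, (a = 0 ∨ a = 1) ∧ quat ω a = α := by
    rcases hα with rfl | rfl
    exacts [⟨0, by simp, rfl⟩, ⟨1, by simp, rfl⟩]
  refine hω.isPCM_mixed_of_check (LT := tabTop4s3 a) (LL := tabLeft4s3) (LB := tabAux4s3) ?_ rfl rfl ?_ ?_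
    (by decide +kernel) rfl (by omega) (by omega) (by omega) (by omega) (by omega) (by omega)
    (by omega) ?_
  · rcases hha with rfl | rfl <;> rfl
  · rcases hha with rfl | rfl <;> decide +kernel
  · rcases hha with rfl | rfl <;> decide +kernel
  · rw [ceilDiv_eq_of_bounds (l := s + 1) (by omega) (by omega) (by omega)]
    omega

theorem IsQuatGen.isPCM_top5s4 (hω : IsQuatGen ω) {s : ℕ} (hs : 2 ≤ s) {α : F}
    (hα : α = 0 ∨ α = 1) :
    IsPCMOfOptimalLRC (mixedPCM (top5s4 α) (left5s4 ω) (s - 1) (aux5s4 ω)) (5 * s + 4) (4 * s + 1) 4 4 := by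
  obtain ⟨a, hha, rfl⟩ : ∃ a, (a = 0 ∨ a = 1) ∧ quat ω a = α := by
    rcases hα with rfl | rfl
    exacts [⟨0, by simp, rfl⟩, ⟨1, by simp, rfl⟩]
  refine hω.isPCM_mixed_of_check (LT := tabTop5s4 a) (LL := tabLeft5s4) (LB := tabAux5s4) ?_ rfl rfl ?_ ?_
    (by decide +kernel) rfl (by omega) (by omega) (by omega) (by omega) (by omega) (by omega)
    (by omega) ?_
  · rcases hha with rfl | rfl <;> rfl
  · rcases hha with rfl | rfl <;> decide +kernel
  · rcases hha with rfl | rfl <;> decide +kernel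
  · rw [ceilDiv_eq_of_bounds (l := s + 1) (by omega) (by omega) (by omega)]
    omega

theorem IsQuatGen.isPCM_top6s4 (hω : IsQuatGen ω) {s : ℕ} (hs : 2 ≤ s) {α β : F}
    (hα : α = 0 ∨ α = 1) (hβ : β = 0 ∨ β = 1) :
    IsPCMOfOptimalLRC (mixedPCM (top6s4 α β) (left6s4 ω) (s - 1) (aux6s4 ω)) (6 * s + 4) (5 * s + 1) 5 4 := by
  obtain ⟨a, hha, rfl⟩ : ∃ a, (a = 0 ∨ a = 1) ∧ quat ω a = α := by
    rcases hα with rfl | rfl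
    exacts [⟨0, by simp, rfl⟩, ⟨1, by simp, rfl⟩]
  obtain ⟨b, hhb, rfl⟩ : ∃ b, (b = 0 ∨ b = 1) ∧ quat ω b = β := by
    rcases hβ with rfl | rfl
    exacts [⟨0, by simp, rfl⟩, ⟨1, by simp, rfl⟩]
  refine hω.isPCM_mixed_of_check (LT := tabTop6s4 a b) (LL := tabLeft6s4) (LB := tabAux6s4) ?_ rfl rfl ?_ ?_
    (by decide +kernel) rfl (by omega) (by omega) (by omega) (by omega) (by omega) (by omega)
    (by omega) ?_
  · rcases hha with rfl | rfl <;> rcases hhb with rfl | rfl <;> rfl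
  · rcases hha with rfl | rfl <;> rcases hhb with rfl | rfl <;> decide +kernel
  · rcases hha with rfl | rfl <;> rcases hhb with rfl | rfl <;> decide +kernel
  · rw [ceilDiv_eq_of_bounds (l := s + 1) (by omega) (by omega) (by omega)]
    omega

theorem IsQuatGen.isPCM_topB6s4 (hω : IsQuatGen ω) {s : ℕ} (hs : 3 ≤ s) {α β : F}
    (hα : α = 0 ∨ α = 1) (hβ : β = 0 ∨ β = 1) :
    IsPCMOfOptimalLRC (mixedPCM (topB6s4 α β) (leftB6s4 ω) (s - 2) (aux6s4 ω)) (6 * s + 4) (5 * s + 1) 5 4 := by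
  obtain ⟨a, hha, rfl⟩ : ∃ a, (a = 0 ∨ a = 1) ∧ quat ω a = α := by
    rcases hα with rfl | rfl
    exacts [⟨0, by simp, rfl⟩, ⟨1, by simp, rfl⟩]
  obtain ⟨b, hhb, rfl⟩ : ∃ b, (b = 0 ∨ b = 1) ∧ quat ω b = β := by
    rcases hβ with rfl | rfl
    exacts [⟨0, by simp, rfl⟩, ⟨1, by simp, rfl⟩]
  refine hω.isPCM_mixed_of_check (LT := tabTopB6s4 a b) (LL := tabLeftB6s4) (LB := tabAux6s4) ?_ rfl rfl ?_ ?_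
    (by decide +kernel) rfl (by omega) (by omega) (by omega) (by omega) (by omega) (by omega)
    (by omega) ?_
  · rcases hha with rfl | rfl <;> rcases hhb with rfl | rfl <;> rfl
  · rcases hha with rfl | rfl <;> rcases hhb with rfl | rfl <;> decide +kernel
  · rcases hha with rfl | rfl <;> rcases hhb with rfl | rfl <;> decide +kernel
  · rw [ceilDiv_eq_of_bounds (l := s + 1) (by omega) (by omega) (by omega)]
    omega

theorem IsQuatGen.isPCM_top6s5 (hω : IsQuatGen ω) {s : ℕ} (hs : 2 ≤ s) {α : F}
    (hα : α = 0 ∨ α = 1) :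
    IsPCMOfOptimalLRC (mixedPCM (top6s5 α) (left6s5 ω) (s - 1) (aux6s5 ω)) (6 * s + 5) (5 * s + 2) 5 4 := by
  obtain ⟨a, hha, rfl⟩ : ∃ a, (a = 0 ∨ a = 1) ∧ quat ω a = α := by
    rcases hα with rfl | rfl
    exacts [⟨0, by simp, rfl⟩, ⟨1, by simp, rfl⟩]
  refine hω.isPCM_mixed_of_check (LT := tabTop6s5 a) (LL := tabLeft6s5) (LB := tabAux6s5) ?_ rfl rfl ?_ ?_
    (by decide +kernel) rfl (by omega) (by omega) (by omega) (by omega) (by omega) (by omega)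
    (by omega) ?_
  · rcases hha with rfl | rfl <;> rfl
  · rcases hha with rfl | rfl <;> decide +kernel
  · rcases hha with rfl | rfl <;> decide +kernel
  · rw [ceilDiv_eq_of_bounds (l := s + 1) (by omega) (by omega) (by omega)]
    omega

/-- The smallest member of the second construction has no regular block, so the row of weight `r +
1` has to come from the special columns. -/
theorem IsQuatGen.isPCM_fromRows_topB6s4 (hω : IsQuatGen ω) {α β : F} (hα : α = 0 ∨ α = 1)
    (hβ : β = 0 ∨ β = 1) :
    IsPCMOfOptimalLRC (Matrix.fromRows (topB6s4 α β) (leftB6s4 ω)) 16 11 5 4 := by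
  obtain ⟨a, hha, rfl⟩ : ∃ a, (a = 0 ∨ a = 1) ∧ quat ω a = α := by
    rcases hα with rfl | rfl
    exacts [⟨0, by simp, rfl⟩, ⟨1, by simp, rfl⟩]
  obtain ⟨b, hhb, rfl⟩ : ∃ b, (b = 0 ∨ b = 1) ∧ quat ω b = β := by
    rcases hβ with rfl | rfl
    exacts [⟨0, by simp, rfl⟩, ⟨1, by simp, rfl⟩]
  refine hω.isPCM_fromRows_of_check (LT := tabTopB6s4 a b) (LL := tabLeftB6s4) ?_ rfl ?_ ?_
    rfl (by omega) (by omega) (by omega) rfl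
  · rcases hha with rfl | rfl <;> rcases hhb with rfl | rfl <;> rfl
  · rcases hha with rfl | rfl <;> rcases hhb with rfl | rfl <;> decide +kernel
  · rcases hha with rfl | rfl <;> rcases hhb with rfl | rfl <;> decide +kernel

end Instances

/-! ### Distance two -/

section DistanceTwo

variable {F ι : Type*} [Field F] [DecidableEq F] [Fintype ι] [DecidableEq ι]

/-- A matrix without zero columns gives distance at least two. -/
theorem isPCM_of_columns_ne_zero {l n k r : ℕ} {H : Matrix (Fin l) ι F}
    (hn : Fintype.card ι = n) (hk : l + k = n) (hl : k ⌈/⌉ r = l) (hr : 1 ≤ r) (hk1 : 1 ≤ k)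
    (hcol : ∀ j, ∃ i, H i j ≠ 0) (hrow : ∀ i, hammingNorm (H i) ≤ r + 1)
    (hex : ∃ i, hammingNorm (H i) = r + 1) : IsPCMOfOptimalLRC H n k r 2 := by
  refine isPCMOfOptimalLRC_of_rows hn (by simpa using hk) hr hk1 le_rfl (by omega) ?_ hex ?_
  · intro j
    obtain ⟨i, hi⟩ := hcol j
    exact ⟨i, hi, hrow i⟩
  · intro x hx hx0
    have h1 : hammingNorm x ≠ 1 := hammingNorm_ne_one_of_sum fun j => by
      obtain ⟨i, hi⟩ := hcol j
      exact ⟨H i, hi, congrFun hx i⟩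
    have := hammingNorm_pos_iff.2 hx0
    omega

omit [DecidableEq F] in
theorem exists_localityRows_ne_zero {l w : ℕ} (j : Fin l × Fin w) :
    ∃ i, localityRows F l w i j ≠ 0 := ⟨j.1, by simp [localityRows]⟩

theorem isPCM_localityRows {k r : ℕ} (hr : 1 ≤ r) (hk : r < k) (hdvd : r ∣ k) :
    IsPCMOfOptimalLRC (localityRows F (k / r) (r + 1)) (k + k ⌈/⌉ r) k r 2 := by
  obtain ⟨q, rfl⟩ := hdvd
  have hq : 0 < q := Nat.pos_of_ne_zero (by rintro rfl; simp at hk)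
  have hc : (r * q) ⌈/⌉ r = q :=
    ceilDiv_eq_of_bounds hr (by rw [mul_comm r]; exact Nat.mul_lt_mul_of_pos_right (by omega) hr)
      (by rw [mul_comm])
  have hd : r * q / r = q := Nat.mul_div_cancel_left q hr
  rw [hd]
  refine isPCM_of_columns_ne_zero ?_ ?_ hc hr (by omega) exists_localityRows_ne_zero
    (fun i => (hammingNorm_localityRow _ _ i).le) ⟨⟨0, hq⟩, hammingNorm_localityRow _ _ _⟩
  · simp only [Fintype.card_prod, Fintype.card_fin, hc]; ring
  · rw [hc]; ring

theorem hammingNorm_truncatedRows_le {l w : ℕ} (D : Finset (Fin l × Fin w)) (i : Fin l) :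
    hammingNorm (truncatedRows F l w D i) ≤ w := by
  refine le_trans ?_ (hammingNorm_localityRow (F := F) l w i).le
  refine Finset.card_le_card_of_injOn Subtype.val (fun j hj => ?_) Subtype.val_injective.injOn
  exact Finset.mem_filter.2 ⟨Finset.mem_univ _, (Finset.mem_filter.1 hj).2⟩

/-- Substitution keeps the nonzero entries. Hence no column becomes zero, which is all that distance
two needs, and the row that was full still has weight `r + 1`. -/
theorem isPCM_of_zeroSubstitution {k r : ℕ} (hr : 1 ≤ r) (hk : 1 ≤ k) (hdvd : ¬ r ∣ k)
    {D : Finset (Fin (k ⌈/⌉ r) × Fin (r + 1))} (hD : D.card = r - k % r)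
    (hfull : ∃ i, ∀ j, (i, j) ∉ D)
    {H : Matrix (Fin (k ⌈/⌉ r)) {j : Fin (k ⌈/⌉ r) × Fin (r + 1) // j ∉ D} F}
    (hH : ∀ i j, truncatedRows F (k ⌈/⌉ r) (r + 1) D i j ≠ 0 →
      H i j = truncatedRows F (k ⌈/⌉ r) (r + 1) D i j)
    (hrow : ∀ i, hammingNorm (H i) ≤ r + 1) :
    IsPCMOfOptimalLRC H (k + k ⌈/⌉ r) k r 2 := by
  have hmod : 0 < k % r := Nat.pos_of_ne_zero fun h => hdvd (Nat.dvd_of_mod_eq_zero h)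
  have hlt : k % r < r := Nat.mod_lt _ hr
  have hdm := Nat.div_add_mod k r
  have hc : k ⌈/⌉ r = k / r + 1 :=
    ceilDiv_eq_of_bounds hr (by rw [Nat.add_sub_cancel, mul_comm]; omega)
      (by rw [add_mul, mul_comm]; omega)
  refine isPCM_of_columns_ne_zero ?_ (add_comm _ _) rfl hr (by omega) ?_ hrow ?_
  · rw [Fintype.card_subtype_compl]
    simp only [Fintype.card_prod, Fintype.card_fin, Fintype.card_coe, hD]
    rw [hc]
    have : (k / r + 1) * (r + 1) = r * (k / r) + r + (k / r + 1) := by ring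
    omega
  · intro j
    have h1 : truncatedRows F (k ⌈/⌉ r) (r + 1) D j.1.1 j ≠ 0 := by
      simp [truncatedRows, localityRows]
    exact ⟨j.1.1, by rw [hH _ _ h1]; exact h1⟩
  · obtain ⟨i, hi⟩ := hfull
    refine ⟨i, le_antisymm (hrow i) ?_⟩
    have := Finset.card_le_card_of_injOn (s := (Finset.univ : Finset (Fin (r + 1))))
      (t := Finset.univ.filter fun j => H i j ≠ 0) (fun c => ⟨(i, c), hi c⟩) (fun c _ => by
        have h1 : truncatedRows F (k ⌈/⌉ r) (r + 1) D i ⟨(i, c), hi c⟩ ≠ 0 := by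
          simp [truncatedRows, localityRows]
        refine Finset.mem_filter.2 ⟨Finset.mem_univ _, ?_⟩
        rw [hH _ _ h1]; exact h1)
      (fun a _ b _ hab => by simpa using hab)
    rwa [Finset.card_univ, Fintype.card_fin] at this

theorem isPCM_truncatedRows {k r : ℕ} (hr : 1 ≤ r) (hk : 1 ≤ k) (hdvd : ¬ r ∣ k)
    {D : Finset (Fin (k ⌈/⌉ r) × Fin (r + 1))} (hD : D.card = r - k % r)
    (hfull : ∃ i, ∀ j, (i, j) ∉ D) :
    IsPCMOfOptimalLRC (truncatedRows F (k ⌈/⌉ r) (r + 1) D) (k + k ⌈/⌉ r) k r 2 :=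
  isPCM_of_zeroSubstitution hr hk hdvd hD hfull (fun _ _ _ => rfl) (hammingNorm_truncatedRows_le D)

end DistanceTwo

/-! ### Reindexing by `Fin n`, and existence for distance two -/

section Transport

variable {F ι : Type*} [Field F] [DecidableEq F] [Fintype ι]

theorem IsOptimalLRC.exists_fin {C : Submodule F (ι → F)} {n k r d : ℕ} (hr : 1 ≤ r) (hk : 1 ≤ k)
    (hd : 2 ≤ d) (h : IsOptimalLRC C n k r d) :
    ∃ C' : Submodule F (Fin n → F), IsOptimalLRC C' n k r d := by
  classical
  obtain ⟨⟨hn, hfin, R, hR, hRr, i₀, hi₀⟩, hmin, hE⟩ := h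
  let e : Fin n ≃ ι := (Fintype.equivFinOfCardEq hn).symm
  refine ⟨C.map (LinearEquiv.funCongrLeft F F e).toLinearMap, isOptimalLRC_of_le (by simp) hr hk hd
    ?_ ⟨fun i => (R (e i)).map e.symm.toEmbedding, fun i => ⟨?_, ?_⟩, fun i => ?_, e.symm i₀, ?_⟩ ?_ hE⟩
  · rw [← hfin]; exact (LinearEquiv.finrank_map_eq (LinearEquiv.funCongrLeft F F e) C).ge
  · have := (hR (e i)).1
    simpa [Finset.mem_map_equiv] using this
  · obtain ⟨-, μ, hμ, hC⟩ := hR (e i)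
    refine ⟨fun j => μ (e j), fun j hj => hμ _ (by simpa [Finset.mem_map_equiv] using hj), ?_⟩
    rintro _ ⟨c, hc, rfl⟩
    simpa [LinearMap.funLeft] using hC c hc
  · simpa using hRr (e i)
  · simpa using hi₀
  · rintro _ ⟨c, hc, rfl⟩ hc0
    have hc1 : c ≠ 0 := by rintro rfl; exact hc0 (map_zero _)
    refine (hmin.le_hammingNorm c hc hc1).trans_eq ?_
    refine Finset.card_equiv e.symm fun i => ?_
    rw [Finset.mem_filter, Finset.mem_filter]
    simp [LinearMap.funLeft]

theorem IsPCMOfOptimalLRC.exists_fin {ρ : Type*} {H : Matrix ρ ι F} {n k r d : ℕ}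
    (h : IsPCMOfOptimalLRC H n k r d) (hr : 1 ≤ r) (hk : r < k) (hd : 2 ≤ d) :
    ∃ C : Submodule F (Fin n → F), IsOptimalLRC C n k r d :=
  h.2.exists_fin hr (by omega) hd

theorem exists_isOptimalLRC_two {k r : ℕ} (hr : 1 ≤ r) (hk : r < k) :
    ∃ C : Submodule F (Fin (k + k ⌈/⌉ r) → F), IsOptimalLRC C (k + k ⌈/⌉ r) k r 2 := by
  classical
  by_cases hdvd : r ∣ k
  · exact (isPCM_localityRows (F := F) hr hk hdvd).exists_fin hr hk le_rfl
  · have h2 : 2 ≤ k ⌈/⌉ r := by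
      have := le_ceilDiv_mul (k := k) (r := r) hr
      by_contra! h
      have : k ⌈/⌉ r * r ≤ 1 * r := Nat.mul_le_mul_right r (by omega)
      omega
    -- All deleted columns are taken from block `0`; since `r < k` there is also a block `1`, which
    -- stays full.
    let f : Fin (r + 1) ↪ Fin (k ⌈/⌉ r) × Fin (r + 1) :=
      ⟨fun c => (⟨0, by omega⟩, c), fun a b h => by simpa using h⟩
    obtain ⟨D, hDs, hD⟩ := Finset.exists_subset_card_eq (s := Finset.univ.map f) (n := r - k % r)
      (by rw [Finset.card_map, Finset.card_univ, Fintype.card_fin]; omega)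
    refine (isPCM_truncatedRows (F := F) hr (by omega) hdvd hD ⟨⟨1, by omega⟩, fun j hj => ?_⟩).exists_fin
      hr hk le_rfl
    obtain ⟨a, -, ha⟩ := Finset.mem_map.1 (hDs hj)
    have := congrArg (fun x => x.1.val) ha
    simp [f] at this

end Transport

/-! ### Shortening and puncturing -/

section ShortenPuncture

variable {F : Type*} [Field F] [DecidableEq F]

/-- Shortening and puncturing a code whose dual words give enough locality. -/
theorem isOptimalLRC_shortenPuncture {ι : Type*} [Fintype ι] [DecidableEq ι]
    {C : Submodule F (ι → F)} {S P : Finset ι} {N n k r d : ℕ} (hSP : Disjoint S P)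
    (hcard : Fintype.card ι = N) (hn : n + S.card + P.card = N)
    (hdim : k + S.card ≤ Module.finrank F C)
    (hdist : ∀ c ∈ C, c ≠ 0 → d + P.card ≤ hammingNorm c) (hr : 1 ≤ r) (hk : 1 ≤ k) (hd : 2 ≤ d)
    (hE : d + k + k ⌈/⌉ r = n + 2)
    (hcov : ∀ j : {j // j ∉ S ∧ j ∉ P}, ∃ w : ι → F, (∀ c ∈ C, ∑ i, w i * c i = 0) ∧
      (∀ i ∈ P, w i = 0) ∧ w j ≠ 0 ∧
        hammingNorm (fun j : {j // j ∉ S ∧ j ∉ P} => w j) ≤ r + 1)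
    (hex : ∃ w : ι → F, (∀ c ∈ C, ∑ i, w i * c i = 0) ∧ (∀ i ∈ P, w i = 0) ∧
        hammingNorm (fun j : {j // j ∉ S ∧ j ∉ P} => w j) = r + 1) :
    IsOptimalLRC (shortenPuncture C S P) n k r d := by
  set CS : Submodule F (ι → F) :=
    C ⊓ ⨅ j ∈ S, LinearMap.ker (LinearMap.proj (R := F) (φ := fun _ : ι => F) j) with hCS
  have hmem : ∀ c, c ∈ CS ↔ c ∈ C ∧ ∀ j ∈ S, c j = 0 := by
    intro c; simp [hCS, Submodule.mem_iInf]
  have hsub : Fintype.card {j // j ∉ S ∧ j ∉ P} = n := by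
    have h1 : Fintype.card {j // j ∉ S ∧ j ∉ P} = Fintype.card {j // j ∉ S ∪ P} :=
      Fintype.card_congr (Equiv.subtypeEquivRight fun j => by simp)
    rw [h1, Fintype.card_subtype_compl, Fintype.card_coe, Finset.card_union_of_disjoint hSP]
    omega
  -- Puncturing costs at most `P.card` in weight. The same estimate later shows that it is
  -- injective.
  have hweight : ∀ c ∈ CS, hammingNorm c ≤
      hammingNorm (fun j : {j // j ∉ S ∧ j ∉ P} => c j) + P.card := by
    intro c hc
    have h1 : (Finset.univ.filter fun i => c i ≠ 0) ⊆
        ((Finset.univ.filter fun j : {j // j ∉ S ∧ j ∉ P} => c j ≠ 0).image Subtype.val) ∪ P := by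
      intro i hi
      by_cases hP : i ∈ P
      · exact Finset.mem_union_right _ hP
      · refine Finset.mem_union_left _ (Finset.mem_image.2 ⟨⟨i, fun hS => ?_, hP⟩, ?_, rfl⟩)
        · simp [((hmem c).1 hc).2 i hS] at hi
        · simpa using hi
    exact (Finset.card_le_card h1).trans
      ((Finset.card_union_le _ _).trans (Nat.add_le_add_right Finset.card_image_le _))
  -- Shortening imposes `S.card` linear conditions.
  have hdimS : k ≤ Module.finrank F CS := by
    let f : C →ₗ[F] (S → F) := (LinearMap.funLeft F F (Subtype.val : S → ι)).comp C.subtype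
    have h1 := LinearMap.finrank_range_add_finrank_ker f
    have h2 := Submodule.finrank_le (LinearMap.range f)
    rw [Module.finrank_pi, Fintype.card_coe] at h2
    have h3 : (LinearMap.ker f).map C.subtype ≤ CS := by
      rintro _ ⟨c, hc, rfl⟩
      refine (hmem _).2 ⟨c.2, fun j hj => congrFun (LinearMap.mem_ker.1 hc) ⟨j, hj⟩⟩
    have h4 := Submodule.finrank_mono h3
    rw [← (Submodule.equivMapOfInjective C.subtype C.injective_subtype _).finrank_eq] at h4
    omega
  -- A dual word that vanishes on `P` stays a dual word, because the shortened codewords vanish on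
  -- `S`.
  have hortho : ∀ w : ι → F, (∀ c ∈ C, ∑ i, w i * c i = 0) → (∀ i ∈ P, w i = 0) →
      ∀ c ∈ shortenPuncture C S P, ∑ i : {j // j ∉ S ∧ j ∉ P}, w i * c i = 0 := by
    rintro w hw hwP _ ⟨c, hc, rfl⟩
    have hc' := (hmem c).1 hc
    rw [← hw c hc'.1]
    simp only [LinearMap.funLeft_apply]
    rw [← Finset.sum_subtype (Finset.univ.filter fun j => j ∉ S ∧ j ∉ P) (by simp)
      (fun i => w i * c i)]
    refine Finset.sum_subset (Finset.subset_univ _) fun i _ hi => ?_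
    simp only [Finset.mem_filter, Finset.mem_univ, true_and, not_and_or, not_not] at hi
    rcases hi with hi | hi
    · rw [hc'.2 i hi, mul_zero]
    · rw [hwP i hi, zero_mul]
  refine isOptimalLRC_of_le hsub hr hk hd ?_ (hasLocality_of_words ?_ ?_) ?_ hE
  · have hinj : LinearMap.ker ((LinearMap.funLeft F F
        (Subtype.val : {j // j ∉ S ∧ j ∉ P} → ι)).domRestrict CS) = ⊥ := by
      rw [LinearMap.ker_eq_bot']
      intro c hc
      by_contra hne
      have h1 := hweight c c.2
      have h2 := hdist c ((hmem _).1 c.2).1 (fun h => hne (Subtype.ext h))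
      have h3 : (fun j : {j // j ∉ S ∧ j ∉ P} => (c : ι → F) j) = 0 := hc
      rw [h3] at h1
      simp at h1
      omega
    have h1 : Module.finrank F (shortenPuncture C S P) = Module.finrank F CS := by
      rw [← LinearMap.finrank_range_of_inj (LinearMap.ker_eq_bot.1 hinj)]
      rw [LinearMap.range_domRestrict]
      rfl
    omega
  · intro j
    obtain ⟨w, hw, hwP, hj, hwt⟩ := hcov j
    exact ⟨fun i => w i, hortho w hw hwP, hj, hwt⟩
  · obtain ⟨w, hw, hwP, hwt⟩ := hex
    exact ⟨fun i => w i, hortho w hw hwP, hwt⟩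
  · rintro _ ⟨c, hc, rfl⟩ hc0
    have h1 := hweight c hc
    have h2 := hdist c ((hmem c).1 hc).1 (by rintro rfl; exact hc0 (map_zero _))
    change d ≤ hammingNorm (fun j : {j // j ∉ S ∧ j ∉ P} => c j)
    omega

/-- The code of entry `j` of the combination of the rows of `L` with coefficients `u`. -/
def combCode (u : List ℕ) (L : List (List ℕ)) (j : ℕ) : ℕ :=
  (List.range L.length).foldr (fun i acc => mulCode (u.getD i 0) (entry L i j) ^^^ acc) 0

/-- The table of the combinations of the rows of `L` with coefficients from `U`. -/
def combTable (U L : List (List ℕ)) (N : ℕ) : List (List ℕ) :=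
  U.map fun u => (List.range N).map (combCode u L)

omit [DecidableEq F] in
theorem IsQuatGen.quat_combCode {ω : F} (hω : IsQuatGen ω) {u : List ℕ} {L : List (List ℕ)}
    (hu : ∀ i, u.getD i 0 < 4) (hL : ∀ i j, entry L i j < 4) (j : ℕ) :
    quat ω (combCode u L j) =
      ((List.range L.length).map fun i => quat ω (u.getD i 0) * quat ω (entry L i j)).sum := by
  unfold combCode
  suffices h : ∀ l : List ℕ, l.foldr (fun i acc => mulCode (u.getD i 0) (entry L i j) ^^^ acc) 0 < 4 ∧
      quat ω (l.foldr (fun i acc => mulCode (u.getD i 0) (entry L i j) ^^^ acc) 0) =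
        (l.map fun i => quat ω (u.getD i 0) * quat ω (entry L i j)).sum from (h _).2
  intro l
  induction l with
  | nil => simp [quat]
  | cons i l ih =>
    simp only [List.foldr_cons, List.map_cons, List.sum_cons]
    refine ⟨Nat.xor_lt_two_pow (n := 2) mulCode_lt ih.1, ?_⟩
    rw [hω.quat_xor mulCode_lt ih.1, ih.2, hω.quat_mul (hu i) (hL i j)]

theorem entry_combTable {U L : List (List ℕ)} {N i j : ℕ} (hi : i < U.length) (hj : j < N) :
    entry (combTable U L N) i j = combCode U[i] L j := by
  unfold entry combTable
  have h1 : (U.map fun u => (List.range N).map (combCode u L)).getD i [] =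
      (List.range N).map (combCode U[i] L) := by
    rw [List.getD_eq_getElem (hn := by simpa using hi), List.getElem_map]
  rw [h1, List.getD_eq_getElem (hn := by simpa using hj), List.getElem_map, List.getElem_range]

theorem IsQuatGen.isOptimalLRC_shortenPuncture_of_check {ω : F} (hω : IsQuatGen ω)
    {L U : List (List ℕ)} {m N n k r d s p : ℕ} {H : Matrix (Fin m) (Fin N) F}
    (hH : (List.ofFn fun i => List.ofFn (H i)) = L.map (List.map (quat ω)))
    (hL : (L.all fun row => row.all fun a => Nat.blt a 4) = true)
    (hU : (U.all fun row => row.all fun a => Nat.blt a 4) = true)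
    (hloc : locCheck (combTable U L N) (List.range' (s + p) n) r = true)
    (hP : ((List.range U.length).all fun i => (List.range' s p).all fun j =>
      Nat.beq (entry (combTable U L N) i j) 0) = true)
    (hn : n + s + p = N)
    (hdim : k + s ≤ Module.finrank F (LinearMap.ker H.mulVecLin))
    (hdist : ∀ c ∈ LinearMap.ker H.mulVecLin, c ≠ 0 → d + p ≤ hammingNorm c)
    (hr : 1 ≤ r) (hk : 1 ≤ k) (hd : 2 ≤ d) (hE : d + k + k ⌈/⌉ r = n + 2) :
    ∃ S P : Finset (Fin N), Disjoint S P ∧ S.card = s ∧ P.card = p ∧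
      IsOptimalLRC (shortenPuncture (LinearMap.ker H.mulVecLin) S P) n k r d := by
  -- Shortening takes the first `s` coordinates and puncturing the next `p`, so locality is checked
  -- on `List.range' (s + p) n`.
  let S : Finset (Fin N) := Finset.univ.filter fun j => j.val < s
  let P : Finset (Fin N) := Finset.univ.filter fun j => s ≤ j.val ∧ j.val < s + p
  have hS : S.card = s := by
    have : S.card = (Finset.range s).card := by
      refine Finset.card_bij (fun j _ => j.val) (by simp [S]) (fun a _ b _ h => Fin.ext h) ?_
      intro b hb
      rw [Finset.mem_range] at hb
      exact ⟨⟨b, by omega⟩, by simpa [S] using hb, rfl⟩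
    simpa using this
  have hPc : P.card = p := by
    have : P.card = (Finset.Ico s (s + p)).card := by
      refine Finset.card_bij (fun j _ => j.val) (by simp [P]) (fun a _ b _ h => Fin.ext h) ?_
      intro b hb
      rw [Finset.mem_Ico] at hb
      exact ⟨⟨b, by omega⟩, by simpa [P] using hb, rfl⟩
    simpa using this
  have hdisj : Disjoint S P := by
    rw [Finset.disjoint_left]
    intro j h1 h2
    simp only [S, P, Finset.mem_filter] at h1 h2
    omega
  refine ⟨S, P, hdisj, hS, hPc, ?_⟩
  obtain ⟨hm, hHe⟩ := entries_of_ofFn hH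
  set W := combTable U L N with hW
  have hWl : W.length = U.length := by simp [hW, combTable]
  let M : Matrix (Fin U.length) {j // j ∉ S ∧ j ∉ P} F := fun i j => quat ω (entry W i j.1.val)
  have hgt : ∀ j : {j // j ∉ S ∧ j ∉ P}, s + p ≤ j.1.val := by
    rintro ⟨j, h1, h2⟩
    simp only [S, P, Finset.mem_filter, Finset.mem_univ, true_and] at h1 h2 ⊢
    omega
  obtain ⟨hcov, hex⟩ := hω.locality_of_locCheck (e := fun j : {j // j ∉ S ∧ j ∉ P} => j.1.val)
    (fun a b h => Subtype.ext (Fin.ext h)) List.nodup_range' (fun a => by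
      rw [List.mem_range'_1]
      constructor
      · rintro ⟨h1, h2⟩
        refine ⟨⟨⟨a, by omega⟩, ?_, ?_⟩, rfl⟩
        · simp only [S, Finset.mem_filter, Finset.mem_univ, true_and]; omega
        · simp only [P, Finset.mem_filter, Finset.mem_univ, true_and]; omega
      · rintro ⟨j, rfl⟩
        have := hgt j; have := j.1.2; omega) hWl (H := M) (fun i j => rfl) hloc
  have hort : ∀ i : Fin U.length, ∀ c ∈ LinearMap.ker H.mulVecLin,
      ∑ j : Fin N, quat ω (entry W i j) * c j = 0 := by
    intro i c hc
    have h1 : ∀ j : Fin N, quat ω (entry W i j) =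
        ∑ a : Fin m, quat ω (U[(i : ℕ)].getD a 0) * H a j := by
      intro j
      rw [hW, entry_combTable i.2 j.2, hω.quat_combCode (fun a => ?_) (entry_lt hL), hm]
      · simp only [hHe]
        rw [Fin.sum_univ_eq_sum_range (fun a => quat ω (U[(i : ℕ)].getD a 0) * quat ω (entry L a j)) m]
        simp [Finset.sum, Finset.range, Multiset.range]
      · have := entry_lt hU i a
        rwa [entry, List.getD_eq_getElem _ _ i.2] at this
    simp only [h1, Finset.sum_mul]
    rw [Finset.sum_comm]
    refine Finset.sum_eq_zero fun a _ => ?_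
    simp only [mul_assoc]
    rw [← Finset.mul_sum]
    have : ∑ j, H a j * c j = 0 := congrFun (LinearMap.mem_ker.1 hc) a
    rw [this, mul_zero]
  have hwP : ∀ i : Fin U.length, ∀ j ∈ P, quat ω (entry W i (j : Fin N)) = 0 := by
    intro i j hj
    rw [hω.quat_eq_zero]
    simp only [List.all_eq_true, List.mem_range, List.mem_range'_1, nat_beq_iff] at hP
    simp only [P, Finset.mem_filter, Finset.mem_univ, true_and] at hj
    exact hP i i.2 j hj
  refine isOptimalLRC_shortenPuncture (N := N) hdisj (by simp) (by omega) (by omega)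
    (by rw [hPc]; exact hdist) hr hk hd hE ?_ ?_
  · intro j
    obtain ⟨i, hi, hw⟩ := hcov j
    exact ⟨fun j => quat ω (entry W i j), hort i, hwP i, hi, hw⟩
  · obtain ⟨i, hi⟩ := hex
    exact ⟨fun j => quat ω (entry W i j), hort i, hwP i, hi⟩

set_option maxRecDepth 10000 in
/-- Optimal codes obtained from the near-MDS code. -/
theorem IsQuatGen.shortenPuncture_nearMDS12 {ω : F} (hω : IsQuatGen ω) {k d : ℕ} (hk : 3 ≤ k)
    (hk6 : k ≤ 6) (hd : 5 ≤ d) (hd6 : d ≤ 6) :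
    ∃ S P : Finset (Fin 12), Disjoint S P ∧ S.card = 6 - k ∧ P.card = 6 - d ∧
      IsOptimalLRC (shortenPuncture (LinearMap.ker (nearMDS12 ω).mulVecLin) S P)
        (k + d) k (k - 1) d := by
  have hC := hω.isPCM_nearMDS12.2
  have key := fun U : List (List ℕ) =>
    hω.isOptimalLRC_shortenPuncture_of_check (L := tabNearMDS12) (U := U) (H := nearMDS12 ω)
      (n := k + d) (k := k) (r := k - 1) (d := d) (s := 6 - k) (p := 6 - d) rfl (by decide +kernel)
  have hdim : k + (6 - k) ≤ Module.finrank F (LinearMap.ker (nearMDS12 ω).mulVecLin) := by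
    rw [hC.1.2.1]; omega
  have hdist : ∀ c ∈ LinearMap.ker (nearMDS12 ω).mulVecLin, c ≠ 0 → d + (6 - d) ≤ hammingNorm c := by
    intro c hc h0
    have := hC.2.1.le_hammingNorm c hc h0
    omega
  have hE : d + k + k ⌈/⌉ (k - 1) = k + d + 2 := by
    rw [ceilDiv_eq_of_bounds (l := 2) (by omega) (by omega) (by omega)]; omega
  have aux : ∀ U : List (List ℕ), (U.all fun row => row.all fun a => Nat.blt a 4) = true →
      locCheck (combTable U tabNearMDS12 12) (List.range' (6 - k + (6 - d)) (k + d)) (k - 1) = true →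
      ((List.range U.length).all fun i => (List.range' (6 - k) (6 - d)).all fun j =>
        Nat.beq (entry (combTable U tabNearMDS12 12) i j) 0) = true → _ :=
    fun U h1 h2 h3 => key U h1 h2 h3 (by omega) hdim hdist (by omega) (by omega) (by omega) hE
  clear key
  interval_cases k <;> interval_cases d
  -- Each list holds coefficient vectors for combinations of the rows. The resulting dual words
  -- vanish on the punctured positions, and those of weight at most `k = r + 1` on the remaining
  -- positions cover these.
  · exact aux [[1, 0, 0, 1, 2, 0], [1, 0, 3, 3, 2, 0], [1, 3, 3, 0, 2, 2]] (by decide +kernel)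
      (by decide +kernel) (by decide +kernel)
  · exact aux [[1, 0, 3, 1, 2, 1], [1, 0, 3, 1, 3, 0], [1, 1, 3, 1, 2, 2]] (by decide +kernel)
      (by decide +kernel) (by decide +kernel)
  · exact aux [[1, 0, 0, 2, 2, 0], [1, 0, 2, 2, 0, 0], [1, 2, 2, 2, 2, 1]] (by decide +kernel)
      (by decide +kernel) (by decide +kernel)
  · exact aux [[1, 0, 0, 0, 0, 0], [1, 0, 0, 1, 2, 0], [1, 2, 0, 2, 2, 0]] (by decide +kernel)
      (by decide +kernel) (by decide +kernel)
  · exact aux [[1, 0, 1, 0, 1, 3], [1, 0, 1, 0, 2, 0], [1, 2, 1, 2, 2, 3]] (by decide +kernel)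
      (by decide +kernel) (by decide +kernel)
  · exact aux [[1, 0, 0, 0, 0, 0], [1, 0, 0, 1, 2, 0], [1, 2, 0, 2, 2, 0]] (by decide +kernel)
      (by decide +kernel) (by decide +kernel)
  · exact aux [[0, 0, 0, 0, 1, 0], [0, 0, 0, 0, 1, 1], [0, 1, 1, 3, 3, 2]] (by decide +kernel)
      (by decide +kernel) (by decide +kernel)
  · exact aux [[1, 0, 0, 0, 0, 0], [0, 1, 0, 0, 0, 0]] (by decide +kernel)
      (by decide +kernel) (by decide +kernel)

end ShortenPuncture

/-! ### Caps and arcs over four elements -/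

section Arcs

variable {F V ι : Type*} [Field F] [DecidableEq F] [AddCommGroup V] [Module F V] [Fintype ι]

theorem RelDist.eq_zero {h : ι → V} {d : ℕ} (H : RelDist F h d) {s : Finset ι} (hs : s.card < d)
    {x : ι → F} (hx : ∑ i ∈ s, x i • h i = 0) : ∀ i ∈ s, x i = 0 :=
  linearIndepOn_finset_iff.1 (H.linearIndepOn hs) x hx

theorem relDist_iff {h : ι → V} {d : ℕ} :
    RelDist F h d ↔ ∀ s : Finset ι, s.card < d → LinearIndepOn F h (s : Set ι) := by
  classical
  refine ⟨fun H s hs => H.linearIndepOn hs, fun H x hx hx0 => ?_⟩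
  by_contra! hlt
  apply hx0
  funext i
  by_contra hi
  refine hi (linearIndepOn_finset_iff.1 (H _ hlt) x ?_ i (Finset.mem_filter.2 ⟨Finset.mem_univ _, hi⟩))
  rw [← hx]
  refine Finset.sum_subset (Finset.subset_univ _) fun j _ hj => ?_
  have : x j = 0 := by simpa using hj
  rw [this, zero_smul]

theorem RelDist.of_comp {W : Type*} [AddCommGroup W] [Module F W] {h : ι → V} {d : ℕ}
    (f : V →ₗ[F] W) (H : RelDist F (f ∘ h) d) : RelDist F h d := by
  rw [relDist_iff] at H ⊢
  exact fun s hs => (LinearIndependent.of_comp f (H s hs) :)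

theorem RelDist.comp {κ : Type*} [Fintype κ] {h : ι → V} {d : ℕ} (H : RelDist F h d) {e : κ → ι}
    (he : Function.Injective e) : RelDist F (h ∘ e) d := by
  classical
  rw [relDist_iff] at H ⊢
  intro s hs
  refine LinearIndepOn.comp_of_image ?_ he.injOn
  rw [← Finset.coe_image]
  exact H _ (by rwa [Finset.card_image_of_injective _ he])

theorem RelDist.restrict {h : ι → V} {d : ℕ} (H : RelDist F h d) (s : Finset ι)
    (W : Submodule F V) (hW : ∀ i ∈ s, h i ∈ W) :
    RelDist F (fun i : s => (⟨h i, hW i i.2⟩ : W)) d :=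
  RelDist.of_comp W.subtype (H.comp (e := ((↑) : s → ι)) Subtype.val_injective)

theorem RelDist.ne_zero {h : ι → V} (H : RelDist F h 2) (i : ι) : h i ≠ 0 := by
  intro h0
  have := H.eq_zero (s := {i}) (x := fun _ => 1) (by simp) (by simp [h0]) i (by simp)
  exact one_ne_zero this

theorem RelDist.eq_zero_of_smul_eq {h : ι → V} (H : RelDist F h 3) {i j : ι} (hij : i ≠ j)
    {a b : F} (e : a • h i = b • h j) : a = 0 := by
  classical
  have := H.eq_zero (s := {i, j}) (x := fun k => if k = i then a else -b)
    (by rw [Finset.card_pair hij]; omega)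
    (by rw [Finset.sum_pair hij]; simp [hij.symm, e]) i (by simp)
  simpa using this

/-- Projection from a point: a relation between the images lifts to one that involves at most the
additional vector `h p`. -/
theorem RelDist.quotient [DecidableEq ι] {h : ι → V} {d : ℕ} (H : RelDist F h (d + 1)) (p : ι) :
    RelDist F (fun i : {i // i ≠ p} => (Submodule.span F {h p}).mkQ (h i)) d := by
  rw [relDist_iff]
  intro s hs
  rw [linearIndepOn_finset_iff]
  intro x hx i hi
  have h1 : ∑ j ∈ s, x j • h j ∈ Submodule.span F {h p} := by
    rw [← Submodule.ker_mkQ (Submodule.span F {h p}), LinearMap.mem_ker, map_sum]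
    simpa using hx
  obtain ⟨c, hc⟩ := Submodule.mem_span_singleton.1 h1
  let y : ι → F := fun j => if hj : j ≠ p then x ⟨j, hj⟩ else -c
  have hp : p ∉ s.map (Function.Embedding.subtype _) := by simp
  have := H.eq_zero (s := insert p (s.map (Function.Embedding.subtype _))) (x := y)
    (by rw [Finset.card_insert_of_notMem hp, Finset.card_map]; omega) (by
      rw [Finset.sum_insert hp, Finset.sum_map]
      have : ∀ j ∈ s, y (Function.Embedding.subtype _ j) • h (Function.Embedding.subtype _ j) =
          x j • h j := by
        intro j _
        have : y j = x j := by simp [y, j.2]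
        simp [this]
      rw [Finset.sum_congr rfl this, ← hc]
      simp [y]) i.1 (by simp [hi, i.2])
  simpa [y, i.2] using this

variable [FiniteDimensional F V]

theorem RelDist.finrank_quotient {h : ι → V} (H : RelDist F h 2) (p : ι) :
    Module.finrank F (V ⧸ Submodule.span F {h p}) + 1 = Module.finrank F V := by
  rw [← Submodule.finrank_quotient_add_finrank (Submodule.span F {h p}),
    finrank_span_singleton (H.ne_zero p)]

omit [DecidableEq F] in
theorem natCard_eq_four_pow (hF : Nat.card F = 4) (W : Type*) [AddCommGroup W] [Module F W]
    [FiniteDimensional F W] : Nat.card W = 4 ^ Module.finrank F W := by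
  rw [Module.natCard_eq_pow_finrank (K := F), hF]

omit [DecidableEq F] in
theorem finite_of_finiteDimensional (hF : Nat.card F = 4) (W : Type*) [AddCommGroup W] [Module F W]
    [FiniteDimensional F W] : Finite W := by
  refine Nat.finite_of_card_ne_zero ?_
  rw [natCard_eq_four_pow hF]
  positivity

omit [DecidableEq F] in
theorem natCard_units (hF : Nat.card F = 4) : Nat.card Fˣ = 3 := by
  have : Finite F := Nat.finite_of_card_ne_zero (by omega)
  rw [Nat.card_units, hF]

/-- Pairwise independent vectors, counted with their multiples. -/
theorem RelDist.three_mul_card_lt (hF : Nat.card F = 4) {h : ι → V} (H : RelDist F h 3) :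
    3 * Fintype.card ι < 4 ^ Module.finrank F V := by
  have hfin := finite_of_finiteDimensional hF V
  have : Finite F := Nat.finite_of_card_ne_zero (by omega)
  let f : Option (ι × Fˣ) → V := fun o => o.elim 0 fun q => (q.2 : F) • h q.1
  have hne : ∀ q : ι × Fˣ, (q.2 : F) • h q.1 ≠ 0 := fun q =>
    smul_ne_zero q.2.ne_zero ((H.mono (by omega)).ne_zero q.1)
  have hf : Function.Injective f := by
    rintro (_ | ⟨i, c⟩) (_ | ⟨j, e⟩) hab
    · rfl
    · exact absurd hab.symm (hne (j, e))
    · exact absurd hab (hne (i, c))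
    · by_cases hij : i = j
      · subst hij
        have h1 : ((c : F) - e) • h i = 0 := by rw [sub_smul, sub_eq_zero]; exact hab
        rcases smul_eq_zero.1 h1 with h2 | h2
        · rw [Units.ext (sub_eq_zero.1 h2)]
        · exact absurd h2 ((H.mono (by omega)).ne_zero i)
      · exact absurd (H.eq_zero_of_smul_eq hij hab) c.ne_zero
  have := Nat.card_le_card_of_injective f hf
  rw [natCard_eq_four_pow hF V, Finite.card_option, Nat.card_prod, natCard_units hF,
    Nat.card_eq_fintype_card] at this
  omega

/-- Pairwise independent vectors off a hyperplane. -/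
theorem RelDist.card_le_of_forall_ne_zero (hF : Nat.card F = 4) {h : ι → V} (H : RelDist F h 3)
    {f : Module.Dual F V} (hf : ∀ i, f (h i) ≠ 0) {m : ℕ} (hV : Module.finrank F V ≤ m + 1) :
    Fintype.card ι ≤ 4 ^ m := by
  rcases isEmpty_or_nonempty ι with he | ⟨⟨i₀⟩⟩
  · simp
  have hfin := finite_of_finiteDimensional hF V
  have hker : Module.finrank F (LinearMap.ker f) ≤ m := by
    have h1 := LinearMap.finrank_range_add_finrank_ker f
    have h2 : 0 < Module.finrank F (LinearMap.range f) := by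
      rw [Module.finrank_pos_iff_exists_ne_zero]
      exact ⟨⟨f (h i₀), LinearMap.mem_range_self _ _⟩, fun h0 => hf i₀ (congrArg Subtype.val h0)⟩
    omega
  -- Scaled to `f = 1`, the vectors are distinct points of an affine space parallel to the kernel.
  let g : ι → LinearMap.ker f := fun i =>
    ⟨(f (h i))⁻¹ • h i - (f (h i₀))⁻¹ • h i₀, by simp [LinearMap.mem_ker, hf]⟩
  have hg : Function.Injective g := by
    intro i j hij
    by_contra hne
    have h1 : (f (h i))⁻¹ • h i = (f (h j))⁻¹ • h j := by
      simpa [g, Subtype.ext_iff] using hij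
    exact inv_ne_zero (hf i) (H.eq_zero_of_smul_eq hne h1)
  have := Nat.card_le_card_of_injective g hg
  rw [natCard_eq_four_pow hF (LinearMap.ker f), Nat.card_eq_fintype_card] at this
  exact this.trans (Nat.pow_le_pow_right (by omega) hker)

/-- In dimension two there are fifteen nonzero vectors, and each of the given ones has three nonzero
multiples. -/
theorem RelDist.card_le_five (hF : Nat.card F = 4) {h : ι → V} (H : RelDist F h 3)
    (hV : Module.finrank F V ≤ 2) : Fintype.card ι ≤ 5 := by
  have h1 := H.three_mul_card_lt hF
  have h2 : 4 ^ Module.finrank F V ≤ 4 ^ 2 := Nat.pow_le_pow_right (by omega) hV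
  omega

/-- Projection from one of the points leaves pairwise independent vectors in dimension at most two.
-/
theorem RelDist.card_le_six (hF : Nat.card F = 4) {h : ι → V} (H : RelDist F h 4)
    (hV : Module.finrank F V ≤ 3) : Fintype.card ι ≤ 6 := by
  classical
  rcases isEmpty_or_nonempty ι with he | ⟨⟨p⟩⟩
  · simp
  have h1 := (H.quotient p).card_le_five hF (by
    have := (H.mono (e := 2) (by omega)).finrank_quotient p
    omega)
  rw [Fintype.card_subtype_compl, Fintype.card_subtype_eq] at h1
  omega

/-- Arcs in dimension at least four. -/
theorem RelDist.card_le_add_one (hF : Nat.card F = 4) {h : ι → V} {m : ℕ} (hm : 4 ≤ m)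
    (H : RelDist F h (m + 1)) (hV : Module.finrank F V ≤ m) : Fintype.card ι ≤ m + 1 := by
  classical
  by_contra! hlt
  have : Finite F := Nat.finite_of_card_ne_zero (by omega)
  have := Fintype.ofFinite F
  obtain ⟨s, -, hs⟩ := Finset.exists_subset_card_eq (s := (Finset.univ : Finset ι)) (n := m + 2) (by
    rw [Finset.card_univ]; omega)
  -- The `m + 1` points other than `p` are dependent in dimension at most `m`, while any `m` points
  -- are independent; so their relation has no zero coefficient.
  have key : ∀ p ∈ s, ∃ x : ι → F, ∑ i ∈ s.erase p, x i • h i = 0 ∧ ∀ i ∈ s.erase p, x i ≠ 0 := by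
    intro p hp
    have hc : (s.erase p).card = m + 1 := by rw [Finset.card_erase_of_mem hp]; omega
    have hdep : ¬ LinearIndepOn F h (s.erase p : Set ι) := by
      intro hli
      have := hli.card_le_finrank_of_mem ⊤ (by simp)
      rw [finrank_top] at this
      omega
    rw [linearIndepOn_finset_iff] at hdep
    push Not at hdep
    obtain ⟨x, hx, i, hi, hxi⟩ := hdep
    refine ⟨x, hx, fun j hj hxj => hxi ?_⟩
    have hij : i ≠ j := by rintro rfl; exact hxi hxj
    refine H.eq_zero (s := (s.erase p).erase j) (by rw [Finset.card_erase_of_mem hj]; omega) ?_ i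
      (Finset.mem_erase.2 ⟨hij, hi⟩)
    rw [← Finset.add_sum_erase _ _ hj, hxj, zero_smul, zero_add] at hx
    exact hx
  obtain ⟨p, hp, q, hq, hpq⟩ := Finset.one_lt_card.1 (show 1 < s.card by omega)
  obtain ⟨x, hx, hx0⟩ := key p hp
  obtain ⟨y, hy, hy0⟩ := key q hq
  have hR : (((s.erase p).erase q)).card = m := by
    rw [Finset.card_erase_of_mem (Finset.mem_erase.2 ⟨hpq.symm, hq⟩), Finset.card_erase_of_mem hp]
    omega
  have hcardF : (Finset.univ.erase (0 : F)).card = 3 := by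
    rw [Finset.card_erase_of_mem (Finset.mem_univ _), Finset.card_univ, ← Nat.card_eq_fintype_card,
      hF]
  -- The relations omitting `p` and `q` share `m ≥ 4` points, but the ratios of their coefficients
  -- take only three values. Subtracting a suitable multiple cancels two points at once and leaves a
  -- relation between at most `m` points whose coefficient at `q` is not zero.
  obtain ⟨i, hi, j, hj, hij, he⟩ := Finset.exists_ne_map_eq_of_card_lt_of_maps_to
    (s := (s.erase p).erase q) (t := Finset.univ.erase (0 : F)) (by omega)
    (f := fun i => x i * (y i)⁻¹) (by
      intro i hi
      have hi' := Finset.mem_erase.1 hi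
      have hi'' := Finset.mem_erase.1 hi'.2
      have h1 := hx0 i hi'.2
      have h2 := hy0 i (Finset.mem_erase.2 ⟨hi'.1, hi''.2⟩)
      simp [h1, h2])
  simp only [Finset.mem_erase] at hi hj
  have hyi := hy0 i (Finset.mem_erase.2 ⟨hi.1, hi.2.2⟩)
  have hyj := hy0 j (Finset.mem_erase.2 ⟨hj.1, hj.2.2⟩)
  set c := x i * (y i)⁻¹ with hc
  let x' : ι → F := fun k => if k = p then 0 else x k
  let y' : ι → F := fun k => if k = q then 0 else y k
  have hx' : ∑ k ∈ s, x' k • h k = 0 := by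
    rw [← Finset.add_sum_erase _ _ hp, ← hx]
    simp only [x', if_true, zero_smul, zero_add]
    exact Finset.sum_congr rfl fun k hk => by rw [if_neg (Finset.ne_of_mem_erase hk)]
  have hy' : ∑ k ∈ s, y' k • h k = 0 := by
    rw [← Finset.add_sum_erase _ _ hq, ← hy]
    simp only [y', if_true, zero_smul, zero_add]
    exact Finset.sum_congr rfl fun k hk => by rw [if_neg (Finset.ne_of_mem_erase hk)]
  have hz : ∑ k ∈ s, (x' k - c * y' k) • h k = 0 := by
    simp only [sub_smul, mul_smul, Finset.sum_sub_distrib, hx', ← Finset.smul_sum, hy', smul_zero,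
      sub_zero]
  have hzi : x' i - c * y' i = 0 := by
    simp only [x', y', if_neg hi.2.1, if_neg hi.1, hc]
    field_simp; ring
  have hzj : x' j - c * y' j = 0 := by
    simp only [x', y', if_neg hj.2.1, if_neg hj.1]
    rw [he]; field_simp; ring
  rw [← Finset.add_sum_erase _ _ hi.2.2, hzi, zero_smul, zero_add,
    ← Finset.add_sum_erase _ _ (Finset.mem_erase.2 ⟨hij.symm, hj.2.2⟩), hzj, zero_smul,
    zero_add] at hz
  have := H.eq_zero (s := (s.erase i).erase j) (by
    rw [Finset.card_erase_of_mem (Finset.mem_erase.2 ⟨hij.symm, hj.2.2⟩),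
      Finset.card_erase_of_mem hi.2.2]; omega) hz q
    (Finset.mem_erase.2 ⟨hj.1.symm, Finset.mem_erase.2 ⟨hi.1.symm, hq⟩⟩)
  simp only [x', y', if_neg hpq.symm, if_true, mul_zero, sub_zero] at this
  exact hx0 q (Finset.mem_erase.2 ⟨hpq.symm, hq⟩) this

end Arcs

/-! ### Optimal configurations, and distance three with at least three groups -/

section OptConfig

variable {F V ι : Type*} [Field F] [DecidableEq F] [AddCommGroup V] [Module F V] [Fintype ι]

/-- The system of vectors given by the columns of a parity-check matrix of an optimal locally
repairable code of dimension `m * r + t` and length `m * (r + 1) + t + d - 1`. -/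
structure IsOptConfig (F : Type*) {V ι : Type*} [Field F] [DecidableEq F] [AddCommGroup V]
    [Module F V] [Fintype ι] (h : ι → V) (m r t d : ℕ) : Prop where
  finrank : Module.finrank F V + 1 = m + d
  card : Fintype.card ι + 1 = m * (r + 1) + t + d
  dist : RelDist F h d
  loc : IsLocal F h r

theorem IsLocalFamily.card_le [DecidableEq ι] {h : ι → V} {r : ℕ} {L : Finset (Module.Dual F V)}
    (hL : IsLocalFamily h r L) : Fintype.card ι ≤ (zeros h L).card + L.card * (r + 1) := by
  have h1 : (Finset.univ : Finset ι) ⊆ zeros h L ∪ L.biUnion (nonzeros h) := by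
    intro i _
    by_cases hi : ∀ u ∈ L, u (h i) = 0
    · exact Finset.mem_union_left _ (mem_zeros.2 hi)
    · push Not at hi
      obtain ⟨u, hu, hi⟩ := hi
      exact Finset.mem_union_right _ (Finset.mem_biUnion.2 ⟨u, hu, mem_nonzeros.2 hi⟩)
  have h2 := Finset.card_le_card h1
  have h3 := Finset.card_union_le (zeros h L) (L.biUnion (nonzeros h))
  have h4 := Finset.card_biUnion_le_card_mul L (nonzeros h) (r + 1) hL.2
  rw [Finset.card_univ] at h2
  omega

/-- The points on which `u` is the only functional of `L` that does not vanish. -/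
def exclusive [DecidableEq (Module.Dual F V)] (h : ι → V) (L : Finset (Module.Dual F V))
    (u : Module.Dual F V) : Finset ι :=
  (zeros h (L.erase u)).filter fun i => u (h i) ≠ 0

variable [DecidableEq (Module.Dual F V)]

theorem mem_exclusive {h : ι → V} {L : Finset (Module.Dual F V)} {u : Module.Dual F V} {i : ι} :
    i ∈ exclusive h L u ↔ u (h i) ≠ 0 ∧ ∀ v ∈ L, v ≠ u → v (h i) = 0 := by
  simp only [exclusive, Finset.mem_filter, mem_zeros, Finset.mem_erase]
  constructor
  · rintro ⟨h1, h2⟩; exact ⟨h2, fun v hv hne => h1 v ⟨hne, hv⟩⟩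
  · rintro ⟨h1, h2⟩; exact ⟨fun v hv => h2 v hv.2 hv.1, h1⟩

theorem exclusive_subset_nonzeros (h : ι → V) (L : Finset (Module.Dual F V))
    (u : Module.Dual F V) : exclusive h L u ⊆ nonzeros h u :=
  fun _ hi => mem_nonzeros.2 (mem_exclusive.1 hi).1

/-- The number of functionals of `L` that do not vanish at a point. -/
def coverCount (h : ι → V) (L : Finset (Module.Dual F V)) (i : ι) : ℕ :=
  (L.filter fun u => u (h i) ≠ 0).card

omit [DecidableEq (Module.Dual F V)] in
theorem sum_card_nonzeros (h : ι → V) (L : Finset (Module.Dual F V)) :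
    ∑ u ∈ L, (nonzeros h u).card = ∑ i, coverCount h L i := by
  simp only [coverCount, nonzeros, Finset.card_filter]
  exact Finset.sum_comm

theorem sum_card_exclusive (h : ι → V) (L : Finset (Module.Dual F V)) :
    ∑ u ∈ L, (exclusive h L u).card =
      (Finset.univ.filter fun i => coverCount h L i = 1).card := by
  classical
  rw [← Finset.card_biUnion]
  · congr 1
    ext i
    simp only [Finset.mem_biUnion, mem_exclusive, Finset.mem_filter, Finset.mem_univ, true_and,
      coverCount, Finset.card_eq_one]
    constructor
    · rintro ⟨u, hu, h1, h2⟩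
      refine ⟨u, ?_⟩
      ext v
      simp only [Finset.mem_filter, Finset.mem_singleton]
      constructor
      · rintro ⟨hv, hv'⟩
        by_contra hne
        exact hv' (h2 v hv hne)
      · rintro rfl
        exact ⟨hu, h1⟩
    · rintro ⟨u, hu⟩
      have hu' : u ∈ L.filter fun u => u (h i) ≠ 0 := by rw [hu]; simp
      simp only [Finset.mem_filter] at hu'
      refine ⟨u, hu'.1, hu'.2, fun v hv hne => ?_⟩
      by_contra hvi
      have : v ∈ L.filter fun u => u (h i) ≠ 0 := Finset.mem_filter.2 ⟨hv, hvi⟩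
      rw [hu] at this
      exact hne (Finset.mem_singleton.1 this)
  · intro u hu v hv hne
    rw [Function.onFun, Finset.disjoint_left]
    intro i hi hi'
    exact (mem_exclusive.1 hi').1 ((mem_exclusive.1 hi).2 v hv hne.symm)

omit [DecidableEq (Module.Dual F V)] in
theorem coverCount_eq_zero {h : ι → V} {L : Finset (Module.Dual F V)} {i : ι} :
    coverCount h L i = 0 ↔ i ∈ zeros h L := by
  simp [coverCount, Finset.filter_eq_empty_iff]

/-- Double counting of incidences. -/
theorem two_mul_card_le (h : ι → V) (L : Finset (Module.Dual F V)) :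
    2 * Fintype.card ι ≤ 2 * (zeros h L).card + ∑ u ∈ L, (nonzeros h u).card +
      ∑ u ∈ L, (exclusive h L u).card := by
  rw [sum_card_nonzeros, sum_card_exclusive, zeros, Finset.card_filter, Finset.card_filter,
    Finset.mul_sum, ← Finset.sum_add_distrib, ← Finset.sum_add_distrib, mul_comm,
    ← smul_eq_mul, ← Finset.card_univ, ← Finset.sum_const]
  -- Pointwise: a point is a common zero, or covered once and then exclusive, or covered at least
  -- twice.
  refine Finset.sum_le_sum fun i _ => ?_
  by_cases h0 : coverCount h L i = 0
  · have := mem_zeros.1 (coverCount_eq_zero.1 h0)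
    rw [if_pos this]; omega
  · split_ifs <;> omega

variable {h : ι → V} {m r t d : ℕ}

omit [DecidableEq (Module.Dual F V)] in
-- The `m` supports of size at most `r + 1` miss this many points, all of which lie in a common
-- kernel of dimension `d - 1`. That so many vectors fit there is the constraint exploited in all
-- that follows.
theorem IsOptConfig.le_zeros (H : IsOptConfig F h m r t d) {L : Finset (Module.Dual F V)}
    (hL : IsLocalFamily h r L) (hc : L.card = m) : t + d ≤ (zeros h L).card + 1 := by
  classical
  have h1 := hL.card_le
  have h2 := H.card
  rw [hc] at h1
  omega

omit [DecidableEq (Module.Dual F V)] in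
theorem IsOptConfig.exists_family (H : IsOptConfig F h m r t d) (ht : 1 ≤ t) (hd : 2 ≤ d) :
    ∃ L : Finset (Module.Dual F V), IsLocalFamily h r L ∧ L.card = m := by
  obtain ⟨M, hM, hc, -⟩ := H.loc.exists_family m (by have := H.card; omega)
  exact ⟨M, hM, hc⟩

/-- A bound for the common zeros of families of size `m` gives a bound for smaller families. -/
theorem IsOptConfig.zeros_le_of_bound (H : IsOptConfig F h m r t d) (ht : 1 ≤ t) (hd : 2 ≤ d) {z : ℕ}
    (hz : ∀ L : Finset (Module.Dual F V), IsLocalFamily h r L → L.card = m → (zeros h L).card ≤ z)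
    {M : Finset (Module.Dual F V)} (hM : IsLocalFamily h r M) {j : ℕ} (hj : M.card + j = m) :
    (zeros h M).card ≤ j * (r + 1) + z := by
  classical
  have h1 := hM.card_le
  have h2 := H.card
  rw [← hj, add_mul] at h2
  obtain ⟨L, -, hL, hLc, hLz⟩ := H.loc.extend j M hM (by omega)
  have := hz L hL (by omega)
  omega

omit [DecidableEq (Module.Dual F V)] in
theorem IsOptConfig.exists_max_family (H : IsOptConfig F h m r t d) (ht : 1 ≤ t) (hd : 2 ≤ d) :
    ∃ L : Finset (Module.Dual F V), IsLocalFamily h r L ∧ L.card = m ∧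
      ∀ M : Finset (Module.Dual F V), IsLocalFamily h r M → M.card = m →
        (zeros h M).card ≤ (zeros h L).card := by
  let S : Set ℕ := {z | ∃ L : Finset (Module.Dual F V), IsLocalFamily h r L ∧ L.card = m ∧
    (zeros h L).card = z}
  have hne : S.Nonempty := by
    obtain ⟨L, hL, hc⟩ := H.exists_family ht hd
    exact ⟨_, L, hL, hc, rfl⟩
  have hb : BddAbove S := ⟨Fintype.card ι, by
    rintro _ ⟨L, -, -, rfl⟩
    exact Finset.card_le_univ _⟩
  obtain ⟨L, hL, hc, hz⟩ := Nat.sSup_mem hne hb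
  exact ⟨L, hL, hc, fun M hM hMc => hz ▸ le_csSup hb ⟨M, hM, hMc, rfl⟩⟩

omit [DecidableEq (Module.Dual F V)] in
theorem IsOptConfig.finrank_commonKer (H : IsOptConfig F h m r t d) [FiniteDimensional F V]
    {L : Finset (Module.Dual F V)} (hL : IsLocalFamily h r L) :
    Module.finrank F (commonKer L) + L.card + 1 = m + d := by
  rw [_root_.finrank_commonKer hL.1, H.finrank]

omit [DecidableEq (Module.Dual F V)] in
-- One functional more than `m` brings the common kernel down to dimension `d - 2`, where the points
-- must be independent.
theorem IsOptConfig.zeros_add_two_le (H : IsOptConfig F h m r t d) [FiniteDimensional F V]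
    {L : Finset (Module.Dual F V)} (hL : IsLocalFamily h r L) (hc : L.card = m + 1) :
    (zeros h L).card + 2 ≤ d := by
  have h1 := H.finrank_commonKer hL
  have := H.dist.card_le_finrank (s := zeros h L) (commonKer L)
    (fun i hi => mem_commonKer_of_mem_zeros hi) (by omega)
  omega

omit [DecidableEq (Module.Dual F V)] in
theorem IsOptConfig.zeros_le_five (hF : Nat.card F = 4) (H : IsOptConfig F h m r t 3)
    [FiniteDimensional F V] {L : Finset (Module.Dual F V)} (hL : IsLocalFamily h r L)
    (hc : L.card = m) : (zeros h L).card ≤ 5 := by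
  have h1 := H.finrank_commonKer hL
  rw [← Fintype.card_coe]
  exact (H.dist.restrict (zeros h L) (commonKer L)
    (fun i hi => mem_commonKer_of_mem_zeros hi)).card_le_five hF (by omega)

omit [DecidableEq (Module.Dual F V)] in
theorem IsOptConfig.zeros_le_six (hF : Nat.card F = 4) (H : IsOptConfig F h m r t 4)
    [FiniteDimensional F V] {L : Finset (Module.Dual F V)} (hL : IsLocalFamily h r L)
    (hc : L.card = m) : (zeros h L).card ≤ 6 := by
  have h1 := H.finrank_commonKer hL
  rw [← Fintype.card_coe]
  exact (H.dist.restrict (zeros h L) (commonKer L)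
    (fun i hi => mem_commonKer_of_mem_zeros hi)).card_le_six hF (by omega)

omit [DecidableEq (Module.Dual F V)] in
theorem IsOptConfig.zeros_le_dist (hF : Nat.card F = 4) (H : IsOptConfig F h m r t d) (hd : 5 ≤ d)
    [FiniteDimensional F V] {L : Finset (Module.Dual F V)} (hL : IsLocalFamily h r L)
    (hc : L.card = m) : (zeros h L).card ≤ d := by
  have h1 := H.finrank_commonKer hL
  obtain ⟨e, rfl⟩ : ∃ e, d = e + 1 := ⟨d - 1, by omega⟩
  rw [← Fintype.card_coe]
  exact (H.dist.restrict (zeros h L) (commonKer L)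
    (fun i hi => mem_commonKer_of_mem_zeros hi)).card_le_add_one hF (by omega) (by omega)

/-- The other `m` functionals have a common kernel of dimension two; the exclusive points of `u` lie
in it off the kernel of `u`, on an affine line with four points. -/
theorem IsOptConfig.exclusive_le_four (hF : Nat.card F = 4) (H : IsOptConfig F h m r t 3)
    [FiniteDimensional F V] {L : Finset (Module.Dual F V)} (hL : IsLocalFamily h r L)
    (hc : L.card = m + 1) {u : Module.Dual F V} (hu : u ∈ L) : (exclusive h L u).card ≤ 4 := by
  have h1 := H.finrank_commonKer (hL.subset (Finset.erase_subset u L))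
  rw [Finset.card_erase_of_mem hu] at h1
  have := (H.dist.restrict (exclusive h L u) (commonKer (L.erase u)) (fun i hi =>
    mem_commonKer_of_mem_zeros (Finset.mem_of_mem_filter _ hi))).card_le_of_forall_ne_zero hF
    (f := u.comp (commonKer (L.erase u)).subtype) (fun i => (mem_exclusive.1 i.2).1) (m := 1)
    (by omega)
  simpa using this

/-- The exclusive points of `u` are common zeros of the other `m` functionals, hence an arc in
dimension three. -/
theorem IsOptConfig.exclusive_le_six (hF : Nat.card F = 4) (H : IsOptConfig F h m r t 4)
    [FiniteDimensional F V] {L : Finset (Module.Dual F V)} (hL : IsLocalFamily h r L)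
    (hc : L.card = m + 1) {u : Module.Dual F V} (hu : u ∈ L) : (exclusive h L u).card ≤ 6 := by
  refine (Finset.card_le_card (Finset.filter_subset _ _)).trans
    (H.zeros_le_six hF (hL.subset (Finset.erase_subset u L)) ?_)
  rw [Finset.card_erase_of_mem hu]; omega

omit [DecidableEq (Module.Dual F V)] in
theorem isLocalFamily_pair [DecidableEq (Module.Dual F V)] {u v : Module.Dual F V} {i j : ι}
    (hu : (nonzeros h u).card ≤ r + 1) (hv : (nonzeros h v).card ≤ r + 1) (huj : u (h j) ≠ 0)
    (hui : u (h i) = 0) (hvi : v (h i) ≠ 0) :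
    IsLocalFamily h r {v, u} ∧ ({v, u} : Finset (Module.Dual F V)).card = 2 := by
  obtain ⟨h1, h2⟩ := (isLocalFamily_empty (F := F) h r).insert (i := j) (by simp) huj hu
  obtain ⟨h3, h4⟩ := h1.insert (i := i) (by simpa using hui) hvi hv
  exact ⟨h3, h4.trans (by rw [h2]; rfl)⟩

theorem card_zeros_pair [DecidableEq ι] (u v : Module.Dual F V) :
    (zeros h {v, u}).card + (nonzeros h u ∪ nonzeros h v).card = Fintype.card ι := by
  have : zeros h {v, u} = (nonzeros h u ∪ nonzeros h v)ᶜ := by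
    ext i; simp; tauto
  rw [this, Finset.card_compl_add_card]

/-- Two independent local words have a large union of supports. -/
theorem IsOptConfig.le_card_union [DecidableEq ι] (H : IsOptConfig F h m r t d) (ht : 1 ≤ t)
    (hd : 2 ≤ d) (hm : 2 ≤ m) {z : ℕ}
    (hz : ∀ L : Finset (Module.Dual F V), IsLocalFamily h r L → L.card = m → (zeros h L).card ≤ z)
    {u v : Module.Dual F V} {i j : ι} (hu : (nonzeros h u).card ≤ r + 1)
    (hv : (nonzeros h v).card ≤ r + 1) (huj : u (h j) ≠ 0) (hui : u (h i) = 0)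
    (hvi : v (h i) ≠ 0) :
    2 * (r + 1) + t + d ≤ z + 1 + (nonzeros h u ∪ nonzeros h v).card := by
  obtain ⟨h1, h2⟩ := isLocalFamily_pair hu hv huj hui hvi
  obtain ⟨j, rfl⟩ : ∃ j, m = 2 + j := ⟨m - 2, by omega⟩
  have h3 := H.zeros_le_of_bound ht hd hz h1 (by rw [h2])
  have h4 := card_zeros_pair (h := h) u v
  have h5 := H.card
  rw [add_mul] at h5
  omega

theorem IsOptConfig.card_inter_le [DecidableEq ι] (H : IsOptConfig F h m r t d) (ht : 1 ≤ t)
    (hd : 2 ≤ d) (hm : 2 ≤ m) {z : ℕ}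
    (hz : ∀ L : Finset (Module.Dual F V), IsLocalFamily h r L → L.card = m → (zeros h L).card ≤ z)
    {u v : Module.Dual F V} {i j : ι} (hu : (nonzeros h u).card ≤ r + 1)
    (hv : (nonzeros h v).card ≤ r + 1) (huj : u (h j) ≠ 0) (hui : u (h i) = 0)
    (hvi : v (h i) ≠ 0) :
    (nonzeros h u ∩ nonzeros h v).card + t + d ≤ z + 1 := by
  have h1 := H.le_card_union ht hd hm hz hu hv huj hui hvi
  have h2 := Finset.card_union_add_card_inter (nonzeros h u) (nonzeros h v)
  omega

omit [DecidableEq (Module.Dual F V)] in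
/-- Distance three, at least three local groups. -/
theorem IsOptConfig.params_of_dist_three (hF : Nat.card F = 4) [FiniteDimensional F V]
    (H : IsOptConfig F h m r t 3) (hm : 2 ≤ m) (ht : 1 ≤ t) :
    (t = 1 ∧ (r = 2 ∨ r = 3 ∨ (r = 4 ∧ m ≤ 3) ∨ (r = 5 ∧ m = 2))) ∨ (t = 2 ∧ r = 3) := by
  classical
  -- If `m + 1` local functionals cover all points, double counting bounds the length. Otherwise
  -- every extension of a family of size `m` leaves a point uncovered, and an extremal family gives
  -- a contradiction.
  by_cases hcov : ∃ L : Finset (Module.Dual F V), IsLocalFamily h r L ∧ L.card = m + 1 ∧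
      zeros h L = ∅
  · obtain ⟨L, hL, hc, hz⟩ := hcov
    have h1 := hL.card_le
    have h2 := two_mul_card_le h L
    have h3 : ∑ u ∈ L, (exclusive h L u).card ≤ L.card * 4 :=
      Finset.sum_le_card_nsmul _ _ _ fun u hu => H.exclusive_le_four hF hL hc hu
    have h4 : ∑ u ∈ L, (nonzeros h u).card ≤ L.card * (r + 1) :=
      Finset.sum_le_card_nsmul _ _ _ fun u hu => hL.2 u hu
    have h5 := H.card
    rw [hz, Finset.card_empty, hc] at h1
    rw [hz, Finset.card_empty] at h2
    rw [hc] at h3 h4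
    have h6 : (m + 1) * (r + 1) = m * (r + 1) + (r + 1) := by ring
    have h7 : m * (r + 1) = m * r + m := by ring
    -- This is `2 * n ≤ (m + 1) * (r + 1) + 4 * (m + 1)` with `n = m * (r + 1) + t + 2`.
    have h8 : m * r + 2 * t ≤ 3 * m + r + 1 := by omega
    have h9 : r ≤ 5 := by
      by_contra! h
      obtain ⟨q, rfl⟩ : ∃ q, r = q + 6 := ⟨r - 6, by omega⟩
      obtain ⟨p, rfl⟩ : ∃ p, m = p + 2 := ⟨m - 2, by omega⟩
      have : (p + 2) * (q + 6) = p * q + 6 * p + 2 * q + 12 := by ring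
      have := Nat.zero_le (p * q)
      omega
    interval_cases r <;> omega
  · exfalso
    push Not at hcov
    obtain ⟨L, hL, hc, hmax⟩ := H.exists_max_family ht (by omega)
    have hZ := H.le_zeros hL hc
    have key : ∀ i ∈ zeros h L, ∃ u : Module.Dual F V, u (h i) ≠ 0 ∧
        (nonzeros h u).card ≤ r + 1 ∧ ∃ i', i' ∈ zeros h L \ nonzeros h u ∧
          (zeros h L \ nonzeros h u).card ≤ 1 := by
      intro i hi
      obtain ⟨u, hu, hur⟩ := H.loc i
      obtain ⟨hL', hc'⟩ := hL.insert hi hu hur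
      have h1 := hcov _ hL' (by omega)
      have h2 := H.zeros_add_two_le hL' (by omega)
      rw [zeros_insert] at h1 h2
      obtain ⟨i', hi'⟩ := h1
      exact ⟨u, hu, hur, i', hi', by omega⟩
    obtain ⟨i, hi⟩ : (zeros h L).Nonempty := by rw [← Finset.card_pos]; omega
    obtain ⟨u, hu, hur, i', hi', hu1⟩ := key i hi
    rw [Finset.mem_sdiff, mem_nonzeros, not_not] at hi'
    obtain ⟨v, hv, hvr, -, -, hv1⟩ := key i' hi'.1
    have h1 := H.card_inter_le ht (by omega) hm hmax hur hvr hu hi'.2 hv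
    -- Let `z` be the number of common zeros of `L`. Each of `u` and `v` misses at most one of them,
    -- so at least `z - 2` lie in both supports; the extremal choice of `L` allows only `z - t - 2`.
    have h2 : zeros h L ⊆ (nonzeros h u ∩ nonzeros h v) ∪
        ((zeros h L \ nonzeros h u) ∪ (zeros h L \ nonzeros h v)) := by
      intro j hj
      simp only [Finset.mem_union, Finset.mem_inter, Finset.mem_sdiff, hj, true_and]
      tauto
    have h3 := Finset.card_le_card h2
    have h4 := Finset.card_union_le (nonzeros h u ∩ nonzeros h v)
      ((zeros h L \ nonzeros h u) ∪ (zeros h L \ nonzeros h v))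
    have h5 := Finset.card_union_le (zeros h L \ nonzeros h u) (zeros h L \ nonzeros h v)
    omega

end OptConfig

/-! ### Two hyperovals in a space of dimension four -/

section FourCover

variable {F V ι : Type*} [Field F] [DecidableEq F] [AddCommGroup V] [Module F V] [Fintype ι]
  [FiniteDimensional F V]

/-- The number of functionals vanishing on few points. -/
theorem RelDist.card_annihilating (hF : Nat.card F = 4) {h : ι → V} {d : ℕ} (H : RelDist F h d)
    [Fintype (Module.Dual F V)] {s : Finset ι} (hs : s.card < d) :
    (Finset.univ.filter fun f : Module.Dual F V => ∀ i ∈ s, f (h i) = 0).card * 4 ^ s.card =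
      4 ^ Module.finrank F V := by
  have hli : LinearIndependent F (fun i : s => h i) := H.linearIndepOn hs
  have h1 := finrank_span_eq_card hli
  have h2 := Subspace.finrank_add_finrank_dualAnnihilator_eq
    (Submodule.span F (Set.range fun i : s => h i))
  have h3 := natCard_eq_four_pow hF
    (Submodule.dualAnnihilator (Submodule.span F (Set.range fun i : s => h i)))
  have h4 : (Finset.univ.filter fun f : Module.Dual F V => ∀ i ∈ s, f (h i) = 0).card =
      Nat.card (Submodule.dualAnnihilator (Submodule.span F (Set.range fun i : s => h i))) := by
    rw [← Fintype.card_subtype, ← Nat.card_eq_fintype_card]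
    refine Nat.card_congr (Equiv.subtypeEquivRight fun f => ?_)
    rw [Submodule.mem_dualAnnihilator]
    constructor
    · intro hf w hw
      induction hw using Submodule.span_induction with
      | mem x hx =>
        obtain ⟨i, rfl⟩ := hx
        exact hf i i.2
      | zero => simp
      | add x y _ _ hx hy => simp [hx, hy]
      | smul c x _ hx => simp [hx]
    · exact fun hf i hi => hf _ (Submodule.subset_span ⟨⟨i, hi⟩, rfl⟩)
  rw [Fintype.card_coe] at h1
  rw [h4, h3, ← pow_add]
  congr 1
  omega

variable {h : ι → V} {m r t : ℕ}

/-- Two disjoint hyperovals in planes of a four-dimensional space cannot be seen from a point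
outside as having a common exterior line. -/
theorem RelDist.hyperoval_pair (hF : Nat.card F = 4) (H : RelDist F h 4)
    (hV : Module.finrank F V = 4) {a b : Module.Dual F V} {S T : Finset ι} {x : ι}
    (hS : S.card = 6) (hT : T.card = 6) (hSa : ∀ i ∈ S, a (h i) ≠ 0 ∧ b (h i) = 0)
    (hTb : ∀ i ∈ T, a (h i) = 0 ∧ b (h i) ≠ 0) (hxa : a (h x) ≠ 0) (hxb : b (h x) ≠ 0) : False := by
  classical
  have : Finite F := Nat.finite_of_card_ne_zero (by omega)
  have := finite_of_finiteDimensional hF (Module.Dual F V)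
  have := Fintype.ofFinite (Module.Dual F V)
  -- Let `z P f` count the zeros of `f` on `P`, and sum `(2 - z S f) * (2 - z T f)` over the `64`
  -- functionals vanishing at `x`. Counting gives `16`, which is already the term of `f = 0`. The
  -- other terms are nonnegative, since such an `f` cuts the planes of `S` and `T` in lines, with at
  -- most two points each. But one functional misses both sets and contributes `4`.
  let z : Finset ι → Module.Dual F V → ℤ := fun P f => ∑ i ∈ P, if f (h i) = 0 then 1 else 0
  let G : Finset (Module.Dual F V) := Finset.univ.filter fun f => f (h x) = 0
  have hxS : ∀ i ∈ S, i ≠ x := fun i hi he => hxb (he ▸ (hSa i hi).2)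
  have hxT : ∀ i ∈ T, i ≠ x := fun i hi he => hxa (he ▸ (hTb i hi).1)
  have hG : (G.card : ℤ) = 64 := by
    have := H.card_annihilating hF (s := {x}) (by simp)
    simp only [Finset.mem_singleton, forall_eq, Finset.card_singleton, hV] at this
    have h2 : G.card = 64 := by change G.card * _ = _ at this; omega
    exact_mod_cast h2
  have h16 : ∀ i, i ≠ x → ∑ f ∈ G, (if f (h i) = 0 then (1 : ℤ) else 0) = 16 := by
    intro i hi
    have := H.card_annihilating hF (s := {x, i}) (by rw [Finset.card_pair hi.symm]; omega)
    rw [Finset.card_pair hi.symm, hV] at this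
    simp only [Finset.mem_insert, Finset.mem_singleton, forall_eq_or_imp, forall_eq] at this
    rw [Finset.sum_boole, Finset.filter_filter]
    norm_num at this ⊢
    omega
  have h4 : ∀ i ∈ S, ∀ j ∈ T,
      ∑ f ∈ G, (if f (h i) = 0 then (1 : ℤ) else 0) * (if f (h j) = 0 then 1 else 0) = 4 := by
    intro i hi j hj
    have hij : i ≠ j := fun he => (hSa i hi).1 (he ▸ (hTb j hj).1)
    have hc : ({x, i, j} : Finset ι).card = 3 := by
      rw [Finset.card_eq_three]
      exact ⟨x, i, j, (hxS i hi).symm, (hxT j hj).symm, hij, rfl⟩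
    have := H.card_annihilating hF (s := {x, i, j}) (by omega)
    rw [hc, hV] at this
    simp only [Finset.mem_insert, Finset.mem_singleton, forall_eq_or_imp, forall_eq] at this
    simp only [← ite_and, mul_ite, mul_one, mul_zero]
    rw [Finset.sum_boole, Finset.filter_filter]
    norm_num at this ⊢
    have h2 : (Finset.univ.filter fun f : Module.Dual F V =>
        f (h x) = 0 ∧ f (h j) = 0 ∧ f (h i) = 0).card = 4 := by
      rw [Finset.filter_congr (q := fun f => f (h x) = 0 ∧ f (h i) = 0 ∧ f (h j) = 0)
        fun f _ => by tauto]
      omega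
    exact_mod_cast h2
  have hz1 : ∀ P : Finset ι, (∀ i ∈ P, i ≠ x) → P.card = 6 → ∑ f ∈ G, z P f = 96 := by
    intro P hP hc
    rw [Finset.sum_comm, Finset.sum_congr rfl fun i hi => h16 i (hP i hi), Finset.sum_const, hc]
    norm_num
  have hz2 : ∑ f ∈ G, z S f * z T f = 144 := by
    simp only [z, Finset.sum_mul_sum]
    rw [Finset.sum_comm]
    have : ∀ i ∈ S, ∑ f ∈ G, ∑ j ∈ T, (if f (h i) = 0 then (1 : ℤ) else 0) *
        (if f (h j) = 0 then 1 else 0) = 24 := by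
      intro i hi
      rw [Finset.sum_comm, Finset.sum_congr rfl fun j hj => h4 i hi j hj, Finset.sum_const, hT]
      norm_num
    rw [Finset.sum_congr rfl this, Finset.sum_const, hS]
    norm_num
  have hsum : ∑ f ∈ G, (2 - z S f) * (2 - z T f) = 16 := by
    have : ∀ f, (2 - z S f) * (2 - z T f) = 4 - 2 * z S f - 2 * z T f + z S f * z T f :=
      fun f => by ring
    simp only [this, Finset.sum_add_distrib, Finset.sum_sub_distrib, ← Finset.mul_sum, hz2,
      hz1 S hxS hS, hz1 T hxT hT, Finset.sum_const, nsmul_eq_mul, hG]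
    norm_num
  have hle : ∀ (P : Finset ι) (c : Module.Dual F V), (∀ i ∈ P, c (h i) = 0) → c (h x) ≠ 0 →
      ∀ f ∈ G, f ≠ 0 → z P f ≤ 2 := by
    intro P c hP hcx f hf hf0
    have hfx : f (h x) = 0 := (Finset.mem_filter.1 hf).2
    have h1 : LinearIndepOn F id (({f} : Finset (Module.Dual F V)) : Set (Module.Dual F V)) := by
      rw [Finset.coe_singleton]; exact LinearIndepOn.singleton hf0
    have h2 : c ∉ Submodule.span F (({f} : Finset (Module.Dual F V)) : Set (Module.Dual F V)) :=
      notMem_span_of_mem_zeros (h := h) (i := x) (by simpa using hfx) hcx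
    have h3 : LinearIndepOn F id ((insert c {f} : Finset (Module.Dual F V)) : Set (Module.Dual F V)) := by
      rw [Finset.coe_insert]; exact LinearIndepOn.id_insert h1 h2
    have h4 := finrank_commonKer h3
    rw [Finset.card_pair (by rintro rfl; exact hcx hfx), hV] at h4
    have h5 := H.card_le_finrank (s := P.filter fun i => f (h i) = 0) _ (fun i hi => by
      rw [Finset.mem_filter] at hi
      refine mem_commonKer (L := insert c {f}).2 fun u hu => ?_
      rw [Finset.mem_insert, Finset.mem_singleton] at hu
      rcases hu with rfl | rfl
      exacts [hP i hi.1, hi.2]) (by omega)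
    simp only [z, Finset.sum_boole]
    have h6 : (P.filter fun i => f (h i) = 0).card ≤ 2 := by omega
    exact_mod_cast h6
  have hnonneg : ∀ f ∈ G, f ≠ 0 → 0 ≤ (2 - z S f) * (2 - z T f) := fun f hf hf0 =>
    mul_nonneg (sub_nonneg.2 (hle S b (fun i hi => (hSa i hi).2) hxb f hf hf0))
      (sub_nonneg.2 (hle T a (fun i hi => (hTb i hi).1) hxa f hf hf0))
  have h0 : (0 : Module.Dual F V) ∈ G := by simp [G]
  -- The combination of `a` and `b` that vanishes at `x`; it has no zero on `S` or `T`.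
  let g : Module.Dual F V := b (h x) • a - a (h x) • b
  have hgS : ∀ i ∈ S, g (h i) ≠ 0 := fun i hi => by simp [g, hSa i hi, hxb]
  have hgT : ∀ i ∈ T, g (h i) ≠ 0 := fun i hi => by simp [g, hTb i hi, hxa]
  have hgG : g ∈ G := by simp [G, g, mul_comm]
  have hg0 : g ≠ 0 := by
    obtain ⟨i, hi⟩ : S.Nonempty := by rw [← Finset.card_pos]; omega
    exact fun h0 => hgS i hi (by rw [h0]; rfl)
  have hz0 : ∀ P : Finset ι, P.card = 6 → z P 0 = 6 := fun P hP => by simp [z, hP]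
  have hzg : ∀ P : Finset ι, (∀ i ∈ P, g (h i) ≠ 0) → z P g = 0 := fun P hP =>
    Finset.sum_eq_zero fun i hi => if_neg (hP i hi)
  rw [← Finset.add_sum_erase _ _ h0, ← Finset.add_sum_erase _ _ (Finset.mem_erase.2 ⟨hg0, hgG⟩),
    hz0 S hS, hz0 T hT, hzg S hgS, hzg T hgT] at hsum
  have hrest := Finset.sum_nonneg (s := (G.erase 0).erase g)
    (f := fun f => (2 - z S f) * (2 - z T f)) fun f hf => by
      have h1 := Finset.mem_erase.1 hf
      have h2 := Finset.mem_erase.1 h1.2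
      exact hnonneg f h2.2 h2.1
  omega

variable [DecidableEq (Module.Dual F V)]

/-- The other `m - 1` functionals have a common kernel of dimension four. It contains the exclusive
points of `a` and of `b`, hyperovals in the planes `b = 0` and `a = 0`, and the point `x` off both
planes. -/
theorem IsOptConfig.not_two_exclusive_six (hF : Nat.card F = 4) (H : IsOptConfig F h m r t 4)
    {L : Finset (Module.Dual F V)} (hL : IsLocalFamily h r L) (hc : L.card = m + 1)
    {a b : Module.Dual F V} (ha : a ∈ L) (hb : b ∈ L) (hab : a ≠ b)
    (hSa : (exclusive h L a).card = 6) (hSb : (exclusive h L b).card = 6) {x : ι}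
    (hxa : a (h x) ≠ 0) (hxb : b (h x) ≠ 0) (hx : ∀ u ∈ L, u ≠ a → u ≠ b → u (h x) = 0) :
    False := by
  classical
  let M := (L.erase a).erase b
  have hM : IsLocalFamily h r M := hL.subset ((Finset.erase_subset _ _).trans (Finset.erase_subset _ _))
  have hMc : M.card + 1 = m := by
    rw [Finset.card_erase_of_mem (Finset.mem_erase.2 ⟨hab.symm, hb⟩), Finset.card_erase_of_mem ha]
    have : 1 < L.card := Finset.one_lt_card.2 ⟨a, ha, b, hb, hab⟩
    omega
  have hW := H.finrank_commonKer hM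
  let s : Finset ι := insert x (exclusive h L a ∪ exclusive h L b)
  have hs : ∀ i ∈ s, h i ∈ commonKer M := by
    intro i hi
    refine mem_commonKer.2 fun u hu => ?_
    simp only [M, Finset.mem_erase] at hu
    simp only [s, Finset.mem_insert, Finset.mem_union, mem_exclusive] at hi
    rcases hi with rfl | hi | hi
    · exact hx u hu.2.2 hu.2.1 hu.1
    · exact hi.2 u hu.2.2 hu.2.1
    · exact hi.2 u hu.2.2 hu.1
  have hR := H.dist.restrict s (commonKer M) hs
  have hsub : ∀ P ⊆ s, (Finset.univ.filter fun i : s => i.1 ∈ P).card = P.card := by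
    intro P hP
    refine Finset.card_bij (fun i _ => i.1) (by simp) (fun a _ b _ hab => Subtype.ext hab) ?_
    exact fun i hi => ⟨⟨i, hP hi⟩, by simpa using hi, rfl⟩
  refine hR.hyperoval_pair hF (by omega) (a := a.comp (commonKer M).subtype)
    (b := b.comp (commonKer M).subtype)
    (S := Finset.univ.filter fun i => i.1 ∈ exclusive h L a)
    (T := Finset.univ.filter fun i => i.1 ∈ exclusive h L b) (x := ⟨x, Finset.mem_insert_self _ _⟩)
    ?_ ?_ ?_ ?_ hxa hxb
  · rw [hsub _ fun i hi => Finset.mem_insert_of_mem (Finset.mem_union_left _ hi), hSa]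
  · rw [hsub _ fun i hi => Finset.mem_insert_of_mem (Finset.mem_union_right _ hi), hSb]
  · intro i hi
    have := mem_exclusive.1 (Finset.mem_filter.1 hi).2
    exact ⟨this.1, this.2 b hb hab.symm⟩
  · intro i hi
    have := mem_exclusive.1 (Finset.mem_filter.1 hi).2
    exact ⟨this.2 a ha hab, this.1⟩

end FourCover

/-! ### Distance four with at least three groups -/

section DistFour

variable {F V ι : Type*} [Field F] [DecidableEq F] [AddCommGroup V] [Module F V] [Fintype ι]
  [FiniteDimensional F V] {h : ι → V} {m r t : ℕ}

/-- Distance four, all points covered by `m + 1` local functionals. -/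
theorem IsOptConfig.cover_dist_four (hF : Nat.card F = 4) (H : IsOptConfig F h m r t 4)
    {L : Finset (Module.Dual F V)} (hL : IsLocalFamily h r L) (hc : L.card = m + 1)
    (hz : zeros h L = ∅) (hm : 2 ≤ m) (ht : 1 ≤ t) :
    t + 2 ≤ r ∧ m * r + 2 * t ≤ 5 * m + r + 1 ∧ (6 ≤ r → m * r + t + 2 ≤ 5 * m + r) := by
  classical
  have hn := H.card
  have e1 : m * (r + 1) = m * r + m := by ring
  have e2 : (m + 1) * (r + 1) = m * r + m + r + 1 := by ring
  have h1 := hL.card_le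
  rw [hz, Finset.card_empty, hc] at h1
  have hcov : ∀ i, 1 ≤ coverCount h L i := fun i => by
    rw [Nat.one_le_iff_ne_zero, Ne, coverCount_eq_zero, hz]; simp
  -- `B` collects the functionals with fewer exclusive points than the maximum six; `T₂` and `T₃`
  -- are the points covered exactly twice and at least three times.
  let B := L.filter fun u => (exclusive h L u).card ≤ 5
  let T₂ := Finset.univ.filter fun i => coverCount h L i = 2
  let T₃ := Finset.univ.filter fun i => 3 ≤ coverCount h L i
  have hex : ∑ u ∈ L, (exclusive h L u).card + B.card ≤ (m + 1) * 6 := by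
    rw [Finset.card_filter, ← Finset.sum_add_distrib, ← hc, ← smul_eq_mul]
    refine Finset.sum_le_card_nsmul _ _ _ fun u hu => ?_
    have := H.exclusive_le_six hF hL hc hu
    split_ifs <;> omega
  have hsupp : ∑ u ∈ L, (nonzeros h u).card ≤ (m + 1) * (r + 1) := by
    rw [← hc]
    exact Finset.sum_le_card_nsmul _ _ _ fun u hu => hL.2 u hu
  have hn2 : 2 * Fintype.card ι + T₃.card ≤
      ∑ u ∈ L, (nonzeros h u).card + ∑ u ∈ L, (exclusive h L u).card := by
    rw [sum_card_nonzeros, sum_card_exclusive, Finset.card_filter, Finset.card_filter,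
      ← Finset.sum_add_distrib, mul_comm, ← smul_eq_mul, ← Finset.card_univ, ← Finset.sum_const,
      ← Finset.sum_add_distrib]
    refine Finset.sum_le_sum fun i _ => ?_
    have := hcov i
    split_ifs <;> omega
  have hn3 : Fintype.card ι ≤ ∑ u ∈ L, (exclusive h L u).card + T₂.card + T₃.card := by
    rw [sum_card_exclusive, Finset.card_filter, Finset.card_filter, Finset.card_filter,
      ← Finset.sum_add_distrib, ← Finset.sum_add_distrib, ← Finset.card_univ,
      Finset.card_eq_sum_ones]
    refine Finset.sum_le_sum fun i _ => ?_
    have := hcov i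
    split_ifs <;> omega
  -- The first bound is `n ≤ (m + 1) * (r + 1)` and the second is the double count. If the third one
  -- failed, the double count would be nearly sharp.
  refine ⟨by omega, by omega, fun hr6 => ?_⟩
  by_contra! hlt
  have hT2 : ∀ x ∈ T₂, ∃ u ∈ B, u (h x) ≠ 0 := by
    intro x hx
    obtain ⟨a, b, hab, hset⟩ := Finset.card_eq_two.1 (Finset.mem_filter.1 hx).2
    have hmem : ∀ u, (u ∈ L ∧ u (h x) ≠ 0) ↔ u = a ∨ u = b := fun u => by
      simpa only [Finset.mem_filter, Finset.mem_insert, Finset.mem_singleton] using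
        Finset.ext_iff.1 hset u
    have ha := (hmem a).2 (Or.inl rfl)
    have hb := (hmem b).2 (Or.inr rfl)
    by_contra! hno
    have h6 : ∀ u ∈ L, u (h x) ≠ 0 → (exclusive h L u).card = 6 := fun u hu hux => by
      have h5 : u ∉ B := fun huB => hux (hno u huB)
      have := H.exclusive_le_six hF hL hc hu
      simp only [B, Finset.mem_filter, hu, true_and] at h5
      omega
    refine H.not_two_exclusive_six hF hL hc ha.1 hb.1 hab (h6 a ha.1 ha.2) (h6 b hb.1 hb.2)
      ha.2 hb.2 fun u hu hua hub => ?_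
    by_contra hux
    rcases (hmem u).1 ⟨hu, hux⟩ with rfl | rfl
    exacts [hua rfl, hub rfl]
  -- Under the failing bound the double count leaves a slack of at most `2 - t`.
  have hB : B.card + T₃.card ≤ 1 := by omega
  rcases B.eq_empty_or_nonempty with hB0 | ⟨A, hA⟩
  · have : T₂ = ∅ := Finset.eq_empty_of_forall_notMem fun x hx => by
      obtain ⟨u, hu, -⟩ := hT2 x hx
      rw [hB0] at hu
      simp at hu
    rw [this, Finset.card_empty] at hn3
    omega
  -- Now `T₃` is empty, and all of `T₂` lies in the support of the only member `A` of `B`, together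
  -- with the exclusive points of `A`. So these account for at most `r + 1` points and the other
  -- functionals for six each, which is less than `n`.
  · have hB1 : B.card ≤ 1 := by omega
    have hBpos := Finset.card_pos.2 ⟨A, hA⟩
    have hAL := (Finset.mem_filter.1 hA).1
    have hT : T₂ ∪ exclusive h L A ⊆ nonzeros h A := by
      refine Finset.union_subset (fun x hx => ?_) (exclusive_subset_nonzeros h L A)
      obtain ⟨u, hu, hux⟩ := hT2 x hx
      rw [Finset.card_le_one.1 hB1 u hu A hA] at hux
      exact mem_nonzeros.2 hux
    have hdisj : Disjoint T₂ (exclusive h L A) := by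
      rw [Finset.disjoint_left]
      intro x hx hxA
      have h2 : coverCount h L x = 2 := (Finset.mem_filter.1 hx).2
      have h3 : coverCount h L x ≤ 1 := by
        refine Finset.card_le_one.2 fun a ha b hb => ?_
        rw [Finset.mem_filter] at ha hb
        have hx' := (mem_exclusive.1 hxA).2
        have e : ∀ u ∈ L, u (h x) ≠ 0 → u = A := fun u hu hux => by
          by_contra hne
          exact hux (hx' u hu hne)
        rw [e a ha.1 ha.2, e b hb.1 hb.2]
      omega
    have h2 := Finset.card_le_card hT
    rw [Finset.card_union_of_disjoint hdisj] at h2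
    have h3 := hL.2 A hAL
    have h4 : ∑ u ∈ L.erase A, (exclusive h L u).card ≤ m * 6 := by
      have : (L.erase A).card = m := by rw [Finset.card_erase_of_mem hAL]; omega
      rw [← this]
      exact Finset.sum_le_card_nsmul _ _ _ fun u hu =>
        H.exclusive_le_six hF hL hc (Finset.mem_of_mem_erase hu)
    have h5 := Finset.add_sum_erase L (fun u => (exclusive h L u).card) hAL
    omega

omit [FiniteDimensional F V] in
/-- A local functional meeting two overlapping ones only outside of them. -/
theorem IsOptConfig.le_card_union_three [DecidableEq ι] {d : ℕ} (H : IsOptConfig F h m r t d)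
    (ht : 1 ≤ t) (hd : 2 ≤ d) (hm : 3 ≤ m) {z : ℕ}
    (hz : ∀ L : Finset (Module.Dual F V), IsLocalFamily h r L → L.card = m → (zeros h L).card ≤ z)
    {u v w : Module.Dual F V} {i j k : ι} (hu : (nonzeros h u).card ≤ r + 1)
    (hv : (nonzeros h v).card ≤ r + 1) (hw : (nonzeros h w).card ≤ r + 1) (huj : u (h j) ≠ 0)
    (hui : u (h i) = 0) (hvi : v (h i) ≠ 0) (huk : u (h k) = 0) (hvk : v (h k) = 0)
    (hwk : w (h k) ≠ 0) :
    3 * (r + 1) + t + d ≤ z + 1 + (nonzeros h u ∪ nonzeros h v ∪ nonzeros h w).card := by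
  classical
  obtain ⟨h1, h2⟩ := isLocalFamily_pair hu hv huj hui hvi
  obtain ⟨h3, h4⟩ := h1.insert (i := k) (by simp [huk, hvk]) hwk hw
  obtain ⟨j, rfl⟩ : ∃ j, m = 3 + j := ⟨m - 3, by omega⟩
  have h5 := H.zeros_le_of_bound ht hd hz h3 (by rw [h4, h2])
  have h6 : (zeros h (insert w {v, u})).card + (nonzeros h u ∪ nonzeros h v ∪ nonzeros h w).card =
      Fintype.card ι := by
    have : zeros h (insert w {v, u}) = (nonzeros h u ∪ nonzeros h v ∪ nonzeros h w)ᶜ := by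
      ext i; simp; tauto
    rw [this, Finset.card_compl_add_card]
  have h7 := H.card
  rw [add_mul] at h7
  omega

/-- Distance four, no `m + 1` local functionals cover all points. -/
theorem IsOptConfig.not_cover_dist_four (hF : Nat.card F = 4) (H : IsOptConfig F h m r t 4)
    (hm : 2 ≤ m) (ht : 1 ≤ t)
    (hcov : ∀ L : Finset (Module.Dual F V), IsLocalFamily h r L → L.card = m + 1 →
      (zeros h L).Nonempty) :
    t = 1 ∧ (r = 1 ∨ r = 3 ∨ (m = 2 ∧ r ≤ 7)) := by
  classical
  obtain ⟨L, hL, hc, hmax⟩ := H.exists_max_family ht (by omega)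
  have hZ := H.le_zeros hL hc
  have hZ6 := H.zeros_le_six hF hL hc
  -- By assumption an added functional never uses up all the common zeros, and it leaves at most `d
  -- - 2 = 2` of them.
  have key : ∀ i ∈ zeros h L, ∃ u : Module.Dual F V, u (h i) ≠ 0 ∧
      (nonzeros h u).card ≤ r + 1 ∧ (zeros h L \ nonzeros h u).Nonempty ∧
        (zeros h L \ nonzeros h u).card ≤ 2 := by
    intro i hi
    obtain ⟨u, hu, hur⟩ := H.loc i
    obtain ⟨hL', hc'⟩ := hL.insert hi hu hur
    have h1 := hcov _ hL' (by omega)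
    have h2 := H.zeros_add_two_le hL' (by omega)
    rw [zeros_insert] at h1 h2
    exact ⟨u, hu, hur, h1, by omega⟩
  obtain ⟨i₀, hi₀⟩ : (zeros h L).Nonempty := by rw [← Finset.card_pos]; omega
  obtain ⟨u, hu₀, hur, ⟨i, hi⟩, hu2⟩ := key i₀ hi₀
  rw [Finset.mem_sdiff, mem_nonzeros, not_not] at hi
  obtain ⟨hiZ, hui⟩ := hi
  obtain ⟨v, hvi, hvr, ⟨j, hj⟩, hv2⟩ := key i hiZ
  rw [Finset.mem_sdiff, mem_nonzeros, not_not] at hj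
  obtain ⟨hjZ, hvj⟩ := hj
  have hint := H.card_inter_le ht (by omega) hm hmax hur hvr hu₀ hui hvi
  have hun := H.le_card_union ht (by omega) hm hmax hur hvr hu₀ hui hvi
  have hui2 := Finset.card_union_add_card_inter (nonzeros h u) (nonzeros h v)
  have hsub : zeros h L ⊆ (nonzeros h u ∩ nonzeros h v) ∪
      ((zeros h L \ nonzeros h u) ∪ (zeros h L \ nonzeros h v)) := by
    intro j hj
    simp only [Finset.mem_union, Finset.mem_inter, Finset.mem_sdiff, hj, true_and]
    tauto
  have h3 := Finset.card_le_card hsub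
  have h4 := Finset.card_union_le (nonzeros h u ∩ nonzeros h v)
    ((zeros h L \ nonzeros h u) ∪ (zeros h L \ nonzeros h v))
  have h5 := Finset.card_union_add_card_inter (zeros h L \ nonzeros h u) (zeros h L \ nonzeros h v)
  -- Let `z` be the number of common zeros of `L`. The supports of `u` and `v` share at most `z - t
  -- - 3` points, while each misses at most two of the zeros. Hence `t = 1` and every estimate is an
  -- equality: each misses exactly two zeros, these pairs are disjoint, and both supports have `r +
  -- 1` points.
  obtain rfl : t = 1 := by omega
  refine ⟨rfl, ?_⟩
  have huj : u (h j) ≠ 0 := by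
    intro h0
    have : (zeros h L \ nonzeros h u ∩ (zeros h L \ nonzeros h v)).card = 0 := by omega
    rw [Finset.card_eq_zero] at this
    exact Finset.notMem_empty j (this ▸ Finset.mem_inter.2
      ⟨Finset.mem_sdiff.2 ⟨hjZ, by simpa using h0⟩, Finset.mem_sdiff.2 ⟨hjZ, by simpa using hvj⟩⟩)
  have hZu := Finset.card_sdiff_add_card_inter (zeros h L) (nonzeros h u)
  have hZv := Finset.card_sdiff_add_card_inter (zeros h L) (nonzeros h v)
  -- the overlap of a member of the family with a functional not vanishing on its zeros
  have hover : ∀ G ∈ L, ∀ w : Module.Dual F V, ∀ k ∈ zeros h L, w (h k) ≠ 0 →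
      (nonzeros h w).card ≤ r + 1 → (nonzeros h G ∩ nonzeros h w).card + 4 ≤ (zeros h L).card ∧
        ((nonzeros h G ∩ nonzeros h w).Nonempty →
          2 * (r + 1) + 4 ≤ (zeros h L).card + (nonzeros h G ∪ nonzeros h w).card) := by
    intro G hG w k hk hwk hw
    have hGk : G (h k) = 0 := mem_zeros.1 hk G hG
    rcases (nonzeros h G ∩ nonzeros h w).eq_empty_or_nonempty with h0 | ⟨p, hp⟩
    · rw [h0, Finset.card_empty]
      exact ⟨by omega, fun h => absurd h (by simp)⟩
    · have hGp := mem_nonzeros.1 (Finset.mem_of_mem_inter_left hp)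
      have h1 := H.card_inter_le ht (by omega) hm hmax (hL.2 G hG) hw hGp hGk hwk
      have h2 := H.le_card_union ht (by omega) hm hmax (hL.2 G hG) hw hGp hGk hwk
      exact ⟨by omega, fun _ => by omega⟩
  -- The support of `u` consists of `z - 2` common zeros and of overlaps of size at most `z - 4`
  -- with the `m` members of `L`. For `m = 2` this gives `r + 1 ≤ 3 * z - 10 ≤ 8`.
  have hcover : nonzeros h u ⊆ (zeros h L ∩ nonzeros h u) ∪
      L.biUnion fun G => nonzeros h G ∩ nonzeros h u := by
    intro p hp
    by_cases hpZ : p ∈ zeros h L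
    · exact Finset.mem_union_left _ (Finset.mem_inter.2 ⟨hpZ, hp⟩)
    · rw [mem_zeros] at hpZ
      push Not at hpZ
      obtain ⟨G, hG, hGp⟩ := hpZ
      exact Finset.mem_union_right _ (Finset.mem_biUnion.2
        ⟨G, hG, Finset.mem_inter.2 ⟨mem_nonzeros.2 hGp, hp⟩⟩)
  have h6 := (Finset.card_le_card hcover).trans (Finset.card_union_le _ _)
  have h7 := Finset.card_biUnion_le_card_mul L (fun G => nonzeros h G ∩ nonzeros h u)
    ((zeros h L).card - 4) fun G hG => by
      have := (hover G hG u j hjZ huj hur).1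
      omega
  rw [hc] at h7
  rcases hm.eq_or_lt with rfl | hm3
  · refine Or.inr (Or.inr ⟨rfl, by omega⟩)
  -- If no member of `L` meets the support of `w₁`, this support consists of common zeros. If a
  -- member `G` meets it, `G` cannot leave the union of the supports of `w₁` and `w₂`, or else the
  -- three functionals would violate the bound for the union of three supports. Being covered by its
  -- overlaps with `w₁` and `w₂`, the support of `G` then forces `r + 9 ≤ 2 * z`.
  have hstep : ∀ w₁ w₂ : Module.Dual F V, ∀ i j, i ∈ zeros h L → j ∈ zeros h L →
      w₁ (h i) = 0 → w₂ (h i) ≠ 0 → w₁ (h j) ≠ 0 → (nonzeros h w₁).card = r + 1 →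
      (nonzeros h w₂).card = r + 1 →
      (nonzeros h w₁ ∪ nonzeros h w₂).card + (zeros h L).card = 2 * (r + 1) + 4 →
      r + 1 + 8 ≤ 2 * (zeros h L).card ∨ nonzeros h w₁ ⊆ zeros h L := by
    intro w₁ w₂ i j hi hj h1i h2i h1j hc1 hc2 hcu
    by_contra! hno
    obtain ⟨p, hp, hpZ⟩ := Finset.not_subset.1 hno.2
    rw [mem_zeros] at hpZ
    push Not at hpZ
    obtain ⟨G, hG, hGp⟩ := hpZ
    have hGw : (nonzeros h G ∩ nonzeros h w₁).Nonempty :=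
      ⟨p, Finset.mem_inter.2 ⟨mem_nonzeros.2 hGp, hp⟩⟩
    have hGsub : nonzeros h G ⊆ nonzeros h w₁ ∪ nonzeros h w₂ := by
      intro k hk
      by_contra hk12
      simp only [Finset.mem_union, mem_nonzeros, not_or, not_not] at hk12 hk
      have h1 := H.le_card_union_three ht (by omega) hm3 hmax hc1.le hc2.le (hL.2 G hG) h1j h1i h2i
        hk12.1 hk12.2 hk
      have h2 := Finset.card_union_add_card_inter (nonzeros h w₁ ∪ nonzeros h w₂) (nonzeros h G)
      have h3 : 0 < ((nonzeros h w₁ ∪ nonzeros h w₂) ∩ nonzeros h G).card := Finset.card_pos.2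
        ⟨p, Finset.mem_inter.2 ⟨Finset.mem_union_left _ hp, mem_nonzeros.2 hGp⟩⟩
      have h4 := hL.2 G hG
      omega
    have h1 := (hover G hG w₁ j hj h1j hc1.le).2 hGw
    have h2 := (hover G hG w₁ j hj h1j hc1.le).1
    have h3 := (hover G hG w₂ i hi h2i hc2.le)
    have h4 := Finset.card_union_add_card_inter (nonzeros h G) (nonzeros h w₁)
    have h5 := Finset.card_union_add_card_inter (nonzeros h G) (nonzeros h w₂)
    have h6 : nonzeros h G ⊆ (nonzeros h G ∩ nonzeros h w₁) ∪ (nonzeros h G ∩ nonzeros h w₂) := by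
      rw [← Finset.inter_union_distrib_left]
      exact Finset.subset_inter subset_rfl hGsub
    have h7 := (Finset.card_le_card h6).trans (Finset.card_union_le _ _)
    have h8 := hL.2 G hG
    rcases (nonzeros h G ∩ nonzeros h w₂).eq_empty_or_nonempty with h0 | h0
    · rw [h0, Finset.card_empty] at h7
      omega
    · have := h3.2 h0
      omega
  have hsu := hstep u v i j hiZ hjZ hui hvi huj (by omega) (by omega) (by omega)
  have hsv := hstep v u j i hjZ hiZ hvj huj hvi (by omega) (by omega)
    (by rw [Finset.union_comm]; omega)
  have hZu' : nonzeros h u ⊆ zeros h L → (zeros h L ∩ nonzeros h u).card = (nonzeros h u).card :=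
    fun hs => by rw [Finset.inter_eq_right.2 hs]
  have hle := Finset.card_le_card (Finset.inter_subset_right (s₁ := zeros h L) (s₂ := nonzeros h u))
  rcases (show (zeros h L).card = 4 ∨ (zeros h L).card = 5 ∨ (zeros h L).card = 6 by omega) with
    hz | hz | hz
  · rw [hz] at h7
    omega
  · exfalso
    have hr2 : r = 2 := by
      rcases hsu with hs | hs
      · omega
      · have := hZu' hs; omega
    subst hr2
    have hsu := hsu.resolve_left (by omega)
    have hsv := hsv.resolve_left (by omega)
    -- Replacing `A` by `u` and `v` gives `m + 1` functionals with at most two common zeros. The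
    -- exclusive points of `A` are among them, because `u` and `v` vanish outside the common zeros
    -- of `L`. The double count then contradicts `m ≥ 3`.
    have hexcl : ∀ A ∈ L, (exclusive h L A).card ≤ 2 := by
      intro A hA
      have hM := hL.subset (Finset.erase_subset A L)
      have hanti := zeros_anti h (Finset.erase_subset A L)
      obtain ⟨h1, h2⟩ := hM.insert (hanti hjZ) huj hur
      obtain ⟨h3, h4⟩ := h1.insert (i := i) (by
        rw [zeros_insert]
        exact Finset.mem_sdiff.2 ⟨hanti hiZ, by simpa using hui⟩) hvi hvr
      have h5 := H.zeros_add_two_le h3 (by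
        rw [h4, h2, Finset.card_erase_of_mem hA]; omega)
      have h6 : exclusive h L A ⊆ zeros h (insert v (insert u (L.erase A))) := by
        intro x hx
        have hx' := mem_exclusive.1 hx
        have hxZ : x ∉ zeros h L := fun hxZ => hx'.1 (mem_zeros.1 hxZ A hA)
        rw [mem_zeros]
        intro w hw
        rw [Finset.mem_insert, Finset.mem_insert, Finset.mem_erase] at hw
        rcases hw with rfl | rfl | hw
        · by_contra h0; exact hxZ (hsv (mem_nonzeros.2 h0))
        · by_contra h0; exact hxZ (hsu (mem_nonzeros.2 h0))
        · exact hx'.2 w hw.2 hw.1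
      have := Finset.card_le_card h6
      omega
    have h8 := two_mul_card_le h L
    have h9 : ∑ u ∈ L, (exclusive h L u).card ≤ m * 2 := by
      rw [← hc]; exact Finset.sum_le_card_nsmul _ _ _ hexcl
    have h10 : ∑ u ∈ L, (nonzeros h u).card ≤ m * 3 := by
      rw [← hc]; exact Finset.sum_le_card_nsmul _ _ _ fun u hu => hL.2 u hu
    have := H.card
    omega
  · refine Or.inr (Or.inl ?_)
    rcases hsu with hs | hs
    · omega
    · have := hZu' hs; omega

/-- Distance four, at least three local groups. -/
theorem IsOptConfig.params_of_dist_four (hF : Nat.card F = 4) (H : IsOptConfig F h m r t 4)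
    (hm : 2 ≤ m) (ht : 1 ≤ t) (htr : t ≤ r) :
    (t = 1 ∧ (r = 1 ∨ r = 3 ∨ r = 4 ∨ r = 5 ∨ (r = 6 ∧ m ≤ 3) ∨ (r = 7 ∧ m = 2) ∨
      (m = 2 ∧ 2 ≤ r ∧ r ≤ 7))) ∨
    (t = 2 ∧ (r = 4 ∨ r = 5 ∨ (r = 6 ∧ m = 2))) ∨ (t = 3 ∧ r = 5) := by
  by_cases hcov : ∃ L : Finset (Module.Dual F V), IsLocalFamily h r L ∧ L.card = m + 1 ∧
      zeros h L = ∅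
  · obtain ⟨L, hL, hc, hz⟩ := hcov
    obtain ⟨h1, h2, h3⟩ := H.cover_dist_four hF hL hc hz hm ht
    have h4 : r ≤ 7 := by
      -- For `r ≥ 8` and `m ≥ 2` the product `m * r` exceeds what the third bound allows.
      by_contra! h
      obtain ⟨q, rfl⟩ : ∃ q, r = q + 8 := ⟨r - 8, by omega⟩
      obtain ⟨p, rfl⟩ : ∃ p, m = p + 2 := ⟨m - 2, by omega⟩
      have := h3 (by omega)
      have : (p + 2) * (q + 8) = p * q + 8 * p + 2 * q + 16 := by ring
      have := Nat.zero_le (p * q)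
      omega
    interval_cases r <;> omega
  · push Not at hcov
    have := H.not_cover_dist_four hF hm ht hcov
    omega

end DistFour

/-! ### Two groups: distance three, and caps without hyperoval sections -/

section TwoGroups

variable {F V ι : Type*} [Field F] [DecidableEq F] [AddCommGroup V] [Module F V] [Fintype ι]
  [FiniteDimensional F V] {h : ι → V} {r t d : ℕ}

omit [FiniteDimensional F V] in
theorem card_zeros_singleton [DecidableEq ι] (u : Module.Dual F V) :
    (zeros h {u}).card + (nonzeros h u).card = Fintype.card ι := by
  have : zeros h {u} = (nonzeros h u)ᶜ := by ext i; simp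
  rw [this, Finset.card_compl_add_card]

theorem IsOptConfig.card_zeros_inter_le [DecidableEq ι] (H : IsOptConfig F h 1 r t d)
    {u v : Module.Dual F V} {i j : ι} (hu : (nonzeros h u).card ≤ r + 1)
    (hv : (nonzeros h v).card ≤ r + 1) (huj : u (h j) ≠ 0) (hui : u (h i) = 0)
    (hvi : v (h i) ≠ 0) : (zeros h {u} ∩ zeros h {v}).card + 2 ≤ d := by
  classical
  obtain ⟨h1, h2⟩ := isLocalFamily_pair hu hv huj hui hvi
  have h3 := H.zeros_add_two_le h1 h2
  have : zeros h {u} ∩ zeros h {v} = zeros h {v, u} := by ext i; simp [and_comm]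
  rwa [this]

/-- Two local functionals without common zeros, or three functionals with few common zeros. -/
theorem IsOptConfig.two_groups_alternative (H : IsOptConfig F h 1 r t d) (ht : 1 ≤ t) (hd : 2 ≤ d)
    {C : Module.Dual F V} {j : ι} (hC : (nonzeros h C).card ≤ r + 1) (hCj : C (h j) ≠ 0) :
    3 * t + 3 ≤ Fintype.card ι ∨ ∃ E : Module.Dual F V, (nonzeros h E).card ≤ r + 1 ∧
      (∀ i, C (h i) = 0 → E (h i) ≠ 0) ∧ 2 * (t + d) ≤ Fintype.card ι + 2 := by
  classical
  have hn := H.card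
  have hz : ∀ u : Module.Dual F V, (nonzeros h u).card ≤ r + 1 → t + d ≤ (zeros h {u}).card + 1 :=
    fun u hu => by have := card_zeros_singleton (h := h) u; omega
  have hzC := hz C hC
  obtain ⟨i, hi⟩ : (zeros h {C}).Nonempty := by rw [← Finset.card_pos]; omega
  have hCi : C (h i) = 0 := by simpa using hi
  obtain ⟨E, hEi, hE⟩ := H.loc i
  have hzE := hz E hE
  have hCE := Finset.card_union_add_card_inter (zeros h {C}) (zeros h {E})
  -- Each zero set has at least `t + d - 1` points. If the two are disjoint, the second alternative
  -- holds. Otherwise a functional nonzero at a common zero provides a third zero set, and any two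
  -- of the three share at most `d - 2` points; so `n ≥ 3 * (t + d - 1) - 3 * (d - 2)`.
  rcases (zeros h {C} ∩ zeros h {E}).eq_empty_or_nonempty with h0 | ⟨k, hk⟩
  · rw [h0, Finset.card_empty] at hCE
    have := Finset.card_le_univ (zeros h {C} ∪ zeros h {E})
    refine Or.inr ⟨E, hE, fun i hi h' => ?_, by omega⟩
    exact Finset.notMem_empty i (h0 ▸ Finset.mem_inter.2 ⟨by simpa using hi, by simpa using h'⟩)
  · left
    have hCk : C (h k) = 0 := by simpa using Finset.mem_of_mem_inter_left hk
    have hEk : E (h k) = 0 := by simpa using Finset.mem_of_mem_inter_right hk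
    obtain ⟨D, hDk, hD⟩ := H.loc k
    have hzD := hz D hD
    have h1 := H.card_zeros_inter_le hC hE hCj hCi hEi
    have h2 := H.card_zeros_inter_le hC hD hCj hCk hDk
    have h3 := H.card_zeros_inter_le hE hD hEi hEk hDk
    have h4 := Finset.card_union_add_card_inter (zeros h {C} ∪ zeros h {E}) (zeros h {D})
    have h5 := Finset.card_le_univ (zeros h {C} ∪ zeros h {E} ∪ zeros h {D})
    rw [Finset.union_inter_distrib_right] at h4
    have h6 := Finset.card_union_le (zeros h {C} ∩ zeros h {D}) (zeros h {E} ∩ zeros h {D})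
    omega

/-- Distance three, two local groups. -/
theorem IsOptConfig.params_of_dist_three_of_two_groups (hF : Nat.card F = 4)
    (H : IsOptConfig F h 1 r t 3) (ht : 1 ≤ t)
    (hex : ∃ u : Module.Dual F V, (nonzeros h u).card = r + 1) :
    (t = 1 ∧ 2 ≤ r ∧ r ≤ 15) ∨ (t = 2 ∧ 3 ≤ r ∧ r ≤ 15) ∨ (t = 3 ∧ 6 ≤ r ∧ r ≤ 15) := by
  classical
  obtain ⟨C, hC⟩ := hex
  have hn := H.card
  have hfr := H.finrank
  obtain ⟨j, hj⟩ : (nonzeros h C).Nonempty := by rw [← Finset.card_pos]; omega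
  have hCj := mem_nonzeros.1 hj
  have hzC := card_zeros_singleton (h := h) C
  have hL : IsLocalFamily h r ({C} : Finset (Module.Dual F V)) := by
    have := (isLocalFamily_empty (F := F) h r).insert (i := j) (by simp) hCj hC.le
    exact this.1
  have h5 := H.zeros_le_five hF hL (Finset.card_singleton C)
  -- The support of `C` lies in an affine plane, so `r + 1 ≤ 16`.
  have h16 := (H.dist.comp (e := fun i : nonzeros h C => i.1)
    Subtype.val_injective).card_le_of_forall_ne_zero hF (f := C)
    (fun i => (mem_nonzeros (h := h)).1 i.2) (m := 2) (by omega)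
  rw [Fintype.card_coe] at h16
  rcases H.two_groups_alternative ht (by omega) hC.le hCj with h1 | ⟨E, hE, hCE, h1⟩
  · omega
  -- `E` vanishes at none of the `t + 2` zeros of `C`, which therefore lie on an affine line; so `t
  -- + 2 ≤ 4`.
  · have h4 := (H.dist.restrict (zeros h {C}) (commonKer {C})
      (fun i hi => mem_commonKer_of_mem_zeros hi)).card_le_of_forall_ne_zero hF
      (f := E.comp (commonKer {C}).subtype) (fun i => hCE i (mem_zeros.1 i.2 C (Finset.mem_singleton_self C))) (m := 1) (by
        have := H.finrank_commonKer hL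
        rw [Finset.card_singleton] at this
        omega)
    rw [Fintype.card_coe] at h4
    omega

/-- Caps with at most five points on every plane. -/
theorem RelDist.card_le_of_zeros_le_five (hF : Nat.card F = 4) (H : RelDist F h 4)
    (hV : Module.finrank F V = 4)
    (h5 : ∀ f : Module.Dual F V, f ≠ 0 → (zeros h {f}).card ≤ 5) {C : Module.Dual F V}
    (hC0 : C ≠ 0) (hC : 2 ≤ (zeros h {C}).card) :
    Fintype.card ι ≤ 17 ∧ ((zeros h {C}).card = 4 → Fintype.card ι ≤ 16) := by
  classical
  have : Finite F := Nat.finite_of_card_ne_zero (by omega)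
  have := Fintype.ofFinite F
  have := finite_of_finiteDimensional hF (Module.Dual F V)
  have := Fintype.ofFinite (Module.Dual F V)
  -- Counting along the line through two zeros `p`, `q` of `C`: fifteen nonzero functionals vanish
  -- on it, each further point is a zero of three of them, and each of them has at most three
  -- further zeros.
  obtain ⟨p, hp, q, hq, hpq⟩ := Finset.one_lt_card.1 (show 1 < (zeros h {C}).card by omega)
  have hCp : C (h p) = 0 := by simpa using hp
  have hCq : C (h q) = 0 := by simpa using hq
  let G : Finset (Module.Dual F V) := Finset.univ.filter fun f => f (h p) = 0 ∧ f (h q) = 0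
  let X : Finset ι := (Finset.univ.erase p).erase q
  have hX : X.card + 2 = Fintype.card ι := by
    have h1 := Finset.card_erase_add_one (Finset.mem_univ p)
    have h2 := Finset.card_erase_add_one (Finset.mem_erase.2 ⟨hpq.symm, Finset.mem_univ q⟩)
    rw [Finset.card_univ] at h1
    change ((Finset.univ.erase p).erase q).card + 2 = _
    omega
  have hG : G.card = 16 := by
    have := H.card_annihilating hF (s := {p, q}) (by rw [Finset.card_pair hpq]; omega)
    rw [Finset.card_pair hpq, hV] at this
    simp only [Finset.mem_insert, Finset.mem_singleton, forall_eq_or_imp, forall_eq] at this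
    change G.card * _ = _ at this
    omega
  let z : Module.Dual F V → ℕ := fun f => (X.filter fun i => f (h i) = 0).card
  have hsum : ∑ f ∈ G, z f = 4 * X.card := by
    simp only [z, Finset.card_filter]
    rw [Finset.sum_comm, mul_comm, ← smul_eq_mul, ← Finset.sum_const]
    refine Finset.sum_congr rfl fun i hi => ?_
    simp only [X, Finset.mem_erase, Finset.mem_univ, and_true] at hi
    have hc : ({p, q, i} : Finset ι).card = 3 :=
      Finset.card_eq_three.2 ⟨p, q, i, hpq, hi.2.symm, hi.1.symm, rfl⟩
    have := H.card_annihilating hF (s := {p, q, i}) (by omega)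
    rw [hc, hV] at this
    simp only [Finset.mem_insert, Finset.mem_singleton, forall_eq_or_imp, forall_eq] at this
    rw [← Finset.card_filter, Finset.filter_filter]
    simp only [and_assoc]
    omega
  have hz : ∀ f ∈ G, z f + 2 = (zeros h {f}).card := by
    intro f hf
    have hf' := (Finset.mem_filter.1 hf).2
    have : zeros h {f} = insert p (insert q (X.filter fun i => f (h i) = 0)) := by
      ext i
      simp only [mem_zeros, Finset.mem_singleton, forall_eq, Finset.mem_insert, Finset.mem_filter,
        X, Finset.mem_erase, Finset.mem_univ, and_true]
      constructor
      · intro hi; tauto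
      · rintro (rfl | rfl | hi)
        exacts [hf'.1, hf'.2, hi.2]
    rw [this, Finset.card_insert_of_notMem (by simp [X, hpq]),
      Finset.card_insert_of_notMem (by simp [X])]
  have h0 : (0 : Module.Dual F V) ∈ G := by simp [G]
  have hz0 : z 0 = X.card := by simp [z]
  rw [← Finset.add_sum_erase _ _ h0, hz0] at hsum
  have hGc : (G.erase 0).card = 15 := by rw [Finset.card_erase_of_mem h0]; omega
  have h3 : ∀ f ∈ G.erase 0, z f ≤ 3 := fun f hf => by
    have h1 := Finset.mem_erase.1 hf
    have := hz f h1.2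
    have := h5 f h1.1
    omega
  constructor
  · have : ∑ f ∈ G.erase 0, z f ≤ _ := Finset.sum_le_card_nsmul _ _ _ h3
    rw [hGc, smul_eq_mul] at this
    omega
  · intro hC4
    -- If `C` has only four zeros, its three nonzero multiples contribute just two further zeros
    -- each.
    let M : Finset (Module.Dual F V) := Finset.univ.image fun a : Fˣ => (a : F) • C
    have hM : M.card = 3 := by
      rw [Finset.card_image_of_injective, Finset.card_univ, ← Nat.card_eq_fintype_card,
        natCard_units hF]
      intro a b hab
      exact Units.ext (smul_left_injective F hC0 hab)
    have hMG : M ⊆ G.erase 0 := by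
      intro f hf
      obtain ⟨a, -, rfl⟩ := Finset.mem_image.1 hf
      refine Finset.mem_erase.2 ⟨smul_ne_zero a.ne_zero hC0, ?_⟩
      simp [G, hCp, hCq]
    have hMz : ∀ f ∈ M, z f ≤ 2 := by
      intro f hf
      have h1 := hz f (Finset.mem_of_mem_erase (hMG hf))
      obtain ⟨a, -, rfl⟩ := Finset.mem_image.1 hf
      have : zeros h {(a : F) • C} = zeros h {C} := by ext i; simp
      rw [this] at h1
      omega
    have h1 := Finset.sum_sdiff (f := z) hMG
    have h2 : ∑ f ∈ M, z f ≤ _ := Finset.sum_le_card_nsmul _ _ _ hMz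
    have h4 : ∑ f ∈ G.erase 0 \ M, z f ≤ _ := Finset.sum_le_card_nsmul _ _ 3 fun f hf =>
      h3 f (Finset.mem_sdiff.1 hf).1
    rw [Finset.card_sdiff_of_subset hMG, hGc, hM, smul_eq_mul] at h4
    rw [hM, smul_eq_mul] at h2
    omega

end TwoGroups

/-! ### A generic exhaustive search -/

section Search

/-- Tests `p` on all ways to split off an element together with the elements after it. -/
def allSplits (p : ℕ → List ℕ → Bool) : List ℕ → Bool
  | [] => true
  | c :: cs => p c cs && allSplits p cs

/-- Tests `leaf` on all extensions of `acc` by `k` elements of a list of candidates. After `c` has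
been chosen, a candidate `v` is kept only if `ok acc c v`. -/
def searchAll (ok : List ℕ → ℕ → ℕ → Bool) (leaf : List ℕ → Bool) : ℕ → List ℕ → List ℕ → Bool
  | 0, acc, _ => leaf acc
  | k + 1, acc, cs => allSplits (fun c ds => Nat.blt ds.length k ||
      searchAll ok leaf k (c :: acc) (ds.filter (ok acc c))) cs

/-- All later elements of the list survive the choice of the earlier ones. -/
def Compatible (ok : List ℕ → ℕ → ℕ → Bool) : List ℕ → List ℕ → Prop
  | _, [] => True
  | acc, c :: S => (∀ v ∈ S, ok acc c v = true) ∧ Compatible ok (c :: acc) S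

/-- A compatible sublist survives the filtering along its own path, so the search arrives at it; the
cut-off by the number of remaining candidates never drops a list of full length. -/
theorem searchAll_sound {ok : List ℕ → ℕ → ℕ → Bool} {leaf : List ℕ → Bool} {k : ℕ} :
    ∀ {acc cs S : List ℕ}, searchAll ok leaf k acc cs = true → S.Sublist cs → S.length = k →
      Compatible ok acc S → leaf (S.reverse ++ acc) = true := by
  induction k with
  | zero =>
    intro acc cs S h _ hS _
    obtain rfl := List.length_eq_zero_iff.1 hS
    simpa [searchAll] using h
  | succ k ih =>
    intro acc cs
    induction cs with
    | nil =>
      intro S _ hsub hS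
      rw [List.sublist_nil.1 hsub] at hS
      simp at hS
    | cons c cs ihc =>
      intro S h hsub hS hok
      simp only [searchAll, allSplits, Bool.and_eq_true, Bool.or_eq_true] at h
      obtain ⟨h1, h2⟩ := h
      cases hsub with
      | cons _ hsub => exact ihc (by simpa [searchAll] using h2) hsub hS hok
      | cons_cons _ hsub =>
        rename_i S
        rw [List.length_cons] at hS
        have hlen := hsub.length_le
        have h3 : searchAll ok leaf k (c :: acc) (cs.filter (ok acc c)) = true := by
          refine h1.resolve_left fun hb => ?_
          have := Nat.le_of_ble_eq_true hb
          omega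
        have h4 : S.Sublist (cs.filter (ok acc c)) := by
          rw [← List.filter_eq_self.2 hok.1]
          exact hsub.filter _
        have := ih h3 h4 (by omega) hok.2
        simpa using this

/-- The search meets a set only in the order of the candidates. Requiring the tests for all orders
of the elements makes the statement independent of it. -/
theorem searchAll_finset {ok : List ℕ → ℕ → ℕ → Bool} {leaf : List ℕ → Bool} {k : ℕ}
    {acc cs : List ℕ} (h : searchAll ok leaf k acc cs = true) (hcs : cs.Nodup) {T : Finset ℕ}
    (hT : ∀ v ∈ T, v ∈ cs) (hk : T.card = k) (hacc : acc.Nodup) (hdisj : ∀ x ∈ acc, x ∉ T)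
    (hok : ∀ (A : List ℕ) (c v : ℕ), (∀ x ∈ A, x ∈ T ∨ x ∈ acc) → c ∈ T → v ∈ T →
      (v :: c :: A).Nodup → ok A c v = true) :
    ∃ S : List ℕ, S.Nodup ∧ (∀ x, x ∈ S ↔ x ∈ T) ∧ leaf (S ++ acc) = true := by
  have hmem : ∀ x, x ∈ cs.filter (· ∈ T) ↔ x ∈ T := fun x => by
    rw [List.mem_filter, decide_eq_true_iff]
    exact ⟨fun hx => hx.2, fun hx => ⟨hT x hx, hx⟩⟩
  have hnd : (cs.filter (· ∈ T)).Nodup := hcs.filter _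
  have hlen : (cs.filter (· ∈ T)).length = k := by
    rw [← hk, ← List.toFinset_card_of_nodup hnd]
    congr 1
    ext x
    rw [List.mem_toFinset, hmem]
  have hcompat : ∀ (S A : List ℕ), (∀ x ∈ S, x ∈ T) → (∀ x ∈ A, x ∈ T ∨ x ∈ acc) →
      (S.reverse ++ A).Nodup → Compatible ok A S := by
    intro S
    induction S with
    | nil => exact fun _ _ _ _ => trivial
    | cons c S ih =>
      intro A hS hA hn
      rw [List.reverse_cons, List.append_assoc, List.singleton_append] at hn
      refine ⟨fun v hv => ?_, ih (c :: A) (fun x hx => hS x (List.mem_cons_of_mem _ hx)) ?_ hn⟩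
      · refine hok A c v hA (hS c List.mem_cons_self) (hS v (List.mem_cons_of_mem _ hv)) ?_
        refine hn.sublist ?_
        rw [← List.singleton_append]
        exact List.Sublist.append (List.singleton_sublist.2 (List.mem_reverse.2 hv))
          (List.Sublist.refl _)
      · intro x hx
        rcases List.mem_cons.1 hx with rfl | hx
        exacts [Or.inl (hS _ List.mem_cons_self), hA x hx]
  refine ⟨(cs.filter (· ∈ T)).reverse, List.nodup_reverse.2 hnd,
    fun x => by rw [List.mem_reverse, hmem], ?_⟩
  refine searchAll_sound h List.filter_sublist hlen ?_
  refine hcompat _ _ (fun x hx => (hmem x).1 hx) (fun x hx => Or.inr hx) ?_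
  rw [List.nodup_append]
  refine ⟨List.nodup_reverse.2 hnd, hacc, ?_⟩
  rintro x hx y hy rfl
  exact hdisj x hy ((hmem x).1 (List.mem_reverse.1 hx))

end Search

/-! ### Vectors as packed codes in a basis -/

section Code

variable {F W : Type*} [Field F] [AddCommGroup W] [Module F W] {ω : F} {n : ℕ}

theorem pack_lt : ∀ {ds : List ℕ}, (∀ d ∈ ds, d < 4) → pack ds < 4 ^ ds.length
  | [], _ => by simp [pack]
  | d :: ds, h => by
    have h1 := pack_lt (ds := ds) fun e he => h e (List.mem_cons_of_mem _ he)
    have h2 := h d List.mem_cons_self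
    rw [List.length_cons, pow_succ, pack]
    omega

/-- The vector with a given packed code in a basis. -/
noncomputable def decode (ω : F) (b : Module.Basis (Fin n) F W) (v : ℕ) : W :=
  ∑ i : Fin n, unpack ω v i • b i

theorem IsQuatGen.decode_xor (hω : IsQuatGen ω) (b : Module.Basis (Fin n) F W) (u v : ℕ) :
    decode ω b (u ^^^ v) = decode ω b u + decode ω b v := by
  simp only [decode, hω.unpack_xor, Pi.add_apply, add_smul, Finset.sum_add_distrib]

theorem IsQuatGen.exists_decode (hω : IsQuatGen ω) (b : Module.Basis (Fin n) F W) (x : W) :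
    ∃ v < 4 ^ n, decode ω b v = x := by
  choose d hd hdx using fun i => hω.exists_code (b.repr x i)
  have h4 : ∀ e ∈ List.ofFn d, e < 4 := fun e he => by
    obtain ⟨i, rfl⟩ := (List.mem_ofFn' d e).1 he
    exact hd i
  refine ⟨pack (List.ofFn d), by simpa using pack_lt h4, ?_⟩
  rw [decode]
  conv_rhs => rw [← b.sum_repr x]
  refine Finset.sum_congr rfl fun i _ => ?_
  rw [unpack_pack h4, ← hdx]
  simp

theorem IsQuatGen.decode_eq_zero (hω : IsQuatGen ω) (b : Module.Basis (Fin n) F W) {v : ℕ}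
    (hv : v < 4 ^ n) (h : decode ω b v = 0) : v = 0 := by
  refine hω.unpack_eq_zero (funext fun i => ?_)
  by_cases hi : i < n
  · exact Fintype.linearIndependent_iff.1 b.linearIndependent (fun i => unpack ω v i) h ⟨i, hi⟩
  · have : v < 2 ^ (2 * i) := by
      rw [pow_mul]
      exact hv.trans_le (Nat.pow_le_pow_right (by omega) (by omega))
    rw [unpack, Nat.div_eq_of_lt this]
    rfl

/-- The packed code of a vector in a basis. -/
noncomputable def code (hω : IsQuatGen ω) (b : Module.Basis (Fin n) F W) (x : W) : ℕ :=
  (hω.exists_decode b x).choose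

variable (hω : IsQuatGen ω) (b : Module.Basis (Fin n) F W)

theorem code_lt (x : W) : code hω b x < 4 ^ n := (hω.exists_decode b x).choose_spec.1

theorem decode_code (x : W) : decode ω b (code hω b x) = x := (hω.exists_decode b x).choose_spec.2

include hω in
theorem IsQuatGen.add_self_vec (x : W) : x + x = 0 := by
  rw [← one_smul F x, ← add_smul, hω.add_self, zero_smul]

include hω in
theorem IsQuatGen.sub_vec (x y : W) : x - y = x + y := by
  rw [sub_eq_add_neg, eq_comm, add_right_inj, ← add_eq_zero_iff_eq_neg]
  exact hω.add_self_vec y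

theorem code_decode {v : ℕ} (hv : v < 4 ^ n) : code hω b (decode ω b v) = v := by
  rw [← Nat.xor_eq_zero_iff]
  have h4 : 4 ^ n = 2 ^ (2 * n) := by rw [pow_mul]; norm_num
  refine hω.decode_eq_zero b (h4 ▸ Nat.xor_lt_two_pow (h4 ▸ code_lt hω b _) (h4 ▸ hv)) ?_
  rw [hω.decode_xor, decode_code, hω.add_self_vec]

theorem code_injective : Function.Injective (code hω b) := fun x y hxy => by
  rw [← decode_code hω b x, hxy, decode_code]

theorem code_add (x y : W) : code hω b (x + y) = code hω b x ^^^ code hω b y := by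
  have h4 : 4 ^ n = 2 ^ (2 * n) := by rw [pow_mul]; norm_num
  rw [← code_decode hω b (v := code hω b x ^^^ code hω b y)
    (h4 ▸ Nat.xor_lt_two_pow (h4 ▸ code_lt hω b _) (h4 ▸ code_lt hω b _)), hω.decode_xor,
    decode_code, decode_code]

theorem code_sub (x y : W) : code hω b (x - y) = code hω b x ^^^ code hω b y := by
  rw [hω.sub_vec, code_add]

theorem code_zero : code hω b 0 = 0 := by
  have h := code_add hω b 0 0
  rw [add_zero, Nat.xor_self] at h
  exact h

theorem code_eq_zero {x : W} : code hω b x = 0 ↔ x = 0 := by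
  rw [← code_zero hω b, (code_injective hω b).eq_iff]

/-- Multiplication by the generator on codes with at most four digits. -/
def genMul (v : ℕ) : ℕ :=
  Nat.xor (Nat.shiftLeft (Nat.land (Nat.xor v (Nat.shiftRight v 1)) 85) 1)
    (Nat.land (Nat.shiftRight v 1) 85)

/-- For a digit with low bit `x` and high bit `y`, `ω * (x + y * ω) = y + (x + y) * ω`. The mask
`85`, in binary `01010101`, selects the low bits of four digits. -/
theorem genMul_digit : ∀ v < 256, ∀ i < 4,
    genMul v / 2 ^ (2 * i) % 4 = mulCode 2 (v / 2 ^ (2 * i) % 4) := by decide +kernel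

theorem genMul_lt : ∀ m ≤ 4, ∀ v < 4 ^ m, genMul v < 4 ^ m := by decide +kernel

theorem code_smul_gen (hn : n ≤ 4) (x : W) : code hω b (ω • x) = genMul (code hω b x) := by
  rw [← code_decode hω b (genMul_lt n hn _ (code_lt hω b x))]
  congr 1
  conv_lhs => rw [← decode_code hω b x]
  rw [decode, decode, Finset.smul_sum]
  refine Finset.sum_congr rfl fun i _ => ?_
  have hv : code hω b x < 256 := (code_lt hω b x).trans_le
    (Nat.pow_le_pow_right (by omega) hn : 4 ^ n ≤ 4 ^ 4)
  rw [smul_smul, unpack, unpack, genMul_digit _ hv i (by omega),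
    hω.quat_mul (by omega) (Nat.mod_lt _ (by omega))]
  rfl

theorem code_smul_gen_sq (hn : n ≤ 4) (x : W) :
    code hω b (ω ^ 2 • x) = genMul (code hω b x) ^^^ code hω b x := by
  rw [hω.sq, add_smul, one_smul, code_add, code_smul_gen hω b hn]

theorem code_basis (i : Fin n) : code hω b (b i) = 4 ^ (i : ℕ) := by
  rw [← code_decode hω b (v := 4 ^ (i : ℕ)) (Nat.pow_lt_pow_right (by omega) i.2)]
  congr 1
  rw [decode, Finset.sum_eq_single i]
  · rw [unpack, pow_mul, show 2 ^ 2 = 4 from rfl, Nat.div_self (by positivity)]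
    exact (one_smul F _).symm
  · intro j _ hj
    have : unpack ω (4 ^ (i : ℕ)) j = 0 := by
      rw [unpack, pow_mul, hω.quat_eq_zero]
      change 4 ^ (i : ℕ) / 4 ^ (j : ℕ) % 4 = 0
      rcases lt_or_gt_of_ne (Fin.val_ne_of_ne hj) with h | h
      · rw [Nat.pow_div h.le (by omega)]
        obtain ⟨e, he⟩ : ∃ e, (i : ℕ) - j = e + 1 := ⟨(i : ℕ) - j - 1, by omega⟩
        rw [he, pow_succ, Nat.mul_mod_left]
      · rw [Nat.div_eq_of_lt (Nat.pow_lt_pow_right (by omega) h)]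
    rw [this, zero_smul]
  · simp

end Code

/-! ### Normal form of hyperovals -/

section Hyperoval

variable {F W ι : Type*} [Field F] [DecidableEq F] [AddCommGroup W] [Module F W] [Fintype ι] {ω : F}

theorem RelDist.eq_zero_of_sum_three {h : ι → W} (H : RelDist F h 4) {i j k : ι} (hij : i ≠ j)
    (hik : i ≠ k) (hjk : j ≠ k) {x y z : F} (e : x • h i + y • h j + z • h k = 0) : x = 0 := by
  classical
  have hc : ({i, j, k} : Finset ι).card = 3 := Finset.card_eq_three.2 ⟨i, j, k, hij, hik, hjk, rfl⟩
  have := H.eq_zero (s := {i, j, k}) (x := fun l => if l = i then x else if l = j then y else z)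
    (by omega) (by
      rw [Finset.sum_insert (by simp [hij, hik]), Finset.sum_pair hjk]
      simpa [hij.symm, hik.symm, hjk.symm, add_assoc] using e) i (by simp)
  simpa using this

omit [DecidableEq F] in
theorem IsQuatGen.eq_sq (hω : IsQuatGen ω) {u v : F} (hu0 : u ≠ 0) (hu1 : u ≠ 1) (hv0 : v ≠ 0)
    (hv1 : v ≠ 1) (huv : u ≠ v) : v = u ^ 2 := by
  have h4 : (ω ^ 2) ^ 2 = ω := by
    have h2 : (2 : F) = 0 := by rw [← one_add_one_eq_two]; exact hω.add_self 1
    have := hω.sq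
    grind
  rcases hω.cases u with rfl | rfl | rfl | rfl <;> rcases hω.cases v with rfl | rfl | rfl | rfl <;>
    first | rfl | exact h4.symm | exact absurd rfl huv | exact absurd rfl hu0 |
      exact absurd rfl hu1 | exact absurd rfl hv0 | exact absurd rfl hv1

omit [DecidableEq F] in
/-- Three distinct nonzero field elements are proportional to `1, ρ, ρ ^ 2`. -/
theorem IsQuatGen.exists_ratio (hω : IsQuatGen ω) {x y z : F} (hx : x ≠ 0) (hy : y ≠ 0)
    (hz : z ≠ 0) (hxy : x ≠ y) (hxz : x ≠ z) (hyz : y ≠ z) :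
    ∃ ρ : F, (ρ = ω ∨ ρ = ω ^ 2) ∧ y = x * ρ ∧ z = x * ρ ^ 2 := by
  have h1 : x * (y / x) = y := mul_div_cancel₀ y hx
  have h2 : x * (z / x) = z := mul_div_cancel₀ z hx
  have hy1 : y / x ≠ 1 := fun h => hxy (by rw [← h1, h, mul_one])
  have hz1 : z / x ≠ 1 := fun h => hxz (by rw [← h2, h, mul_one])
  have hyz' : y / x ≠ z / x := fun h => hyz (by rw [← h1, h, h2])
  have h3 := hω.eq_sq (div_ne_zero hy hx) hy1 (div_ne_zero hz hx) hz1 hyz'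
  refine ⟨y / x, ?_, h1.symm, by rw [← h3, h2]⟩
  rcases hω.cases (y / x) with h | h | h | h
  exacts [absurd h (div_ne_zero hy hx), absurd h hy1, Or.inl h, Or.inr h]

omit [DecidableEq F] in
theorem IsQuatGen.quat_injOn (hω : IsQuatGen ω) {a b : ℕ} (ha : a < 4) (hb : b < 4)
    (h : quat ω a = quat ω b) : a = b := by
  have h1 := hω.quat_xor ha hb
  rw [h, hω.add_self, hω.quat_eq_zero, Nat.xor_eq_zero_iff] at h1
  exact h1

/-- The codes of the multiples of the points of a hyperoval, as a bit mask. -/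
def hyperovalMask : ℕ := 9385823236096332062

set_option synthInstance.maxSize 2000 in
set_option synthInstance.maxHeartbeats 200000 in
-- The mask marks the nonzero multiples of the unit vectors, of `(1, 1, 1)`, and of `(1, ω, ω ^ 2)`
-- and `(1, ω ^ 2, ω)`. The multiples of the last two are the triples of distinct nonzero digits.
theorem digits_of_hyperovalMask : ∀ v < 64, Nat.testBit hyperovalMask v = true →
    (v / 4 % 4 = 0 ∧ v / 16 % 4 = 0) ∨ (v % 4 = 0 ∧ v / 16 % 4 = 0) ∨
    (v % 4 = 0 ∧ v / 4 % 4 = 0) ∨ (v % 4 = v / 4 % 4 ∧ v / 4 % 4 = v / 16 % 4) ∨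
    (v % 4 ≠ 0 ∧ v / 4 % 4 ≠ 0 ∧ v / 16 % 4 ≠ 0 ∧ v % 4 ≠ v / 4 % 4 ∧ v % 4 ≠ v / 16 % 4 ∧
      v / 4 % 4 ≠ v / 16 % 4) := by decide +kernel

/-- Normal form of hyperovals. -/
theorem IsQuatGen.exists_hyperoval_basis (hω : IsQuatGen ω) {g : Fin 6 → W} (H : RelDist F g 4)
    (hW : Module.finrank F W = 3) : ∃ b : Module.Basis (Fin 3) F W,
      ∀ v < 64, Nat.testBit hyperovalMask v = true → ∃ p, ∃ s : F, decode ω b v = s • g p := by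
  -- The first three points form a basis, which is then scaled to make the fourth `(1, 1, 1)`. As no
  -- three points are dependent, the last two have nonzero and pairwise distinct coordinates; so
  -- they are proportional to `(1, ρ, ρ ^ 2)` for the two values `ω` and `ω ^ 2` of `ρ`, in some
  -- order.
  have hli : LinearIndependent F ![g 0, g 1, g 2] := by
    rw [Fintype.linearIndependent_iff]
    intro x hx
    simp only [Fin.sum_univ_three, Matrix.cons_val_zero, Matrix.cons_val_one, Matrix.cons_val] at hx
    have h0 := H.eq_zero_of_sum_three (i := 0) (j := 1) (k := 2) (by decide) (by decide)
      (by decide) hx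
    have h1 := H.eq_zero_of_sum_three (i := 1) (j := 0) (k := 2) (by decide) (by decide)
      (by decide) (x := x 1) (y := x 0) (z := x 2) (by rw [← hx]; abel)
    have h2 := H.eq_zero_of_sum_three (i := 2) (j := 0) (k := 1) (by decide) (by decide)
      (by decide) (x := x 2) (y := x 0) (z := x 1) (by rw [← hx]; abel)
    intro i
    fin_cases i
    exacts [h0, h1, h2]
  let c : Module.Basis (Fin 3) F W := basisOfLinearIndependentOfCardEqFinrank hli (by simp [hW])
  have hc0 : c 0 = g 0 := by simp [c]
  have hc1 : c 1 = g 1 := by simp [c]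
  have hc2 : c 2 = g 2 := by simp [c]
  -- no coordinate of another point vanishes
  have hne : ∀ (p : Fin 6) (x y z : F), 3 ≤ p → x • g 0 + y • g 1 + z • g 2 = g p →
      x ≠ 0 ∧ y ≠ 0 ∧ z ≠ 0 := by
    intro p x y z hp e
    have hp0 : p ≠ 0 := by rintro rfl; exact absurd hp (by decide)
    have hp1 : p ≠ 1 := by rintro rfl; exact absurd hp (by decide)
    have hp2 : p ≠ 2 := by rintro rfl; exact absurd hp (by decide)
    refine ⟨?_, ?_, ?_⟩ <;> rintro rfl
    · exact one_ne_zero (H.eq_zero_of_sum_three hp1 hp2 (by decide) (x := 1) (y := -y) (z := -z)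
        (by rw [← e]; module))
    · exact one_ne_zero (H.eq_zero_of_sum_three hp0 hp2 (by decide) (x := 1) (y := -x) (z := -z)
        (by rw [← e]; module))
    · exact one_ne_zero (H.eq_zero_of_sum_three hp0 hp1 (by decide) (x := 1) (y := -x) (z := -y)
        (by rw [← e]; module))
  have h3 := c.sum_repr (g 3)
  rw [Fin.sum_univ_three, hc0, hc1, hc2] at h3
  obtain ⟨ha0, ha1, ha2⟩ := hne 3 _ _ _ le_rfl h3
  obtain ⟨b, hb0, hb1, hb2⟩ : ∃ b : Module.Basis (Fin 3) F W, b 0 = c.repr (g 3) 0 • g 0 ∧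
      b 1 = c.repr (g 3) 1 • g 1 ∧ b 2 = c.repr (g 3) 2 • g 2 := by
    refine ⟨c.unitsSMul fun i => Units.mk0 (c.repr (g 3) i)
      (by fin_cases i; exacts [ha0, ha1, ha2]), ?_, ?_, ?_⟩
    · rw [← hc0]; exact Module.Basis.unitsSMul_apply (v := c) 0
    · rw [← hc1]; exact Module.Basis.unitsSMul_apply (v := c) 1
    · rw [← hc2]; exact Module.Basis.unitsSMul_apply (v := c) 2
  generalize c.repr (g 3) 0 = a₀ at *
  generalize c.repr (g 3) 1 = a₁ at *
  generalize c.repr (g 3) 2 = a₂ at *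
  have hb3 : b 0 + b 1 + b 2 = g 3 := by rw [hb0, hb1, hb2, h3]
  have hratio : ∀ p : Fin 6, 4 ≤ p → ∃ x ρ : F, x ≠ 0 ∧ (ρ = ω ∨ ρ = ω ^ 2) ∧
      g p = x • b 0 + (x * ρ) • b 1 + (x * ρ ^ 2) • b 2 := by
    intro p hp
    have e := b.sum_repr (g p)
    rw [Fin.sum_univ_three] at e
    generalize b.repr (g p) 0 = x at e
    generalize b.repr (g p) 1 = y at e
    generalize b.repr (g p) 2 = z at e
    have e' : (x * a₀) • g 0 + (y * a₁) • g 1 + (z * a₂) • g 2 = g p := by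
      rw [← e, hb0, hb1, hb2]; simp only [smul_smul]
    obtain ⟨h0, h1, h2⟩ := hne p _ _ _ (le_trans (by decide) hp) e'
    have hp0 : p ≠ 0 := by rintro rfl; exact absurd hp (by decide)
    have hp1 : p ≠ 1 := by rintro rfl; exact absurd hp (by decide)
    have hp2 : p ≠ 2 := by rintro rfl; exact absurd hp (by decide)
    have hp3 : p ≠ 3 := by rintro rfl; exact absurd hp (by decide)
    -- Two equal coordinates would put the point on the line through the fourth point and a basis
    -- point.
    have hxy : x ≠ y := by
      rintro rfl
      refine one_ne_zero (H.eq_zero_of_sum_three hp3 hp2 (by decide) (x := 1) (y := -x)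
        (z := (x - z) * a₂) ?_)
      rw [← e, ← hb3, hb2]; module
    have hxz : x ≠ z := by
      rintro rfl
      refine one_ne_zero (H.eq_zero_of_sum_three hp3 hp1 (by decide) (x := 1) (y := -x)
        (z := (x - y) * a₁) ?_)
      rw [← e, ← hb3, hb1]; module
    have hyz : y ≠ z := by
      rintro rfl
      refine one_ne_zero (H.eq_zero_of_sum_three hp3 hp0 (by decide) (x := 1) (y := -y)
        (z := (y - x) * a₀) ?_)
      rw [← e, ← hb3, hb0]; module
    obtain ⟨ρ, hρ, rfl, rfl⟩ := hω.exists_ratio (left_ne_zero_of_mul h0) (left_ne_zero_of_mul h1)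
      (left_ne_zero_of_mul h2) hxy hxz hyz
    exact ⟨x, ρ, left_ne_zero_of_mul h0, hρ, e.symm⟩
  obtain ⟨x₄, ρ₄, hx4, hρ4, e4⟩ := hratio 4 le_rfl
  obtain ⟨x₅, ρ₅, hx5, hρ5, e5⟩ := hratio 5 (by decide)
  have hρ : ρ₄ ≠ ρ₅ := by
    rintro rfl
    refine hx5 ((H.mono (by omega)).eq_zero_of_smul_eq (i := 4) (j := 5) (by decide) (b := x₄) ?_)
    rw [e4, e5]; module
  refine ⟨b, fun v hv hbit => ?_⟩
  have hdec : decode ω b v = quat ω (v % 4) • b 0 + quat ω (v / 4 % 4) • b 1 +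
      quat ω (v / 16 % 4) • b 2 := by
    rw [decode, Fin.sum_univ_three]
    simp [unpack]
  have q0 : quat ω 0 = 0 := rfl
  rcases digits_of_hyperovalMask v hv hbit with ⟨h1, h2⟩ | ⟨h1, h2⟩ | ⟨h1, h2⟩ | ⟨h1, h2⟩ |
    ⟨h1, h2, h3, h4, h5, h6⟩
  · exact ⟨0, quat ω (v % 4) * a₀, by rw [hdec, h1, h2, q0, hb0]; module⟩
  · exact ⟨1, quat ω (v / 4 % 4) * a₁, by rw [hdec, h1, h2, q0, hb1]; module⟩
  · exact ⟨2, quat ω (v / 16 % 4) * a₂, by rw [hdec, h1, h2, q0, hb2]; module⟩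
  · exact ⟨3, quat ω (v % 4), by rw [hdec, ← h2, ← h1, ← hb3]; module⟩
  · have hm : ∀ k, k % 4 < 4 := fun k => Nat.mod_lt _ (by omega)
    obtain ⟨τ, hτ, hy, hz⟩ := hω.exists_ratio
      (x := quat ω (v % 4)) (y := quat ω (v / 4 % 4)) (z := quat ω (v / 16 % 4))
      (by rwa [Ne, hω.quat_eq_zero]) (by rwa [Ne, hω.quat_eq_zero]) (by rwa [Ne, hω.quat_eq_zero])
      (fun h => h4 (hω.quat_injOn (hm _) (hm _) h)) (fun h => h5 (hω.quat_injOn (hm _) (hm _) h))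
      (fun h => h6 (hω.quat_injOn (hm _) (hm _) h))
    rw [hy, hz] at hdec
    generalize quat ω (v % 4) = x at hdec
    have hτ' : τ = ρ₄ ∨ τ = ρ₅ := by
      rcases hτ with rfl | rfl <;> rcases hρ4 with rfl | rfl <;> rcases hρ5 with rfl | rfl <;> tauto
    rcases hτ' with rfl | rfl
    · refine ⟨4, x / x₄, ?_⟩
      rw [hdec, e4, smul_add, smul_add, smul_smul, smul_smul, smul_smul, ← mul_assoc, ← mul_assoc,
        div_mul_cancel₀ _ hx4]
    · refine ⟨5, x / x₅, ?_⟩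
      rw [hdec, e5, smul_add, smul_add, smul_smul, smul_smul, smul_smul, ← mul_assoc, ← mul_assoc,
        div_mul_cancel₀ _ hx5]

end Hyperoval

/-! ### Caps with a hyperoval section, and distance four with two groups -/

section Caps

theorem Nat.beq_eq_false_iff_ne {a b : ℕ} : Nat.beq a b = false ↔ a ≠ b := by
  rw [← Bool.not_eq_true, Nat.beq_eq]

/-- Search for affine parts of caps containing a hyperoval: `v` is compatible with the point `c` and
the earlier points `acc` if no line through two of these points contains it and the line through
`c` and `v` misses the hyperoval. -/
def capOk (acc : List ℕ) (c v : ℕ) : Bool :=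
  !(Nat.testBit hyperovalMask (c ^^^ v)) && acc.all fun x =>
    !(Nat.beq (v ^^^ x) (genMul (c ^^^ x))) && !(Nat.beq (v ^^^ x) (genMul (c ^^^ x) ^^^ (c ^^^ x)))

def capCandidates : List ℕ :=
  (List.range 64).filter fun v => !(Nat.beq v 0) && !(Nat.testBit hyperovalMask v)

/-- Every leaf is rejected, so success means that none is reached: the origin and eight further
affine points never satisfy all the conditions. -/
theorem capSearch : searchAll capOk (fun _ => false) 8 [0] capCandidates = true := by
  decide +kernel

variable {F V ι : Type*} [Field F] [DecidableEq F] [AddCommGroup V] [Module F V] [Fintype ι]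

omit [DecidableEq F] in
theorem exists_isQuatGen (hF : Nat.card F = 4) : ∃ ω : F, IsQuatGen ω := by
  classical
  have hfin : Finite F := Nat.finite_of_card_ne_zero (by omega)
  have := Fintype.ofFinite F
  have h2 : ({0, 1} : Finset F).card < (Finset.univ : Finset F).card := by
    rw [Finset.card_univ, ← Nat.card_eq_fintype_card, hF]
    exact (Finset.card_le_two).trans_lt (by omega)
  obtain ⟨ω, -, hω⟩ := Finset.exists_mem_notMem_of_card_lt_card h2
  simp only [Finset.mem_insert, Finset.mem_singleton, not_or] at hω
  exact ⟨ω, isQuatGen hF hω.1 hω.2⟩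

/-- A cap containing a hyperoval has at most eight points off its plane. -/
theorem RelDist.card_nonzeros_le_eight (hF : Nat.card F = 4) [FiniteDimensional F V] {h : ι → V}
    (H : RelDist F h 4) (hV : Module.finrank F V = 4) {a : Module.Dual F V}
    (ha : (zeros h {a}).card = 6) : (nonzeros h a).card ≤ 8 := by
  classical
  obtain ⟨ω, hω⟩ := exists_isQuatGen hF
  by_contra! hlt
  obtain ⟨i₀, hi₀⟩ : (nonzeros h a).Nonempty := by rw [← Finset.card_pos]; omega
  have ha0 : a ≠ 0 := by rintro rfl; simp at hi₀
  have hker : Module.finrank F (LinearMap.ker a) = 3 := by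
    have := Module.Dual.finrank_ker_add_one_of_ne_zero ha0
    omega
  have e : Fin 6 ≃ zeros h {a} := (Finset.equivFinOfCardEq ha).symm
  have hp : ∀ p, a (h (e p)) = 0 := fun p => mem_zeros.1 (e p).2 a (Finset.mem_singleton_self a)
  let g : Fin 6 → LinearMap.ker a := fun p => ⟨h (e p), hp p⟩
  have hg : RelDist F g 4 := RelDist.of_comp (LinearMap.ker a).subtype
    (H.comp (e := fun p => (e p : ι)) (Subtype.val_injective.comp e.injective))
  obtain ⟨b, hb⟩ := hω.exists_hyperoval_basis hg hker
  -- The points off the plane are scaled to `a = 1`, and one of them is subtracted, so that they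
  -- become affine points in the kernel of `a` with that one as the origin.
  let y : ι → V := fun i => (a (h i))⁻¹ • h i
  have hy : ∀ i ∈ nonzeros h a, a (y i) = 1 := fun i hi => by
    have := mem_nonzeros.1 hi
    simp [y, this]
  let w : nonzeros h a → LinearMap.ker a := fun i =>
    ⟨y i - y i₀, by rw [LinearMap.mem_ker, map_sub, hy i i.2, hy i₀ hi₀, sub_self]⟩
  let c : nonzeros h a → ℕ := fun i => code hω b (w i)
  have hc0 : c ⟨i₀, hi₀⟩ = 0 := by
    rw [code_eq_zero]
    exact Subtype.ext (sub_self _)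
  have hinv : ∀ i : nonzeros h a, (a (h i))⁻¹ ≠ 0 := fun i => inv_ne_zero (mem_nonzeros.1 i.2)
  have hxor : ∀ i j, c i ^^^ c j = code hω b (w i - w j) := fun i j => (code_sub hω b _ _).symm
  have hwsub : ∀ i j, ((w i - w j : LinearMap.ker a) : V) = y i - y j := fun i j => by
    simp [w]
  -- A marked difference would put two affine points on a line with a point of the hyperoval.
  have hline : ∀ i j : nonzeros h a, i ≠ j →
      Nat.testBit hyperovalMask (c i ^^^ c j) = false := by
    intro i j hij
    rw [← Bool.not_eq_true]
    intro hbit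
    rw [hxor] at hbit
    obtain ⟨p, s, hs⟩ := hb _ (code_lt hω b _) hbit
    rw [decode_code] at hs
    have hs' : y i - y j = s • h (e p) := by rw [← hwsub, hs]; rfl
    have hpi : ∀ i : nonzeros h a, (i : ι) ≠ e p := fun i hip =>
      mem_nonzeros.1 i.2 (hip ▸ hp p)
    refine hinv i (H.eq_zero_of_sum_three (i := i) (j := j) (k := e p)
      (fun hij' => hij (Subtype.ext hij')) (hpi i) (hpi j) (y := -(a (h j))⁻¹) (z := -s) ?_)
    rw [neg_smul, neg_smul, ← hs']
    simp only [y]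
    abel
  -- No three affine points are collinear. The search uses this for the factors `ω` and `ω ^ 2`
  -- only, since `0` and `1` would mean coinciding points.
  have hcol : ∀ i j k : nonzeros h a, i ≠ j → i ≠ k → j ≠ k → ∀ s : F,
      w j - w k ≠ s • (w i - w k) := by
    intro i j k hij hik hjk s hs
    have hs' : y j - y k = s • (y i - y k) := by rw [← hwsub, ← hwsub, hs]; rfl
    refine hinv j (H.eq_zero_of_sum_three (i := j) (j := i) (k := k)
      (fun h => hij (Subtype.ext h).symm) (fun h => hjk (Subtype.ext h))
      (fun h => hik (Subtype.ext h)) (y := -(s * (a (h i))⁻¹)) (z := (s - 1) * (a (h k))⁻¹) ?_)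
    have : y j - y k - s • (y i - y k) = 0 := sub_eq_zero.2 hs'
    rw [← this]
    simp only [y]
    module
  have hcinj : Function.Injective c := by
    intro i j hij
    by_contra hne
    have h1 := hxor i j
    rw [hij, Nat.xor_self] at h1
    have h2 : w i = w j := sub_eq_zero.1 ((code_eq_zero hω b).1 h1.symm)
    have h3 : y i = y j := by simpa [w, Subtype.ext_iff] using h2
    exact hinv i ((H.mono (by omega)).eq_zero_of_smul_eq (fun h => hne (Subtype.ext h)) h3)
  have hcard : 8 ≤ ((Finset.univ : Finset (nonzeros h a)).erase ⟨i₀, hi₀⟩).card := by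
    rw [Finset.card_erase_of_mem (Finset.mem_univ _), Finset.card_univ, Fintype.card_coe]
    omega
  obtain ⟨N, hN, hN8⟩ := Finset.exists_subset_card_eq hcard
  have hN0 : ∀ i ∈ N, i ≠ ⟨i₀, hi₀⟩ := fun i hi => Finset.ne_of_mem_erase (hN hi)
  have hmem : ∀ v ∈ N.image c, v ∈ capCandidates := by
    intro v hv
    obtain ⟨i, hi, rfl⟩ := Finset.mem_image.1 hv
    have h1 := hline i ⟨i₀, hi₀⟩ (hN0 i hi)
    rw [hc0, Nat.xor_zero] at h1
    have h2 : c i ≠ 0 := fun h0 => hN0 i hi (hcinj (h0.trans hc0.symm))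
    rw [capCandidates, List.mem_filter, List.mem_range, h1]
    refine ⟨code_lt hω b (w i), ?_⟩
    rw [Nat.beq_eq_false_iff_ne.2 h2]
    rfl
  have hdisj : ∀ x ∈ [0], x ∉ N.image c := by
    intro x hx hxN
    obtain ⟨i, hi, rfl⟩ := Finset.mem_image.1 hxN
    rw [List.mem_singleton, ← hc0] at hx
    exact hN0 i hi (hcinj hx)
  have hok : ∀ (A : List ℕ) (u v : ℕ), (∀ x ∈ A, x ∈ N.image c ∨ x ∈ [0]) → u ∈ N.image c →
      v ∈ N.image c → (v :: u :: A).Nodup → capOk A u v = true := by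
    intro A u v hA hu hv hnd
    obtain ⟨i, hi, rfl⟩ := Finset.mem_image.1 hu
    obtain ⟨j, hj, rfl⟩ := Finset.mem_image.1 hv
    simp only [List.nodup_cons, List.mem_cons, not_or] at hnd
    have hij : i ≠ j := fun h => hnd.1.1 (h ▸ rfl)
    rw [capOk, hline i j hij, Bool.not_false, Bool.true_and, List.all_eq_true]
    intro x hx
    obtain ⟨k, rfl⟩ : ∃ k, c k = x := by
      rcases hA x hx with hxN | hx0
      · obtain ⟨k, -, hk⟩ := Finset.mem_image.1 hxN
        exact ⟨k, hk⟩
      · exact ⟨_, hc0.trans (List.mem_singleton.1 hx0).symm⟩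
    have hik : i ≠ k := fun h => hnd.2.1 (h ▸ hx)
    have hjk : j ≠ k := fun h => hnd.1.2 (h ▸ hx)
    rw [hxor, hxor, ← code_smul_gen hω b (by omega), ← code_add, Bool.and_eq_true,
      Bool.not_eq_true', Bool.not_eq_true', Nat.beq_eq_false_iff_ne, Nat.beq_eq_false_iff_ne,
      (code_injective hω b).ne_iff, (code_injective hω b).ne_iff]
    refine ⟨hcol i j k hij hik hjk ω, ?_⟩
    have := hcol i j k hij hik hjk (ω + 1)
    rwa [add_smul, one_smul] at this
  obtain ⟨S, -, -, hS⟩ := searchAll_finset capSearch (List.nodup_range.filter _) hmem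
    (by rw [Finset.card_image_of_injective _ hcinj, hN8]) (by simp) hdisj hok
  exact Bool.noConfusion hS

variable {h : ι → V} {r t : ℕ}

/-- Distance four, two local groups. -/
theorem IsOptConfig.params_of_dist_four_of_two_groups (hF : Nat.card F = 4) [FiniteDimensional F V]
    (H : IsOptConfig F h 1 r t 4) (ht : 1 ≤ t)
    (hex : ∃ u : Module.Dual F V, (nonzeros h u).card = r + 1) :
    (t = 1 ∧ r ≤ 11) ∨ (t = 2 ∧ 3 ≤ r ∧ r ≤ 11) ∨ (t = 3 ∧ 5 ≤ r ∧ r ≤ 7) := by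
  classical
  obtain ⟨C, hC⟩ := hex
  have hn := H.card
  have hV : Module.finrank F V = 4 := by have := H.finrank; omega
  obtain ⟨j, hj⟩ : (nonzeros h C).Nonempty := by rw [← Finset.card_pos]; omega
  have hCj := mem_nonzeros.1 hj
  have hzC := card_zeros_singleton (h := h) C
  have h6 : ∀ f : Module.Dual F V, f ≠ 0 → (zeros h {f}).card ≤ 6 := by
    intro f hf
    have h1 := _root_.finrank_commonKer (L := {f}) (by
      rw [Finset.coe_singleton]; exact LinearIndepOn.singleton hf)
    rw [Finset.card_singleton] at h1
    rw [← Fintype.card_coe]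
    exact (H.dist.restrict (zeros h {f}) (commonKer {f})
      (fun i hi => mem_commonKer_of_mem_zeros hi)).card_le_six hF (by omega)
  have hC0 : C ≠ 0 := by rintro rfl; exact hCj rfl
  have h6C := h6 C hC0
  have hlow : t + 2 ≤ r + 1 ∨ t = 1 := by
    rcases H.two_groups_alternative ht (by omega) hC.le hCj with h1 | ⟨E, hE, hCE, h1⟩ <;> omega
  have hlow3 : t = 3 → 5 ≤ r := by
    rcases H.two_groups_alternative ht (by omega) hC.le hCj with h1 | ⟨E, hE, hCE, h1⟩ <;> omega
  -- The zeros of `C` number `t + 3`. If some plane has six points, then `n ≤ 6 + 8`. Otherwise all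
  -- planes have at most five points and `n ≤ 17`, and even `n ≤ 16` for `t = 1`, where `C` has
  -- exactly four zeros.
  by_cases hhex : ∃ a : Module.Dual F V, a ≠ 0 ∧ (zeros h {a}).card = 6
  · obtain ⟨a, -, ha⟩ := hhex
    have h8 := H.dist.card_nonzeros_le_eight hF hV ha
    have := card_zeros_singleton (h := h) a
    omega
  · push Not at hhex
    have h5 : ∀ f : Module.Dual F V, f ≠ 0 → (zeros h {f}).card ≤ 5 := fun f hf => by
      have := h6 f hf
      have := hhex f hf
      omega
    have h17 := H.dist.card_le_of_zeros_le_five hF hV h5 hC0 (by omega)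
    have := hhex C hC0
    have h5C := h5 C hC0
    obtain ⟨h17, h16⟩ := h17
    by_cases ht1 : t = 1
    · have := h16 (by omega)
      omega
    · omega

end Caps

/-! ### Lines of the projective plane of order four, and near-MDS bounds -/

section Arrangements

variable {F V ι : Type*} [Field F] [DecidableEq F] [AddCommGroup V] [Module F V] [Fintype ι]

omit [DecidableEq F] in
theorem finrank_le_finrank_ker_add_one [FiniteDimensional F V] (f : Module.Dual F V) :
    Module.finrank F V ≤ Module.finrank F (LinearMap.ker f) + 1 := by
  have h1 := LinearMap.finrank_range_add_finrank_ker f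
  have h2 := (LinearMap.range f).finrank_le
  rw [Module.finrank_self] at h2
  omega

/-- Ten planes in a three-dimensional space have a nonzero common point of four of them. -/
theorem not_card_eq_ten_of_zeros_le_three (hF : Nat.card F = 4) [FiniteDimensional F V]
    (hV : Module.finrank F V = 3) (p : ι → Module.Dual F V)
    (hz : ∀ e : V, e ≠ 0 → (Finset.univ.filter fun i => p i e = 0).card ≤ 3) :
    Fintype.card ι ≠ 10 := by
  classical
  intro hι
  obtain ⟨ω, hω⟩ := exists_isQuatGen hF
  have hω1 : ω ≠ 1 := by
    rintro rfl
    have := hω.sq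
    rw [one_pow, hω.add_self] at this
    exact one_ne_zero this
  have := finite_of_finiteDimensional hF V
  have := Fintype.ofFinite V
  let z : V → ℕ := fun e => (Finset.univ.filter fun i => p i e = 0).card
  let E : Finset V := Finset.univ.erase 0
  let M : ι → Finset V := fun i => E.filter fun e => p i e = 0
  let N : ι → ι → Finset V := fun i j => (M i).filter fun e => p j e = 0
  have hE : E.card = 63 := by
    rw [Finset.card_erase_of_mem (Finset.mem_univ _), Finset.card_univ, ← Nat.card_eq_fintype_card,
      natCard_eq_four_pow hF V, hV]
    norm_num
  have hMc : ∀ i, ∃ k, 2 ≤ k ∧ k ≤ 3 ∧ (M i).card + 1 = 4 ^ k ∧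
      ∀ j, ∃ l, l ≤ 3 ∧ k ≤ l + 1 ∧ (N i j).card + 1 = 4 ^ l := by
    intro i
    have h1 := finrank_le_finrank_ker_add_one (p i)
    have h2 := (LinearMap.ker (p i)).finrank_le
    refine ⟨Module.finrank F (LinearMap.ker (p i)), by omega, by omega, ?_, fun j => ?_⟩
    · rw [← natCard_eq_four_pow hF (LinearMap.ker (p i))]
      have : M i = (Finset.univ.filter fun e => p i e = 0).erase 0 := by
        ext e; simp [M, E]
      rw [this, Finset.card_erase_add_one (by simp), ← Fintype.card_subtype,
        ← Nat.card_eq_fintype_card]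
      rfl
    · have h3 := finrank_le_finrank_ker_add_one ((p j).comp (LinearMap.ker (p i)).subtype)
      have h4 := (LinearMap.ker ((p j).comp (LinearMap.ker (p i)).subtype)).finrank_le
      refine ⟨_, by omega, h3, ?_⟩
      rw [← natCard_eq_four_pow hF (LinearMap.ker ((p j).comp (LinearMap.ker (p i)).subtype))]
      have : N i j = (Finset.univ.filter fun e => p i e = 0 ∧ p j e = 0).erase 0 := by
        ext e; simp [N, M, E, and_assoc]
      rw [this, Finset.card_erase_add_one (by simp), ← Fintype.card_subtype,
        ← Nat.card_eq_fintype_card]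
      exact (Nat.card_congr (Equiv.subtypeSubtypeEquivSubtypeInter
        (fun e => p i e = 0) (fun e => p j e = 0))).symm
  have hsum : ∀ i, ∑ e ∈ M i, z e = ∑ j, (N i j).card := by
    intro i
    simp only [z, N, Finset.card_filter]
    exact Finset.sum_comm
  have hMsub : ∀ i, ∀ e ∈ M i, e ≠ 0 := fun i e he =>
    (Finset.mem_erase.1 (Finset.mem_of_mem_filter e he)).1
  have hNii : ∀ i, N i i = M i := fun i => by
    ext e; simp only [N, M, Finset.mem_filter]; tauto
  -- If `p i` were zero or proportional to another `p j`, too many zeros would accumulate on `M i`.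
  -- So `M i` has `15` elements, and each of the nine other functionals vanishes on `3` of them; the
  -- sum is `15 + 9 * 3`.
  have hM : ∀ i, (M i).card = 15 ∧ ∑ e ∈ M i, z e = 42 := by
    intro i
    obtain ⟨k, hk2, hk3, hk, hl⟩ := hMc i
    have h1 : ∑ e ∈ M i, z e ≤ (M i).card * 3 :=
      Finset.sum_le_card_nsmul _ _ _ fun e he => hz e (hMsub i e he)
    rw [hsum, ← Finset.add_sum_erase _ _ (Finset.mem_univ i), hNii] at h1
    have hc : (Finset.univ.erase i).card = 9 := by
      rw [Finset.card_erase_of_mem (Finset.mem_univ _), Finset.card_univ, hι]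
    obtain rfl | rfl : k = 2 ∨ k = 3 := by omega
    · refine ⟨by omega, ?_⟩
      have h3 : ∀ j, 3 ≤ (N i j).card := fun j => by
        obtain ⟨l, hl3, hkl, hNl⟩ := hl j
        have : 4 ^ 1 ≤ 4 ^ l := Nat.pow_le_pow_right (by omega) (by omega)
        omega
      have h4 : ∀ j ∈ Finset.univ.erase i, (N i j).card = 3 := by
        intro j hj
        rw [← Finset.add_sum_erase _ _ hj] at h1
        have h5 := Finset.card_nsmul_le_sum ((Finset.univ.erase i).erase j)
          (fun j => (N i j).card) 3 fun j _ => h3 j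
        rw [Finset.card_erase_of_mem hj, hc, smul_eq_mul] at h5
        obtain ⟨l, hl3, hkl, hNl⟩ := hl j
        have := h3 j
        interval_cases l <;> omega
      rw [hsum, ← Finset.add_sum_erase _ _ (Finset.mem_univ i), hNii, Finset.sum_congr rfl h4,
        Finset.sum_const, hc, smul_eq_mul]
      omega
    · exfalso
      have h3 := Finset.card_nsmul_le_sum (Finset.univ.erase i) (fun j => (N i j).card) 15
        fun j _ => by
          obtain ⟨l, hl3, hkl, hNl⟩ := hl j
          have : 4 ^ 2 ≤ 4 ^ l := Nat.pow_le_pow_right (by omega) (by omega)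
          omega
      rw [hc, smul_eq_mul] at h3
      omega
  -- The sum `42` is only three short of `15 * 3`, whereas a vector with `z e = 1` and its multiple
  -- by `ω` would together lose four.
  have hz1 : ∀ e, e ≠ 0 → z e ≠ 1 := by
    intro e he h1
    obtain ⟨i, hi⟩ := Finset.card_pos.1 (show 0 < z e by omega)
    have hie : p i e = 0 := (Finset.mem_filter.1 hi).2
    have hωe : ω • e ≠ e := fun h => by
      have : (ω - 1) • e = 0 := by rw [sub_smul, one_smul, h, sub_self]
      rcases smul_eq_zero.1 this with h | h
      exacts [hω1 (sub_eq_zero.1 h), he h]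
    have hmem : ({e, ω • e} : Finset V) ⊆ M i := by
      intro x hx
      rw [Finset.mem_insert, Finset.mem_singleton] at hx
      rcases hx with rfl | rfl
      · simp [M, E, he, hie]
      · simp [M, E, he, hie, hω.ne_zero]
    have hzω : z (ω • e) = z e := by simp [z, hω.ne_zero]
    have h2 := Finset.sum_sdiff (f := z) hmem
    rw [Finset.sum_pair hωe.symm, hzω, h1, (hM i).2] at h2
    have h3 : ∑ x ∈ M i \ {e, ω • e}, z x ≤ _ := Finset.sum_le_card_nsmul _ _ 3 fun x hx =>
      hz x (hMsub i x (Finset.mem_sdiff.1 hx).1)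
    rw [Finset.card_sdiff_of_subset hmem, Finset.card_pair hωe.symm, (hM i).1, smul_eq_mul] at h3
    omega
  have hs1 : ∑ e ∈ E, z e = 150 := by
    have : ∑ e ∈ E, z e = ∑ i, (M i).card := by
      simp only [z, M, Finset.card_filter]
      exact Finset.sum_comm
    rw [this, Finset.sum_congr rfl fun i _ => (hM i).1, Finset.sum_const, Finset.card_univ, hι]
    norm_num
  have hs2 : ∑ e ∈ E, z e * z e = 420 := by
    have : ∑ e ∈ E, z e * z e = ∑ i, ∑ e ∈ M i, z e := by
      simp only [M, Finset.sum_filter]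
      rw [Finset.sum_comm]
      refine Finset.sum_congr rfl fun e _ => ?_
      rw [← Finset.sum_filter, Finset.sum_const, smul_eq_mul]
    rw [this, Finset.sum_congr rfl fun i _ => (hM i).2, Finset.sum_const, Finset.card_univ, hι]
    norm_num
  let T : Finset V := E.filter fun e => z e = 0
  -- As `z` takes only the values `0, 2, 3`, the polynomial `z ^ 2 - 5 * z + 6` is six times the
  -- indicator function of `T`. It follows that `T` has eight elements; but multiplication by `ω`
  -- acts on `T` with orbits of length three.
  have hT : 6 * T.card + 5 * 150 = 420 + 6 * 63 := by
    rw [← hs1, ← hs2, ← hE, Finset.card_filter, Finset.mul_sum, Finset.mul_sum,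
      ← Finset.sum_add_distrib, mul_comm 6 E.card, ← smul_eq_mul, ← Finset.sum_const,
      ← Finset.sum_add_distrib]
    refine Finset.sum_congr rfl fun e he => ?_
    have h0 := (Finset.mem_erase.1 he).1
    have h1 : z e ≤ 3 := hz e h0
    have h2 := hz1 e h0
    generalize z e = y at h1 h2 ⊢
    interval_cases y <;> simp at h2 ⊢
  have hT8 : T.card = 8 := by omega
  have hω3 : ω ^ 3 = 1 := by
    have h2 : (2 : F) = 0 := by rw [← one_add_one_eq_two]; exact hω.add_self 1
    have := hω.sq
    grind
  have hTω : ∀ e : V, e ∈ T → ω • e ∈ T := fun e he => by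
    simp only [T, E, z, Finset.mem_filter, Finset.mem_erase, Finset.mem_univ, and_true] at he ⊢
    simpa [hω.ne_zero] using he
  let f : Function.End T := fun e => ⟨ω • e.1, hTω e e.2⟩
  have hf3 : ∀ e, f (f (f e)) = e := fun e => Subtype.ext (by
    simp only [f, smul_smul]
    rw [show ω * (ω * ω) = ω ^ 3 by ring, hω3, one_smul])
  have hσ : f ^ 3 ^ 1 = 1 := funext hf3
  have : Fact (Nat.Prime 3) := ⟨Nat.prime_three⟩
  have hmod := Equiv.Perm.card_fixedPoints_modEq hσ
  have hfix : IsEmpty (Function.fixedPoints f) := ⟨fun e => by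
    have h1 : ω • (e.1 : V) = e.1 := congrArg Subtype.val e.2
    have h2 : (ω - 1) • (e.1 : V) = 0 := by rw [sub_smul, one_smul, h1, sub_self]
    rcases smul_eq_zero.1 h2 with h | h
    · exact hω1 (sub_eq_zero.1 h)
    · have h3 := (Finset.mem_erase.1 (Finset.mem_of_mem_filter _ e.1.2)).1
      exact h3 h⟩
  rw [Fintype.card_coe, hT8, Fintype.card_eq_zero] at hmod
  exact absurd hmod (by decide)

theorem card_le_nine_of_zeros_le_three (hF : Nat.card F = 4) [FiniteDimensional F V]
    (hV : Module.finrank F V = 3) (p : ι → Module.Dual F V)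
    (hz : ∀ e : V, e ≠ 0 → (Finset.univ.filter fun i => p i e = 0).card ≤ 3) :
    Fintype.card ι ≤ 9 := by
  classical
  by_contra! hlt
  obtain ⟨s, -, hs⟩ := Finset.exists_subset_card_eq (s := (Finset.univ : Finset ι)) (n := 10)
    (by rw [Finset.card_univ]; omega)
  refine not_card_eq_ten_of_zeros_le_three hF hV (fun i : s => p i) (fun e he => ?_)
    (by rw [Fintype.card_coe, hs])
  refine le_trans ?_ (hz e he)
  exact Finset.card_le_card_of_injOn Subtype.val
    (fun i hi => Finset.mem_filter.2 ⟨Finset.mem_univ _, (Finset.mem_filter.1 hi).2⟩)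
    Subtype.val_injective.injOn

variable {h : ι → V} {d : ℕ}

/-- Near-MDS relations: few points beyond the dimension bound the distance. -/
theorem RelDist.dist_le_six (hF : Nat.card F = 4) [FiniteDimensional F V] (H : RelDist F h d)
    (hV : Module.finrank F V ≤ d) (hc : Fintype.card ι = d + 3) : d ≤ 6 := by
  let φ := Fintype.linearCombination F h
  have h1 := LinearMap.finrank_range_add_finrank_ker φ
  have h2 := (LinearMap.range φ).finrank_le
  rw [Module.finrank_fintype_fun_eq_card, hc] at h1
  -- There are three independent relations. The coordinates are `d + 3` functionals on their span,
  -- and a nonzero relation has at most three zero coordinates.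
  obtain ⟨f, hf⟩ := exists_linearIndependent_of_le_finrank
    (show 3 ≤ Module.finrank F (LinearMap.ker φ) by omega)
  let ψ := Fintype.linearCombination F f
  have hψ : Function.Injective ψ := hf.fintypeLinearCombination_injective
  have := card_le_nine_of_zeros_le_three hF (V := Fin 3 → F) (by simp)
    (fun i : ι => (LinearMap.proj i).comp ((LinearMap.ker φ).subtype.comp ψ)) (fun e he => by
      have hx0 : ((ψ e : LinearMap.ker φ) : ι → F) ≠ 0 := fun h0 => he (hψ (by
        rw [map_zero]; exact Subtype.ext h0))
      have h3 := H (ψ e : LinearMap.ker φ) (ψ e).2 hx0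
      have h4 := Finset.card_filter_add_card_filter_not (s := Finset.univ)
        (fun i : ι => ((ψ e : LinearMap.ker φ) : ι → F) i = 0)
      rw [Finset.card_univ, hc] at h4
      have h5 : (Finset.univ.filter fun i : ι => ((ψ e : LinearMap.ker φ) : ι → F) i = 0).card ≤ 3 := by
        change d ≤ (Finset.univ.filter fun i : ι => ¬((ψ e : LinearMap.ker φ) : ι → F) i = 0).card at h3
        omega
      exact h5)
  omega

/-- Systems of vectors with defect one. -/
theorem RelDist.card_le_add_six (hF : Nat.card F = 4) [FiniteDimensional F V] (H : RelDist F h d)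
    (hd : 5 ≤ d) (hV : Module.finrank F V = d) : Fintype.card ι ≤ d + 6 := by
  classical
  by_contra! hlt
  -- The functionals vanishing on `d - 3` chosen points form a space of dimension three, on which
  -- the other points act as functionals. A nonzero member vanishes on at most `d` points, as these
  -- form an arc in dimension `d - 1 ≥ 4`, hence on at most three of the others. So there are at
  -- most nine others.
  obtain ⟨Q, -, hQ⟩ := Finset.exists_subset_card_eq (s := (Finset.univ : Finset ι)) (n := d - 3)
    (by rw [Finset.card_univ]; omega)
  let E : Submodule F (Module.Dual F V) :=
    (Submodule.span F (Set.range fun i : Q => h i)).dualAnnihilator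
  have hE : Module.finrank F E = 3 := by
    have hli : LinearIndependent F (fun i : Q => h i) := H.linearIndepOn (by omega)
    have h1 := finrank_span_eq_card hli
    have h2 := Subspace.finrank_add_finrank_dualAnnihilator_eq
      (Submodule.span F (Set.range fun i : Q => h i))
    rw [Fintype.card_coe] at h1
    change Module.finrank F _ + Module.finrank F E = _ at h2
    omega
  have hEQ : ∀ f ∈ E, ∀ i ∈ Q, f (h i) = 0 := fun f hf i hi =>
    (Submodule.mem_dualAnnihilator f).1 hf _ (Submodule.subset_span ⟨⟨i, hi⟩, rfl⟩)
  have h9 := card_le_nine_of_zeros_le_three hF (V := E) hE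
    (fun i : {i // i ∉ Q} => (Module.Dual.eval F V (h i)).comp E.subtype) (fun f hf => by
      have hf0 : (f : Module.Dual F V) ≠ 0 := fun h0 => hf (Subtype.ext h0)
      have hker : Module.finrank F (commonKer {(f : Module.Dual F V)}) + 1 = d := by
        have := _root_.finrank_commonKer (L := {(f : Module.Dual F V)}) (by
          rw [Finset.coe_singleton]; exact LinearIndepOn.singleton hf0)
        rwa [Finset.card_singleton, hV] at this
      obtain ⟨e, rfl⟩ : ∃ e, d = e + 1 := ⟨d - 1, by omega⟩
      have h1 := (H.restrict (zeros h {(f : Module.Dual F V)}) (commonKer {(f : Module.Dual F V)})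
        (fun i hi => mem_commonKer_of_mem_zeros hi)).card_le_add_one hF (by omega) (by omega)
      rw [Fintype.card_coe] at h1
      have h2 : Q ⊆ zeros h {(f : Module.Dual F V)} := fun i hi =>
        mem_zeros.2 fun u hu => by
          rw [Finset.mem_singleton.1 hu]
          exact hEQ f f.2 i hi
      have h3 := Finset.card_sdiff_of_subset h2
      have h4 : (Finset.univ.filter fun i : {i // i ∉ Q} => (f : Module.Dual F V) (h i) = 0).card ≤
          (zeros h {(f : Module.Dual F V)} \ Q).card :=
        Finset.card_le_card_of_injOn Subtype.val (fun i hi => by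
          refine Finset.mem_sdiff.2 ⟨mem_zeros.2 fun u hu => ?_, i.2⟩
          rw [Finset.mem_singleton.1 hu]
          exact (Finset.mem_filter.1 hi).2) Subtype.val_injective.injOn
      refine le_trans h4 ?_
      omega)
  rw [Fintype.card_subtype_compl, Fintype.card_coe] at h9
  omega

end Arrangements

/-! ### Distance at least five: partition into blocks -/

section Blocks

variable {F V W ι κ : Type*} [Field F] [DecidableEq F] [AddCommGroup V] [Module F V] [Fintype ι]
  [AddCommGroup W] [Module F W] [Fintype κ] [DecidableEq κ] {q d : ℕ}

/-- Families of points `w b` indexed by blocks, regarded as affine points: every nontrivial relation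
whose coefficients add up to zero in every block involves at least `d` points. -/
def BlockRel (F : Type*) {W κ : Type*} [Field F] [AddCommGroup W] [Module F W] [Fintype κ]
    {q : ℕ} (w : κ → Fin q → W) (d : ℕ) : Prop :=
  ∀ x : κ → Fin q → F, (∀ b, ∑ i, x b i = 0) → ∑ b, ∑ i, x b i • w b i = 0 →
    ∀ s : Finset (κ × Fin q), (∀ b i, x b i ≠ 0 → (b, i) ∈ s) → s.card < d → ∀ b i, x b i = 0

omit [DecidableEq F] in
/-- Relations given by a list of coefficients and positions. -/
theorem BlockRel.eq_zero_of_list {w : κ → Fin q → W} (H : BlockRel F w d)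
    (L : List (F × (κ × Fin q))) (hL : L.length < d)
    (h0 : ∀ b, (L.map fun t => if t.2.1 = b then t.1 else 0).sum = 0)
    (hw : (L.map fun t => t.1 • w t.2.1 t.2.2).sum = 0) (p : κ × Fin q) :
    (L.map fun t => if t.2 = p then t.1 else 0).sum = 0 := by
  let x : List (F × (κ × Fin q)) → κ → Fin q → F := fun L b i =>
    (L.map fun t => if t.2 = (b, i) then t.1 else 0).sum
  have hx : ∀ t L b i, x (t :: L) b i = (if t.2 = (b, i) then t.1 else 0) + x L b i :=
    fun t L b i => by simp [x]
  have h1 : ∀ L b, ∑ i, x L b i = (L.map fun t => if t.2.1 = b then t.1 else 0).sum := by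
    intro L b
    induction L with
    | nil => simp [x]
    | cons t L ih =>
      simp only [hx, Finset.sum_add_distrib, ih, List.map_cons, List.sum_cons]
      congr 1
      obtain ⟨c, b', i'⟩ := t
      by_cases hb : b' = b <;> simp [Prod.ext_iff, hb]
  have h2 : ∀ L, ∑ b, ∑ i, x L b i • w b i = (L.map fun t => t.1 • w t.2.1 t.2.2).sum := by
    intro L
    induction L with
    | nil => simp [x]
    | cons t L ih =>
      simp only [hx, add_smul, Finset.sum_add_distrib, ih, List.map_cons, List.sum_cons]
      congr 1
      obtain ⟨c, b', i'⟩ := t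
      simp only [Prod.ext_iff]
      rw [Finset.sum_eq_single b', Finset.sum_eq_single i']
      · simp
      · intro i _ hi; simp [hi.symm]
      · simp
      · intro b _ hb; simp [hb.symm]
      · simp
  refine H (x L) (fun b => (h1 L b).trans (h0 b)) ((h2 L).trans hw) (L.map Prod.snd).toFinset ?_
    ((List.toFinset_card_le _).trans_lt (by simpa using hL)) p.1 p.2
  intro b i hbi
  rw [List.mem_toFinset]
  by_contra hno
  refine hbi (List.sum_eq_zero fun c hc => ?_)
  obtain ⟨t, ht, rfl⟩ := List.mem_map.1 hc
  refine if_neg fun h => hno ?_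
  rw [← h]
  exact List.mem_map_of_mem ht

variable {h : ι → V} {m r t : ℕ}

/-- The common zeros of `m` functionals, at least `t + d - 1` in number, form an arc in dimension `d
- 1 ≥ 4`, which has at most `d` points. -/
theorem IsOptConfig.t_eq_one (hF : Nat.card F = 4) [FiniteDimensional F V]
    (H : IsOptConfig F h m r t d) (hd : 5 ≤ d) (ht : 1 ≤ t) : t = 1 := by
  obtain ⟨L, hL, hc⟩ := H.exists_family ht (by omega)
  have h1 := H.le_zeros hL hc
  have h2 := H.zeros_le_dist hF hd hL hc
  omega

variable [DecidableEq (Module.Dual F V)]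

/-- A smaller support could be completed to a family of size `m` with more than `d` common zeros. -/
theorem IsOptConfig.card_nonzeros_eq (hF : Nat.card F = 4) [FiniteDimensional F V]
    (H : IsOptConfig F h m r 1 d) (hd : 5 ≤ d) (hm : 1 ≤ m) {u : Module.Dual F V} {i : ι}
    (hu : (nonzeros h u).card ≤ r + 1) (hi : u (h i) ≠ 0) : (nonzeros h u).card = r + 1 := by
  classical
  have h1 := (isLocalFamily_empty (F := F) h r).insert (i := i) (by simp) hi hu
  obtain ⟨j, rfl⟩ : ∃ j, m = 1 + j := ⟨m - 1, by omega⟩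
  have h2 := H.zeros_le_of_bound le_rfl (by omega)
    (fun L hL hc => H.zeros_le_dist hF hd hL hc) h1.1 (j := j) (by rw [h1.2]; simp)
  have h3 := card_zeros_singleton (h := h) u
  have h4 := H.card
  rw [add_mul] at h4
  change (zeros h {u}).card ≤ _ at h2
  omega

/-- For `m ≥ 2` an overlap would again lead to more than `d` common zeros. For `m = r = 1` two
functionals leave at most `d - 2` of the `d + 2` points, so two supports of size at most two cannot
overlap. -/
theorem IsOptConfig.disjoint_nonzeros (hF : Nat.card F = 4) [FiniteDimensional F V]
    (H : IsOptConfig F h m r 1 d) (hd : 5 ≤ d) (hm : 2 ≤ m ∨ m = 1 ∧ r = 1)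
    {u v : Module.Dual F V} {i j : ι} (hu : (nonzeros h u).card ≤ r + 1)
    (hv : (nonzeros h v).card ≤ r + 1) (huj : u (h j) ≠ 0) (hui : u (h i) = 0)
    (hvi : v (h i) ≠ 0) : Disjoint (nonzeros h u) (nonzeros h v) := by
  classical
  rw [Finset.disjoint_iff_inter_eq_empty, ← Finset.card_eq_zero]
  rcases hm with hm | ⟨rfl, rfl⟩
  · have := H.card_inter_le le_rfl (by omega) hm
      (fun L hL hc => H.zeros_le_dist hF hd hL hc) hu hv huj hui hvi
    omega
  · obtain ⟨h1, h2⟩ := isLocalFamily_pair hu hv huj hui hvi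
    have h3 := H.zeros_add_two_le h1 h2
    have h4 := card_zeros_pair (h := h) u v
    have h5 := Finset.card_union_add_card_inter (nonzeros h u) (nonzeros h v)
    have h6 := H.card
    omega

/-- The supports of suitable local functionals partition the points. -/
theorem IsOptConfig.exists_partition (hF : Nat.card F = 4) [FiniteDimensional F V]
    (H : IsOptConfig F h m r 1 d) (hd : 5 ≤ d) (hm : 2 ≤ m ∨ m = 1 ∧ r = 1) :
    ∃ L : Finset (Module.Dual F V), IsLocalFamily h r L ∧ (∀ u ∈ L, (nonzeros h u).card = r + 1) ∧
      (∀ u ∈ L, ∀ v ∈ L, u ≠ v → Disjoint (nonzeros h u) (nonzeros h v)) ∧ zeros h L = ∅ := by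
  classical
  have := finite_of_finiteDimensional hF (Module.Dual F V)
  obtain ⟨L, -, ⟨hL, hc, hdis⟩, hmax⟩ := Finite.exists_le_maximal
    (p := fun L : Finset (Module.Dual F V) => IsLocalFamily h r L ∧
      (∀ u ∈ L, (nonzeros h u).card = r + 1) ∧
      ∀ u ∈ L, ∀ v ∈ L, u ≠ v → Disjoint (nonzeros h u) (nonzeros h v)) (a := ∅)
    ⟨isLocalFamily_empty h r, by simp, by simp⟩
  refine ⟨L, hL, hc, hdis, ?_⟩
  by_contra hne
  obtain ⟨i, hi⟩ := Finset.nonempty_iff_ne_empty.2 hne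
  obtain ⟨w, hwi, hw⟩ := H.loc i
  obtain ⟨h1, h2⟩ := hL.insert hi hwi hw
  have h3 : ∀ u ∈ L, Disjoint (nonzeros h u) (nonzeros h w) := by
    intro u hu
    obtain ⟨j, hj⟩ : (nonzeros h u).Nonempty := by rw [← Finset.card_pos, hc u hu]; omega
    exact H.disjoint_nonzeros hF hd hm (hc u hu).le hw (mem_nonzeros.1 hj) (mem_zeros.1 hi u hu) hwi
  have h4 := hmax (y := insert w L) ⟨h1, ?_, ?_⟩ (Finset.subset_insert w L)
  · have := Finset.card_le_card h4
    omega
  · intro u hu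
    rcases Finset.mem_insert.1 hu with rfl | hu
    exacts [H.card_nonzeros_eq hF hd (by omega) hw hwi, hc u hu]
  · intro u hu v hv huv
    rcases Finset.mem_insert.1 hu with rfl | hu' <;> rcases Finset.mem_insert.1 hv with rfl | hv'
    exacts [absurd rfl huv, (h3 v hv').symm, h3 u hu', hdis u hu' v hv' huv]

/-- Each point is scaled so that the functional of its block takes the value one, and the first
point of the block is subtracted to reach the common kernel. A relation whose coefficients add up to
zero on every block does not notice this translation, so it is a relation between the original
points. -/
theorem IsOptConfig.exists_blocks (hF : Nat.card F = 4) [FiniteDimensional F V]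
    (H : IsOptConfig F h m r 1 d) (hd : 5 ≤ d) (hm : 2 ≤ m ∨ m = 1 ∧ r = 1) :
    ∃ (g : ℕ) (K : Submodule F V) (w : Fin g → Fin (r + 1) → K),
      g * (r + 1) = m * (r + 1) + d ∧ Module.finrank F K + g + 1 = m + d ∧ BlockRel F w d := by
  classical
  obtain ⟨L, hL, hc, hdis, hz⟩ := H.exists_partition hF hd hm
  have hcard : L.card * (r + 1) = Fintype.card ι := by
    rw [← smul_eq_mul, ← Finset.sum_const, ← Finset.sum_congr rfl hc,
      ← Finset.card_biUnion hdis, ← Finset.card_univ]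
    congr 1
    ext i
    simp only [Finset.mem_biUnion, Finset.mem_univ, iff_true]
    have : i ∉ zeros h L := by rw [hz]; simp
    rw [mem_zeros] at this
    push Not at this
    obtain ⟨u, hu, hui⟩ := this
    exact ⟨u, hu, mem_nonzeros.2 hui⟩
  let blk : Fin L.card ≃ L := L.equivFin.symm
  let e : ∀ b, Fin (r + 1) ≃ nonzeros h (blk b).1 := fun b =>
    (Finset.equivFinOfCardEq (hc _ (blk b).2)).symm
  let pos : Fin L.card × Fin (r + 1) → ι := fun p => (e p.1 p.2).1
  have hpos : ∀ p, (blk p.1).1 (h (pos p)) ≠ 0 := fun p => mem_nonzeros.1 (e p.1 p.2).2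
  have hpos0 : ∀ p, ∀ v ∈ L, v ≠ (blk p.1).1 → v (h (pos p)) = 0 := by
    intro p v hv hne
    by_contra h0
    exact Finset.disjoint_left.1 (hdis v hv _ (blk p.1).2 hne) (mem_nonzeros.2 h0) (e p.1 p.2).2
  have hinj : Function.Injective pos := by
    rintro ⟨b, i⟩ ⟨b', i'⟩ hp
    have hb : b = b' := by
      by_contra hne
      refine hpos (b, i) ?_
      rw [hp]
      exact hpos0 (b', i') _ (blk b).2 fun h => hne (blk.injective (Subtype.ext h))
    subst hb
    rw [Prod.mk.injEq]
    exact ⟨rfl, (e b).injective (Subtype.ext hp)⟩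
  let s : Fin L.card → Fin (r + 1) → F := fun b i => ((blk b).1 (h (pos (b, i))))⁻¹
  have hs : ∀ b i, s b i ≠ 0 := fun b i => inv_ne_zero (hpos (b, i))
  let a : Fin L.card → Fin (r + 1) → V := fun b i => s b i • h (pos (b, i))
  have ha : ∀ b i, ∀ v ∈ L, v (a b i) = if v = (blk b).1 then 1 else 0 := by
    intro b i v hv
    split_ifs with hvb
    · subst hvb
      simp only [a, s, map_smul, smul_eq_mul]
      exact inv_mul_cancel₀ (hpos (b, i))
    · simp only [a, map_smul, hpos0 (b, i) v hv hvb, smul_zero]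
  refine ⟨L.card, commonKer L, fun b i => ⟨a b i - a b 0, mem_commonKer.2 fun v hv => by
    rw [map_sub, ha b i v hv, ha b 0 v hv, sub_self]⟩, by have := H.card; omega, ?_, ?_⟩
  · have := H.finrank_commonKer hL
    omega
  · intro x hx0 hx t hxt ht b i
    have h1 : ∑ b, ∑ i, x b i • a b i = 0 := by
      have h2 := congrArg (commonKer L).subtype hx
      simp only [map_sum, map_smul, Submodule.subtype_apply, smul_sub, Finset.sum_sub_distrib,
        ← Finset.sum_smul, hx0, map_zero, zero_smul, sub_zero] at h2
      exact h2
    have h3 := (H.dist.comp hinj).eq_zero ht (x := fun p => x p.1 p.2 * s p.1 p.2) (by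
      rw [← Fintype.sum_prod_type'] at h1
      rw [← h1]
      refine (Finset.sum_subset (Finset.subset_univ t) fun p _ hp => ?_).trans
        (Finset.sum_congr rfl fun p _ => ?_)
      · have : x p.1 p.2 = 0 := by
          by_contra h0
          exact hp (hxt p.1 p.2 h0)
        rw [this, zero_mul, zero_smul]
      · exact mul_smul _ _ _)
    by_contra h0
    exact mul_ne_zero h0 (hs b i) (h3 (b, i) (hxt b i h0))

end Blocks

/-! ### Bounds for blocks of two, three and five points -/

section BlockBounds

variable {F V W ι κ : Type*} [Field F] [DecidableEq F] [AddCommGroup V] [Module F V] [Fintype ι]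
  [AddCommGroup W] [Module F W] [Fintype κ] [DecidableEq κ] {q d : ℕ}

/-- Multiples of pairwise independent vectors are distinct. -/
theorem RelDist.smul_injective {h : ι → V} (H : RelDist F h 3) :
    Function.Injective fun p : ι × Fˣ => (p.2 : F) • h p.1 := by
  rintro ⟨i, c⟩ ⟨j, e⟩ hab
  by_cases hij : i = j
  · subst hij
    have h1 : ((c : F) - e) • h i = 0 := by rw [sub_smul, sub_eq_zero]; exact hab
    rcases smul_eq_zero.1 h1 with h2 | h2
    · rw [Units.ext (sub_eq_zero.1 h2)]
    · exact absurd h2 ((H.mono (by omega)).ne_zero i)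
  · exact absurd (H.eq_zero_of_smul_eq hij hab) c.ne_zero

theorem relDist_three_of_pairs [Nontrivial ι] {h : ι → V}
    (H : ∀ i j, i ≠ j → ∀ a b : F, a • h i + b • h j = 0 → a = 0) : RelDist F h 3 := by
  classical
  intro x hx hx0
  by_contra! hlt
  obtain ⟨i, hi⟩ := Function.ne_iff.1 hx0
  change (Finset.univ.filter fun i => x i ≠ 0).card < 3 at hlt
  set S := Finset.univ.filter fun i => x i ≠ 0 with hS
  have hiS : i ∈ S := Finset.mem_filter.2 ⟨Finset.mem_univ _, hi⟩
  obtain ⟨j, hij, hj⟩ : ∃ j, i ≠ j ∧ S ⊆ {i, j} := by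
    by_cases hone : (S.erase i).Nonempty
    · obtain ⟨j, hj⟩ := hone
      have hij := (Finset.ne_of_mem_erase hj).symm
      refine ⟨j, hij, (Finset.eq_of_subset_of_card_le ?_ ?_).ge⟩
      · intro k hk
        rcases Finset.mem_insert.1 hk with rfl | hk
        · exact hiS
        · exact Finset.mem_singleton.1 hk ▸ Finset.mem_of_mem_erase hj
      · rw [Finset.card_pair hij]; omega
    · obtain ⟨j, hj⟩ := exists_ne i
      refine ⟨j, hj.symm, fun k hk => ?_⟩
      rw [Finset.not_nonempty_iff_eq_empty] at hone
      by_contra hne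
      have : k ∈ S.erase i := Finset.mem_erase.2
        ⟨fun h => hne (h ▸ Finset.mem_insert_self _ _), hk⟩
      rw [hone] at this
      simp at this
  refine hi (H i j hij (x i) (x j) ?_)
  rw [← Finset.sum_pair (f := fun k => x k • h k) hij, ← hx]
  refine Finset.sum_subset (Finset.subset_univ _) fun k _ hk => ?_
  have : x k = 0 := by
    by_contra h0
    exact hk (hj (Finset.mem_filter.2 ⟨Finset.mem_univ _, h0⟩))
  rw [this, zero_smul]

theorem BlockRel.eq_zero_of_block {w : κ → Fin q → W} (H : BlockRel F w d) {b : κ} {x : Fin q → F}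
    (h0 : ∑ i, x i = 0) (hw : ∑ i, x i • w b i = 0) (hd : hammingNorm x < d) : x = 0 := by
  funext i
  have := H (fun c i => if c = b then x i else 0) (fun c => by by_cases hc : c = b <;> simp [hc, h0])
    (by
      rw [Finset.sum_eq_single b]
      · simpa using hw
      · intro c _ hc; simp [hc]
      · simp)
    ((Finset.univ.filter fun i => x i ≠ 0).map ⟨Prod.mk b, Prod.mk_right_injective b⟩)
    (by
      intro c i hci
      by_cases hc : c = b
      · subst hc; simpa using hci
      · simp [hc] at hci)
    (by rw [Finset.card_map]; exact hd) b i
  simpa using this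

omit [DecidableEq F] in
-- The equation is a relation between at most five points, two of block `b` and three of `b'`, with
-- zero sum on both blocks. So no difference in one block is parallel to the plane through three
-- points of another.
theorem BlockRel.cross {w : κ → Fin q → W} (H : BlockRel F w 6) {b b' : κ} (hb : b ≠ b')
    {u v i j k : Fin q} (huv : u ≠ v) {c s t : F}
    (h : c • (w b u - w b v) = s • (w b' i - w b' j) + t • (w b' i - w b' k)) : c = 0 := by
  have := H.eq_zero_of_list
    [(c, (b, u)), (-c, (b, v)), (-(s + t), (b', i)), (s, (b', j)), (t, (b', k))] (by simp)
    (fun a => by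
      by_cases h1 : b = a
      · subst h1; simp [hb.symm]
      · by_cases h2 : b' = a
        · subst h2; simp [h1]
        · simp [h1, h2])
    (by
      have h' := sub_eq_zero.2 h
      simp only [List.map_cons, List.map_nil, List.sum_cons, List.sum_nil]
      refine Eq.trans ?_ h'
      module) (b, u)
  simpa [hb.symm, huv.symm] using this

/-- The differences of points in the same block. -/
def blockDiff {q : ℕ} (w : κ → Fin q → W) (p : κ × {p : Fin q × Fin q // p.1 < p.2}) : W :=
  w p.1 p.2.1.1 - w p.1 p.2.1.2

/-- Proportional differences would give a relation between at most four points; its coefficients at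
the two ends of the first pair show that it is trivial. -/
theorem BlockRel.relDist_blockDiff {w : κ → Fin q → W} (H : BlockRel F w d) (hd : 5 ≤ d)
    [Nontrivial (κ × {p : Fin q × Fin q // p.1 < p.2})] : RelDist F (blockDiff w) 3 := by
  refine relDist_three_of_pairs ?_
  rintro ⟨b, ⟨i, j⟩, hij⟩ ⟨b', ⟨k, l⟩, hkl⟩ hne a c hac
  dsimp only at hij hkl
  have key := H.eq_zero_of_list [(a, (b, i)), (-a, (b, j)), (c, (b', k)), (-c, (b', l))]
    (by simp; omega)
    (fun a => by by_cases h1 : b = a <;> by_cases h2 : b' = a <;> simp [h1, h2])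
    (by
      simp only [blockDiff] at hac
      simp only [List.map_cons, List.map_nil, List.sum_cons, List.sum_nil]
      refine Eq.trans ?_ hac
      module)
  have h1 := key (b, i)
  have h2 := key (b, j)
  simp only [List.map_cons, List.map_nil, List.sum_cons, List.sum_nil, Prod.mk.injEq, true_and,
    hij.ne, hij.ne', if_true, if_false, add_zero, zero_add] at h1 h2
  by_cases hb : b' = b
  · subst hb
    simp only [true_and] at h1 h2
    by_cases hki : k = i
    · subst hki
      have : l ≠ j := by rintro rfl; exact hne rfl
      simpa [hij.ne, this] using h2
    · by_cases hli : l = i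
      · subst hli
        have : k ≠ j := (hkl.trans hij).ne
        simpa [hij.ne, this] using h2
      · simpa [hki, hli] using h1
  · simpa [hb] using h1

omit [DecidableEq κ] in
/-- Blocks of two points. -/
theorem BlockRel.relDist_of_two {w : κ → Fin 2 → W} {e : ℕ} (H : BlockRel F w (2 * e)) :
    RelDist F (fun b => w b 1 - w b 0) e := by
  intro x hx hx0
  by_contra! hlt
  refine hx0 (funext fun b => ?_)
  have := H (fun b i => if i = 1 then x b else -x b) (fun b => by simp [Fin.sum_univ_two]) (by
      rw [← hx]
      refine Finset.sum_congr rfl fun b _ => ?_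
      simp only [Fin.sum_univ_two, zero_ne_one, if_true, if_false]
      module)
    ((Finset.univ.filter fun b => x b ≠ 0) ×ˢ Finset.univ) (fun b i hbi => by
      refine Finset.mem_product.2 ⟨Finset.mem_filter.2 ⟨Finset.mem_univ _, fun h0 => hbi ?_⟩,
        Finset.mem_univ _⟩
      simp [h0]) (by
      change (Finset.univ.filter fun b => x b ≠ 0).card < e at hlt
      rw [Finset.card_product, Finset.card_univ, Fintype.card_fin]
      omega) b 1
  simpa using this

/-- Here `d = 2 * e`, and the `g = m + e` differences have distance `e` in dimension `e - 1`. There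
are at most five of them for `e = 3`, six for `e = 4`, and `e` for `e ≥ 5`. -/
theorem BlockRel.params_of_two (hF : Nat.card F = 4) {m g : ℕ} {w : Fin g → Fin 2 → W}
    [FiniteDimensional F W] (H : BlockRel F w d) (hd : 5 ≤ d) (hm : 1 ≤ m)
    (hg : g * 2 = m * 2 + d) (hW : Module.finrank F W + g + 1 = m + d) :
    m ≤ 2 ∧ (d = 6 ∨ d = 8) := by
  obtain ⟨e, rfl⟩ : ∃ e, d = 2 * e := ⟨d / 2, by omega⟩
  have h1 := H.relDist_of_two
  rcases (by omega : e = 3 ∨ e = 4 ∨ 5 ≤ e) with rfl | rfl | he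
  · have := h1.card_le_five hF (by omega)
    rw [Fintype.card_fin] at this
    omega
  · have := h1.card_le_six hF (by omega)
    rw [Fintype.card_fin] at this
    omega
  · have := RelDist.card_le_add_one hF (m := e - 1) (by omega)
      ((Nat.sub_add_cancel (by omega : 1 ≤ e)).symm ▸ h1) (by omega)
    rw [Fintype.card_fin] at this
    omega

/-- Blocks of five points in distance five. -/
theorem BlockRel.not_five_five (hF : Nat.card F = 4) {g : ℕ} {w : Fin g → Fin 5 → W}
    [FiniteDimensional F W] (H : BlockRel F w 5) (hg : 3 ≤ g) (hW : Module.finrank F W = 3) :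
    False := by
  have hP : Fintype.card {p : Fin 5 × Fin 5 // p.1 < p.2} = 10 := by decide
  have hc : Fintype.card (Fin g × {p : Fin 5 × Fin 5 // p.1 < p.2}) = g * 10 := by
    rw [Fintype.card_prod, Fintype.card_fin, hP]
  have : Nontrivial (Fin g × {p : Fin 5 × Fin 5 // p.1 < p.2}) := by
    rw [← Fintype.one_lt_card_iff_nontrivial]; omega
  -- Ten differences from each of at least three blocks have at least `90` nonzero multiples, too
  -- many for a space of `64` vectors.
  have h1 := (H.relDist_blockDiff le_rfl).three_mul_card_lt hF
  rw [hW, hc] at h1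
  omega

/-- Six six-element subsets of a nine-element set do not meet pairwise in at most three elements. -/
theorem not_six_sets {α : Type*} [DecidableEq α] {U : Finset α} (hU : U.card ≤ 9)
    {A : Fin 6 → Finset α} (hA : ∀ b, A b ⊆ U) (h6 : ∀ b, 6 ≤ (A b).card)
    (h3 : ∀ b c, b ≠ c → (A b ∩ A c).card ≤ 3) : False := by
  obtain ⟨B, hB⟩ : ∃ B : Fin 6 → Finset α, ∀ b, B b ⊆ A b ∧ (B b).card = 6 := by
    choose B hB using fun b => Finset.exists_subset_card_eq (h6 b)
    exact ⟨B, hB⟩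
  let k : α → ℕ := fun x => ∑ b, if x ∈ B b then 1 else 0
  have hBU : ∀ b, U ∩ B b = B b := fun b =>
    Finset.inter_eq_right.2 ((hB b).1.trans (hA b))
  -- The multiplicities add up to `36` and their squares to at most `6 * 6 + 30 * 3 = 126`, but the
  -- Cauchy–Schwarz inequality demands `36 ^ 2 ≤ 9 * 126`.
  have h1 : ∑ x ∈ U, k x = 36 := by
    rw [Finset.sum_comm]
    simp [Finset.sum_ite_mem, hBU, hB]
  have h2 : ∑ x ∈ U, k x ^ 2 ≤ 126 := by
    have e1 : ∀ x, k x ^ 2 = ∑ b, ∑ c, if x ∈ B b ∩ B c then 1 else 0 := by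
      intro x
      rw [sq, Finset.sum_mul_sum]
      refine Finset.sum_congr rfl fun b _ => Finset.sum_congr rfl fun c _ => ?_
      by_cases hb : x ∈ B b <;> by_cases hc : x ∈ B c <;> simp [hb, hc]
    have e2 : ∑ x ∈ U, k x ^ 2 = ∑ b, ∑ c, (B b ∩ B c).card := by
      simp only [e1]
      rw [Finset.sum_comm]
      refine Finset.sum_congr rfl fun b _ => ?_
      rw [Finset.sum_comm]
      refine Finset.sum_congr rfl fun c _ => ?_
      rw [Finset.sum_ite_mem, ← Finset.card_eq_sum_ones, ← Finset.inter_assoc, hBU]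
    rw [e2]
    calc ∑ b, ∑ c, (B b ∩ B c).card ≤ ∑ b : Fin 6, ∑ c : Fin 6, if b = c then 6 else 3 := by
          refine Finset.sum_le_sum fun b _ => Finset.sum_le_sum fun c _ => ?_
          split_ifs with hbc
          · subst hbc; rw [Finset.inter_self]; exact (hB b).2.le
          · exact (Finset.card_le_card (Finset.inter_subset_inter (hB b).1 (hB c).1)).trans
              (h3 b c hbc)
      _ = 126 := by decide
  have h4 := sq_sum_le_card_mul_sum_sq (s := U) (f := k)
  rw [h1] at h4
  have h5 := Nat.mul_le_mul hU h2
  simp only [Nat.cast_id] at h4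
  omega

/-- Blocks of three points in distance six. -/
theorem BlockRel.card_le_five_of_three (hF : Nat.card F = 4) {g : ℕ} {w : Fin g → Fin 3 → W}
    [FiniteDimensional F W] (H : BlockRel F w 6) (hW : Module.finrank F W = 3) : g ≤ 5 := by
  classical
  by_contra! hg
  have hfin := finite_of_finiteDimensional hF W
  have := Fintype.ofFinite W
  have : Finite F := Nat.finite_of_card_ne_zero (by omega)
  have := Fintype.ofFinite F
  have hunits : Fintype.card Fˣ = 3 := by rw [← Nat.card_eq_fintype_card, natCard_units hF]
  have hcW : ∀ P : Submodule F W, ∀ S : Finset W, (∀ x, x ∈ S ↔ x ∈ P) →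
      S.card = 4 ^ Module.finrank F P := by
    intro P S hS
    rw [← natCard_eq_four_pow hF P, ← Nat.card_eq_finsetCard]
    exact Nat.card_congr (Equiv.subtypeEquivRight hS)
  have hP3 : Fintype.card {p : Fin 3 × Fin 3 // p.1 < p.2} = 3 := by decide
  have : Nontrivial (Fin g × {p : Fin 3 × Fin 3 // p.1 < p.2}) := by
    rw [← Fintype.one_lt_card_iff_nontrivial, Fintype.card_prod, Fintype.card_fin, hP3]; omega
  have hinj := (H.relDist_blockDiff (by omega)).smul_injective
  -- The differences of a block span a plane of `16` vectors; the `9` nonzero multiples of its three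
  -- differences lie in no plane of another block. For six blocks these `54` vectors leave `9` other
  -- nonzero ones. Each plane contains six of the latter, while two planes share at most three
  -- nonzero vectors.
  let blk : Fin 6 → Fin g := Fin.castLE hg
  have hblk : Function.Injective blk := Fin.castLE_injective hg
  let P : Fin 6 → Submodule F W := fun b =>
    Submodule.span F {w (blk b) 0 - w (blk b) 1, w (blk b) 0 - w (blk b) 2}
  let S : Fin 6 → Finset W := fun b => Finset.univ.filter (· ∈ P b)
  let f : Fin 6 × {p : Fin 3 × Fin 3 // p.1 < p.2} × Fˣ → W := fun t =>
    (t.2.2 : F) • blockDiff w (blk t.1, t.2.1)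
  have hf : Function.Injective f := by
    rintro ⟨b, p, c⟩ ⟨b', p', c'⟩ h
    have := @hinj ((blk b, p), c) ((blk b', p'), c') h
    simp only [Prod.mk.injEq] at this ⊢
    exact ⟨hblk this.1.1, this.1.2, this.2⟩
  have hf0 : ∀ t, f t ≠ 0 := fun t => smul_ne_zero t.2.2.ne_zero
    (((H.relDist_blockDiff (by omega)).mono (by omega)).ne_zero _)
  let M : Fin 6 → Finset W := fun b => Finset.univ.image fun t => f (b, t)
  have hM : ∀ b, (M b).card = 9 := fun b => by
    have := Finset.card_image_of_injective Finset.univ (hf.comp (Prod.mk_right_injective b))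
    rw [Finset.card_univ, Fintype.card_prod, hP3, hunits] at this
    exact this
  have hMP : ∀ b, M b ⊆ S b := by
    intro b x hx
    obtain ⟨⟨⟨⟨i, j⟩, hij⟩, c⟩, -, rfl⟩ := Finset.mem_image.1 hx
    refine Finset.mem_filter.2 ⟨Finset.mem_univ _, (P b).smul_mem _ ?_⟩
    have h0 : ∀ k, w (blk b) 0 - w (blk b) k ∈ P b := by
      intro k
      fin_cases k
      · simp
      · exact Submodule.subset_span (by simp)
      · exact Submodule.subset_span (by simp)
    have := (P b).sub_mem (h0 j) (h0 i)
    rwa [sub_sub_sub_cancel_left] at this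
  have hdisj : ∀ b b', b ≠ b' → ∀ x ∈ M b, x ∉ P b' := by
    intro b b' hb x hx hxP
    obtain ⟨⟨⟨⟨i, j⟩, hij⟩, c⟩, -, rfl⟩ := Finset.mem_image.1 hx
    obtain ⟨s, t, hst⟩ := Submodule.mem_span_pair.1 hxP
    exact c.ne_zero (H.cross (hblk.ne hb) (ne_of_lt hij) hst.symm)
  have hP : ∀ b, Module.finrank F (P b) = 2 := by
    intro b
    have hli : LinearIndependent F
        ![w (blk b) 0 - w (blk b) 1, w (blk b) 0 - w (blk b) 2] := by
      refine LinearIndependent.pair_iff.2 fun s t hst => ?_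
      have h1 := H.eq_zero_of_block (b := blk b) (x := ![s + t, -s, -t])
        (by simp [Fin.sum_univ_three]) (by
          refine Eq.trans ?_ hst
          simp only [Fin.sum_univ_three, Matrix.cons_val]
          module) (hammingNorm_le_card_fintype.trans_lt (by simp))
      exact ⟨by simpa using congrFun h1 1, by simpa using congrFun h1 2⟩
    have := finrank_span_eq_card hli
    rwa [Matrix.range_cons_cons_empty, Fintype.card_fin] at this
  have hS : ∀ b, (S b).card = 16 := fun b => by rw [hcW (P b) (S b) (by simp [S]), hP]; rfl
  let U : Finset W := Finset.univ \ (insert 0 (Finset.univ.image f))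
  have hU : U.card = 9 := by
    rw [Finset.card_univ_sdiff, Finset.card_insert_of_notMem, Finset.card_image_of_injective _ hf,
      Finset.card_univ, Fintype.card_prod, Fintype.card_prod, hP3, hunits, Fintype.card_fin,
      ← Nat.card_eq_fintype_card, natCard_eq_four_pow hF, hW]
    · norm_num
    · intro h0
      obtain ⟨t, -, ht⟩ := Finset.mem_image.1 h0
      exact hf0 t ht
  refine not_six_sets hU.le (A := fun b => (S b \ M b).erase 0) ?_ ?_ ?_
  · intro b x hx
    obtain ⟨h0, hx⟩ := Finset.mem_erase.1 hx
    obtain ⟨h1, h2⟩ := Finset.mem_sdiff.1 hx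
    refine Finset.mem_sdiff.2 ⟨Finset.mem_univ _, fun h3 => ?_⟩
    obtain ⟨t, -, rfl⟩ := Finset.mem_image.1 (Finset.mem_of_mem_insert_of_ne h3 h0)
    by_cases hb : t.1 = b
    · subst hb
      exact h2 (Finset.mem_image.2 ⟨t.2, Finset.mem_univ _, rfl⟩)
    · exact hdisj t.1 b hb _ (Finset.mem_image.2 ⟨t.2, Finset.mem_univ _, rfl⟩)
        (Finset.mem_filter.1 h1).2
  · intro b
    have h1 := Finset.pred_card_le_card_erase (s := S b \ M b) (a := 0)
    rw [Finset.card_sdiff_of_subset (hMP b), hS, hM] at h1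
    exact h1
  · intro b c hbc
    have h1 : Module.finrank F (P b ⊓ P c : Submodule F W) ≤ 1 := by
      by_contra! hlt
      have h2 : P b ⊓ P c = P b :=
        Submodule.eq_of_le_of_finrank_le inf_le_left (by rw [hP]; omega)
      obtain ⟨x, hx⟩ : (M b).Nonempty := by rw [← Finset.card_pos, hM]; omega
      exact hdisj b c hbc x hx ((inf_eq_left.1 h2) (Finset.mem_filter.1 (hMP b hx)).2)
    have h2 := hcW (P b ⊓ P c) (S b ∩ S c) (by simp [S])
    have h3 : 4 ^ Module.finrank F (P b ⊓ P c : Submodule F W) ≤ 4 ^ 1 :=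
      Nat.pow_le_pow_right (by omega) h1
    have h4 : ((S b \ M b).erase 0 ∩ (S c \ M c).erase 0) ⊆ (S b ∩ S c).erase 0 := by
      intro x hx
      simp only [Finset.mem_inter, Finset.mem_erase, Finset.mem_sdiff] at hx ⊢
      exact ⟨hx.1.1, hx.1.2.1, hx.2.2.1⟩
    have h5 := Finset.card_le_card h4
    rw [Finset.card_erase_of_mem (by simp [S])] at h5
    omega

end BlockBounds

/-! ### Search for blocks of six points -/

section BlockSearch

/-- Multiplication by the field element with the given code. -/
def smulCode (c v : ℕ) : ℕ :=
  match c with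
  | 0 => 0
  | 1 => v
  | 2 => genMul v
  | _ => Nat.xor (genMul v) v

/-- The codes of all combinations of two vectors. -/
def spanCodes (p q : ℕ) : List ℕ :=
  [0, 1, 2, 3].flatMap fun s => [0, 1, 2, 3].map fun t => Nat.xor (smulCode s p) (smulCode t q)

/-- The codes of all combinations of two of the given vectors. -/
def fanCodes : List ℕ → List ℕ
  | [] => []
  | y :: l => (l.flatMap fun z => spanCodes y z) ++ fanCodes l

/-- The codes of the vectors in the directions of the planes through three of the given points. -/
def planeCodes : List ℕ → List ℕ
  | [] => []
  | x :: l => fanCodes (l.map (Nat.xor x)) ++ planeCodes l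

/-- The codes of the multiples of differences of two of the given points. -/
def diffCodes : List ℕ → List ℕ
  | [] => []
  | x :: l => (l.flatMap fun y => [0, 1, 2, 3].map fun s => smulCode s (Nat.xor x y)) ++ diffCodes l

/-- A list of numbers as a bit mask. -/
def bitMask (l : List ℕ) : ℕ := l.foldr (fun v m => Nat.lor (Nat.shiftLeft 1 v) m) 0

theorem testBit_bitMask {l : List ℕ} {v : ℕ} : Nat.testBit (bitMask l) v = true ↔ v ∈ l := by
  induction l with
  | nil => simp [bitMask]
  | cons a l ih =>
    change Nat.testBit (1 <<< a ||| bitMask l) v = true ↔ _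
    rw [Nat.testBit_or, Bool.or_eq_true, ih, Nat.one_shiftLeft, Nat.testBit_two_pow,
      decide_eq_true_iff, List.mem_cons, eq_comm]

/-- The pairwise and triple conditions on the points of a second block. -/
def blockOk (L D : ℕ) (acc : List ℕ) (v w : ℕ) : Bool :=
  !Nat.testBit L (Nat.xor v w) && acc.all fun x =>
    !Nat.testBit D (Nat.xor (Nat.xor v x) (genMul (Nat.xor w x))) &&
    !Nat.testBit D (Nat.xor (Nat.xor v x) (Nat.xor (genMul (Nat.xor w x)) (Nat.xor w x)))

/-- The number of elements of a list outside a bit mask. -/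
def countOutside (cs : List ℕ) : ℕ → ℕ
  | 0 => cs.length
  | m + 1 => (cs.filter fun v => !Nat.testBit (m + 1) v).length

/-- A pair of blocks is excluded if the second one contains five dependent points, or if there is no
room for the differences of a third one. -/
def blockLeaf (cs : List ℕ) : List ℕ → Bool
  | a :: b :: c :: d :: e :: _ =>
    (List.contains ([0, 1, 2, 3].flatMap fun s => (spanCodes c d).map (Nat.xor (smulCode s e))) b) ||
    Nat.blt (countOutside cs (bitMask (fanCodes [a, b, c, d, e]))) 45
  | _ => false

/-- The origin, the unit vectors, and the vector with digits `x, x, y, y`: here `5 = 1 + 4` and `80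
= 16 + 64`. -/
def blockPoints (x y : ℕ) : List ℕ := [0, 1, 4, 16, 64, x * 5 + y * 80]

/-- The numbers below `256` outside a bit mask. -/
def bitComplement (L : ℕ) : List ℕ := (List.range 256).filter fun v => !Nat.testBit L v

/-- The search for a second block. The masks are taken apart to have them evaluated first. -/
def blockSearch : ℕ → ℕ → Bool
  | L + 1, D + 1 => searchAll (blockOk (L + 1) (D + 1)) (blockLeaf (bitComplement (L + 1))) 5 [0]
      (bitComplement (L + 1))
  | _, _ => false

/-- The masks express `BlockRel.cross` in both directions: differences in the second block avoid the
plane directions of the first, and plane directions of the second avoid the differences of the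
first. -/
def blockCheck (pts : List ℕ) : Bool :=
  blockSearch (bitMask (planeCodes pts)) (bitMask (diffCodes pts))


/-- The normalized coefficients of the relation between six points. -/
def blockPatterns : List (ℕ × ℕ) := [(1, 1), (2, 2), (3, 3), (2, 1), (3, 1), (2, 3)]

theorem blockCheck_eq_true : ∀ p ∈ blockPatterns, blockCheck (blockPoints p.1 p.2) = true := by
  decide +kernel

/-- Nonzero elements add up to zero only if `1`, `ω` and `ω ^ 2` occur with the same parity. Among
six elements all three multiplicities are then even, so the sorted coefficients come in equal pairs,
and the last pair is normalized to `1`. -/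
theorem exists_blockPattern : ∀ a b c d e f : Fin 4,
    a.val ≠ 0 ∧ a ≤ b ∧ b ≤ c ∧ c ≤ d ∧ d ≤ e ∧ e ≤ f ∧
      a.val ^^^ b.val ^^^ c.val ^^^ d.val ^^^ e.val ^^^ f.val = 0 →
    ∃ p ∈ blockPatterns, a.val = mulCode p.1 f ∧ b.val = mulCode p.1 f ∧ c.val = mulCode p.2 f ∧
      d.val = mulCode p.2 f ∧ e = f := by
  decide +kernel

theorem mem_fanCodes {l : List ℕ} {v : ℕ} (h : v ∈ fanCodes l) :
    ∃ p ∈ l, ∃ q ∈ l, ∃ s < 4, ∃ t < 4, v = smulCode s p ^^^ smulCode t q := by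
  induction l with
  | nil => simp [fanCodes] at h
  | cons y l ih =>
    rcases List.mem_append.1 h with h | h
    · obtain ⟨z, hz, h⟩ := List.mem_flatMap.1 h
      obtain ⟨s, hs, h⟩ := List.mem_flatMap.1 h
      obtain ⟨t, ht, rfl⟩ := List.mem_map.1 h
      have h4 : ∀ k ∈ [0, 1, 2, 3], k < 4 := by decide
      exact ⟨y, List.mem_cons_self, z, List.mem_cons_of_mem _ hz, s, h4 s hs, t, h4 t ht, rfl⟩
    · obtain ⟨p, hp, q, hq, h⟩ := ih h
      exact ⟨p, List.mem_cons_of_mem _ hp, q, List.mem_cons_of_mem _ hq, h⟩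

theorem mem_planeCodes {l : List ℕ} {v : ℕ} (h : v ∈ planeCodes l) :
    ∃ x ∈ l, ∃ y ∈ l, ∃ z ∈ l, ∃ s < 4, ∃ t < 4,
      v = smulCode s (x ^^^ y) ^^^ smulCode t (x ^^^ z) := by
  induction l with
  | nil => simp [planeCodes] at h
  | cons x l ih =>
    rcases List.mem_append.1 h with h | h
    · obtain ⟨p, hp, q, hq, h⟩ := mem_fanCodes h
      obtain ⟨y, hy, rfl⟩ := List.mem_map.1 hp
      obtain ⟨z, hz, rfl⟩ := List.mem_map.1 hq
      exact ⟨x, List.mem_cons_self, y, List.mem_cons_of_mem _ hy, z, List.mem_cons_of_mem _ hz, h⟩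
    · obtain ⟨x, hx, y, hy, z, hz, h⟩ := ih h
      exact ⟨x, List.mem_cons_of_mem _ hx, y, List.mem_cons_of_mem _ hy, z,
        List.mem_cons_of_mem _ hz, h⟩

theorem mem_diffCodes {l : List ℕ} {v : ℕ} (h : v ∈ diffCodes l) :
    ∃ x ∈ l, ∃ y ∈ l, ∃ s < 4, v = smulCode s (x ^^^ y) := by
  induction l with
  | nil => simp [diffCodes] at h
  | cons x l ih =>
    rcases List.mem_append.1 h with h | h
    · obtain ⟨y, hy, h⟩ := List.mem_flatMap.1 h
      obtain ⟨s, hs, rfl⟩ := List.mem_map.1 h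
      have h4 : ∀ k ∈ [0, 1, 2, 3], k < 4 := by decide
      exact ⟨x, List.mem_cons_self, y, List.mem_cons_of_mem _ hy, s, h4 s hs, rfl⟩
    · obtain ⟨x, hx, y, hy, h⟩ := ih h
      exact ⟨x, List.mem_cons_of_mem _ hx, y, List.mem_cons_of_mem _ hy, h⟩

end BlockSearch

/-! ### No three blocks of six points in dimension four -/

section SixPoints

theorem length_filter_le_countOutside (cs : List ℕ) (m : ℕ) :
    (cs.filter fun v => !Nat.testBit m v).length ≤ countOutside cs m := by
  cases m with
  | zero => exact List.length_filter_le _ _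
  | succ m => exact le_rfl

variable {F W κ : Type*} [Field F] [DecidableEq F] [AddCommGroup W] [Module F W] [Fintype κ]
  [DecidableEq κ] {ω : F} {n : ℕ}

omit [DecidableEq F] in
theorem code_smul_quat (hω : IsQuatGen ω) (b : Module.Basis (Fin n) F W) (hn : n ≤ 4) {c : ℕ}
    (hc : c < 4) (x : W) : code hω b (quat ω c • x) = smulCode c (code hω b x) := by
  interval_cases c
  · simp [quat, smulCode, code_zero]
  · simp [quat, smulCode]
  · simp [quat, smulCode, code_smul_gen hω b hn]
  · exact code_smul_gen_sq hω b hn x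

/-- Six points in dimension four without shorter relation have a normalized coordinate system. -/
theorem BlockRel.exists_blockPoints (hω : IsQuatGen ω) {w : κ → Fin 6 → W} [FiniteDimensional F W]
    (H : BlockRel F w 6) (hW : Module.finrank F W = 4) (k : κ) :
    ∃ (b : Module.Basis (Fin 4) F W) (o : Fin 6) (p : ℕ × ℕ), p ∈ blockPatterns ∧
     
      ∀ x ∈ blockPoints p.1 p.2, ∃ i, code hω b (w k i - w k o) = x := by
  classical
  -- Five differences in dimension four are dependent, which gives a relation between the six
  -- points. Shorter relations being excluded, none of its coefficients vanishes.
  obtain ⟨μ, hμ0, hμw, hμ⟩ : ∃ μ : Fin 6 → F, ∑ i, μ i = 0 ∧ ∑ i, μ i • w k i = 0 ∧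
      ∀ i, μ i ≠ 0 := by
    have hdep : ¬ LinearIndependent F fun i : Fin 5 => w k i.succ - w k 0 := by
      intro hli
      have := hli.fintype_card_le_finrank
      rw [hW, Fintype.card_fin] at this
      omega
    rw [Fintype.not_linearIndependent_iff] at hdep
    obtain ⟨g, hg, i, hi⟩ := hdep
    have h0 : ∑ j, (Fin.cons (-∑ i, g i) g : Fin 6 → F) j = 0 := by
      rw [Fin.sum_univ_succ]
      simp
    have h1 : ∑ j, (Fin.cons (-∑ i, g i) g : Fin 6 → F) j • w k j = 0 := by
      rw [Fin.sum_univ_succ, ← hg]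
      simp only [Fin.cons_zero, Fin.cons_succ, smul_sub, Finset.sum_sub_distrib, ← Finset.sum_smul]
      module
    refine ⟨_, h0, h1, fun j hj => hi ?_⟩
    have h2 := H.eq_zero_of_block h0 h1 (by
      refine lt_of_lt_of_eq (Finset.card_lt_univ_of_notMem (x := j) ?_) (Fintype.card_fin 6)
      simpa using hj)
    simpa using congrFun h2 i.succ
  choose c hc hcμ using fun i => hω.exists_code (μ i)
  -- Sorting by the codes of the coefficients brings equal ones together; the last point becomes the
  -- origin and the first four give the basis.
  let σ := Tuple.sort c
  have hσ : Monotone (c ∘ σ) := Tuple.monotone_sort c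
  have hle : ∀ i j, i ≤ j → c (σ i) ≤ c (σ j) := fun i j hij => hσ hij
  have hxor : c (σ 0) ^^^ c (σ 1) ^^^ c (σ 2) ^^^ c (σ 3) ^^^ c (σ 4) ^^^ c (σ 5) = 0 := by
    have hx : ∀ {a b : ℕ}, a < 4 → b < 4 → a ^^^ b < 4 := fun ha hb =>
      Nat.xor_lt_two_pow (n := 2) ha hb
    have hs := fun i => hc (σ i)
    rw [← hω.quat_eq_zero, hω.quat_xor (hx (hx (hx (hx (hs 0) (hs 1)) (hs 2)) (hs 3)) (hs 4)) (hs 5),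
      hω.quat_xor (hx (hx (hx (hs 0) (hs 1)) (hs 2)) (hs 3)) (hs 4),
      hω.quat_xor (hx (hx (hs 0) (hs 1)) (hs 2)) (hs 3), hω.quat_xor (hx (hs 0) (hs 1)) (hs 2),
      hω.quat_xor (hs 0) (hs 1)]
    simp only [hcμ]
    rw [← Equiv.sum_comp σ, Fin.sum_univ_six] at hμ0
    exact hμ0
  have hc0 : c (σ 0) ≠ 0 := fun h => hμ (σ 0) (by rw [← hcμ, h]; rfl)
  let f : Fin 6 → Fin 4 := fun i => ⟨c (σ i), hc _⟩
  obtain ⟨p, hp, e0, e1, e2, e3, e4⟩ := exists_blockPattern (f 0) (f 1) (f 2) (f 3) (f 4) (f 5)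
    ⟨hc0, hle 0 1 (by decide), hle 1 2 (by decide), hle 2 3 (by decide),
      hle 3 4 (by decide), hle 4 5 (by decide), hxor⟩
  have hp4 : p.1 < 4 ∧ p.2 < 4 := by
    have : ∀ p ∈ blockPatterns, p.1 < 4 ∧ p.2 < 4 := by decide
    exact this p hp
  have hf : ∀ i a, a < 4 → c (σ i) = mulCode a (c (σ 5)) → μ (σ i) = μ (σ 5) * quat ω a := by
    intro i a ha h
    rw [← hcμ, h, hω.quat_mul ha (hc _), hcμ, mul_comm]
  let v : Fin 4 → W := fun i => w k (σ (i.castLE (by omega))) - w k (σ 5)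
  have hli : LinearIndependent F v := by
    rw [Fintype.linearIndependent_iff]
    intro g hg i
    have h1 := H.eq_zero_of_block (b := k)
      (x := fun j => if j = σ 5 then -∑ i, g i else
        if h : (σ.symm j : ℕ) < 4 then g ⟨σ.symm j, h⟩ else 0) ?_ ?_ ?_
    · have := congrFun h1 (σ (i.castLE (by omega)))
      have hne : i.castLE (by omega) ≠ (5 : Fin 6) := by
        intro h; have := congrArg Fin.val h; simp at this; omega
      simpa [hne] using this
    · rw [← Equiv.sum_comp σ, Fin.sum_univ_six, Fin.sum_univ_four]
      simp
    · rw [← hg, ← Equiv.sum_comp σ, Fin.sum_univ_six, Fin.sum_univ_four, Fin.sum_univ_four]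
      simp [v]
      module
    · refine lt_of_lt_of_eq (Finset.card_lt_univ_of_notMem (x := σ 4) ?_) (Fintype.card_fin 6)
      simp
  let b := basisOfLinearIndependentOfCardEqFinrank hli (by rw [hW, Fintype.card_fin])
  have hb : ∀ i, code hω b (v i) = 4 ^ (i : ℕ) := fun i => by
    rw [← code_basis hω b i]
    simp [b]
  have h4 : w k (σ 4) - w k (σ 5) = quat ω p.1 • v 0 + quat ω p.1 • v 1 + quat ω p.2 • v 2 +
      quat ω p.2 • v 3 := by
    have h1 := hf 0 _ hp4.1 e0
    have h2 := hf 1 _ hp4.1 e1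
    have h3 := hf 2 _ hp4.2 e2
    have h5 := hf 3 _ hp4.2 e3
    have h6 : μ (σ 4) = μ (σ 5) := by
      rw [← hcμ, ← hcμ]
      exact congrArg (fun k : Fin 4 => quat ω k) e4
    rw [← Equiv.sum_comp σ, Fin.sum_univ_six, h1, h2, h3, h5, h6] at hμw hμ0
    have h8 : μ (σ 5) • (w k (σ 4) - w k (σ 5) - (quat ω p.1 • v 0 + quat ω p.1 • v 1 +
        quat ω p.2 • v 2 + quat ω p.2 • v 3)) = 0 := by
      rw [hω.sub_vec]
      change μ (σ 5) • (w k (σ 4) - w k (σ 5) + (quat ω p.1 • (w k (σ 0) - w k (σ 5)) +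
        quat ω p.1 • (w k (σ 1) - w k (σ 5)) + quat ω p.2 • (w k (σ 2) - w k (σ 5)) +
        quat ω p.2 • (w k (σ 3) - w k (σ 5)))) = 0
      linear_combination (norm := module) hμw - hμ0 • w k (σ 5)
    exact sub_eq_zero.1 ((smul_eq_zero.1 h8).resolve_left (hμ _))
  have hcode : code hω b (w k (σ 4) - w k (σ 5)) = p.1 * 5 + p.2 * 80 := by
    rw [h4]
    simp only [code_add, code_smul_quat hω b le_rfl hp4.1, code_smul_quat hω b le_rfl hp4.2, hb]
    have : ∀ p ∈ blockPatterns, smulCode p.1 (4 ^ ((0 : Fin 4) : ℕ)) ^^^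
        smulCode p.1 (4 ^ ((1 : Fin 4) : ℕ)) ^^^ smulCode p.2 (4 ^ ((2 : Fin 4) : ℕ)) ^^^
        smulCode p.2 (4 ^ ((3 : Fin 4) : ℕ)) = p.1 * 5 + p.2 * 80 := by decide +kernel
    exact this p hp
  refine ⟨b, σ 5, p, hp, ?_⟩
  intro x hx
  simp only [blockPoints, List.mem_cons, List.not_mem_nil, or_false] at hx
  rcases hx with rfl | rfl | rfl | rfl | rfl | rfl
  exacts [⟨σ 5, by rw [sub_self, code_zero]⟩, ⟨_, hb 0⟩, ⟨_, hb 1⟩, ⟨_, hb 2⟩, ⟨_, hb 3⟩, ⟨_, hcode⟩]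

variable (hω : IsQuatGen ω) (b : Module.Basis (Fin n) F W)

omit [DecidableEq F] in
theorem exists_of_mem_planeCodes (hn : n ≤ 4) {y : Fin 6 → W} {o : Fin 6} {l : List ℕ}
    (hl : ∀ x ∈ l, ∃ i, code hω b (y i - y o) = x) {v : ℕ} (hv : v ∈ planeCodes l) :
    ∃ (i j k : Fin 6) (s t : F), v = code hω b (s • (y i - y j) + t • (y i - y k)) := by
  obtain ⟨x₁, h1, x₂, h2, x₃, h3, s, hs, t, ht, rfl⟩ := mem_planeCodes hv
  obtain ⟨i, rfl⟩ := hl _ h1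
  obtain ⟨j, rfl⟩ := hl _ h2
  obtain ⟨k, rfl⟩ := hl _ h3
  refine ⟨i, j, k, quat ω s, quat ω t, ?_⟩
  rw [code_add, code_smul_quat hω b hn hs, code_smul_quat hω b hn ht, ← code_sub, ← code_sub,
    sub_sub_sub_cancel_right, sub_sub_sub_cancel_right]

omit [DecidableEq F] in
theorem exists_of_mem_diffCodes (hn : n ≤ 4) {y : Fin 6 → W} {o : Fin 6} {l : List ℕ}
    (hl : ∀ x ∈ l, ∃ i, code hω b (y i - y o) = x) {v : ℕ} (hv : v ∈ diffCodes l) :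
    ∃ (i j : Fin 6) (s : F), v = code hω b (s • (y i - y j)) := by
  obtain ⟨x₁, h1, x₂, h2, s, hs, rfl⟩ := mem_diffCodes hv
  obtain ⟨i, rfl⟩ := hl _ h1
  obtain ⟨j, rfl⟩ := hl _ h2
  refine ⟨i, j, quat ω s, ?_⟩
  rw [code_smul_quat hω b hn hs, ← code_sub, sub_sub_sub_cancel_right]

/-- Three blocks of six points do not fit into dimension four. -/
theorem BlockRel.not_six_six (hF : Nat.card F = 4) {g : ℕ} {w : Fin g → Fin 6 → W}
    [FiniteDimensional F W] (H : BlockRel F w 6) (hg : 3 ≤ g) (hW : Module.finrank F W = 4) :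
    False := by
  classical
  obtain ⟨ω, hω⟩ := exists_isQuatGen hF
  let A : Fin g := ⟨0, by omega⟩
  let B : Fin g := ⟨1, by omega⟩
  let C : Fin g := ⟨2, by omega⟩
  have hAB : A ≠ B := by simp [A, B]
  have hAC : A ≠ C := by simp [A, C]
  have hBC : B ≠ C := by simp [B, C]
  obtain ⟨b, o, p, hp, hpts⟩ := H.exists_blockPoints hω hW A
  have hplane : ∀ (k k' : Fin g) (o : Fin 6) (l : List ℕ), k ≠ k' →
      (∀ x ∈ l, ∃ i, code hω b (w k i - w k o) = x) → ∀ u v, u ≠ v → ∀ c : F, c ≠ 0 →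
      code hω b (c • (w k' u - w k' v)) ∉ planeCodes l := by
    intro k k' o l hk hl u v huv c hc hmem
    obtain ⟨i, j, m, s, t, h⟩ := exists_of_mem_planeCodes hω b le_rfl hl hmem
    exact hc (H.cross hk.symm huv (code_injective hω b h))
  have hmask : ∀ (l : List ℕ) (x : ℕ), x ∉ l → Nat.testBit (bitMask l) x = false := by
    intro l x hx
    rw [← Bool.not_eq_true, testBit_bitMask]
    exact hx
  let y : Fin 6 → ℕ := fun i => code hω b (w B i - w B 0)
  have hy0 : y 0 = 0 := by simp only [y, sub_self, code_zero]
  have hinj3 : ∀ i j k : Fin 6, i ≠ j → i ≠ k → j ≠ k → ∀ s : F,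
      w B i - w B k + s • (w B j - w B k) ≠ 0 := by
    intro i j k hij hik hjk s h
    have := H.eq_zero_of_list [(1, (B, i)), (s, (B, j)), (-(1 + s), (B, k))] (by simp)
      (fun a => by by_cases h1 : B = a <;> simp [h1])
      (by
        refine Eq.trans ?_ h
        simp only [List.map_cons, List.map_nil, List.sum_cons, List.sum_nil]
        module) (B, i)
    simp [hij.symm, hik.symm] at this
  have hsub : ∀ i j, y i ^^^ y j = code hω b (w B i - w B j) := fun i j => by
    rw [← code_sub, sub_sub_sub_cancel_right]
  have hy : Function.Injective y := by
    intro i j hij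
    by_contra hne
    have h1 := hsub i j
    rw [hij, Nat.xor_self, eq_comm, code_eq_zero] at h1
    obtain ⟨k, hk⟩ : ∃ k : Fin 6, k ≠ i ∧ k ≠ j := by
      clear * -
      revert i j; decide
    refine hinj3 i k j hk.1.symm hne hk.2 0 ?_
    rw [h1, zero_smul, add_zero]
  let T : Finset ℕ := (Finset.univ.erase (0 : Fin 6)).image y
  have hT : T.card = 5 := by
    rw [Finset.card_image_of_injective _ hy, Finset.card_erase_of_mem (Finset.mem_univ _)]
    simp
  set pts := blockPoints p.1 p.2 with hptsdef
  have hcheck : searchAll (blockOk (bitMask (planeCodes pts)) (bitMask (diffCodes pts)))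
      (blockLeaf (bitComplement (bitMask (planeCodes pts)))) 5 [0]
      (bitComplement (bitMask (planeCodes pts))) = true := by
    have h1 := blockCheck_eq_true p hp
    rw [blockCheck, ← hptsdef] at h1
    -- The check fails for a zero mask, so both masks are successors and the search unfolds.
    cases hL : bitMask (planeCodes pts) with
    | zero => rw [hL] at h1; simp [blockSearch] at h1
    | succ L =>
      cases hD : bitMask (diffCodes pts) with
      | zero => rw [hL, hD] at h1; simp [blockSearch] at h1
      | succ D => rw [hL, hD] at h1; exact h1
  have hcand : ∀ k, k ≠ A → ∀ u v, u ≠ v → ∀ c : F, c ≠ 0 →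
      code hω b (c • (w k u - w k v)) ∈ bitComplement (bitMask (planeCodes pts)) := by
    intro k hk u v huv c hc
    rw [bitComplement, List.mem_filter, List.mem_range,
      hmask _ _ (hplane A k o pts hk.symm hpts u v huv c hc)]
    exact ⟨code_lt hω b _, rfl⟩
  have hTcand : ∀ x ∈ T, x ∈ bitComplement (bitMask (planeCodes pts)) := by
    intro x hx
    obtain ⟨i, hi, rfl⟩ := Finset.mem_image.1 hx
    have := hcand B hAB.symm i 0 (Finset.ne_of_mem_erase hi) 1 one_ne_zero
    rwa [one_smul] at this
  have hTdisj : ∀ x ∈ [0], x ∉ T := by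
    intro x hx hxT
    obtain ⟨i, hi, rfl⟩ := Finset.mem_image.1 hxT
    rw [List.mem_singleton, ← hy0] at hx
    exact Finset.ne_of_mem_erase hi (hy hx)
  have hTok : ∀ (L : List ℕ) (u v : ℕ), (∀ x ∈ L, x ∈ T ∨ x ∈ [0]) → u ∈ T → v ∈ T →
      (v :: u :: L).Nodup →
      blockOk (bitMask (planeCodes pts)) (bitMask (diffCodes pts)) L u v = true := by
    intro L u v hL hu hv hnd
    obtain ⟨i, hi, rfl⟩ := Finset.mem_image.1 hu
    obtain ⟨j, hj, rfl⟩ := Finset.mem_image.1 hv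
    simp only [List.nodup_cons, List.mem_cons, not_or] at hnd
    have hij : i ≠ j := fun h => hnd.1.1 (h ▸ rfl)
    have hL1 : y i ^^^ y j ∉ planeCodes pts := by
      have := hplane A B o pts hAB hpts i j hij 1 one_ne_zero
      rwa [one_smul, ← hsub] at this
    have hD : ∀ k, i ≠ k → j ≠ k → ∀ s : F, s ≠ 0 →
        code hω b (w B i - w B k + s • (w B j - w B k)) ∉ diffCodes pts := by
      intro k hik hjk s hs hmem
      obtain ⟨u, v, c, h⟩ := exists_of_mem_diffCodes hω b le_rfl hpts hmem
      have h' := code_injective hω b h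
      by_cases huv : u = v
      · subst huv
        rw [sub_self, smul_zero] at h'
        exact hinj3 i j k hij hik hjk s h'
      · have hc := H.cross (b' := B) (i := k) (j := i) (k := j) (s := -1) (t := -s) hAB huv
          (h'.symm.trans (by module))
        rw [hc, zero_smul] at h'
        exact hinj3 i j k hij hik hjk s h'
    rw [blockOk, Bool.and_eq_true, List.all_eq_true]
    refine ⟨by rw [Bool.not_eq_true']; exact hmask _ _ hL1, ?_⟩
    intro x hx
    obtain ⟨k, rfl⟩ : ∃ k, y k = x := by
      rcases hL x hx with hxT | hx0
      · obtain ⟨k, -, hk⟩ := Finset.mem_image.1 hxT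
        exact ⟨k, hk⟩
      · exact ⟨0, hy0.trans (List.mem_singleton.1 hx0).symm⟩
    have hik : i ≠ k := fun h => hnd.2.1 (h ▸ hx)
    have hjk : j ≠ k := fun h => hnd.1.2 (h ▸ hx)
    have h1 := hD k hik hjk ω hω.ne_zero
    have h2 := hD k hik hjk (ω ^ 2) (pow_ne_zero 2 hω.ne_zero)
    rw [code_add, code_smul_gen hω b le_rfl, ← hsub, ← hsub] at h1
    rw [code_add, code_smul_gen_sq hω b le_rfl, ← hsub, ← hsub] at h2
    rw [Bool.and_eq_true, Bool.not_eq_true', Bool.not_eq_true']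
    exact ⟨hmask _ _ h1, hmask _ _ h2⟩
  obtain ⟨S, hSn, hST, hS⟩ := searchAll_finset hcheck (List.nodup_range.filter _) hTcand hT
    (by simp) hTdisj hTok
  have hSlen : S.length = 5 := by
    rw [← hT, ← List.toFinset_card_of_nodup hSn]
    congr 1
    ext x
    rw [List.mem_toFinset, hST]
  obtain ⟨v₁, v₂, v₃, v₄, v₅, rfl⟩ : ∃ v₁ v₂ v₃ v₄ v₅, S = [v₁, v₂, v₃, v₄, v₅] := by
    match S, hSlen with
    | [v₁, v₂, v₃, v₄, v₅], _ => exact ⟨_, _, _, _, _, rfl⟩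
  have hmemT : ∀ v ∈ [v₁, v₂, v₃, v₄, v₅], ∃ i, i ≠ 0 ∧ y i = v := fun v hv => by
    obtain ⟨i, hi, h⟩ := Finset.mem_image.1 ((hST v).1 hv)
    exact ⟨i, Finset.ne_of_mem_erase hi, h⟩
  rw [List.cons_append, List.cons_append, List.cons_append, List.cons_append, List.cons_append,
    blockLeaf, Bool.or_eq_true] at hS
  -- At a leaf, either five points of the second block are dependent, or the `45 = 15 * 3` multiples
  -- of the differences of a third block have no room outside the plane directions already excluded.
  rcases hS with hS | hS
  · rw [List.contains_iff_mem] at hS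
    obtain ⟨s, hs, hS⟩ := List.mem_flatMap.1 hS
    obtain ⟨z, hz, hS⟩ := List.mem_map.1 hS
    obtain ⟨s', hs', hz⟩ := List.mem_flatMap.1 hz
    obtain ⟨t', ht', rfl⟩ := List.mem_map.1 hz
    have h4 : ∀ k ∈ [0, 1, 2, 3], k < 4 := by decide
    obtain ⟨i₂, h20, rfl⟩ := hmemT v₂ (by simp)
    obtain ⟨i₃, h30, rfl⟩ := hmemT v₃ (by simp)
    obtain ⟨i₄, h40, rfl⟩ := hmemT v₄ (by simp)
    obtain ⟨i₅, h50, rfl⟩ := hmemT v₅ (by simp)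
    simp only [List.nodup_cons, List.mem_cons, not_or, hy.eq_iff] at hSn
    have h5 : quat ω s • (w B i₅ - w B 0) + (quat ω s' • (w B i₃ - w B 0) +
        quat ω t' • (w B i₄ - w B 0)) = w B i₂ - w B 0 := by
      refine code_injective hω b ?_
      rw [code_add, code_add, code_smul_quat hω b le_rfl (h4 _ hs),
        code_smul_quat hω b le_rfl (h4 _ hs'), code_smul_quat hω b le_rfl (h4 _ ht')]
      exact hS
    have := H.eq_zero_of_list [(1, (B, i₂)), (-quat ω s, (B, i₅)), (-quat ω s', (B, i₃)),
      (-quat ω t', (B, i₄)), (quat ω s + quat ω s' + quat ω t' - 1, (B, 0))] (by simp)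
      (fun a => by
        by_cases h1 : B = a
        · simp [h1]; ring
        · simp [h1])
      (by
        refine Eq.trans ?_ (sub_eq_zero.2 h5.symm)
        simp only [List.map_cons, List.map_nil, List.sum_cons, List.sum_nil]
        module) (B, i₂)
    simp [Ne.symm hSn.2.1.1, Ne.symm hSn.2.1.2.1, Ne.symm hSn.2.1.2.2.1, h20.symm] at this
  · have hP : Fintype.card {p : Fin 6 × Fin 6 // p.1 < p.2} = 15 := by decide
    have : Finite F := Nat.finite_of_card_ne_zero (by omega)
    have := Fintype.ofFinite F
    have hunits : Fintype.card Fˣ = 3 := by rw [← Nat.card_eq_fintype_card, natCard_units hF]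
    have : Nontrivial (Fin g × {p : Fin 6 × Fin 6 // p.1 < p.2}) := by
      rw [← Fintype.one_lt_card_iff_nontrivial, Fintype.card_prod, Fintype.card_fin, hP]; omega
    let f : {p : Fin 6 × Fin 6 // p.1 < p.2} × Fˣ → ℕ := fun t =>
      code hω b ((t.2 : F) • blockDiff w (C, t.1))
    have hf : Function.Injective f := by
      rintro ⟨p, c⟩ ⟨p', c'⟩ h
      have := @RelDist.smul_injective _ _ _ _ _ _ _ _ _ (H.relDist_blockDiff (by omega))
        ((C, p), c) ((C, p'), c') (code_injective hω b h)
      simpa using this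
    have hfcard : (Finset.univ.image f).card = 45 := by
      rw [Finset.card_image_of_injective _ hf, Finset.card_univ, Fintype.card_prod, hP, hunits]
    have hsub : Finset.univ.image f ⊆ ((bitComplement (bitMask (planeCodes pts))).filter fun v =>
        !Nat.testBit (bitMask (fanCodes [v₁, v₂, v₃, v₄, v₅])) v).toFinset := by
      intro x hx
      obtain ⟨⟨⟨⟨i, j⟩, hij⟩, c⟩, -, rfl⟩ := Finset.mem_image.1 hx
      rw [List.mem_toFinset, List.mem_filter]
      refine ⟨hcand C hAC.symm i j (ne_of_lt hij) c c.ne_zero, ?_⟩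
      rw [Bool.not_eq_true']
      refine hmask _ _ fun hmem => ?_
      obtain ⟨p, hp, q, hq, s, hs, t, ht, h⟩ := mem_fanCodes hmem
      obtain ⟨k, -, rfl⟩ := hmemT p hp
      obtain ⟨l, -, rfl⟩ := hmemT q hq
      rw [← code_smul_quat hω b le_rfl hs, ← code_smul_quat hω b le_rfl ht, ← code_add] at h
      have h' := code_injective hω b h
      exact c.ne_zero (H.cross (b' := B) (i := 0) (j := k) (k := l) (s := -quat ω s)
        (t := -quat ω t) hBC.symm (ne_of_lt hij) (h'.trans (by module)))
    have h1 := Finset.card_le_card hsub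
    have h2 := List.toFinset_card_le ((bitComplement (bitMask (planeCodes pts))).filter fun v =>
        !Nat.testBit (bitMask (fanCodes [v₁, v₂, v₃, v₄, v₅])) v)
    have h3 := length_filter_le_countOutside (bitComplement (bitMask (planeCodes pts)))
      (bitMask (fanCodes [v₁, v₂, v₃, v₄, v₅]))
    have h4 := Nat.le_of_ble_eq_true hS
    omega

end SixPoints

/-! ### Distance at least five: the remaining parameters -/

section LargeDistance

variable {F V ι : Type*} [Field F] [DecidableEq F] [AddCommGroup V] [Module F V] [Fintype ι]
  {h : ι → V} {m r t d : ℕ}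

/-- With only `m - 1` functionals the common kernel has dimension `d` and contains at least `d + r +
1` points. Such a system has at most `d + 6` points, and `d + 3` points are possible only for `d ≤
6`. -/
theorem IsOptConfig.bounds_of_five_le_dist (hF : Nat.card F = 4) [FiniteDimensional F V]
    (H : IsOptConfig F h m r 1 d) (hd : 5 ≤ d) (hm : 1 ≤ m) (hr : 2 ≤ r) : r ≤ 5 ∧ d ≤ 6 := by
  classical
  have hn := H.card
  obtain ⟨j, rfl⟩ : ∃ j, m = j + 1 := ⟨m - 1, by omega⟩
  have h1 : (j + 1) * (r + 1) = j * (r + 1) + (r + 1) := by ring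
  obtain ⟨L, hL, hc, hz⟩ := H.loc.exists_family j (by omega)
  have hker := _root_.finrank_commonKer hL.1
  have hV := H.finrank
  refine ⟨?_, ?_⟩
  · have := (H.dist.restrict (zeros h L) (commonKer L)
      (fun i hi => mem_commonKer_of_mem_zeros hi)).card_le_add_six hF hd (by omega)
    rw [Fintype.card_coe] at this
    omega
  · obtain ⟨s, hs, hsc⟩ := Finset.exists_subset_card_eq (s := zeros h L) (n := d + 3) (by omega)
    exact (H.dist.restrict s (commonKer L) (fun i hi => mem_commonKer_of_mem_zeros (hs hi))).dist_le_six
      hF (by omega) (by rw [Fintype.card_coe, hsc])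

/-- Distance at least five. -/
theorem IsOptConfig.params_of_five_le_dist (hF : Nat.card F = 4) [FiniteDimensional F V]
    (H : IsOptConfig F h m r t d) (hd : 5 ≤ d) (hm : 1 ≤ m) (ht : 1 ≤ t) (htr : t ≤ r) :
    t = 1 ∧ ((r = 1 ∧ m ≤ 2 ∧ (d = 6 ∨ d = 8)) ∨ (m = 1 ∧ 2 ≤ r ∧ r ≤ 5 ∧ d ≤ 6) ∨
      (r = 2 ∧ d = 6 ∧ (m = 2 ∨ m = 3))) := by
  classical
  obtain rfl := H.t_eq_one hF hd ht
  refine ⟨rfl, ?_⟩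
  rcases htr.eq_or_lt with rfl | hr
  · obtain ⟨g, K, w, hg, hK, hw⟩ := H.exists_blocks hF hd (by omega)
    exact Or.inl ⟨rfl, hw.params_of_two hF hd hm hg hK⟩
  obtain ⟨hr5, hd6⟩ := H.bounds_of_five_le_dist hF hd hm hr
  by_cases hm1 : m = 1
  · exact Or.inr (Or.inl ⟨hm1, hr, hr5, hd6⟩)
  obtain ⟨g, K, w, hg, hK, hw⟩ := H.exists_blocks hF hd (Or.inl (by omega))
  have hdvd : r + 1 ∣ d := by
    rw [← Nat.dvd_add_right (Dvd.intro_left m rfl), ← hg]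
    exact Dvd.intro_left g rfl
  -- Divisibility leaves `(r, d) = (2, 6), (4, 5), (5, 6)`.
  interval_cases r <;> interval_cases d <;> first | omega | skip
  · have := hw.card_le_five_of_three hF (by omega)
    omega
  · exact (hw.not_five_five hF (by omega) (by omega)).elim
  · exact (hw.not_six_six hF (by omega) (by omega)).elim

end LargeDistance

/-! ### The classification -/

theorem IsOptimalLRC.exists_isOptConfig {F ι : Type*} [Field F] [DecidableEq F] [Fintype ι]
    [DecidableEq ι] {C : Submodule F (ι → F)} {n k r d : ℕ} (hC : IsOptimalLRC C n k r d)
    (hr : 1 ≤ r) (hk : r < k) : ∃ m t, 1 ≤ m ∧ 1 ≤ t ∧ t ≤ r ∧ k = m * r + t ∧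
      n + 1 = m * (r + 1) + t + d ∧ IsOptConfig F (quotCol C) m r t d ∧
      ∃ u : Module.Dual F ((ι → F) ⧸ C), (nonzeros (quotCol C) u).card = r + 1 := by
  classical
  obtain ⟨⟨hn, hdim, hloc⟩, hd, hopt⟩ := hC
  obtain ⟨hl, hex⟩ := hloc.isLocal
  have h1 := le_ceilDiv_mul (k := k) hr
  have h2 := ceilDiv_sub_one_mul_lt (k := k) hr (by omega)
  have h3 := ceilDiv_pos_of_pos (k := k) hr (by omega)
  -- The number of groups is `m + 1 = ⌈k / r⌉`, whence `1 ≤ t ≤ r`; and `m ≥ 1` because `r < k`.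
  obtain ⟨m, hm⟩ : ∃ m, k ⌈/⌉ r = m + 1 := ⟨k ⌈/⌉ r - 1, by omega⟩
  rw [hm] at h1 h2 hopt
  rw [Nat.add_sub_cancel] at h2
  obtain ⟨t, rfl⟩ : ∃ t, k = m * r + t := ⟨k - m * r, by omega⟩
  have h4 : (m + 1) * r = m * r + r := by ring
  have h5 : m * (r + 1) = m * r + m := by ring
  have hm1 : 1 ≤ m := by
    rcases Nat.eq_zero_or_pos m with rfl | h0 <;> omega
  have hrank := C.finrank_quotient_add_finrank
  rw [Module.finrank_fintype_fun_eq_card, hn, hdim] at hrank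
  refine ⟨m, t, hm1, by omega, by omega, rfl, by omega, ⟨by omega, by omega, ?_, hl⟩, hex⟩
  exact (relDist_quotCol_iff C d).2 hd.le_hammingNorm

set_option maxHeartbeats 2000000 in
theorem IsOptimalLRC.params {F : Type*} [Field F] [DecidableEq F] (hF : Nat.card F = 4)
    {n k r d : ℕ} (hr : 1 ≤ r) (hk : r < k) (hd : 2 ≤ d)
    {C : Submodule F (Fin n → F)} (hC : IsOptimalLRC C n k r d) :
    (d = 2 ∧ n = k + k ⌈/⌉ r) ∨
    (d = 3 ∧ ∃ s, 2 ≤ s ∧ n = 3 * s + 3 ∧ k = 2 * s + 1 ∧ r = 2) ∨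
    (d = 3 ∧ ∃ s, 2 ≤ s ∧ n = 4 * s + 3 ∧ k = 3 * s + 1 ∧ r = 3) ∨
    (d = 3 ∧ ∃ s, 2 ≤ s ∧ s ≤ 3 ∧ n = 5 * s + 3 ∧ k = 4 * s + 1 ∧ r = 4) ∨
    (d = 3 ∧ ∃ s, s = 2 ∧ n = 6 * s + 3 ∧ k = 5 * s + 1 ∧ r = 5) ∨
    (d = 3 ∧ ∃ s, 2 ≤ s ∧ n = 4 * s + 4 ∧ k = 3 * s + 2 ∧ r = 3) ∨
    (d = 3 ∧ 2 ≤ r ∧ r ≤ 15 ∧ n = r + 4 ∧ k = r + 1) ∨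
    (d = 3 ∧ 3 ≤ r ∧ r ≤ 15 ∧ n = r + 5 ∧ k = r + 2) ∨
    (d = 3 ∧ 6 ≤ r ∧ r ≤ 15 ∧ n = r + 6 ∧ k = r + 3) ∨
    (d = 4 ∧ ∃ s, 2 ≤ s ∧ n = 4 * s + 4 ∧ k = 3 * s + 1 ∧ r = 3) ∨
    (d = 4 ∧ ∃ s, 2 ≤ s ∧ n = 5 * s + 4 ∧ k = 4 * s + 1 ∧ r = 4) ∨
    (d = 4 ∧ ∃ s, 2 ≤ s ∧ n = 6 * s + 4 ∧ k = 5 * s + 1 ∧ r = 5) ∨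
    (d = 4 ∧ ∃ s, 2 ≤ s ∧ s ≤ 3 ∧ n = 7 * s + 4 ∧ k = 6 * s + 1 ∧ r = 6) ∨
    (d = 4 ∧ ∃ s, s = 2 ∧ n = 8 * s + 4 ∧ k = 7 * s + 1 ∧ r = 7) ∨
    (d = 4 ∧ ∃ s, 2 ≤ s ∧ n = 5 * s + 5 ∧ k = 4 * s + 2 ∧ r = 4) ∨
    (d = 4 ∧ ∃ s, 2 ≤ s ∧ n = 6 * s + 5 ∧ k = 5 * s + 2 ∧ r = 5) ∨
    (d = 4 ∧ ∃ s, s = 2 ∧ n = 7 * s + 5 ∧ k = 6 * s + 2 ∧ r = 6) ∨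
    (d = 4 ∧ ∃ s, 2 ≤ s ∧ n = 6 * s + 6 ∧ k = 5 * s + 3 ∧ r = 5) ∨
    (d = 4 ∧ ∃ s, 2 ≤ s ∧ n = 2 * s + 2 ∧ k = s ∧ r = 1) ∨
    (d = 4 ∧ 2 ≤ r ∧ r ≤ 11 ∧ n = r + 5 ∧ k = r + 1) ∨
    (d = 4 ∧ 3 ≤ r ∧ r ≤ 11 ∧ n = r + 6 ∧ k = r + 2) ∨
    (d = 4 ∧ 5 ≤ r ∧ r ≤ 7 ∧ n = r + 7 ∧ k = r + 3) ∨
    (d = 4 ∧ 2 ≤ r ∧ r ≤ 7 ∧ n = 2 * r + 6 ∧ k = 2 * r + 1) ∨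
    (d = 6 ∧ 2 ≤ k ∧ k ≤ 3 ∧ n = 2 * k + 4 ∧ r = 1) ∨
    (d = 8 ∧ 2 ≤ k ∧ k ≤ 3 ∧ n = 2 * k + 6 ∧ r = 1) ∨
    (3 ≤ k ∧ k ≤ 6 ∧ r + 1 = k ∧ 5 ≤ d ∧ d ≤ 6 ∧ n = k + d) ∨
    (d = 6 ∧ ∃ s, 2 ≤ s ∧ s ≤ 3 ∧ n = 3 * s + 6 ∧ k = 2 * s + 1 ∧ r = 2) := by
  rcases hd.eq_or_lt with rfl | hd'
  · have := hC.2.2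
    exact Or.inl ⟨rfl, by omega⟩
  obtain ⟨m, t, hm, ht, htr, rfl, hn, H, hex⟩ := hC.exists_isOptConfig hr hk
  refine Or.inr ?_
  rcases (show d = 3 ∨ d = 4 ∨ 5 ≤ d by omega) with rfl | rfl | hd5
  · rcases hm.eq_or_lt with rfl | hm2
    · iterate 5 refine Or.inr ?_
      rcases H.params_of_dist_three_of_two_groups hF ht hex with
        ⟨rfl, h1, h2⟩ | ⟨rfl, h1, h2⟩ | ⟨rfl, h1, h2⟩
      · exact Or.inl ⟨rfl, h1, h2, by omega, by omega⟩
      · exact Or.inr (Or.inl ⟨rfl, h1, h2, by omega, by omega⟩)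
      · exact Or.inr (Or.inr (Or.inl ⟨rfl, h1, h2, by omega, by omega⟩))
    · have h1 := H.params_of_dist_three hF hm2 ht
      rcases h1 with ⟨rfl, rfl | rfl | ⟨rfl, h⟩ | ⟨rfl, h⟩⟩ | ⟨rfl, rfl⟩
      · exact Or.inl ⟨rfl, m, hm2, by omega, by omega, rfl⟩
      · exact Or.inr (Or.inl ⟨rfl, m, hm2, by omega, by omega, rfl⟩)
      · exact Or.inr (Or.inr (Or.inl ⟨rfl, m, hm2, h, by omega, by omega, rfl⟩))
      · exact Or.inr (Or.inr (Or.inr (Or.inl ⟨rfl, m, h, by omega, by omega, rfl⟩)))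
      · exact Or.inr (Or.inr (Or.inr (Or.inr (Or.inl ⟨rfl, m, hm2, by omega, by omega, rfl⟩))))
  · iterate 8 refine Or.inr ?_
    rcases hm.eq_or_lt with rfl | hm2
    · iterate 9 refine Or.inr ?_
      rcases H.params_of_dist_four_of_two_groups hF ht hex with
        ⟨rfl, h1⟩ | ⟨rfl, h1, h2⟩ | ⟨rfl, h1, h2⟩
      -- For `r = 1` the parameters belong to the family with `k = s`, here with `s = m + 1 = 2`.
      · rcases hr.eq_or_lt with rfl | hr2
        · exact Or.inl ⟨rfl, 2, le_rfl, by omega, by omega, rfl⟩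
        · exact Or.inr (Or.inl ⟨rfl, hr2, h1, by omega, by omega⟩)
      · exact Or.inr (Or.inr (Or.inl ⟨rfl, h1, h2, by omega, by omega⟩))
      · exact Or.inr (Or.inr (Or.inr (Or.inl ⟨rfl, h1, h2, by omega, by omega⟩)))
    · have h1 := H.params_of_dist_four hF hm2 ht htr
      rcases h1 with ⟨rfl, rfl | rfl | rfl | rfl | ⟨rfl, h⟩ | ⟨rfl, h⟩ | ⟨rfl, h, h'⟩⟩ |
        ⟨rfl, rfl | rfl | ⟨rfl, h⟩⟩ | ⟨rfl, rfl⟩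
      · iterate 9 refine Or.inr ?_
        exact Or.inl ⟨rfl, m + 1, by omega, by omega, by omega, rfl⟩
      · exact Or.inl ⟨rfl, m, hm2, by omega, by omega, rfl⟩
      · iterate 1 refine Or.inr ?_
        exact Or.inl ⟨rfl, m, hm2, by omega, by omega, rfl⟩
      · iterate 2 refine Or.inr ?_
        exact Or.inl ⟨rfl, m, hm2, by omega, by omega, rfl⟩
      · iterate 3 refine Or.inr ?_
        exact Or.inl ⟨rfl, m, hm2, h, by omega, by omega, rfl⟩
      · iterate 4 refine Or.inr ?_
        exact Or.inl ⟨rfl, m, h, by omega, by omega, rfl⟩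
      · iterate 13 refine Or.inr ?_
        exact Or.inl ⟨rfl, h, h', by omega, by omega⟩
      · iterate 5 refine Or.inr ?_
        exact Or.inl ⟨rfl, m, hm2, by omega, by omega, rfl⟩
      · iterate 6 refine Or.inr ?_
        exact Or.inl ⟨rfl, m, hm2, by omega, by omega, rfl⟩
      · iterate 7 refine Or.inr ?_
        exact Or.inl ⟨rfl, m, h, by omega, by omega, rfl⟩
      · iterate 8 refine Or.inr ?_
        exact Or.inl ⟨rfl, m, hm2, by omega, by omega, rfl⟩
  · iterate 22 refine Or.inr ?_
    obtain ⟨rfl, ⟨rfl, h1, rfl | rfl⟩ | ⟨rfl, h1, h2, h3⟩ | ⟨rfl, rfl, h1⟩⟩ :=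
      H.params_of_five_le_dist hF hd5 hm ht htr
    · exact Or.inl ⟨rfl, by omega, by omega, by omega, rfl⟩
    · exact Or.inr (Or.inl ⟨rfl, by omega, by omega, by omega, rfl⟩)
    · exact Or.inr (Or.inr (Or.inl ⟨by omega, by omega, by omega, by omega, by omega, by omega⟩))
    · exact Or.inr (Or.inr (Or.inr ⟨rfl, m, by omega, by omega, by omega, by omega, rfl⟩))
set_option maxHeartbeats 2000000 in
theorem IsQuatGen.exists_isOptimalLRC {F : Type*} [Field F] [DecidableEq F] {ω : F} (hω : IsQuatGen ω)
    {n k r d : ℕ} (hr : 1 ≤ r) (hk : r < k) (hd : 2 ≤ d)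
    (h :
    (d = 2 ∧ n = k + k ⌈/⌉ r) ∨
    (d = 3 ∧ ∃ s, 2 ≤ s ∧ n = 3 * s + 3 ∧ k = 2 * s + 1 ∧ r = 2) ∨
    (d = 3 ∧ ∃ s, 2 ≤ s ∧ n = 4 * s + 3 ∧ k = 3 * s + 1 ∧ r = 3) ∨
    (d = 3 ∧ ∃ s, 2 ≤ s ∧ s ≤ 3 ∧ n = 5 * s + 3 ∧ k = 4 * s + 1 ∧ r = 4) ∨
    (d = 3 ∧ ∃ s, s = 2 ∧ n = 6 * s + 3 ∧ k = 5 * s + 1 ∧ r = 5) ∨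
    (d = 3 ∧ ∃ s, 2 ≤ s ∧ n = 4 * s + 4 ∧ k = 3 * s + 2 ∧ r = 3) ∨
    (d = 3 ∧ 2 ≤ r ∧ r ≤ 15 ∧ n = r + 4 ∧ k = r + 1) ∨
    (d = 3 ∧ 3 ≤ r ∧ r ≤ 15 ∧ n = r + 5 ∧ k = r + 2) ∨
    (d = 3 ∧ 6 ≤ r ∧ r ≤ 15 ∧ n = r + 6 ∧ k = r + 3) ∨
    (d = 4 ∧ ∃ s, 2 ≤ s ∧ n = 4 * s + 4 ∧ k = 3 * s + 1 ∧ r = 3) ∨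
    (d = 4 ∧ ∃ s, 2 ≤ s ∧ n = 5 * s + 4 ∧ k = 4 * s + 1 ∧ r = 4) ∨
    (d = 4 ∧ ∃ s, 2 ≤ s ∧ n = 6 * s + 4 ∧ k = 5 * s + 1 ∧ r = 5) ∨
    (d = 4 ∧ ∃ s, 2 ≤ s ∧ s ≤ 3 ∧ n = 7 * s + 4 ∧ k = 6 * s + 1 ∧ r = 6) ∨
    (d = 4 ∧ ∃ s, s = 2 ∧ n = 8 * s + 4 ∧ k = 7 * s + 1 ∧ r = 7) ∨
    (d = 4 ∧ ∃ s, 2 ≤ s ∧ n = 5 * s + 5 ∧ k = 4 * s + 2 ∧ r = 4) ∨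
    (d = 4 ∧ ∃ s, 2 ≤ s ∧ n = 6 * s + 5 ∧ k = 5 * s + 2 ∧ r = 5) ∨
    (d = 4 ∧ ∃ s, s = 2 ∧ n = 7 * s + 5 ∧ k = 6 * s + 2 ∧ r = 6) ∨
    (d = 4 ∧ ∃ s, 2 ≤ s ∧ n = 6 * s + 6 ∧ k = 5 * s + 3 ∧ r = 5) ∨
    (d = 4 ∧ ∃ s, 2 ≤ s ∧ n = 2 * s + 2 ∧ k = s ∧ r = 1) ∨
    (d = 4 ∧ 2 ≤ r ∧ r ≤ 11 ∧ n = r + 5 ∧ k = r + 1) ∨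
    (d = 4 ∧ 3 ≤ r ∧ r ≤ 11 ∧ n = r + 6 ∧ k = r + 2) ∨
    (d = 4 ∧ 5 ≤ r ∧ r ≤ 7 ∧ n = r + 7 ∧ k = r + 3) ∨
    (d = 4 ∧ 2 ≤ r ∧ r ≤ 7 ∧ n = 2 * r + 6 ∧ k = 2 * r + 1) ∨
    (d = 6 ∧ 2 ≤ k ∧ k ≤ 3 ∧ n = 2 * k + 4 ∧ r = 1) ∨
    (d = 8 ∧ 2 ≤ k ∧ k ≤ 3 ∧ n = 2 * k + 6 ∧ r = 1) ∨
    (3 ≤ k ∧ k ≤ 6 ∧ r + 1 = k ∧ 5 ≤ d ∧ d ≤ 6 ∧ n = k + d) ∨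
    (d = 6 ∧ ∃ s, 2 ≤ s ∧ s ≤ 3 ∧ n = 3 * s + 6 ∧ k = 2 * s + 1 ∧ r = 2)) :
    ∃ C : Submodule F (Fin n → F), IsOptimalLRC C n k r d := by
  revert h
  rintro (⟨rfl, rfl⟩ | ⟨rfl, s, hs, rfl, rfl, rfl⟩ | ⟨rfl, s, hs, rfl, rfl, rfl⟩ |
    ⟨rfl, s, hs, hs', rfl, rfl, rfl⟩ | ⟨rfl, s, rfl, rfl, rfl, rfl⟩ |
    ⟨rfl, s, hs, rfl, rfl, rfl⟩ | ⟨rfl, h1, h2, rfl, rfl⟩ | ⟨rfl, h1, h2, rfl, rfl⟩ |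
    ⟨rfl, h1, h2, rfl, rfl⟩ | ⟨rfl, s, hs, rfl, rfl, rfl⟩ | ⟨rfl, s, hs, rfl, rfl, rfl⟩ |
    ⟨rfl, s, hs, rfl, rfl, rfl⟩ | ⟨rfl, s, hs, hs', rfl, rfl, rfl⟩ |
    ⟨rfl, s, rfl, rfl, rfl, rfl⟩ | ⟨rfl, s, hs, rfl, rfl, rfl⟩ | ⟨rfl, s, hs, rfl, rfl, rfl⟩ |
    ⟨rfl, s, rfl, rfl, rfl, rfl⟩ | ⟨rfl, s, hs, rfl, rfl, rfl⟩ | ⟨rfl, s, hs, rfl, rfl, rfl⟩ |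
    ⟨rfl, h1, h2, rfl, rfl⟩ | ⟨rfl, h1, h2, rfl, rfl⟩ | ⟨rfl, h1, h2, rfl, rfl⟩ |
    ⟨rfl, h1, h2, rfl, rfl⟩ | ⟨rfl, h1, h2, rfl, rfl⟩ | ⟨rfl, h1, h2, rfl, rfl⟩ |
    ⟨h1, h2, h3, h4, h5, rfl⟩ | ⟨rfl, s, hs, hs', rfl, rfl, rfl⟩)
  · exact exists_isOptimalLRC_two hr hk
  · exact (hω.isPCM_aux3s3 hs).exists_fin hr hk hd
  -- Either value of the parameter would do for existence; zero is taken here and below.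
  · exact (hω.isPCM_top4s3 hs (Or.inl rfl)).exists_fin hr hk hd
  · obtain rfl | rfl : s = 2 ∨ s = 3 := by omega
    · exact hω.isPCM_mat13_9.exists_fin hr hk hd
    · exact hω.isPCM_mat18_13_d3.exists_fin hr hk hd
  · exact hω.isPCM_mat15_11.exists_fin hr hk hd
  · exact (hω.isPCM_aux4s4 hs).exists_fin hr hk hd
  · exact (hω.isPCM_ham19 h1 h2).exists_fin hr hk hd
  · exact (hω.isPCM_ham20 h1 h2).exists_fin hr hk hd
  · exact (hω.isPCM_ham21 h1 h2).exists_fin hr hk hd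
  · exact (hω.isPCM_aux4s4d4 hs).exists_fin hr hk hd
  · exact (hω.isPCM_top5s4 hs (Or.inl rfl)).exists_fin hr hk hd
  · exact (hω.isPCM_top6s4 hs (Or.inl rfl) (Or.inl rfl)).exists_fin hr hk hd
  · obtain rfl | rfl : s = 2 ∨ s = 3 := by omega
    · exact hω.isPCM_mat18_13.exists_fin hr hk hd
    · exact hω.isPCM_mat25_19.exists_fin hr hk hd
  · exact hω.isPCM_mat20_15.exists_fin hr hk hd
  · exact (hω.isPCM_aux5s5 hs).exists_fin hr hk hd
  · exact (hω.isPCM_top6s5 hs (Or.inl rfl)).exists_fin hr hk hd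
  · exact hω.isPCM_mat19_14.exists_fin hr hk hd
  · exact (hω.isPCM_aux6s6 hs).exists_fin hr hk hd
  · exact (hω.isPCM_aux2s2 hs).exists_fin hr hk hd
  · exact (hω.isPCM_cap16 h1 h2).exists_fin hr hk hd
  · exact (hω.isPCM_cap17 h1 h2).exists_fin hr hk hd
  · exact (hω.isPCM_cap14 h1 h2).exists_fin hr hk hd
  · interval_cases r
    · exact hω.isPCM_matTwo2.exists_fin hr hk hd
    · exact hω.isPCM_matTwo3.exists_fin hr hk hd
    · exact hω.isPCM_matTwo4.exists_fin hr hk hd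
    · exact hω.isPCM_matTwo5.exists_fin hr hk hd
    · exact hω.isPCM_matTwo6.exists_fin hr hk hd
    · exact hω.isPCM_matTwo7.exists_fin hr hk hd
  · obtain rfl | rfl : k = 2 ∨ k = 3 := by omega
    · exact hω.isPCM_mat8_2.exists_fin hr hk hd
    · exact hω.isPCM_mat10_3.exists_fin hr hk hd
  · obtain rfl | rfl : k = 2 ∨ k = 3 := by omega
    · exact hω.isPCM_mat10_2.exists_fin hr hk hd
    · exact hω.isPCM_mat12_3.exists_fin hr hk hd
  · obtain ⟨S, P, -, -, -, h⟩ := hω.shortenPuncture_nearMDS12 h1 h2 h4 h5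
    obtain rfl : r = k - 1 := by omega
    exact h.exists_fin hr (by omega) hd
  · obtain rfl | rfl : s = 2 ∨ s = 3 := by omega
    · exact hω.isPCM_mat12_5.exists_fin hr hk hd
    · exact hω.isPCM_mat15_7.exists_fin hr hk hd

theorem theorem1 {F : Type*} [Field F] [DecidableEq F] (hF : Nat.card F = 4)
    (ω : F) (hω0 : ω ≠ 0) (hω1 : ω ≠ 1) :
    -- the parameters of optimal quaternary LRCs are exactly those of the 27 classes
    (∀ n k r d : ℕ, 1 ≤ r → r < k → 2 ≤ d →
      ((∃ C : Submodule F (Fin n → F), IsOptimalLRC C n k r d) ↔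
        (d = 2 ∧ n = k + k ⌈/⌉ r) ∨
        (d = 3 ∧ ∃ s, 2 ≤ s ∧ n = 3 * s + 3 ∧ k = 2 * s + 1 ∧ r = 2) ∨
        (d = 3 ∧ ∃ s, 2 ≤ s ∧ n = 4 * s + 3 ∧ k = 3 * s + 1 ∧ r = 3) ∨
        (d = 3 ∧ ∃ s, 2 ≤ s ∧ s ≤ 3 ∧ n = 5 * s + 3 ∧ k = 4 * s + 1 ∧ r = 4) ∨
        (d = 3 ∧ ∃ s, s = 2 ∧ n = 6 * s + 3 ∧ k = 5 * s + 1 ∧ r = 5) ∨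
        (d = 3 ∧ ∃ s, 2 ≤ s ∧ n = 4 * s + 4 ∧ k = 3 * s + 2 ∧ r = 3) ∨
        (d = 3 ∧ 2 ≤ r ∧ r ≤ 15 ∧ n = r + 4 ∧ k = r + 1) ∨
        (d = 3 ∧ 3 ≤ r ∧ r ≤ 15 ∧ n = r + 5 ∧ k = r + 2) ∨
        (d = 3 ∧ 6 ≤ r ∧ r ≤ 15 ∧ n = r + 6 ∧ k = r + 3) ∨
        (d = 4 ∧ ∃ s, 2 ≤ s ∧ n = 4 * s + 4 ∧ k = 3 * s + 1 ∧ r = 3) ∨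
        (d = 4 ∧ ∃ s, 2 ≤ s ∧ n = 5 * s + 4 ∧ k = 4 * s + 1 ∧ r = 4) ∨
        (d = 4 ∧ ∃ s, 2 ≤ s ∧ n = 6 * s + 4 ∧ k = 5 * s + 1 ∧ r = 5) ∨
        (d = 4 ∧ ∃ s, 2 ≤ s ∧ s ≤ 3 ∧ n = 7 * s + 4 ∧ k = 6 * s + 1 ∧ r = 6) ∨
        (d = 4 ∧ ∃ s, s = 2 ∧ n = 8 * s + 4 ∧ k = 7 * s + 1 ∧ r = 7) ∨
        (d = 4 ∧ ∃ s, 2 ≤ s ∧ n = 5 * s + 5 ∧ k = 4 * s + 2 ∧ r = 4) ∨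
        (d = 4 ∧ ∃ s, 2 ≤ s ∧ n = 6 * s + 5 ∧ k = 5 * s + 2 ∧ r = 5) ∨
        (d = 4 ∧ ∃ s, s = 2 ∧ n = 7 * s + 5 ∧ k = 6 * s + 2 ∧ r = 6) ∨
        (d = 4 ∧ ∃ s, 2 ≤ s ∧ n = 6 * s + 6 ∧ k = 5 * s + 3 ∧ r = 5) ∨
        (d = 4 ∧ ∃ s, 2 ≤ s ∧ n = 2 * s + 2 ∧ k = s ∧ r = 1) ∨
        (d = 4 ∧ 2 ≤ r ∧ r ≤ 11 ∧ n = r + 5 ∧ k = r + 1) ∨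
        (d = 4 ∧ 3 ≤ r ∧ r ≤ 11 ∧ n = r + 6 ∧ k = r + 2) ∨
        (d = 4 ∧ 5 ≤ r ∧ r ≤ 7 ∧ n = r + 7 ∧ k = r + 3) ∨
        (d = 4 ∧ 2 ≤ r ∧ r ≤ 7 ∧ n = 2 * r + 6 ∧ k = 2 * r + 1) ∨
        (d = 6 ∧ 2 ≤ k ∧ k ≤ 3 ∧ n = 2 * k + 4 ∧ r = 1) ∨
        (d = 8 ∧ 2 ≤ k ∧ k ≤ 3 ∧ n = 2 * k + 6 ∧ r = 1) ∨
        (3 ≤ k ∧ k ≤ 6 ∧ r + 1 = k ∧ 5 ≤ d ∧ d ≤ 6 ∧ n = k + d) ∨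
        (d = 6 ∧ ∃ s, 2 ≤ s ∧ s ≤ 3 ∧ n = 3 * s + 6 ∧ k = 2 * s + 1 ∧ r = 2))) ∧
    -- explicit parity-check matrices, class by class; first `d = 2`
    ((∀ k r : ℕ, 1 ≤ r → r < k → r ∣ k →
        IsPCMOfOptimalLRC (localityRows F (k / r) (r + 1)) (k + k ⌈/⌉ r) k r 2) ∧
      (∀ k r : ℕ, 1 ≤ r → r < k → ¬ r ∣ k →
        ∀ D : Finset (Fin (k ⌈/⌉ r) × Fin (r + 1)), D.card = r - k % r →
          (∃ i, ∀ j, (i, j) ∉ D) →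
          IsPCMOfOptimalLRC (truncatedRows F (k ⌈/⌉ r) (r + 1) D) (k + k ⌈/⌉ r) k r 2 ∧
          ∀ H' : Matrix (Fin (k ⌈/⌉ r)) {j : Fin (k ⌈/⌉ r) × Fin (r + 1) // j ∉ D} F,
            IsZeroSubstitution (truncatedRows F (k ⌈/⌉ r) (r + 1) D) H' (r - k % r) →
            (∀ i, hammingNorm (H' i) ≤ r + 1) →
            IsPCMOfOptimalLRC H' (k + k ⌈/⌉ r) k r 2)) ∧
    -- `d = 3`
    (∀ s : ℕ, 2 ≤ s →
      IsPCMOfOptimalLRC (uniformPCM (s + 1) (aux3s3 ω)) (3 * s + 3) (2 * s + 1) 2 3) ∧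
    (∀ s : ℕ, 2 ≤ s → ∀ α : F, α = 0 ∨ α = 1 →
      IsPCMOfOptimalLRC (mixedPCM (top4s3 α) (left4s3 ω) (s - 1) (aux4s3 ω))
        (4 * s + 3) (3 * s + 1) 3 3) ∧
    (IsPCMOfOptimalLRC (mat13_9 ω) 13 9 4 3 ∧ IsPCMOfOptimalLRC (mat18_13_d3 ω) 18 13 4 3) ∧
    IsPCMOfOptimalLRC (mat15_11 ω) 15 11 5 3 ∧
    (∀ s : ℕ, 2 ≤ s →
      IsPCMOfOptimalLRC (uniformPCM (s + 1) (aux4s4 ω)) (4 * s + 4) (3 * s + 2) 3 3) ∧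
    (∀ r : ℕ, 2 ≤ r → r ≤ 15 →
      IsPCMOfOptimalLRC (dropCols (15 - r) (ham19 ω)) (r + 4) (r + 1) r 3) ∧
    (∀ r : ℕ, 3 ≤ r → r ≤ 15 →
      IsPCMOfOptimalLRC (dropCols (15 - r) (ham20 ω)) (r + 5) (r + 2) r 3) ∧
    (∀ r : ℕ, 6 ≤ r → r ≤ 15 →
      IsPCMOfOptimalLRC (dropCols (15 - r) (ham21 ω)) (r + 6) (r + 3) r 3) ∧
    -- `d = 4`
    (∀ s : ℕ, 2 ≤ s →
      IsPCMOfOptimalLRC (uniformPCM (s + 1) (aux4s4d4 F)) (4 * s + 4) (3 * s + 1) 3 4) ∧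
    (∀ s : ℕ, 2 ≤ s → ∀ α : F, α = 0 ∨ α = 1 →
      IsPCMOfOptimalLRC (mixedPCM (top5s4 α) (left5s4 ω) (s - 1) (aux5s4 ω))
        (5 * s + 4) (4 * s + 1) 4 4) ∧
    (∀ α β : F, (α = 0 ∨ α = 1) → (β = 0 ∨ β = 1) →
      (∀ s : ℕ, 2 ≤ s →
        IsPCMOfOptimalLRC (mixedPCM (top6s4 α β) (left6s4 ω) (s - 1) (aux6s4 ω))
          (6 * s + 4) (5 * s + 1) 5 4) ∧
      IsPCMOfOptimalLRC (Matrix.fromRows (topB6s4 α β) (leftB6s4 ω)) 16 11 5 4 ∧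
      (∀ s : ℕ, 3 ≤ s →
        IsPCMOfOptimalLRC (mixedPCM (topB6s4 α β) (leftB6s4 ω) (s - 2) (aux6s4 ω))
          (6 * s + 4) (5 * s + 1) 5 4)) ∧
    (IsPCMOfOptimalLRC (mat18_13 ω) 18 13 6 4 ∧ IsPCMOfOptimalLRC (mat25_19 ω) 25 19 6 4) ∧
    IsPCMOfOptimalLRC (mat20_15 ω) 20 15 7 4 ∧
    (∀ s : ℕ, 2 ≤ s →
      IsPCMOfOptimalLRC (uniformPCM (s + 1) (aux5s5 ω)) (5 * s + 5) (4 * s + 2) 4 4) ∧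
    (∀ s : ℕ, 2 ≤ s → ∀ α : F, α = 0 ∨ α = 1 →
      IsPCMOfOptimalLRC (mixedPCM (top6s5 α) (left6s5 ω) (s - 1) (aux6s5 ω))
        (6 * s + 5) (5 * s + 2) 5 4) ∧
    IsPCMOfOptimalLRC (mat19_14 ω) 19 14 6 4 ∧
    (∀ s : ℕ, 2 ≤ s →
      IsPCMOfOptimalLRC (uniformPCM (s + 1) (aux6s6 ω)) (6 * s + 6) (5 * s + 3) 5 4) ∧
    (∀ s : ℕ, 2 ≤ s →
      IsPCMOfOptimalLRC (uniformPCM (s + 1) (aux2s2 F)) (2 * s + 2) s 1 4) ∧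
    (∀ r : ℕ, 2 ≤ r → r ≤ 11 →
      IsPCMOfOptimalLRC (takeCols (r + 5) (cap16 ω)) (r + 5) (r + 1) r 4) ∧
    (∀ r : ℕ, 3 ≤ r → r ≤ 11 →
      IsPCMOfOptimalLRC (takeCols (r + 6) (cap17 ω)) (r + 6) (r + 2) r 4) ∧
    (∀ r : ℕ, 5 ≤ r → r ≤ 7 →
      IsPCMOfOptimalLRC (takeCols (r + 7) (cap14 ω)) (r + 7) (r + 3) r 4) ∧
    (IsPCMOfOptimalLRC (matTwo2 ω) 10 5 2 4 ∧ IsPCMOfOptimalLRC (matTwo3 ω) 12 7 3 4 ∧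
      IsPCMOfOptimalLRC (matTwo4 ω) 14 9 4 4 ∧ IsPCMOfOptimalLRC (matTwo5 ω) 16 11 5 4 ∧
      IsPCMOfOptimalLRC (matTwo6 ω) 18 13 6 4 ∧ IsPCMOfOptimalLRC (matTwo7 ω) 20 15 7 4) ∧
    -- `5 ≤ d ≤ 8`
    (IsPCMOfOptimalLRC (mat8_2 ω) 8 2 1 6 ∧ IsPCMOfOptimalLRC (mat10_3 ω) 10 3 1 6) ∧
    (IsPCMOfOptimalLRC (mat10_2 ω) 10 2 1 8 ∧ IsPCMOfOptimalLRC (mat12_3 ω) 12 3 1 8) ∧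
    (IsPCMOfOptimalLRC (nearMDS12 ω) 12 6 5 6 ∧
      ∀ k d : ℕ, 3 ≤ k → k ≤ 6 → 5 ≤ d → d ≤ 6 →
        ∃ S P : Finset (Fin 12), Disjoint S P ∧ S.card = 6 - k ∧ P.card = 6 - d ∧
          IsOptimalLRC (shortenPuncture (LinearMap.ker (nearMDS12 ω).mulVecLin) S P)
            (k + d) k (k - 1) d) ∧
    (IsPCMOfOptimalLRC (mat12_5 ω) 12 5 2 6 ∧ IsPCMOfOptimalLRC (mat15_7 ω) 15 7 2 6) := by
  have hω := isQuatGen hF hω0 hω1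
  refine ⟨fun n k r d hr hk hd => ⟨fun ⟨C, hC⟩ => hC.params hF hr hk hd,
      hω.exists_isOptimalLRC hr hk hd⟩,
    ⟨fun k r hr hk hdvd => isPCM_localityRows hr hk hdvd, fun k r hr hk hdvd D hD hfull =>
      ⟨isPCM_truncatedRows hr (by omega) hdvd hD hfull, fun H hH hrow =>
        isPCM_of_zeroSubstitution hr (by omega) hdvd hD hfull hH.1 hrow⟩⟩,
    fun s hs => hω.isPCM_aux3s3 hs, fun s hs α hα => hω.isPCM_top4s3 hs hα,
    ⟨hω.isPCM_mat13_9, hω.isPCM_mat18_13_d3⟩, hω.isPCM_mat15_11,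
    fun s hs => hω.isPCM_aux4s4 hs, fun r h1 h2 => hω.isPCM_ham19 h1 h2,
    fun r h1 h2 => hω.isPCM_ham20 h1 h2, fun r h1 h2 => hω.isPCM_ham21 h1 h2,
    fun s hs => hω.isPCM_aux4s4d4 hs, fun s hs α hα => hω.isPCM_top5s4 hs hα,
    fun α β hα hβ => ⟨fun s hs => hω.isPCM_top6s4 hs hα hβ, hω.isPCM_fromRows_topB6s4 hα hβ,
      fun s hs => hω.isPCM_topB6s4 hs hα hβ⟩,
    ⟨hω.isPCM_mat18_13, hω.isPCM_mat25_19⟩, hω.isPCM_mat20_15,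
    fun s hs => hω.isPCM_aux5s5 hs, fun s hs α hα => hω.isPCM_top6s5 hs hα, hω.isPCM_mat19_14,
    fun s hs => hω.isPCM_aux6s6 hs, fun s hs => hω.isPCM_aux2s2 hs,
    fun r h1 h2 => hω.isPCM_cap16 h1 h2, fun r h1 h2 => hω.isPCM_cap17 h1 h2,
    fun r h1 h2 => hω.isPCM_cap14 h1 h2,
    ⟨hω.isPCM_matTwo2, hω.isPCM_matTwo3, hω.isPCM_matTwo4, hω.isPCM_matTwo5, hω.isPCM_matTwo6,
      hω.isPCM_matTwo7⟩,
    ⟨hω.isPCM_mat8_2, hω.isPCM_mat10_3⟩, ⟨hω.isPCM_mat10_2, hω.isPCM_mat12_3⟩,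
    ⟨hω.isPCM_nearMDS12, fun k d h1 h2 h3 h4 => hω.shortenPuncture_nearMDS12 h1 h2 h3 h4⟩,
    ⟨hω.isPCM_mat12_5, hω.isPCM_mat15_7⟩⟩
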